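/- **Model.** Algorithms are programs for a randomized algebraic word RAM: a memory of words and of elements of a finite field $\mathbb F$, indirect addressing, unit-cost word operations, unit-cost field operations and zero tests in $\mathbb F$, and independent uniform random bits and elements of $\mathbb F$. Programs use only the field constants $0,1$, so that one program runs over every field. For inputs of dimension $n$ the words are bounded by a fixed polynomial in $n$. An entry-update of a dynamic matrix $A\in\mathbb F^{n\times n}$ sets one entry $A_{i,j}$ to a given value. Fix a family of finite fields, over which everything below takes place. A data structure has preprocessing time $O(P(n))$ and update time $O(U(n))$ and is correct *with high probability* if for every constant $a$ there is a version of it (with constants, and exponents $b,c$, depending on $a$) such that for all $n\ge 1$, all fields $\mathbb F$ of the family with $|\mathbb F|\ge (n+1)^{b}$, with words below $(n+1)^c$, and all admissible initial matrices in $\mathbb F^{n\times n}$: the time bounds hold for each of the first $(n+1)^a$ updates, whatever the updates and the random choices are, and the probability that one of the outputs up to the $(n+1)^a$-th update is wrong is at most $(n+1)^{-a}$. **Theorem 1.6.** Let $P,U:\mathbb N\to[0,\infty)$ be such that $P(m)=O(P(n))$ and $U(m)=O(U(n))$ uniformly for $1\le n\le m\le 2n$. Let $\omega>2$ be such that $n\times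 n$ matrices over the fields of the family can be multiplied deterministically, by one program, in $O(n^{\omega})$ time. Assume that there is a (possibly randomized) data structure with preprocessing time $O(P(n))$ and entry-update time $O(U(n))$ that detects when a dynamic, initially invertible $n\times n$ matrix becomes singular for the first time: after each step it outputs whether the matrix is singular, until it reports singularity, after which nothing is required of it; it is correct with high probability on every update sequence that is fixed in advance. Then there is a randomized data structure with preprocessing time $O(P(n)+n^{\omega})$ and entry-update time $\tilde O(U(n))$, that is, $O(U(n)(1+\log n)^k)$ for a constant $k$, that maintains a maximum full-rank submatrix of an arbitrary dynamic matrix $A\in\mathbb F^{n\times n}$: after the preprocessing and after each update its memory holds lists, each without repetitions, of the elements of sets $I,J\subseteq\{1,\dots,n\}$ with $|I|=|J|=\operatorname{rank}(A)$ and $\det(A_{I,J})\neq 0$. It is correct with high probability against every output-adaptive adversary, that is, when each update is chosen depending on all previous outputs, but not on the random choices. -/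

import Mathlib

open MeasureTheory
open scoped ENNReal

namespace DynRAM

/-! ### The machine: a randomized algebraic word RAM

The memory consists of word arrays and of arrays of field elements; arrays have names in `ℕ` (a
program mentions finitely many of them) and are indexed by words.  Word operations and field
operations cost one unit each.  A word has to stay below a bound `W`, which will be polynomial in
the dimension of the input (words of `O(log n)` bits); a program that exceeds the bound is stuck.
The only constants of the field that occur in a program are `0` and `1`, so one program runs over
every field. -/

/-- Binary operations on words. -/
inductive WOp
  | add | sub | mul | div | mod | land | lor | lxor | shl | shr | lt | eq

/-- The value of a word operation. -/
def WOp.val : WOp → ℕ → ℕ → ℕ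
  | .add, x, y => x + y
  | .sub, x, y => x - y
  | .mul, x, y => x * y
  | .div, x, y => x / y
  | .mod, x, y => x % y
  | .land, x, y => x &&& y
  | .lor, x, y => x ||| y
  | .lxor, x, y => x ^^^ y
  | .shl, x, y => x <<< y
  | .shr, x, y => x >>> y
  | .lt, x, y => if x < y then 1 else 0
  | .eq, x, y => if x = y then 1 else 0

/-- Word expressions: constants, array cells (indirect addressing), random bits, operations. -/
inductive WExp
  | const (c : ℕ)
  | cell (a : ℕ) (i : WExp)
  | coin (a : ℕ) (i : WExp)
  | op (o : WOp) (x y : WExp)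

/-- Field expressions: `0`, `1`, array cells, random field elements, the four operations. -/
inductive FExp
  | zero
  | one
  | cell (a : ℕ) (i : WExp)
  | rand (a : ℕ) (i : WExp)
  | add (x y : FExp)
  | sub (x y : FExp)
  | mul (x y : FExp)
  | div (x y : FExp)

/-- Programs.  `ite` and `loop` branch on a word being nonzero, `ifZero` on a field element being
zero. -/
inductive Cmd
  | skip
  | setW (a : ℕ) (i : WExp) (e : WExp)
  | setF (a : ℕ) (i : WExp) (e : FExp)
  | seq (p q : Cmd)
  | ite (c : WExp) (p q : Cmd)
  | ifZero (e : FExp) (p q : Cmd)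
  | loop (c : WExp) (p : Cmd)

/-- The memory: word arrays `w` and field arrays `f`, by name and index. -/
structure State (F : Type*) where
  w : ℕ → ℕ → ℕ
  f : ℕ → ℕ → F

/-- The random source: named arrays of independent fair bits and of independent uniform field
elements.  A cell keeps its value when it is read again, so this is the same as drawing a sample
and storing it. -/
structure Tape (F : Type*) where
  bit : ℕ × ℕ → Bool
  elt : ℕ × ℕ → F

section Semantics

variable {F : Type*} [Field F]

/-- The value of a word expression. -/
def WExp.val (ω : Tape F) (s : State F) : WExp → ℕ
  | .const c => c
  | .cell a i => s.w a (i.val ω s)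
  | .coin a i => (ω.bit (a, i.val ω s)).toNat
  | .op o x y => o.val (x.val ω s) (y.val ω s)

/-- All words that are computed while evaluating the expression are below `W`. -/
def WExp.Fits (ω : Tape F) (W : ℕ) (s : State F) : WExp → Prop
  | .const c => c < W
  | .cell _ i => i.Fits ω W s
  | .coin _ i => i.Fits ω W s
  | .op o x y => x.Fits ω W s ∧ y.Fits ω W s ∧ o.val (x.val ω s) (y.val ω s) < W

/-- The number of steps for evaluating a word expression. -/
def WExp.cost : WExp → ℕ
  | .const _ => 1
  | .cell _ i => i.cost + 1
  | .coin _ i => i.cost + 1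
  | .op _ x y => x.cost + y.cost + 1

/-- The value of a field expression. -/
def FExp.val (ω : Tape F) (s : State F) : FExp → F
  | .zero => 0
  | .one => 1
  | .cell a i => s.f a (i.val ω s)
  | .rand a i => ω.elt (a, i.val ω s)
  | .add x y => x.val ω s + y.val ω s
  | .sub x y => x.val ω s - y.val ω s
  | .mul x y => x.val ω s * y.val ω s
  | .div x y => x.val ω s / y.val ω s

/-- All words that are computed while evaluating the expression are below `W`. -/
def FExp.Fits (ω : Tape F) (W : ℕ) (s : State F) : FExp → Prop
  | .zero => True
  | .one => True
  | .cell _ i => i.Fits ω W s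
  | .rand _ i => i.Fits ω W s
  | .add x y => x.Fits ω W s ∧ y.Fits ω W s
  | .sub x y => x.Fits ω W s ∧ y.Fits ω W s
  | .mul x y => x.Fits ω W s ∧ y.Fits ω W s
  | .div x y => x.Fits ω W s ∧ y.Fits ω W s

/-- The number of steps for evaluating a field expression. -/
def FExp.cost : FExp → ℕ
  | .zero => 1
  | .one => 1
  | .cell _ i => i.cost + 1
  | .rand _ i => i.cost + 1
  | .add x y => x.cost + y.cost + 1
  | .sub x y => x.cost + y.cost + 1
  | .mul x y => x.cost + y.cost + 1
  | .div x y => x.cost + y.cost + 1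

/-- Write a word. -/
def State.putW (s : State F) (a i v : ℕ) : State F :=
  { s with w := Function.update s.w a (Function.update (s.w a) i v) }

/-- Write a field element. -/
def State.putF (s : State F) (a i : ℕ) (v : F) : State F :=
  { s with f := Function.update s.f a (Function.update (s.f a) i v) }

/-- `Exec ω W p s s' t`: with random source `ω` and word bound `W`, the program `p` started in
memory `s` halts in memory `s'` after `t` steps. -/
inductive Exec (ω : Tape F) (W : ℕ) : Cmd → State F → State F → ℕ → Prop
  | skip (s : State F) : Exec ω W .skip s s 1
  | setW {s : State F} {a : ℕ} {i e : WExp} (hi : i.Fits ω W s) (he : e.Fits ω W s) :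
      Exec ω W (.setW a i e) s (s.putW a (i.val ω s) (e.val ω s)) (i.cost + e.cost + 1)
  | setF {s : State F} {a : ℕ} {i : WExp} {e : FExp} (hi : i.Fits ω W s) (he : e.Fits ω W s) :
      Exec ω W (.setF a i e) s (s.putF a (i.val ω s) (e.val ω s)) (i.cost + e.cost + 1)
  | seq {p q : Cmd} {s s₁ s₂ : State F} {t₁ t₂ : ℕ} (hp : Exec ω W p s s₁ t₁)
      (hq : Exec ω W q s₁ s₂ t₂) : Exec ω W (.seq p q) s s₂ (t₁ + t₂)
  | iteTrue {c : WExp} {p q : Cmd} {s s' : State F} {t : ℕ} (hf : c.Fits ω W s)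
      (hc : c.val ω s ≠ 0) (hp : Exec ω W p s s' t) : Exec ω W (.ite c p q) s s' (c.cost + 1 + t)
  | iteFalse {c : WExp} {p q : Cmd} {s s' : State F} {t : ℕ} (hf : c.Fits ω W s)
      (hc : c.val ω s = 0) (hq : Exec ω W q s s' t) : Exec ω W (.ite c p q) s s' (c.cost + 1 + t)
  | ifZeroTrue {e : FExp} {p q : Cmd} {s s' : State F} {t : ℕ} (hf : e.Fits ω W s)
      (he : e.val ω s = 0) (hp : Exec ω W p s s' t) :
      Exec ω W (.ifZero e p q) s s' (e.cost + 1 + t)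
  | ifZeroFalse {e : FExp} {p q : Cmd} {s s' : State F} {t : ℕ} (hf : e.Fits ω W s)
      (he : e.val ω s ≠ 0) (hq : Exec ω W q s s' t) :
      Exec ω W (.ifZero e p q) s s' (e.cost + 1 + t)
  | loopStop {c : WExp} {p : Cmd} {s : State F} (hf : c.Fits ω W s) (hc : c.val ω s = 0) :
      Exec ω W (.loop c p) s s (c.cost + 1)
  | loopStep {c : WExp} {p : Cmd} {s s₁ s₂ : State F} {t₁ t₂ : ℕ} (hf : c.Fits ω W s)
      (hc : c.val ω s ≠ 0) (hp : Exec ω W p s s₁ t₁) (hl : Exec ω W (.loop c p) s₁ s₂ t₂) :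
      Exec ω W (.loop c p) s s₂ (c.cost + 1 + t₁ + t₂)

/-- The probability of an event: all bits are fair, all field elements are uniform on the finite
field `F`, and all of them are independent. -/
noncomputable def tapeProb [Fintype F] (E : Set (Tape F)) : ℝ≥0∞ :=
  letI : MeasurableSpace F := ⊤
  ((Measure.infinitePi fun _ : ℕ × ℕ => (PMF.uniformOfFintype Bool).toMeasure).prod
    (Measure.infinitePi fun _ : ℕ × ℕ => (PMF.uniformOfFintype F).toMeasure))
    {x | (⟨x.1, x.2⟩ : Tape F) ∈ E}

/-- A square matrix as the content of a field array: entry `(i, j)` is in cell `i * n + j`, the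
remaining cells are `0`. -/
def rowMajor {n : ℕ} (A : Matrix (Fin n) (Fin n) F) (k : ℕ) : F :=
  if h : k < n * n then A (finProdFinEquiv.symm ⟨k, h⟩).1 (finProdFinEquiv.symm ⟨k, h⟩).2 else 0

end Semantics

/-! ### Matrix multiplication -/

/-- Over all fields `K i`, two `n × n` matrices can be multiplied in `O(n ^ τ)` steps by one
deterministic program.  Input: `n` in word array `0`, the factors in field arrays `0` and `1`, all
other cells `0`.  Output: field array `2`. -/
def MatMulInTime {ι : Type*} (K : ι → Type*) [∀ i, Field (K i)] (τ : ℝ) : Prop :=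
  ∃ (p : Cmd) (c : ℕ) (C : ℝ), ∀ (i : ι) (n : ℕ), 1 ≤ n →
    ∀ (A B : Matrix (Fin n) (Fin n) (K i)) (ω : Tape (K i)), ∃ (s : State (K i)) (t : ℕ),
      Exec ω ((n + 1) ^ c) p
        { w := fun a k => if a = 0 ∧ k = 0 then n else 0
          f := fun a => if a = 0 then rowMajor A else if a = 1 then rowMajor B else fun _ => 0 }
        s t ∧
      (t : ℝ) ≤ C * (n : ℝ) ^ τ ∧
      ∀ k l : Fin n, s.f 2 (k * n + l) = (A * B) k l

/-! ### Dynamic matrices and data structures -/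

/-- An entry-update `(i, j, v)` of an `n × n` matrix: set entry `(i, j)` to `v`. -/
structure Update (n : ℕ) (F : Type*) where
  row : Fin n
  col : Fin n
  value : F

/-- The matrix after one update. -/
def Update.apply {n : ℕ} {F : Type*} (u : Update n F) (A : Matrix (Fin n) (Fin n) F) :
    Matrix (Fin n) (Fin n) F :=
  Matrix.of fun i j => if i = u.row ∧ j = u.col then u.value else A i j

/-- The matrix after a list of updates; here and below, the most recent one comes first. -/
def applyAll {n : ℕ} {F : Type*} (A : Matrix (Fin n) (Fin n) F) (us : List (Update n F)) :
    Matrix (Fin n) (Fin n) F :=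
  us.foldr Update.apply A

/-- A problem about a dynamic matrix: which initial matrices are admitted, where in the word memory
the output is found, after which outputs the updates go on, and which outputs are correct for the
current matrix. -/
structure Problem (F : Type*) where
  Out : Type
  Init : ∀ {n : ℕ}, Matrix (Fin n) (Fin n) F → Prop
  read : (ℕ → ℕ → ℕ) → Out
  Continue : Out → Prop
  Correct : ∀ {n : ℕ}, Matrix (Fin n) (Fin n) F → Out → Prop

/-- Detecting when an initially invertible matrix becomes singular for the first time: the output
is a flag (cell `0` of word array `2`), nonzero iff the matrix is singular.  Once singularity has
been reported there are no further updates. -/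
def firstSingular (F : Type*) [Field F] : Problem F where
  Out := ℕ
  Init A := A.det ≠ 0
  read w := w 2 0
  Continue o := o = 0
  Correct A o := o ≠ 0 ↔ A.det = 0

/-- Maintaining a maximum full-rank submatrix: the output is the list of the row indices and the
list of the column indices of `A.rank` many rows and columns on which the determinant is nonzero.
Cell `0` of word array `2` holds the common length of the lists, which are in word arrays `3` and
`4`. -/
def maxFullRankSubmatrix (F : Type*) [Field F] : Problem F where
  Out := List ℕ × List ℕ
  Init _ := True
  read w := ((List.range (w 2 0)).map (w 3), (List.range (w 2 0)).map (w 4))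
  Continue _ := True
  Correct {n} A o := ∃ I J : Fin A.rank → Fin n, Function.Injective I ∧ Function.Injective J ∧
    o.1 = List.ofFn (fun k => (I k : ℕ)) ∧ o.2 = List.ofFn (fun k => (J k : ℕ)) ∧
    (A.submatrix I J).det ≠ 0

/-- A dynamic algorithm: a program for the preprocessing and one for an update. -/
structure DynAlg where
  prep : Cmd
  upd : Cmd

section Dynamic

variable {F : Type*} [Field F] {n : ℕ}

/-- The memory before the preprocessing: `n` in word array `0`, the matrix in field array `0`,
all other cells `0`. -/
def initState (A : Matrix (Fin n) (Fin n) F) : State F where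
  w := fun a k => if a = 0 ∧ k = 0 then n else 0
  f := fun a => if a = 0 then rowMajor A else fun _ => 0

/-- An update is handed over in the cells `0` and `1` of word array `1` and in cell `0` of field
array `1`. -/
def State.feed (s : State F) (u : Update n F) : State F :=
  ((s.putW 1 0 u.row).putW 1 1 u.col).putF 1 0 u.value

/-- `Runs pr D ω W A us os s`: the algorithm `D`, initialized with `A` and then given the updates
`us`, all of them arriving after outputs that let the updates go on, has given the outputs `os`
(the first of them after the preprocessing) and is in memory `s`. -/
inductive Runs (pr : Problem F) (D : DynAlg) (ω : Tape F) (W : ℕ)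
    (A : Matrix (Fin n) (Fin n) F) : List (Update n F) → List pr.Out → State F → Prop
  | prep {s : State F} {t : ℕ} (h : Exec ω W D.prep (initState A) s t) :
      Runs pr D ω W A [] [pr.read s.w] s
  | upd {us : List (Update n F)} {os : List pr.Out} {s s' : State F} {t : ℕ}
      (h : Runs pr D ω W A us os s) (hc : pr.Continue (pr.read s.w)) (u : Update n F)
      (hu : Exec ω W D.upd (s.feed u) s' t) :
      Runs pr D ω W A (u :: us) (pr.read s'.w :: os) s'

/-- Whatever the first `L` updates are, the preprocessing takes at most `TP` and each update at most
`TU` steps. -/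
def TimeBound (pr : Problem F) (D : DynAlg) (ω : Tape F) (W L : ℕ)
    (A : Matrix (Fin n) (Fin n) F) (TP TU : ℝ) : Prop :=
  (∃ (s : State F) (t : ℕ), Exec ω W D.prep (initState A) s t ∧ (t : ℝ) ≤ TP) ∧
  ∀ (us : List (Update n F)) (os : List pr.Out) (s : State F), us.length < L →
    Runs pr D ω W A us os s → pr.Continue (pr.read s.w) → ∀ u : Update n F,
      ∃ (s' : State F) (t : ℕ), Exec ω W D.upd (s.feed u) s' t ∧ (t : ℝ) ≤ TU

/-- Each update is the one that the strategy chooses from the outputs given so far. -/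
def Follows {Out : Type*} (adv : List Out → Update n F) : List (Update n F) → List Out → Prop
  | [], _ => True
  | _ :: _, [] => False
  | u :: us, _ :: os => u = adv os ∧ Follows adv us os

/-- Against the strategy `adv`, one of the outputs up to the `L`-th update is wrong. -/
def Errs (pr : Problem F) (D : DynAlg) (ω : Tape F) (W L : ℕ)
    (A : Matrix (Fin n) (Fin n) F) (adv : List pr.Out → Update n F) : Prop :=
  ∃ (us : List (Update n F)) (os : List pr.Out) (s : State F), us.length ≤ L ∧
    Runs pr D ω W A us os s ∧ Follows adv us os ∧ ¬ pr.Correct (applyAll A us) (pr.read s.w)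

end Dynamic

/-- Oblivious adversaries fix the sequence of updates beforehand; output-adaptive ones choose each
update knowing all previous outputs, but not the random source. -/
inductive Adversary
  | oblivious
  | outputAdaptive

/-- The strategies that an adversary may use. -/
def Adversary.Allows {Out X : Type*} : Adversary → (List Out → X) → Prop
  | .oblivious, adv => ∃ u : ℕ → X, ∀ os, adv os = u os.length
  | .outputAdaptive, _ => True

/-- Over the fields `K i` there is a randomized data structure for the problem `pr` with
preprocessing time `O(P n)` and update time `O(U n)`, correct with high probability: for every `a`
there is an algorithm which, for the first `(n + 1) ^ a` updates of an `n × n` matrix over a field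
of at least polynomial size `(n + 1) ^ b`, with words below a polynomial bound `(n + 1) ^ c`,
respects the time bounds for every value of the random source, and which errs with probability at
most `(n + 1) ^ (-a)`. -/
def HasDataStructure {ι : Type*} (K : ι → Type*) [∀ i, Field (K i)] [∀ i, Fintype (K i)]
    (pr : ∀ i, Problem (K i)) (ad : Adversary) (P U : ℕ → ℝ) : Prop :=
  ∀ a : ℕ, ∃ (D : DynAlg) (b c : ℕ) (C : ℝ), ∀ (i : ι) (n : ℕ), 1 ≤ n →
    (n + 1) ^ b ≤ Fintype.card (K i) →
    ∀ A : Matrix (Fin n) (Fin n) (K i), (pr i).Init A →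
      (∀ ω : Tape (K i),
        TimeBound (pr i) D ω ((n + 1) ^ c) ((n + 1) ^ a) A (C * P n) (C * U n)) ∧
      ∀ adv : List (pr i).Out → Update n (K i), ad.Allows adv →
        tapeProb {ω | Errs (pr i) D ω ((n + 1) ^ c) ((n + 1) ^ a) A adv} ≤
          (((n : ℝ≥0∞) + 1) ^ a)⁻¹

/-- A nonnegative function that grows at most by a constant factor when its argument is at most
doubled, as all functions `n ^ α * (1 + log n) ^ β` do. -/
def DoublingBounded (f : ℕ → ℝ) : Prop :=
  (∀ n, 0 ≤ f n) ∧
    ∃ κ : ℝ, ∀ n m : ℕ, 1 ≤ n → n ≤ m → m ≤ 2 * n → f m ≤ κ * f n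

end DynRAM

set_option linter.all false

namespace DynRAM

open Finset Function
open Submodule (span)

variable {F : Type*} [Field F]

section

/-! ### Execution -/

section Execution

variable {ω : Tape F} {W B : ℕ} {p : Cmd} {s : State F}

theorem WExp.Fits.mono {W' : ℕ} (hW : W ≤ W') {s : State F} :
    ∀ {e : WExp}, e.Fits ω W s → e.Fits ω W' s
  | .const _, h => lt_of_lt_of_le h hW
  | .cell _ i, h => WExp.Fits.mono (e := i) hW h
  | .coin _ i, h => WExp.Fits.mono (e := i) hW h
  | .op _ _ _, h => ⟨WExp.Fits.mono hW h.1, WExp.Fits.mono hW h.2.1, lt_of_lt_of_le h.2.2 hW⟩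

theorem FExp.Fits.mono {W' : ℕ} (hW : W ≤ W') {s : State F} :
    ∀ {e : FExp}, e.Fits ω W s → e.Fits ω W' s
  | .zero, _ => trivial
  | .one, _ => trivial
  | .cell _ i, h => WExp.Fits.mono (e := i) hW h
  | .rand _ i, h => WExp.Fits.mono (e := i) hW h
  | .add _ _, h => ⟨FExp.Fits.mono hW h.1, FExp.Fits.mono hW h.2⟩
  | .sub _ _, h => ⟨FExp.Fits.mono hW h.1, FExp.Fits.mono hW h.2⟩
  | .mul _ _, h => ⟨FExp.Fits.mono hW h.1, FExp.Fits.mono hW h.2⟩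
  | .div _ _, h => ⟨FExp.Fits.mono hW h.1, FExp.Fits.mono hW h.2⟩

theorem Exec.mono {W' : ℕ} (hW : W ≤ W') {p : Cmd} {s s' : State F} {t : ℕ}
    (h : Exec ω W p s s' t) : Exec ω W' p s s' t := by
  induction h with
  | skip s => exact .skip s
  | setW hi he => exact .setW (hi.mono hW) (he.mono hW)
  | setF hi he => exact .setF (hi.mono hW) (he.mono hW)
  | seq _ _ h₁ h₂ => exact .seq h₁ h₂
  | iteTrue hf hc _ h => exact .iteTrue (hf.mono hW) hc h
  | iteFalse hf hc _ h => exact .iteFalse (hf.mono hW) hc h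
  | ifZeroTrue hf hc _ h => exact .ifZeroTrue (hf.mono hW) hc h
  | ifZeroFalse hf hc _ h => exact .ifZeroFalse (hf.mono hW) hc h
  | loopStop hf hc => exact .loopStop (hf.mono hW) hc
  | loopStep hf hc _ _ h₁ h₂ => exact .loopStep (hf.mono hW) hc h₁ h₂

/-- Programs are deterministic, given the random source. -/
theorem Exec.det {s₁ : State F} {t₁ : ℕ}
    (h₁ : Exec ω W p s s₁ t₁) : ∀ {s₂ : State F} {t₂ : ℕ}, Exec ω W p s s₂ t₂ →
      s₁ = s₂ ∧ t₁ = t₂ := by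
  induction h₁ with
  | skip s => intro _ _ h; cases h; exact ⟨rfl, rfl⟩
  | setW hi he => intro _ _ h; cases h; exact ⟨rfl, rfl⟩
  | setF hi he => intro _ _ h; cases h; exact ⟨rfl, rfl⟩
  | seq _ _ ih₁ ih₂ =>
    intro _ _ h
    cases h with
    | seq hp hq =>
      obtain ⟨rfl, rfl⟩ := ih₁ hp
      obtain ⟨rfl, rfl⟩ := ih₂ hq
      exact ⟨rfl, rfl⟩
  | iteTrue hf hc _ ih =>
    intro _ _ h
    cases h with
    | iteTrue _ _ h => obtain ⟨rfl, rfl⟩ := ih h; exact ⟨rfl, rfl⟩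
    | iteFalse _ h _ => exact absurd h hc
  | iteFalse hf hc _ ih =>
    intro _ _ h
    cases h with
    | iteFalse _ _ h => obtain ⟨rfl, rfl⟩ := ih h; exact ⟨rfl, rfl⟩
    | iteTrue _ h _ => exact absurd hc h
  | ifZeroTrue hf hc _ ih =>
    intro _ _ h
    cases h with
    | ifZeroTrue _ _ h => obtain ⟨rfl, rfl⟩ := ih h; exact ⟨rfl, rfl⟩
    | ifZeroFalse _ h _ => exact absurd hc h
  | ifZeroFalse hf hc _ ih =>
    intro _ _ h
    cases h with
    | ifZeroFalse _ _ h => obtain ⟨rfl, rfl⟩ := ih h; exact ⟨rfl, rfl⟩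
    | ifZeroTrue _ h _ => exact absurd h hc
  | loopStop hf hc =>
    intro _ _ h
    cases h with
    | loopStop _ _ => exact ⟨rfl, rfl⟩
    | loopStep _ h _ _ => exact absurd hc h
  | loopStep hf hc _ _ ih₁ ih₂ =>
    intro _ _ h
    cases h with
    | loopStop _ h => exact absurd h hc
    | loopStep _ _ hp hl =>
      obtain ⟨rfl, rfl⟩ := ih₁ hp
      obtain ⟨rfl, rfl⟩ := ih₂ hl
      exact ⟨rfl, rfl⟩

theorem Exec.one_le {s' : State F} {t : ℕ}
    (h : Exec ω W p s s' t) : 1 ≤ t := by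
  induction h <;> omega

/-- `Halts ω W p s B Q`: started in `s`, the program `p` halts after at most `B` steps in a memory
that satisfies `Q`. -/
def Halts (ω : Tape F) (W : ℕ) (p : Cmd) (s : State F) (B : ℕ) (Q : State F → Prop) : Prop :=
  ∃ (s' : State F) (t : ℕ), Exec ω W p s s' t ∧ t ≤ B ∧ Q s'

theorem Halts.imp {B' : ℕ} {Q Q' : State F → Prop}
    (h : Halts ω W p s B Q) (hB : B ≤ B') (hQ : ∀ s', Q s' → Q' s') : Halts ω W p s B' Q' := by
  obtain ⟨s', t, h₁, h₂, h₃⟩ := h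
  exact ⟨s', t, h₁, h₂.trans hB, hQ _ h₃⟩

theorem Halts.seq {q : Cmd} {B₁ B₂ : ℕ} {Q₁ Q₂ : State F → Prop} (h₁ : Halts ω W p s B₁ Q₁)
    (h₂ : ∀ s₁, Q₁ s₁ → Halts ω W q s₁ B₂ Q₂) : Halts ω W (.seq p q) s (B₁ + B₂) Q₂ := by
  obtain ⟨s₁, t₁, e₁, l₁, q₁⟩ := h₁
  obtain ⟨s₂, t₂, e₂, l₂, q₂⟩ := h₂ s₁ q₁
  exact ⟨s₂, t₁ + t₂, .seq e₁ e₂, by omega, q₂⟩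

theorem Halts.ite {c : WExp} {q : Cmd} {Q : State F → Prop} (hf : c.Fits ω W s) (hp : c.val ω s ≠ 0 → Halts ω W p s B Q)
    (hq : c.val ω s = 0 → Halts ω W q s B Q) : Halts ω W (.ite c p q) s (c.cost + 1 + B) Q := by
  by_cases hc : c.val ω s = 0
  · obtain ⟨s', t, e, l, r⟩ := hq hc
    exact ⟨s', _, .iteFalse hf hc e, by omega, r⟩
  · obtain ⟨s', t, e, l, r⟩ := hp hc
    exact ⟨s', _, .iteTrue hf hc e, by omega, r⟩

/-! ### Programs without loops -/

/-- The memory after a program without loops. -/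
noncomputable def Cmd.ev (ω : Tape F) : Cmd → State F → State F
  | .skip, s => s
  | .setW a i e, s => s.putW a (i.val ω s) (e.val ω s)
  | .setF a i e, s => s.putF a (i.val ω s) (e.val ω s)
  | .seq p q, s => q.ev ω (p.ev ω s)
  | .ite c p q, s => if c.val ω s = 0 then q.ev ω s else p.ev ω s
  | .ifZero e p q, s => open Classical in if e.val ω s = 0 then p.ev ω s else q.ev ω s
  | .loop _ _, s => s

/-- The program has no loops, and all its words are below `W`. -/
def Cmd.Ok (ω : Tape F) (W : ℕ) : Cmd → State F → Prop
  | .skip, _ => True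
  | .setW _ i e, s => i.Fits ω W s ∧ e.Fits ω W s
  | .setF _ i e, s => i.Fits ω W s ∧ e.Fits ω W s
  | .seq p q, s => p.Ok ω W s ∧ q.Ok ω W (p.ev ω s)
  | .ite c p q, s => c.Fits ω W s ∧ (c.val ω s ≠ 0 → p.Ok ω W s) ∧ (c.val ω s = 0 → q.Ok ω W s)
  | .ifZero e p q, s =>
    e.Fits ω W s ∧ (e.val ω s = 0 → p.Ok ω W s) ∧ (e.val ω s ≠ 0 → q.Ok ω W s)
  | .loop _ _, _ => False

/-- A bound for the running time of a program without loops. -/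
def Cmd.cost : Cmd → ℕ
  | .skip => 1
  | .setW _ i e => i.cost + e.cost + 1
  | .setF _ i e => i.cost + e.cost + 1
  | .seq p q => p.cost + q.cost
  | .ite c p q => c.cost + 1 + p.cost + q.cost
  | .ifZero e p q => e.cost + 1 + p.cost + q.cost
  | .loop _ _ => 1

theorem Cmd.Ok.exec : ∀ {p : Cmd} {s : State F}, p.Ok ω W s →
    ∃ t, Exec ω W p s (p.ev ω s) t ∧ t ≤ p.cost
  | .skip, s, _ => ⟨1, .skip s, le_rfl⟩
  | .setW _ _ _, _, h => ⟨_, .setW h.1 h.2, le_rfl⟩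
  | .setF _ _ _, _, h => ⟨_, .setF h.1 h.2, le_rfl⟩
  | .seq _ _, _, h => by
    obtain ⟨t₁, e₁, l₁⟩ := Cmd.Ok.exec h.1
    obtain ⟨t₂, e₂, l₂⟩ := Cmd.Ok.exec h.2
    exact ⟨_, .seq e₁ e₂, by simp only [Cmd.cost]; omega⟩
  | .ite c _ _, s, h => by
    by_cases hc : c.val ω s = 0
    · obtain ⟨t, e, l⟩ := Cmd.Ok.exec (h.2.2 hc)
      simp only [Cmd.ev, if_pos hc]
      exact ⟨_, .iteFalse h.1 hc e, by simp only [Cmd.cost]; omega⟩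
    · obtain ⟨t, e, l⟩ := Cmd.Ok.exec (h.2.1 hc)
      simp only [Cmd.ev, if_neg hc]
      exact ⟨_, .iteTrue h.1 hc e, by simp only [Cmd.cost]; omega⟩
  | .ifZero x _ _, s, h => by
    by_cases hc : x.val ω s = 0
    · obtain ⟨t, e, l⟩ := Cmd.Ok.exec (h.2.1 hc)
      simp only [Cmd.ev, if_pos hc]
      exact ⟨_, .ifZeroTrue h.1 hc e, by simp only [Cmd.cost]; omega⟩
    · obtain ⟨t, e, l⟩ := Cmd.Ok.exec (h.2.2 hc)
      simp only [Cmd.ev, if_neg hc]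
      exact ⟨_, .ifZeroFalse h.1 hc e, by simp only [Cmd.cost]; omega⟩

theorem Cmd.Ok.halts (h : p.Ok ω W s)
    {Q : State F → Prop} (hQ : Q (p.ev ω s)) : Halts ω W p s p.cost Q := by
  obtain ⟨t, e, l⟩ := h.exec
  exact ⟨_, t, e, l, hQ⟩

/-- A program without loops at the beginning. -/
theorem Cmd.Ok.halts_seq {q : Cmd} (h : p.Ok ω W s) {B : ℕ}
    {Q : State F → Prop} (hQ : Halts ω W q (p.ev ω s) B Q) :
    Halts ω W (.seq p q) s (p.cost + B) Q :=
  (h.halts (Q := fun s' => s' = p.ev ω s) rfl).seq (by rintro _ rfl; exact hQ)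

/-- A loop with a variant. -/
theorem Halts.loop {c : WExp} (Inv : ℕ → State F → Prop)
    (hf : ∀ k s, Inv k s → c.Fits ω W s) (h0 : ∀ s, Inv 0 s → c.val ω s = 0)
    (hstep : ∀ k s, Inv (k + 1) s → c.val ω s ≠ 0 → Halts ω W p s B (Inv k)) :
    ∀ k s, Inv k s → Halts ω W (.loop c p) s ((k + 1) * (B + c.cost + 1))
      fun s' => (∃ j ≤ k, Inv j s') ∧ c.val ω s' = 0 := by
  intro k
  induction k with
  | zero =>
    intro s hs
    exact ⟨s, _, .loopStop (hf _ _ hs) (h0 _ hs), by nlinarith, ⟨0, le_rfl, hs⟩, h0 _ hs⟩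
  | succ k ih =>
    intro s hs
    by_cases hc : c.val ω s = 0
    · exact ⟨s, _, .loopStop (hf _ _ hs) hc, by nlinarith, ⟨k + 1, le_rfl, hs⟩, hc⟩
    · obtain ⟨s₁, t₁, e₁, l₁, q₁⟩ := hstep k s hs hc
      obtain ⟨s₂, t₂, e₂, l₂, ⟨j, hj, q₂⟩, r⟩ := ih s₁ q₁
      refine ⟨s₂, _, .loopStep (hf _ _ hs) hc e₁ e₂, ?_, ⟨j, by omega, q₂⟩, r⟩
      rw [Nat.add_mul (k + 1) 1]
      omega

/-! ### Reading the memory after writing -/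

@[simp] theorem State.putW_w (s : State F) (a i v b : ℕ) :
    (s.putW a i v).w b = if b = a then update (s.w a) i v else s.w b := by
  simp only [State.putW, update_apply]

@[simp] theorem State.putW_f (s : State F) (a i v : ℕ) : (s.putW a i v).f = s.f := rfl

@[simp] theorem State.putF_f (s : State F) (a i : ℕ) (v : F) (b : ℕ) :
    (s.putF a i v).f b = if b = a then update (s.f a) i v else s.f b := by
  simp only [State.putF, update_apply]

@[simp] theorem State.putF_w (s : State F) (a i : ℕ) (v : F) : (s.putF a i v).w = s.w := rfl

theorem State.ext' {r : State F} (hw : ∀ a i, s.w a i = r.w a i)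
    (hf : ∀ a i, s.f a i = r.f a i) : s = r := by
  cases s; cases r
  simp only [State.mk.injEq]
  exact ⟨funext fun a => funext (hw a), funext fun a => funext (hf a)⟩

/-! ### Counting loops -/

/-- `for x := 0, …, e - 1 do p`, with the counter in cell `x` of word array `a`. -/
def forTo (a x : ℕ) (e : WExp) (p : Cmd) : Cmd :=
  .seq (.setW a (.const x) (.const 0))
    (.loop (.op .lt (.cell a (.const x)) e)
      (.seq p (.setW a (.const x) (.op .add (.cell a (.const x)) (.const 1)))))

theorem Halts.forTo {a x : ℕ} {e : WExp} {len : ℕ}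
    (Inv : ℕ → State F → Prop) (hx : x < W) (hlen : len < W) (hW : 1 < W)
    (h0 : Inv 0 (s.putW a x 0))
    (hinv : ∀ k s, Inv k s → e.Fits ω W s ∧ e.val ω s = len ∧ s.w a x = k)
    (hstep : ∀ k s, k < len → Inv k s →
      Halts ω W p s B fun s' => s'.w a x = k ∧ Inv (k + 1) (s'.putW a x (k + 1))) :
    Halts ω W (DynRAM.forTo a x e p) s ((len + 1) * (B + e.cost + 20)) (Inv len) := by
  have key := Halts.loop (ω := ω) (W := W) (c := .op .lt (.cell a (.const x)) e)
    (p := .seq p (.setW a (.const x) (.op .add (.cell a (.const x)) (.const 1)))) (B := B + 6)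
    (fun k s => k ≤ len ∧ Inv (len - k) s)
    (fun k s h => by
      obtain ⟨h₁, h₂, h₃⟩ := hinv _ _ h.2
      refine ⟨hx, h₁, ?_⟩
      simp only [WOp.val]
      split_ifs <;> omega)
    (fun s h => by
      obtain ⟨h₁, h₂, h₃⟩ := hinv _ _ h.2
      simp only [WExp.val, WOp.val, h₂, h₃]
      simp)
    (fun k s h hc => by
      obtain ⟨h₁, h₂, h₃⟩ := hinv _ _ h.2
      have := hstep (len - (k + 1)) s (by omega) h.2
      refine (this.seq (B₂ := 6) (Q₂ := fun s => k ≤ len ∧ Inv (len - k) s)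
        fun s₁ hs₁ => ?_).imp le_rfl fun _ h => h
      refine (Cmd.Ok.halts (p := .setW a (.const x) (.op .add (.cell a (.const x)) (.const 1)))
        ⟨hx, hx, hW, ?_⟩ ?_).imp ?_ fun _ h => h
      · simp only [WExp.val, WOp.val, hs₁.1]; omega
      · simp only [Cmd.ev, WExp.val, WOp.val, hs₁.1]
        refine ⟨by omega, ?_⟩
        have e1 : len - (k + 1) + 1 = len - k := by omega
        rw [← e1]; exact hs₁.2
      · simp [Cmd.cost, WExp.cost]) len (s.putW a x 0) ⟨le_rfl, by simpa using h0⟩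
  refine (Cmd.Ok.halts_seq (p := .setW a (.const x) (.const 0)) ⟨hx, by exact (by omega : 0 < W)⟩
    (B := (len + 1) * (B + e.cost + 12)) (Q := Inv len) ?_).imp ?_ fun _ h => h
  · refine key.imp ?_ ?_
    · refine Nat.mul_le_mul_left _ ?_
      simp only [WExp.cost]; omega
    · rintro s' ⟨⟨j, hj, -, h⟩, hc⟩
      obtain ⟨h₁, h₂, h₃⟩ := hinv _ _ h
      simp only [WExp.val, WOp.val, h₂, h₃] at hc
      have : j = 0 := by
        by_contra hne
        simp [show len - j < len by omega] at hc
      simpa [this] using h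
  · simp only [Cmd.cost, WExp.cost]
    nlinarith

end Execution

end

section

section Simulation

variable {ω : Tape F} {s r : State F} {W K a t : ℕ} {p : Cmd}

/-! ### Running a program in a part of the memory

Arrays of the guest program are shifted by `K`. -/

def WExp.shift (K : ℕ) : WExp → WExp
  | .const c => .const c
  | .cell a i => .cell (a + K) (i.shift K)
  | .coin a i => .coin (a + K) (i.shift K)
  | .op o x y => .op o (x.shift K) (y.shift K)

def FExp.shift (K : ℕ) : FExp → FExp
  | .zero => .zero
  | .one => .one
  | .cell a i => .cell (a + K) (i.shift K)
  | .rand a i => .rand (a + K) (i.shift K)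
  | .add x y => .add (x.shift K) (y.shift K)
  | .sub x y => .sub (x.shift K) (y.shift K)
  | .mul x y => .mul (x.shift K) (y.shift K)
  | .div x y => .div (x.shift K) (y.shift K)

def Cmd.shift (K : ℕ) : Cmd → Cmd
  | .skip => .skip
  | .setW a i e => .setW (a + K) (i.shift K) (e.shift K)
  | .setF a i e => .setF (a + K) (i.shift K) (e.shift K)
  | .seq p q => .seq (p.shift K) (q.shift K)
  | .ite c p q => .ite (c.shift K) (p.shift K) (q.shift K)
  | .ifZero e p q => .ifZero (e.shift K) (p.shift K) (q.shift K)
  | .loop c p => .loop (c.shift K) (p.shift K)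

def Tape.guest (K : ℕ) (ω : Tape F) : Tape F where
  bit x := ω.bit (x.1 + K, x.2)
  elt x := ω.elt (x.1 + K, x.2)

/-- The part of the memory that the guest sees. -/
def State.guest (K : ℕ) (s : State F) : State F where
  w a := s.w (a + K)
  f a := s.f (a + K)

/-- Replace the guest's part of the memory. -/
def State.withGuest (K : ℕ) (s g : State F) : State F where
  w a := if a < K then s.w a else g.w (a - K)
  f a := if a < K then s.f a else g.f (a - K)

@[simp] theorem State.guest_withGuest (K : ℕ) (s g : State F) :
    (s.withGuest K g).guest K = g := by
  apply State.ext' <;> intro a i <;> simp [State.guest, State.withGuest]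

@[simp] theorem State.withGuest_guest (K : ℕ) (s : State F) : s.withGuest K (s.guest K) = s := by
  apply State.ext' <;> intro a i <;> simp only [State.guest, State.withGuest] <;> split_ifs <;>
    first | rfl | (rw [Nat.sub_add_cancel (by omega)])

@[simp] theorem State.withGuest_withGuest (K : ℕ) (s g g' : State F) :
    (s.withGuest K g).withGuest K g' = s.withGuest K g' := by
  apply State.ext' <;> intro a i <;> simp only [State.withGuest] <;> split_ifs <;> rfl

theorem State.withGuest_putW (K : ℕ) (s : State F) (a i v : ℕ) :
    s.withGuest K ((s.guest K).putW a i v) = s.putW (a + K) i v := by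
  apply State.ext' <;> intro b j
  · simp only [State.withGuest, State.putW_w, State.guest]
    by_cases hb : b < K
    · simp [hb, show b ≠ a + K by omega]
    · have : b - K + K = b := by omega
      simp only [hb, if_false, this, show (b - K = a) = (b = a + K) by
        apply propext; omega]
  · simp only [State.withGuest, State.putW_f, State.guest]
    split_ifs
    · rfl
    · rw [Nat.sub_add_cancel (by omega)]

theorem State.withGuest_putF (K : ℕ) (s : State F) (a i : ℕ) (v : F) :
    s.withGuest K ((s.guest K).putF a i v) = s.putF (a + K) i v := by
  apply State.ext' <;> intro b j
  · simp only [State.withGuest, State.putF_w, State.guest]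
    split_ifs
    · rfl
    · rw [Nat.sub_add_cancel (by omega)]
  · simp only [State.withGuest, State.putF_f, State.guest]
    by_cases hb : b < K
    · simp [hb, show b ≠ a + K by omega]
    · have : b - K + K = b := by omega
      simp only [hb, if_false, this, show (b - K = a) = (b = a + K) by
        apply propext; omega]

theorem WExp.val_shift (K : ℕ) (ω : Tape F) (s : State F) :
    ∀ e : WExp, (e.shift K).val ω s = e.val (ω.guest K) (s.guest K)
  | .const _ => rfl
  | .cell a i => by simp only [WExp.shift, WExp.val, WExp.val_shift K ω s i]; rfl
  | .coin a i => by simp only [WExp.shift, WExp.val, WExp.val_shift K ω s i]; rfl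
  | .op o x y => by simp only [WExp.shift, WExp.val, WExp.val_shift K ω s x, WExp.val_shift K ω s y]

theorem WExp.fits_shift (K : ℕ) (ω : Tape F) (W : ℕ) (s : State F) :
    ∀ e : WExp, (e.shift K).Fits ω W s ↔ e.Fits (ω.guest K) W (s.guest K)
  | .const _ => Iff.rfl
  | .cell a i => WExp.fits_shift K ω W s i
  | .coin a i => WExp.fits_shift K ω W s i
  | .op o x y => by
    simp only [WExp.shift, WExp.Fits, WExp.fits_shift K ω W s x, WExp.fits_shift K ω W s y,
      WExp.val_shift]

theorem FExp.val_shift (K : ℕ) (ω : Tape F) (s : State F) :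
    ∀ e : FExp, (e.shift K).val ω s = e.val (ω.guest K) (s.guest K)
  | .zero => rfl
  | .one => rfl
  | .cell a i => by simp only [FExp.shift, FExp.val, WExp.val_shift K ω s i]; rfl
  | .rand a i => by simp only [FExp.shift, FExp.val, WExp.val_shift K ω s i]; rfl
  | .add x y => by simp only [FExp.shift, FExp.val, FExp.val_shift K ω s x, FExp.val_shift K ω s y]
  | .sub x y => by simp only [FExp.shift, FExp.val, FExp.val_shift K ω s x, FExp.val_shift K ω s y]
  | .mul x y => by simp only [FExp.shift, FExp.val, FExp.val_shift K ω s x, FExp.val_shift K ω s y]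
  | .div x y => by simp only [FExp.shift, FExp.val, FExp.val_shift K ω s x, FExp.val_shift K ω s y]

theorem FExp.fits_shift (K : ℕ) (ω : Tape F) (W : ℕ) (s : State F) :
    ∀ e : FExp, (e.shift K).Fits ω W s ↔ e.Fits (ω.guest K) W (s.guest K)
  | .zero => Iff.rfl
  | .one => Iff.rfl
  | .cell a i => WExp.fits_shift K ω W s i
  | .rand a i => WExp.fits_shift K ω W s i
  | .add x y => and_congr (FExp.fits_shift K ω W s x) (FExp.fits_shift K ω W s y)
  | .sub x y => and_congr (FExp.fits_shift K ω W s x) (FExp.fits_shift K ω W s y)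
  | .mul x y => and_congr (FExp.fits_shift K ω W s x) (FExp.fits_shift K ω W s y)
  | .div x y => and_congr (FExp.fits_shift K ω W s x) (FExp.fits_shift K ω W s y)

theorem WExp.cost_shift (K : ℕ) : ∀ e : WExp, (e.shift K).cost = e.cost
  | .const _ => rfl
  | .cell a i => by simp only [WExp.shift, WExp.cost, WExp.cost_shift K i]
  | .coin a i => by simp only [WExp.shift, WExp.cost, WExp.cost_shift K i]
  | .op o x y => by simp only [WExp.shift, WExp.cost, WExp.cost_shift K x, WExp.cost_shift K y]

theorem FExp.cost_shift (K : ℕ) : ∀ e : FExp, (e.shift K).cost = e.cost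
  | .zero => rfl
  | .one => rfl
  | .cell a i => by simp only [FExp.shift, FExp.cost, WExp.cost_shift K i]
  | .rand a i => by simp only [FExp.shift, FExp.cost, WExp.cost_shift K i]
  | .add x y => by simp only [FExp.shift, FExp.cost, FExp.cost_shift K x, FExp.cost_shift K y]
  | .sub x y => by simp only [FExp.shift, FExp.cost, FExp.cost_shift K x, FExp.cost_shift K y]
  | .mul x y => by simp only [FExp.shift, FExp.cost, FExp.cost_shift K x, FExp.cost_shift K y]
  | .div x y => by simp only [FExp.shift, FExp.cost, FExp.cost_shift K x, FExp.cost_shift K y]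

/-- The guest program runs in its part of the memory as it runs alone. -/
theorem Exec.shift {g g' : State F}
    (h : Exec (ω.guest K) W p g g' t) : ∀ s : State F, s.guest K = g →
      Exec ω W (p.shift K) s (s.withGuest K g') t := by
  induction h with
  | skip g => rintro s rfl; rw [State.withGuest_guest]; exact .skip s
  | @setW g a i e hi he =>
    rintro s rfl
    have h := Exec.setW (a := a + K) ((WExp.fits_shift K ω W s _).2 hi) ((WExp.fits_shift K ω W s _).2 he)
    simp only [WExp.val_shift, WExp.cost_shift] at h
    rw [State.withGuest_putW]
    exact h
  | @setF g a i e hi he =>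
    rintro s rfl
    have h := Exec.setF (a := a + K) ((WExp.fits_shift K ω W s _).2 hi) ((FExp.fits_shift K ω W s _).2 he)
    simp only [WExp.val_shift, WExp.cost_shift, FExp.val_shift, FExp.cost_shift] at h
    rw [State.withGuest_putF]
    exact h
  | seq _ _ ih₁ ih₂ =>
    rintro s rfl
    have h₂ := ih₂ _ (State.guest_withGuest K s _)
    rw [State.withGuest_withGuest] at h₂
    exact .seq (ih₁ s rfl) h₂
  | @iteTrue c p q g g' t hf hc _ ih =>
    rintro s rfl
    rw [← WExp.cost_shift K]
    exact .iteTrue ((WExp.fits_shift ..).2 hf) (by rwa [WExp.val_shift]) (ih s rfl)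
  | iteFalse hf hc _ ih =>
    rintro s rfl
    rw [← WExp.cost_shift K]
    exact .iteFalse ((WExp.fits_shift ..).2 hf) (by rwa [WExp.val_shift]) (ih s rfl)
  | ifZeroTrue hf hc _ ih =>
    rintro s rfl
    rw [← FExp.cost_shift K]
    exact .ifZeroTrue ((FExp.fits_shift ..).2 hf) (by rwa [FExp.val_shift]) (ih s rfl)
  | ifZeroFalse hf hc _ ih =>
    rintro s rfl
    rw [← FExp.cost_shift K]
    exact .ifZeroFalse ((FExp.fits_shift ..).2 hf) (by rwa [FExp.val_shift]) (ih s rfl)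
  | loopStop hf hc =>
    rintro s rfl
    rw [← WExp.cost_shift K, State.withGuest_guest]
    exact .loopStop ((WExp.fits_shift ..).2 hf) (by rwa [WExp.val_shift])
  | loopStep hf hc _ _ ih₁ ih₂ =>
    rintro s rfl
    have h₂ := ih₂ _ (State.guest_withGuest K s _)
    rw [State.withGuest_withGuest] at h₂
    rw [← WExp.cost_shift K]
    exact .loopStep ((WExp.fits_shift ..).2 hf) (by rwa [WExp.val_shift]) (ih₁ s rfl) h₂

/-! ### Undoing a program

The arrays `13, …, 16` hold a log of the writes: its length, the array, the index, and the old
word and field element. -/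

/-- The arrays of the log. -/
def IsLog (a : ℕ) : Prop := 13 ≤ a ∧ a < 17

theorem notLog {b : ℕ} (h : b < 13 ∨ 16 < b) : ¬ IsLog b := fun hb => by
  have := hb.1; have := hb.2; omega

instance : DecidablePred IsLog := fun a => inferInstanceAs (Decidable (13 ≤ a ∧ a < 17))

def WExp.Free : WExp → Prop
  | .const _ => True
  | .cell a i => ¬ IsLog a ∧ i.Free
  | .coin _ i => i.Free
  | .op _ x y => x.Free ∧ y.Free

def FExp.Free : FExp → Prop
  | .zero => True
  | .one => True
  | .cell a i => ¬ IsLog a ∧ i.Free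
  | .rand _ i => i.Free
  | .add x y => x.Free ∧ y.Free
  | .sub x y => x.Free ∧ y.Free
  | .mul x y => x.Free ∧ y.Free
  | .div x y => x.Free ∧ y.Free

/-- The program does not use the log. -/
def Cmd.Free : Cmd → Prop
  | .skip => True
  | .setW a i e => ¬ IsLog a ∧ i.Free ∧ e.Free
  | .setF a i e => ¬ IsLog a ∧ i.Free ∧ e.Free
  | .seq p q => p.Free ∧ q.Free
  | .ite c p q => c.Free ∧ p.Free ∧ q.Free
  | .ifZero e p q => e.Free ∧ p.Free ∧ q.Free
  | .loop c p => c.Free ∧ p.Free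

/-- The arrays that the program writes. -/
def Cmd.writes : Cmd → List ℕ
  | .skip => []
  | .setW a _ _ => [a]
  | .setF a _ _ => [a]
  | .seq p q => p.writes ++ q.writes
  | .ite _ p q => p.writes ++ q.writes
  | .ifZero _ p q => p.writes ++ q.writes
  | .loop _ p => p.writes

theorem WExp.free_shift (hK : 17 ≤ K) : ∀ e : WExp, (e.shift K).Free
  | .const _ => trivial
  | .cell a i => ⟨notLog (by omega), WExp.free_shift hK i⟩
  | .coin a i => WExp.free_shift hK i
  | .op o x y => ⟨WExp.free_shift hK x, WExp.free_shift hK y⟩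

theorem FExp.free_shift (hK : 17 ≤ K) : ∀ e : FExp, (e.shift K).Free
  | .zero => trivial
  | .one => trivial
  | .cell a i => ⟨notLog (by omega), WExp.free_shift hK i⟩
  | .rand a i => WExp.free_shift hK i
  | .add x y => ⟨FExp.free_shift hK x, FExp.free_shift hK y⟩
  | .sub x y => ⟨FExp.free_shift hK x, FExp.free_shift hK y⟩
  | .mul x y => ⟨FExp.free_shift hK x, FExp.free_shift hK y⟩
  | .div x y => ⟨FExp.free_shift hK x, FExp.free_shift hK y⟩

theorem Cmd.free_shift (hK : 17 ≤ K) : ∀ p : Cmd, (p.shift K).Free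
  | .skip => trivial
  | .setW a i e => ⟨notLog (by omega), i.free_shift hK, e.free_shift hK⟩
  | .setF a i e => ⟨notLog (by omega), i.free_shift hK, e.free_shift hK⟩
  | .seq p q => ⟨p.free_shift hK, q.free_shift hK⟩
  | .ite c p q => ⟨c.free_shift hK, p.free_shift hK, q.free_shift hK⟩
  | .ifZero e p q => ⟨e.free_shift hK, p.free_shift hK, q.free_shift hK⟩
  | .loop c p => ⟨c.free_shift hK, p.free_shift hK⟩

theorem Cmd.le_of_mem_writes_shift : ∀ {p : Cmd} {a : ℕ}, a ∈ (p.shift K).writes → K ≤ a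
  | .skip, a, h => by simp [Cmd.shift, Cmd.writes] at h
  | .setW _ _ _, a, h => by simp [Cmd.shift, Cmd.writes] at h; omega
  | .setF _ _ _, a, h => by simp [Cmd.shift, Cmd.writes] at h; omega
  | .seq p q, a, h => by
    simp only [Cmd.shift, Cmd.writes, List.mem_append] at h
    exact h.elim Cmd.le_of_mem_writes_shift Cmd.le_of_mem_writes_shift
  | .ite _ p q, a, h => by
    simp only [Cmd.shift, Cmd.writes, List.mem_append] at h
    exact h.elim Cmd.le_of_mem_writes_shift Cmd.le_of_mem_writes_shift
  | .ifZero _ p q, a, h => by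
    simp only [Cmd.shift, Cmd.writes, List.mem_append] at h
    exact h.elim Cmd.le_of_mem_writes_shift Cmd.le_of_mem_writes_shift
  | .loop _ p, a, h => Cmd.le_of_mem_writes_shift (p := p) h

/-- Log the content of a cell that is to be overwritten. -/
def logCell (a : ℕ) (i : WExp) : Cmd :=
  .seq (.setW 14 (.cell 13 (.const 0)) (.const a))
  (.seq (.setW 15 (.cell 13 (.const 0)) i)
  (.seq (.setW 16 (.cell 13 (.const 0)) (.cell a i))
  (.seq (.setF 16 (.cell 13 (.const 0)) (.cell a i))
    (.setW 13 (.const 0) (.op .add (.cell 13 (.const 0)) (.const 1))))))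

/-- The program with a log of its writes. -/
def Cmd.logged : Cmd → Cmd
  | .skip => .skip
  | .setW a i e => .seq (logCell a i) (.setW a i e)
  | .setF a i e => .seq (logCell a i) (.setF a i e)
  | .seq p q => .seq p.logged q.logged
  | .ite c p q => .ite c p.logged q.logged
  | .ifZero e p q => .ifZero e p.logged q.logged
  | .loop c p => .loop c p.logged

/-- An entry of the log. -/
structure LogEntry (F : Type*) where
  a : ℕ
  i : ℕ
  v : ℕ
  x : F

def LogEntry.restore (e : LogEntry F) (s : State F) : State F :=
  (s.putW e.a e.i e.v).putF e.a e.i e.x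

/-- The memories agree, except for the log. -/
def SameMem (s r : State F) : Prop := ∀ a, ¬ IsLog a → s.w a = r.w a ∧ s.f a = r.f a

/-- The entries of the log are `es`. -/
structure LogOf (r : State F) (es : List (LogEntry F)) : Prop where
  len : r.w 13 0 = es.length
  get : ∀ k (h : k < es.length), r.w 14 k = es[k].a ∧ r.w 15 k = es[k].i ∧ r.w 16 k = es[k].v ∧
    r.f 16 k = es[k].x

theorem WExp.val_same (h : SameMem s r) :
    ∀ {e : WExp}, e.Free → e.val ω r = e.val ω s
  | .const _, _ => rfl
  | .cell a i, he => by simp only [WExp.val, WExp.val_same h he.2, (h a he.1).1]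
  | .coin a i, he => by simp only [WExp.val, WExp.val_same (e := i) h he]
  | .op o x y, he => by simp only [WExp.val, WExp.val_same h he.1, WExp.val_same h he.2]

theorem WExp.fits_same (h : SameMem s r) :
    ∀ {e : WExp}, e.Free → e.Fits ω W s → e.Fits ω W r
  | .const _, _, hf => hf
  | .cell a i, he, hf => WExp.fits_same (e := i) h he.2 hf
  | .coin a i, he, hf => WExp.fits_same (e := i) h he hf
  | .op o x y, he, hf => ⟨WExp.fits_same h he.1 hf.1, WExp.fits_same h he.2 hf.2.1, by
      rw [WExp.val_same h he.1, WExp.val_same h he.2]; exact hf.2.2⟩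

theorem FExp.val_same (h : SameMem s r) :
    ∀ {e : FExp}, e.Free → e.val ω r = e.val ω s
  | .zero, _ => rfl
  | .one, _ => rfl
  | .cell a i, he => by simp only [FExp.val, WExp.val_same h he.2, (h a he.1).2]
  | .rand a i, he => by simp only [FExp.val, WExp.val_same (e := i) h he]
  | .add x y, he => by simp only [FExp.val, FExp.val_same h he.1, FExp.val_same h he.2]
  | .sub x y, he => by simp only [FExp.val, FExp.val_same h he.1, FExp.val_same h he.2]
  | .mul x y, he => by simp only [FExp.val, FExp.val_same h he.1, FExp.val_same h he.2]
  | .div x y, he => by simp only [FExp.val, FExp.val_same h he.1, FExp.val_same h he.2]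

theorem FExp.fits_same (h : SameMem s r) :
    ∀ {e : FExp}, e.Free → e.Fits ω W s → e.Fits ω W r
  | .zero, _, _ => trivial
  | .one, _, _ => trivial
  | .cell a i, he, hf => WExp.fits_same (e := i) h he.2 hf
  | .rand a i, he, hf => WExp.fits_same (e := i) h he hf
  | .add x y, he, hf => ⟨FExp.fits_same h he.1 hf.1, FExp.fits_same h he.2 hf.2⟩
  | .sub x y, he, hf => ⟨FExp.fits_same h he.1 hf.1, FExp.fits_same h he.2 hf.2⟩
  | .mul x y, he, hf => ⟨FExp.fits_same h he.1 hf.1, FExp.fits_same h he.2 hf.2⟩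
  | .div x y, he, hf => ⟨FExp.fits_same h he.1 hf.1, FExp.fits_same h he.2 hf.2⟩

theorem logCell_exec {i : WExp} {es : List (LogEntry F)}
    (hs : SameMem s r) (hl : LogOf r es) (ha : ¬ IsLog a) (hi : i.Free) (hf : i.Fits ω W s)
    (haW : a < W) (hW : es.length + 1 < W) :
    ∃ r' t, Exec ω W (logCell a i) r r' t ∧ SameMem s r' ∧
      LogOf r' (es ++ [⟨a, i.val ω s, s.w a (i.val ω s), s.f a (i.val ω s)⟩]) ∧
      t ≤ 3 * i.cost + 24 := by
  have hne : ∀ {c}, ¬ IsLog c → c ≠ 13 ∧ c ≠ 14 ∧ c ≠ 15 ∧ c ≠ 16 := fun h => by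
    simp only [IsLog] at h; omega
  obtain ⟨-, h14, h15, -⟩ := hne ha
  have same : ∀ {r₁ : State F} (b j v : ℕ), IsLog b → SameMem s r₁ → SameMem s (r₁.putW b j v) := by
    intro r₁ b j v hb h c hc
    have : c ≠ b := fun h => hc (h ▸ hb)
    simpa [this] using h c hc
  have s1 : SameMem s (r.putW 14 (r.w 13 0) a) := same _ _ _ ⟨by omega, by omega⟩ hs
  have s2 := same 15 (r.w 13 0) (i.val ω s) ⟨by omega, by omega⟩ s1
  have s3 := same 16 (r.w 13 0) (s.w a (i.val ω s)) ⟨by omega, by omega⟩ s2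
  have hok : (logCell a i).Ok ω W r := by
    have p0 : 0 < W := by omega
    have p1 : 1 < W := by omega
    simp only [logCell, Cmd.Ok, Cmd.ev, WExp.Fits, FExp.Fits, WExp.val, FExp.val, State.putW_w,
      State.putF_w, WOp.val, if_neg h14, if_neg h15, WExp.val_same s1 hi, WExp.val_same s2 hi,
      (hs a ha).1.symm, Nat.reduceEqDiff, if_false]
    refine ⟨⟨p0, haW⟩, ⟨p0, WExp.fits_same s1 hi hf⟩, ⟨p0, WExp.fits_same s2 hi hf⟩,
      ⟨p0, WExp.fits_same s3 hi hf⟩, p0, p0, p1, ?_⟩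
    simpa [hl.len] using hW
  obtain ⟨t, e, ht⟩ := hok.exec
  refine ⟨_, t, e, ?_, ?_, ht.trans (by simp only [logCell, Cmd.cost, WExp.cost, FExp.cost]; omega)⟩
  · intro c hc
    obtain ⟨c13, c14, c15, c16⟩ := hne hc
    simp only [logCell, Cmd.ev, State.putW_w, State.putF_w, State.putF_f, State.putW_f, if_neg c13,
      if_neg c14, if_neg c15, if_neg c16]
    exact hs c hc
  · have hev : (logCell a i).ev ω r = ((((r.putW 14 (r.w 13 0) a).putW 15 (r.w 13 0)
        (i.val ω s)).putW 16 (r.w 13 0) (s.w a (i.val ω s))).putF 16 (r.w 13 0)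
        (s.f a (i.val ω s))).putW 13 0 (r.w 13 0 + 1) := by
      simp only [logCell, Cmd.ev, WExp.val, FExp.val, WOp.val, State.putW_w, State.putF_w,
        State.putW_f, if_neg h14, if_neg h15, Nat.reduceEqDiff, if_false,
        WExp.val_same s1 hi, WExp.val_same s2 hi, (hs a ha).1.symm, (hs a ha).2.symm,
        WExp.val_same s3 hi]
    rw [hev]
    constructor
    · simp [hl.len]
    · intro k hk
      simp only [State.putW_w, State.putF_w, State.putF_f, State.putW_f, 
        Nat.reduceEqDiff, if_false, if_true, hl.len, update_apply]
      by_cases hke : k = es.length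
      · subst hke
        simp
      · have hk' : k < es.length := by simp at hk; omega
        simp only [if_neg hke, List.getElem_append_left hk']
        exact hl.get k hk'

theorem restore_putW (s : State F) (a i v : ℕ) :
    LogEntry.restore ⟨a, i, s.w a i, s.f a i⟩ (s.putW a i v) = s := by
  apply State.ext' <;> intro b j <;>
    simp only [LogEntry.restore, State.putW_w, State.putF_w, State.putF_f, State.putW_f
      ] <;> split_ifs <;> simp_all

theorem restore_putF (s : State F) (a i : ℕ) (v : F) :
    LogEntry.restore ⟨a, i, s.w a i, s.f a i⟩ (s.putF a i v) = s := by
  apply State.ext' <;> intro b j <;>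
    simp only [LogEntry.restore, State.putW_w, State.putF_w, State.putF_f, State.putW_f
      ] <;> split_ifs <;> simp_all

theorem SameMem.putW (h : SameMem s r) (a i v : ℕ) :
    SameMem (s.putW a i v) (r.putW a i v) := by
  intro b hb
  refine ⟨?_, (h b hb).2⟩
  simp only [State.putW_w]
  split_ifs with hba
  · subst hba; rw [(h b hb).1]
  · exact (h b hb).1

theorem SameMem.putF (h : SameMem s r) (a i : ℕ) (v : F) :
    SameMem (s.putF a i v) (r.putF a i v) := by
  intro b hb
  refine ⟨(h b hb).1, ?_⟩
  simp only [State.putF_f]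
  split_ifs with hba
  · subst hba; rw [(h b hb).2]
  · exact (h b hb).2

theorem LogOf.putW {es : List (LogEntry F)} (h : LogOf r es) {a : ℕ}
    (ha : ¬ IsLog a) (i v : ℕ) : LogOf (r.putW a i v) es := by
  have h13 : ¬ (13 = a) := fun h => ha (h ▸ ⟨le_rfl, by omega⟩)
  have h14 : ¬ (14 = a) := fun h => ha (h ▸ ⟨by omega, by omega⟩)
  have h15 : ¬ (15 = a) := fun h => ha (h ▸ ⟨by omega, by omega⟩)
  have h16 : ¬ (16 = a) := fun h => ha (h ▸ ⟨by omega, by omega⟩)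
  constructor
  · simp [h13, h.len]
  · simpa [h14, h15, h16] using h.get

theorem LogOf.putF {es : List (LogEntry F)} (h : LogOf r es) {a : ℕ}
    (ha : ¬ IsLog a) (i : ℕ) (v : F) : LogOf (r.putF a i v) es := by
  have h16 : ¬ (16 = a) := fun h => ha (h ▸ ⟨by omega, by omega⟩)
  constructor
  · simp [h.len]
  · simpa [h16] using h.get

theorem WExp.one_le_cost : ∀ e : WExp, 1 ≤ e.cost
  | .const _ => le_rfl
  | .cell _ _ => by simp [WExp.cost]
  | .coin _ _ => by simp [WExp.cost]
  | .op _ _ _ => by simp [WExp.cost]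

/-- The logged version of `p` follows the run of `p` from `s` to `s'`, appending to the log what
leads back to `s`. -/
def Cmd.Mirrored (ω : Tape F) (W : ℕ) (p : Cmd) (s s' : State F) (t : ℕ) : Prop :=
  (∀ a ∈ p.writes, a < W) →
    ∀ (r : State F) (es : List (LogEntry F)), SameMem s r → LogOf r es → es.length + t < W →
    ∃ r' es' t', Exec ω W p.logged r r' t' ∧ SameMem s' r' ∧ LogOf r' (es ++ es') ∧
      es'.foldr LogEntry.restore s' = s ∧ es'.length ≤ t ∧ (∀ e ∈ es', e.a ∈ p.writes) ∧
      t' ≤ 40 * t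

theorem Cmd.Mirrored.branch {q : Cmd} {s' : State F} {k : ℕ} (h : p.Mirrored ω W s s' t)
    (hw : ∀ a ∈ p.writes, a ∈ q.writes) (he : ∀ {r r' t'}, SameMem s r →
      Exec ω W p.logged r r' t' → Exec ω W q.logged r r' (k + t')) :
    q.Mirrored ω W s s' (k + t) := by
  intro hW r es hs hl hk
  obtain ⟨r₁, es₁, t₁, e₁, s₁, l₁, u₁, n₁, w₁, c₁⟩ := h (fun a ha => hW a (hw a ha)) r es hs hl
    (by omega)
  exact ⟨r₁, es₁, _, he hs e₁, s₁, l₁, u₁, by omega, fun e h => hw _ (w₁ e h), by omega⟩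

theorem Exec.logged {s' : State F} (h : Exec ω W p s s' t) : p.Free → p.Mirrored ω W s s' t := by
  induction h with
  | skip s =>
    intro _ _ r es hs hl _
    exact ⟨r, [], 1, .skip r, hs, by simpa using hl, rfl, by simp, by simp, by omega⟩
  | @setW s a i e hi he =>
    intro hf hw r es hs hl hW
    have ha : a < W := hw a (by simp [Cmd.writes])
    obtain ⟨r₁, t₁, e₁, s₁, l₁, c₁⟩ := logCell_exec hs hl hf.1 hf.2.1 hi ha
      (by have := i.one_le_cost; omega)
    refine ⟨_, _, _, .seq e₁ (.setW (WExp.fits_same s₁ hf.2.1 hi) (WExp.fits_same s₁ hf.2.2 he)),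
      ?_, l₁.putW hf.1 _ _, ?_, ?_, ?_, ?_⟩
    · rw [WExp.val_same s₁ hf.2.1, WExp.val_same s₁ hf.2.2]
      exact s₁.putW _ _ _
    · simpa using restore_putW s a _ _
    · simp
    · simp [Cmd.writes]
    · have := i.one_le_cost
      omega
  | @setF s a i e hi he =>
    intro hf hw r es hs hl hW
    have ha : a < W := hw a (by simp [Cmd.writes])
    obtain ⟨r₁, t₁, e₁, s₁, l₁, c₁⟩ := logCell_exec hs hl hf.1 hf.2.1 hi ha
      (by have := i.one_le_cost; omega)
    refine ⟨_, _, _, .seq e₁ (.setF (WExp.fits_same s₁ hf.2.1 hi) (FExp.fits_same s₁ hf.2.2 he)),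
      ?_, l₁.putF hf.1 _ _, ?_, ?_, ?_, ?_⟩
    · rw [WExp.val_same s₁ hf.2.1, FExp.val_same s₁ hf.2.2]
      exact s₁.putF _ _ _
    · simpa using restore_putF s a _ _
    · simp
    · simp [Cmd.writes]
    · have := i.one_le_cost
      omega
  | seq hp hq ih₁ ih₂ =>
    intro hf hw r es hs hl hW
    obtain ⟨r₁, es₁, t₁, e₁, s₁, l₁, u₁, n₁, w₁, c₁⟩ := ih₁ hf.1
      (fun a ha => hw a (by simp [Cmd.writes, ha])) r es hs hl (by omega)
    obtain ⟨r₂, es₂, t₂, e₂, s₂, l₂, u₂, n₂, w₂, c₂⟩ := ih₂ hf.2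
      (fun a ha => hw a (by simp [Cmd.writes, ha])) r₁ _ s₁ l₁ (by simp; omega)
    refine ⟨r₂, es₁ ++ es₂, _, .seq e₁ e₂, s₂, by simpa using l₂, ?_, by simp; omega, ?_, by omega⟩
    · rw [List.foldr_append, u₂, u₁]
    · intro e he
      simp only [Cmd.writes, List.mem_append] at he ⊢
      exact he.imp (w₁ e) (w₂ e)
  | iteTrue hf' hc hp ih =>
    exact fun hf => (ih hf.2.1).branch (by simp +contextual [Cmd.writes]) fun hs =>
      .iteTrue (WExp.fits_same hs hf.1 hf') (by rwa [WExp.val_same hs hf.1])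
  | iteFalse hf' hc hp ih =>
    exact fun hf => (ih hf.2.2).branch (by simp +contextual [Cmd.writes]) fun hs =>
      .iteFalse (WExp.fits_same hs hf.1 hf') (by rwa [WExp.val_same hs hf.1])
  | ifZeroTrue hf' hc hp ih =>
    exact fun hf => (ih hf.2.1).branch (by simp +contextual [Cmd.writes]) fun hs =>
      .ifZeroTrue (FExp.fits_same hs hf.1 hf') (by rwa [FExp.val_same hs hf.1])
  | ifZeroFalse hf' hc hp ih =>
    exact fun hf => (ih hf.2.2).branch (by simp +contextual [Cmd.writes]) fun hs =>
      .ifZeroFalse (FExp.fits_same hs hf.1 hf') (by rwa [FExp.val_same hs hf.1])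
  | loopStop hf' hc =>
    intro hf hw r es hs hl hW
    exact ⟨r, [], _, .loopStop (WExp.fits_same hs hf.1 hf') (by rwa [WExp.val_same hs hf.1]), hs,
      by simpa using hl, rfl, by simp, by simp, by omega⟩
  | loopStep hf' hc hp hq ih₁ ih₂ =>
    intro hf hw r es hs hl hW
    obtain ⟨r₁, es₁, t₁, e₁, s₁, l₁, u₁, n₁, w₁, c₁⟩ := ih₁ hf.2 hw r es hs hl (by omega)
    obtain ⟨r₂, es₂, t₂, e₂, s₂, l₂, u₂, n₂, w₂, c₂⟩ := ih₂ hf hw r₁ _ s₁ l₁ (by simp; omega)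
    refine ⟨r₂, es₁ ++ es₂, _, .loopStep (WExp.fits_same hs hf.1 hf')
      (by rwa [WExp.val_same hs hf.1]) e₁ e₂, s₂, by simpa using l₂, ?_, by simp; omega, ?_,
      by omega⟩
    · rw [List.foldr_append, u₂, u₁]
    · intro e he
      simp only [List.mem_append] at he
      exact he.elim (w₁ e) (w₂ e)

/-! ### Undo -/

/-- Restore the cell of array `a` that the last entry of the log is about. -/
def restoreCell (a : ℕ) : Cmd :=
  .seq (.setW a (.cell 15 (.cell 13 (.const 0))) (.cell 16 (.cell 13 (.const 0))))
    (.setF a (.cell 15 (.cell 13 (.const 0))) (.cell 16 (.cell 13 (.const 0))))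

def restoreOne : List ℕ → Cmd
  | [] => .skip
  | a :: l => .ite (.op .eq (.cell 14 (.cell 13 (.const 0))) (.const a)) (restoreCell a)
      (restoreOne l)

/-- Undo all the writes in the log, which are in arrays of the list. -/
def undo (l : List ℕ) : Cmd :=
  .loop (.cell 13 (.const 0))
    (.seq (.setW 13 (.const 0) (.op .sub (.cell 13 (.const 0)) (.const 1))) (restoreOne l))

theorem restoreCell_ok (hW : 0 < W) :
    (restoreCell a).Ok ω W s := by
  simp [restoreCell, Cmd.Ok, WExp.Fits, FExp.Fits, hW]

theorem restoreCell_ev (ha : ¬ IsLog a) :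
    (restoreCell a).ev ω s = LogEntry.restore ⟨a, s.w 15 (s.w 13 0), s.w 16 (s.w 13 0),
      s.f 16 (s.w 13 0)⟩ s := by
  have h13 : ¬ (13 = a) := fun h => ha (h ▸ ⟨le_rfl, by omega⟩)
  have h15 : ¬ (15 = a) := fun h => ha (h ▸ ⟨by omega, by omega⟩)
  simp [restoreCell, Cmd.ev, WExp.val, FExp.val, LogEntry.restore, h13, h15]

theorem restoreOne_ok (hW : 1 < W) :
    ∀ {l : List ℕ}, (∀ a ∈ l, a < W) → (restoreOne l).Ok ω W s
  | [], _ => trivial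
  | a :: l, h => by
    refine ⟨⟨by simp [WExp.Fits]; omega, h a (by simp), ?_⟩, fun _ => restoreCell_ok (by omega),
      fun _ => restoreOne_ok hW fun b hb => h b (by simp [hb])⟩
    simp only [WOp.val]
    split_ifs <;> omega

theorem restoreOne_ev :
    ∀ {l : List ℕ}, (∀ a ∈ l, ¬ IsLog a) → s.w 14 (s.w 13 0) ∈ l →
      (restoreOne l).ev ω s = LogEntry.restore ⟨s.w 14 (s.w 13 0), s.w 15 (s.w 13 0),
        s.w 16 (s.w 13 0), s.f 16 (s.w 13 0)⟩ s
  | [], _, h => by simp at h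
  | a :: l, hl, h => by
    simp only [restoreOne, Cmd.ev, WExp.val, WOp.val]
    by_cases ha : s.w 14 (s.w 13 0) = a
    · simp only [ha, if_true, one_ne_zero, if_false, restoreCell_ev (hl a (by simp))]
    · simp only [ha, if_false, if_true]
      exact restoreOne_ev (fun b hb => hl b (by simp [hb])) (by simpa [ha] using h)

theorem SameMem.restore (h : SameMem s r) (e : LogEntry F) :
    SameMem (e.restore s) (e.restore r) := (h.putW _ _ _).putF _ _ _

theorem undo_exec {l : List ℕ} (hl : ∀ a ∈ l, ¬ IsLog a)
    (hlW : ∀ a ∈ l, a < W) (es : List (LogEntry F)) :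
    ∀ (s r : State F), SameMem s r → LogOf r es → (∀ e ∈ es, e.a ∈ l) → es.length + 1 < W →
      Halts ω W (undo l) r ((es.length + 1) * ((restoreOne l).cost + 20)) fun r' =>
        SameMem (es.foldr LogEntry.restore s) r' ∧ r'.w 13 0 = 0 := by
  induction es using List.reverseRecOn with
  | nil =>
    intro s r hs hr _ hW
    refine ⟨r, _, .loopStop (by exact (by omega : 0 < W)) (by simpa [WExp.val] using hr.len), ?_,
      hs, by simpa using hr.len⟩
    simp [WExp.cost]
  | append_singleton es e ih =>
    intro s r hs hr hel hW
    simp only [List.length_append, List.length_singleton] at hW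
    have hlen := hr.len
    simp only [List.length_append, List.length_singleton] at hlen
    set r₁ := r.putW 13 0 es.length with hr₁
    have hs₁ : SameMem s r₁ := by
      intro a ha
      have h13 : ¬ (a = 13) := fun h => ha (h ▸ ⟨le_rfl, by omega⟩)
      simpa [hr₁, h13] using hs a ha
    have hg := hr.get es.length (by simp)
    have hea : e.a ∈ l := hel e (by simp)
    have hlog : ¬ IsLog e.a := hl _ hea
    have hev : (restoreOne l).ev ω r₁ = e.restore r₁ := by
      rw [restoreOne_ev hl]
      · simp [hr₁, hg]
      · simpa [hr₁, hg] using hea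
    have hok : (Cmd.seq (.setW 13 (.const 0) (.op .sub (.cell 13 (.const 0)) (.const 1)))
        (restoreOne l)).Ok ω W r := by
      refine ⟨⟨by exact (by omega : 0 < W), by exact (by omega : 0 < W),
        by exact (by omega : 1 < W), ?_⟩, restoreOne_ok (by omega) hlW⟩
      simp only [WOp.val, WExp.val, hlen]; omega
    have hev' : (Cmd.seq (.setW 13 (.const 0) (.op .sub (.cell 13 (.const 0)) (.const 1)))
        (restoreOne l)).ev ω r = e.restore r₁ := by
      simp only [Cmd.ev, WExp.val, WOp.val, hlen, Nat.add_sub_cancel]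
      exact hev
    obtain ⟨t₁, e₁, c₁⟩ := hok.exec
    rw [hev'] at e₁
    have hl₁ : LogOf (e.restore r₁) es := by
      refine LogOf.putF (LogOf.putW (r := r₁) ?_ hlog _ _) hlog _ _
      constructor
      · simp [hr₁]
      · intro k hk
        have := hr.get k (by simp; omega)
        rw [List.getElem_append_left hk] at this
        simpa [hr₁] using this
    obtain ⟨r₂, t₂, e₂, c₂, q₂⟩ := ih _ _ (hs₁.restore e) hl₁ (fun e he => hel e (by simp [he]))
      (by omega)
    refine ⟨r₂, _, .loopStep (by exact (by omega : 0 < W)) ?_ e₁ e₂, ?_, ?_⟩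
    · simp [WExp.val, hlen]
    · simp only [Cmd.cost, WExp.cost] at c₁
      simp only [List.length_append, List.length_singleton, WExp.cost]
      nlinarith
    · simpa [List.foldr_append] using q₂

theorem foldr_restore_of_notMem : ∀ (es : List (LogEntry F)), (∀ e ∈ es, e.a ≠ a) →
    ∀ s : State F, (es.foldr LogEntry.restore s).w a = s.w a ∧
      (es.foldr LogEntry.restore s).f a = s.f a
  | [], _, s => ⟨rfl, rfl⟩
  | e :: es, h, s => by
    have ha : ¬ (a = e.a) := fun h' => h e (by simp) h'.symm
    have ih := foldr_restore_of_notMem es (fun e he => h e (by simp [he])) s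
    simpa [LogEntry.restore, ha] using ih

theorem foldr_restore_congr : ∀ (es : List (LogEntry F)) (s r : State F),
    s.w a = r.w a → s.f a = r.f a →
      (es.foldr LogEntry.restore s).w a = (es.foldr LogEntry.restore r).w a ∧
      (es.foldr LogEntry.restore s).f a = (es.foldr LogEntry.restore r).f a
  | [], _, _, hw, hf => ⟨hw, hf⟩
  | e :: es, s, r, hw, hf => by
    have ih := foldr_restore_congr es s r hw hf
    constructor <;> simp only [List.foldr_cons, LogEntry.restore, State.putF_w, State.putW_w,
      State.putF_f, State.putW_f] <;> split_ifs with h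
    · subst h; rw [ih.1]
    · exact ih.1
    · subst h; rw [ih.2]
    · exact ih.2

/-- Run `p`, then save some results with `q`, then undo `p`. -/
def sandbox (p q : Cmd) : Cmd := .seq p.logged (.seq q (undo p.writes))

theorem Cmd.Free.writes : ∀ {p : Cmd}, p.Free → ∀ a ∈ p.writes, ¬ IsLog a
  | .skip, _ => by simp [Cmd.writes]
  | .setW a _ _, h => by simpa [Cmd.writes] using h.1
  | .setF a _ _, h => by simpa [Cmd.writes] using h.1
  | .seq p q, h => by
    simp only [Cmd.writes, List.mem_append]
    exact fun a ha => ha.elim (h.1.writes a) (h.2.writes a)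
  | .ite _ p q, h => by
    simp only [Cmd.writes, List.mem_append]
    exact fun a ha => ha.elim (h.2.1.writes a) (h.2.2.writes a)
  | .ifZero _ p q, h => by
    simp only [Cmd.writes, List.mem_append]
    exact fun a ha => ha.elim (h.2.1.writes a) (h.2.2.writes a)
  | .loop _ p, h => h.2.writes

theorem sandbox_halts {q : Cmd} {s' : State F} {B : ℕ}
    (hp : Exec ω W p r s' t) (hfree : p.Free) (hpW : ∀ a ∈ p.writes, a < W) (hr : r.w 13 0 = 0)
    (hW : t + 1 < W) {Post : State F → Prop}
    (hq : ∀ r₁, SameMem s' r₁ → Halts ω W q r₁ B fun r₂ =>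
      (∀ a, a ∈ p.writes ∨ IsLog a → r₂.w a = r₁.w a ∧ r₂.f a = r₁.f a) ∧ Post r₂) :
    Halts ω W (sandbox p q) r (B + (t + 1) * ((restoreOne p.writes).cost + 60)) fun r₃ =>
      (∀ a ∈ p.writes, r₃.w a = r.w a ∧ r₃.f a = r.f a) ∧ r₃.w 13 0 = 0 ∧
      ∃ r₂, Post r₂ ∧ ∀ a, a ∉ p.writes → ¬ IsLog a → r₃.w a = r₂.w a ∧ r₃.f a = r₂.f a := by
  obtain ⟨r₁, es, t₁, e₁, s₁, l₁, u₁, n₁, w₁, c₁⟩ := hp.logged hfree hpW r []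
    (fun _ _ => ⟨rfl, rfl⟩) ⟨by simpa using hr, by simp⟩ (by simp; omega)
  obtain ⟨r₂, t₂, e₂, c₂, k₂, post⟩ := hq r₁ s₁
  rw [List.nil_append] at l₁
  have l₂ : LogOf r₂ es := by
    have h13 := k₂ 13 (.inr ⟨by omega, by omega⟩)
    have h14 := k₂ 14 (.inr ⟨by omega, by omega⟩)
    have h15 := k₂ 15 (.inr ⟨by omega, by omega⟩)
    have h16 := k₂ 16 (.inr ⟨by omega, by omega⟩)
    exact ⟨by rw [h13.1]; exact l₁.len, by rw [h14.1, h15.1, h16.1, h16.2]; exact l₁.get⟩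
  obtain ⟨r₃, t₃, e₃, c₃, s₃, z₃⟩ := undo_exec (ω := ω) (W := W) hfree.writes hpW es r₂ r₂
    (fun _ _ => ⟨rfl, rfl⟩) l₂ w₁ (by omega)
  refine ⟨r₃, _, .seq e₁ (.seq e₂ e₃), ?_, ?_, z₃, r₂, post, ?_⟩
  · nlinarith
  · intro a ha
    have hla := hfree.writes a ha
    have h₁ := s₃ a hla
    have h₂ := foldr_restore_congr (a := a) es s' r₂
      (by rw [(k₂ a (.inl ha)).1, (s₁ a hla).1]) (by rw [(k₂ a (.inl ha)).2, (s₁ a hla).2])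
    rw [u₁] at h₂
    exact ⟨by rw [← h₁.1, ← h₂.1], by rw [← h₁.2, ← h₂.2]⟩
  · intro a ha hla
    have h₁ := s₃ a hla
    have h₂ := foldr_restore_of_notMem (a := a) es (fun e he h => ha (h ▸ w₁ e he)) r₂
    exact ⟨by rw [← h₁.1, h₂.1], by rw [← h₁.2, h₂.2]⟩

/-- Run `p` and undo it unless the word `c` is then `0`. -/
def trial (p : Cmd) (c : WExp) : Cmd :=
  .seq p.logged (.ite c (undo p.writes) (.setW 13 (.const 0) (.const 0)))

theorem trial_halts {c : WExp} {s' : State F}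
    (hp : Exec ω W p r s' t) (hfree : p.Free) (hpW : ∀ a ∈ p.writes, a < W) (hr : r.w 13 0 = 0)
    (hW : t + 1 < W) (hc : c.Free) (hcf : c.Fits ω W s') :
    Halts ω W (trial p c) r ((t + 1) * ((restoreOne p.writes).cost + c.cost + 70)) fun r' =>
      r'.w 13 0 = 0 ∧ SameMem (if c.val ω s' = 0 then s' else r) r' := by
  obtain ⟨r₁, es, t₁, e₁, s₁, l₁, u₁, n₁, w₁, c₁⟩ := hp.logged hfree hpW r []
    (fun _ _ => ⟨rfl, rfl⟩) ⟨by simpa using hr, by simp⟩ (by simp; omega)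
  rw [List.nil_append] at l₁
  have hcv := WExp.val_same (ω := ω) s₁ hc
  by_cases h0 : c.val ω s' = 0
  · refine ⟨_, _, .seq e₁ (.iteFalse (WExp.fits_same s₁ hc hcf) (by rw [hcv, h0])
      (.setW (by exact (by omega : 0 < W)) (by exact (by omega : 0 < W)))), ?_, ?_, ?_⟩
    · simp only [WExp.cost]; nlinarith
    · simp [WExp.val]
    · rw [if_pos h0]
      intro a ha
      have h13 : ¬ (a = 13) := fun h => ha (h ▸ ⟨le_rfl, by omega⟩)
      simpa [h13, WExp.val] using s₁ a ha
  · obtain ⟨r₃, t₃, e₃, c₃, s₃, z₃⟩ := undo_exec (ω := ω) (W := W) hfree.writes hpW es s' r₁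
      s₁ l₁ w₁ (by omega)
    refine ⟨_, _, .seq e₁ (.iteTrue (WExp.fits_same s₁ hc hcf) (by rwa [hcv]) e₃), ?_, z₃, ?_⟩
    · nlinarith
    · rw [if_neg h0, ← u₁]
      exact s₃

end Simulation

end

section

section Blocks

variable {s : State F} {ω : Tape F} {m W S a : ℕ} {p : Cmd}

theorem Exec.frame {s' : State F} {t : ℕ}
    (h : Exec ω W p s s' t) {b : ℕ} : b ∉ p.writes → s'.w b = s.w b ∧ s'.f b = s.f b := by
  induction h with
  | skip => exact fun _ => ⟨rfl, rfl⟩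
  | setW => intro hb; simp only [Cmd.writes, List.mem_singleton] at hb; simp [hb]
  | setF => intro hb; simp only [Cmd.writes, List.mem_singleton] at hb; simp [hb]
  | seq _ _ ih₁ ih₂ =>
    intro hb
    simp only [Cmd.writes, List.mem_append, not_or] at hb
    rw [(ih₂ hb.2).1, (ih₂ hb.2).2]
    exact ih₁ hb.1
  | iteTrue _ _ _ ih =>
    intro hb
    simp only [Cmd.writes, List.mem_append, not_or] at hb
    exact ih hb.1
  | iteFalse _ _ _ ih =>
    intro hb
    simp only [Cmd.writes, List.mem_append, not_or] at hb
    exact ih hb.2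
  | ifZeroTrue _ _ _ ih =>
    intro hb
    simp only [Cmd.writes, List.mem_append, not_or] at hb
    exact ih hb.1
  | ifZeroFalse _ _ _ ih =>
    intro hb
    simp only [Cmd.writes, List.mem_append, not_or] at hb
    exact ih hb.2
  | loopStop => exact fun _ => ⟨rfl, rfl⟩
  | loopStep _ _ _ _ ih₁ ih₂ =>
    intro hb
    rw [(ih₂ hb).1, (ih₂ hb).2]
    exact ih₁ hb

/-- A loop that fills cells of the field array `arr`. -/
theorem fill_halts {ca len arr : ℕ} {e : WExp}
    (addr : ℕ → ℕ) (v : ℕ → F) (hinj : ∀ j < len, ∀ k < len, addr j = addr k → j = k)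
    (hlen : len < W) (hW : 1 < W)
    (he : ∀ s' : State F, (∀ b, b ≠ ca → s'.w b = s.w b) → e.Fits ω W s' ∧ e.val ω s' = len)
    (hp : ∀ k < len, ∀ s' : State F, (∀ b, b ≠ ca → s'.w b = s.w b) →
      (∀ b, b ≠ arr → s'.f b = s.f b) → s'.w ca 0 = k →
      (∀ c, (∀ j < k, addr j ≠ c) → s'.f arr c = s.f arr c) →
      p.Ok ω W s' ∧ p.ev ω s' = s'.putF arr (addr k) (v k)) :
    Halts ω W (forTo ca 0 e p) s ((len + 1) * (p.cost + e.cost + 20)) fun s' =>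
      (∀ b, b ≠ ca → s'.w b = s.w b) ∧ (∀ b, b ≠ arr → s'.f b = s.f b) ∧
      (∀ k < len, s'.f arr (addr k) = v k) ∧
      ∀ c, (∀ j < len, addr j ≠ c) → s'.f arr c = s.f arr c := by
  refine (Halts.forTo (ω := ω) (W := W) (a := ca) (x := 0) (e := e) (p := p) (B := p.cost)
    (len := len) (s := s) (fun k s' => (∀ b, b ≠ ca → s'.w b = s.w b) ∧
      (∀ b, b ≠ arr → s'.f b = s.f b) ∧ s'.w ca 0 = k ∧ k ≤ len ∧
      (∀ j < k, s'.f arr (addr j) = v j) ∧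
      ∀ c, (∀ j < k, addr j ≠ c) → s'.f arr c = s.f arr c) (by omega) hlen hW ?_ ?_ ?_).imp
    le_rfl ?_
  · refine ⟨fun b hb => by simp [hb], fun b hb => by simp, by simp, by omega, by simp, by simp⟩
  · rintro k s' ⟨h₁, h₂, h₃, -⟩
    exact ⟨(he s' h₁).1, (he s' h₁).2, h₃⟩
  · rintro k s' hk ⟨h₁, h₂, h₃, h₆, h₄, h₅⟩
    obtain ⟨ok, ev⟩ := hp k hk s' h₁ h₂ h₃ h₅
    refine ok.halts ?_
    rw [ev]
    refine ⟨by simpa using h₃, fun b hb => by simpa [hb] using h₁ b hb,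
      fun b hb => by simpa [hb] using h₂ b hb, by simp, by omega, ?_, ?_⟩
    · intro j hj
      simp only [State.putW_f, State.putF_f, if_true, update_apply]
      by_cases hjk : j = k
      · subst hjk; simp
      · have : addr j ≠ addr k := fun h => hjk (hinj j (by omega) k hk h)
        rw [if_neg this]
        exact h₄ j (by omega)
    · intro c hc
      simp only [State.putW_f, State.putF_f, if_true, update_apply]
      rw [if_neg (fun h => hc k (by omega) h.symm)]
      exact h₅ c fun j hj => hc j (by omega)
  · rintro s' ⟨h₁, h₂, -, -, h₄, h₅⟩
    exact ⟨h₁, h₂, h₄, h₅⟩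

/-! ### Multiplication of blocks

The current block has size `2 m` and starts at `a`; it is divided into four blocks of size `m`.
Matrices have the row length `S`.  The cells `1, 2, 3` of word array `5` hold `S`, `a` and `m`.
The guest arrays start at `20`. -/

def blockOff (b : Bool) : WExp :=
  if b then .op .add (.cell 5 (.const 2)) (.cell 5 (.const 3)) else .cell 5 (.const 2)

/-- The address of the entry that the counter in word array `ca` is at. -/
def blockAddr (ca : ℕ) (rb cb : Bool) : WExp :=
  .op .add (.op .mul (.op .add (blockOff rb)
      (.op .div (.cell ca (.const 0)) (.cell 5 (.const 3)))) (.cell 5 (.const 1)))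
    (.op .add (blockOff cb) (.op .mod (.cell ca (.const 0)) (.cell 5 (.const 3))))

def blockLen : WExp := .op .mul (.cell 5 (.const 3)) (.cell 5 (.const 3))

def loadBlock (src dst : ℕ) (rb cb : Bool) : Cmd :=
  forTo 17 0 blockLen (.setF dst (.cell 17 (.const 0)) (.cell src (blockAddr 17 rb cb)))

/-- How the product of two blocks is combined with the content of the destination. -/
inductive Mode
  | set | neg | sub

def Mode.exp (o x : FExp) : Mode → FExp
  | .set => x
  | .neg => .sub .zero x
  | .sub => .sub o x

def Mode.val (o x : F) : Mode → F
  | .set => x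
  | .neg => 0 - x
  | .sub => o - x

def mulGuest (p : Cmd) (src₁ src₂ : ℕ) (rb kb cb : Bool) : Cmd :=
  .seq (loadBlock src₁ 20 rb kb) (.seq (loadBlock src₂ 21 kb cb)
    (.seq (.setW 20 (.const 0) (.cell 5 (.const 3))) (p.shift 20)))

def storeBlock (md : Mode) (dst : ℕ) (rb cb : Bool) : Cmd :=
  forTo 6 0 blockLen (.setF dst (blockAddr 6 rb cb)
    (md.exp (.cell dst (blockAddr 6 rb cb)) (.cell 22 (.cell 6 (.const 0)))))

/-- Multiply two blocks with the program `p`. -/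
def mulBlock (p : Cmd) (md : Mode) (dst src₁ src₂ : ℕ) (rb kb cb : Bool) : Cmd :=
  sandbox (mulGuest p src₁ src₂ rb kb cb) (storeBlock md dst rb cb)

/-- The cells with the parameters of the current block. -/
structure BlockParams (s : State F) (S a m : ℕ) : Prop where
  hS : s.w 5 1 = S
  ha : s.w 5 2 = a
  hm : s.w 5 3 = m
  pos : 1 ≤ m
  le : a + 2 * m ≤ S

def offVal (a m : ℕ) (b : Bool) : ℕ := if b then a + m else a

theorem offVal_le (a m : ℕ) (b : Bool) : offVal a m b ≤ a + m := by
  cases b <;> simp [offVal]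

theorem BlockParams.congr {s' : State F} (h : BlockParams s S a m)
    (hs : s'.w 5 = s.w 5) : BlockParams s' S a m :=
  ⟨by rw [hs, h.hS], by rw [hs, h.ha], by rw [hs, h.hm], h.pos, h.le⟩

theorem blockAddr_lt {k : ℕ} (hm : 1 ≤ m) (hle : a + 2 * m ≤ S) (hk : k < m * m)
    (rb cb : Bool) :
    (offVal a m rb + k / m) * S + (offVal a m cb + k % m) < S * S := by
  have h₁ : k / m < m := Nat.div_lt_of_lt_mul hk
  have h₂ : k % m < m := Nat.mod_lt _ hm
  have h₃ := offVal_le a m rb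
  have h₄ := offVal_le a m cb
  have : offVal a m rb + k / m + 1 ≤ S := by omega
  nlinarith

theorem BlockParams.addr {ca k : ℕ}
    (h : BlockParams s S a m) (hW : S * S + 30 < W) (hk : k < m * m) (hc : s.w ca 0 = k)
    (rb cb : Bool) : (blockAddr ca rb cb).Fits ω W s ∧
      (blockAddr ca rb cb).val ω s =
        (offVal a m rb + k / m) * S + (offVal a m cb + k % m) := by
  have hS : S ≤ S * S := Nat.le_mul_self S
  have hoff : ∀ b, (blockOff b).Fits ω W s ∧ (blockOff b).val ω s = offVal a m b := by
    have := h.le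
    intro b
    cases b
    · simp only [blockOff, Bool.false_eq_true, if_false, WExp.Fits, WExp.val, offVal, h.ha]
      exact ⟨by omega, trivial⟩
    · simp only [blockOff, if_true, WExp.Fits, WExp.val, offVal, h.ha, h.hm, WOp.val]
      exact ⟨⟨by omega, by omega, by omega⟩, trivial⟩
  have h₁ : k / m < m := Nat.div_lt_of_lt_mul hk
  have h₂ : k % m < m := Nat.mod_lt _ h.pos
  have h₃ := offVal_le a m rb
  have h₄ := offVal_le a m cb
  have h₅ := h.le
  have h₆ := blockAddr_lt h.pos h.le hk rb cb
  refine ⟨⟨⟨⟨(hoff rb).1, ⟨?_, ?_, ?_⟩, ?_⟩, ?_, ?_⟩, ⟨(hoff cb).1, ⟨?_, ?_, ?_⟩, ?_⟩, ?_⟩, ?_⟩ <;>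
    (try simp only [blockAddr, WExp.Fits, WExp.val, WOp.val, (hoff rb).2, (hoff cb).2, h.hS, h.hm,
      hc]) <;> omega

theorem BlockParams.len
    (h : BlockParams s S a m) (hW : S * S + 30 < W) :
    blockLen.Fits ω W s ∧ blockLen.val ω s = m * m := by
  have := h.le
  have : m * m ≤ S * S := Nat.mul_le_mul (by omega) (by omega)
  refine ⟨⟨?_, ?_, ?_⟩, ?_⟩ <;>
    (try simp only [blockLen, WExp.Fits, WExp.val, WOp.val, h.hm]) <;> omega

theorem loadBlock_halts (h : BlockParams s S a m)
    (hW : S * S + 30 < W) {src dst : ℕ} (hne : src ≠ dst) (rb cb : Bool) :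
    Halts ω W (loadBlock src dst rb cb) s ((m * m + 1) * 100) fun s' =>
      (∀ b, b ≠ 17 → s'.w b = s.w b) ∧ (∀ b, b ≠ dst → s'.f b = s.f b) ∧
      (∀ k < m * m, s'.f dst k =
        s.f src ((offVal a m rb + k / m) * S + (offVal a m cb + k % m))) ∧
      ∀ c, m * m ≤ c → s'.f dst c = s.f dst c := by
  have hmm : m * m ≤ S * S := by
    have := h.le
    exact Nat.mul_le_mul (by omega) (by omega)
  refine (fill_halts (ω := ω) (W := W) (ca := 17) (len := m * m) (arr := dst) (e := blockLen)
    (s := s) (fun k => k)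
    (fun k => s.f src ((offVal a m rb + k / m) * S + (offVal a m cb + k % m)))
    (fun _ _ _ _ h => h) (by omega) (by omega) ?_ ?_).imp ?_ ?_
  · intro s' hs'
    exact (h.congr (hs' 5 (by omega))).len hW
  · intro k hk s' h₁ h₂ h₃ _
    obtain ⟨hf, hv⟩ := (h.congr (h₁ 5 (by omega))).addr (ω := ω) hW hk h₃ rb cb
    refine ⟨⟨by exact (by omega : 0 < W), hf⟩, ?_⟩
    simp only [Cmd.ev, WExp.val, FExp.val, h₃, hv, h₂ src hne]
  · refine Nat.mul_le_mul_left _ ?_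
    cases rb <;> cases cb <;> simp [Cmd.cost, WExp.cost, FExp.cost, blockAddr, blockLen, blockOff]
  · rintro s' ⟨h₁, h₂, h₃, h₄⟩
    exact ⟨h₁, h₂, h₃, fun c hc => h₄ c fun j hj => by omega⟩

theorem Mode.exp_fits {o x : FExp} (ho : o.Fits ω W s)
    (hx : x.Fits ω W s) : ∀ md : Mode, (md.exp o x).Fits ω W s
  | .set => hx
  | .neg => ⟨trivial, hx⟩
  | .sub => ⟨ho, hx⟩

theorem Mode.exp_val {o x : FExp} : ∀ md : Mode,
    (md.exp o x).val ω s = md.val (o.val ω s) (x.val ω s)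
  | .set => rfl
  | .neg => rfl
  | .sub => rfl

theorem flat_inj {i j i' j' : ℕ} (hj : j < S) (hj' : j' < S) (h : i * S + j = i' * S + j') :
    i = i' ∧ j = j' := by
  have hi : i = i' := by
    by_contra hne
    rcases Nat.lt_or_gt_of_ne hne with hlt | hlt <;> nlinarith
  subst hi
  exact ⟨rfl, by omega⟩

theorem storeBlock_halts (h : BlockParams s S a m)
    (hW : S * S + 30 < W) {md : Mode} {dst : ℕ} (hne : 22 ≠ dst) (rb cb : Bool) :
    Halts ω W (storeBlock md dst rb cb) s ((m * m + 1) * 100) fun s' =>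
      (∀ b, b ≠ 6 → s'.w b = s.w b) ∧ (∀ b, b ≠ dst → s'.f b = s.f b) ∧
      ∀ i j, j < S → s'.f dst (i * S + j) =
        if (offVal a m rb ≤ i ∧ i < offVal a m rb + m) ∧
          (offVal a m cb ≤ j ∧ j < offVal a m cb + m) then
          md.val (s.f dst (i * S + j)) (s.f 22 ((i - offVal a m rb) * m + (j - offVal a m cb)))
        else s.f dst (i * S + j) := by
  have hle := h.le
  have hpos := h.pos
  have hmm : m * m ≤ S * S := Nat.mul_le_mul (by omega) (by omega)
  have ho := offVal_le a m cb
  have hinj : ∀ j < m * m, ∀ k < m * m,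
      (offVal a m rb + j / m) * S + (offVal a m cb + j % m) =
      (offVal a m rb + k / m) * S + (offVal a m cb + k % m) → j = k := by
    intro j hj k hk he
    have h₁ : j % m < m := Nat.mod_lt _ hpos
    have h₂ : k % m < m := Nat.mod_lt _ hpos
    obtain ⟨e₁, e₂⟩ := flat_inj (by omega) (by omega) he
    rw [← Nat.div_add_mod j m, ← Nat.div_add_mod k m, show j / m = k / m by omega,
      show j % m = k % m by omega]
  refine (fill_halts (ω := ω) (W := W) (ca := 6) (len := m * m) (arr := dst) (e := blockLen)
    (s := s) (fun k => (offVal a m rb + k / m) * S + (offVal a m cb + k % m))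
    (fun k => md.val (s.f dst ((offVal a m rb + k / m) * S + (offVal a m cb + k % m))) (s.f 22 k))
    hinj (by omega) (by omega) ?_ ?_).imp ?_ ?_
  · intro s' hs'
    exact (h.congr (hs' 5 (by omega))).len hW
  · intro k hk s' h₁ h₂ h₃ h₄
    obtain ⟨hf, hv⟩ := (h.congr (h₁ 5 (by omega))).addr (ω := ω) hW hk h₃ rb cb
    refine ⟨⟨hf, Mode.exp_fits (o := .cell dst (blockAddr 6 rb cb)) hf
      (x := .cell 22 (.cell 6 (.const 0))) (by exact (by omega : 0 < W)) md⟩, ?_⟩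
    simp only [Cmd.ev, WExp.val, FExp.val, h₃, hv, h₂ 22 hne, Mode.exp_val]
    rw [h₄ _ fun j hj he => by have := hinj j (by omega) k hk he; omega]
  · refine Nat.mul_le_mul_left _ ?_
    cases rb <;> cases cb <;> cases md <;>
      simp [Cmd.cost, WExp.cost, FExp.cost, blockAddr, blockLen, blockOff, Mode.exp]
  · rintro s' ⟨h₁, h₂, h₃, h₄⟩
    refine ⟨h₁, h₂, fun i j hj => ?_⟩
    split_ifs with hb
    · have hlt : (i - offVal a m rb) * m + (j - offVal a m cb) < m * m := by
        have : i - offVal a m rb + 1 ≤ m := by omega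
        nlinarith [show j - offVal a m cb < m by omega]
      have := h₃ _ hlt
      have d₁ : ((i - offVal a m rb) * m + (j - offVal a m cb)) / m = i - offVal a m rb := by
        rw [Nat.mul_comm, Nat.mul_add_div hpos, Nat.div_eq_of_lt (by omega), Nat.add_zero]
      have d₂ : ((i - offVal a m rb) * m + (j - offVal a m cb)) % m = j - offVal a m cb := by
        rw [Nat.mul_comm, Nat.mul_add_mod, Nat.mod_eq_of_lt (by omega)]
      rw [d₁, d₂, Nat.add_sub_cancel' hb.1.1, Nat.add_sub_cancel' hb.2.1] at this
      exact this
    · refine h₄ _ fun k hk he => hb ?_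
      have h₁ : k % m < m := Nat.mod_lt _ hpos
      have h₂ : k / m < m := Nat.div_lt_of_lt_mul hk
      obtain ⟨e₁, e₂⟩ := flat_inj (by omega) hj he
      generalize k / m = d at *
      generalize k % m = r at *
      omega

/-- The program `p` multiplies `m × m` matrices in `TM` steps. -/
def Multiplies (p : Cmd) (F : Type*) [Field F] (W m TM : ℕ) : Prop :=
  ∀ (A B : Matrix (Fin m) (Fin m) F) (ω : Tape F), ∃ (s : State F) (t : ℕ),
    Exec ω W p
      { w := fun a k => if a = 0 ∧ k = 0 then m else 0
        f := fun a => if a = 0 then rowMajor A else if a = 1 then rowMajor B else fun _ => 0 }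
      s t ∧ t ≤ TM ∧ ∀ k l : Fin m, s.f 2 (k * m + l) = (A * B) k l

theorem rowMajor_of_lt (A : Matrix (Fin m) (Fin m) F) {k : ℕ} (hk : k < m * m) :
    rowMajor A k = A ⟨k / m, Nat.div_lt_of_lt_mul hk⟩
      ⟨k % m, Nat.mod_lt _ (Nat.pos_of_ne_zero (by rintro rfl; simp at hk))⟩ := by
  simp only [rowMajor, dif_pos hk]
  rfl

theorem rowMajor_of_le (A : Matrix (Fin m) (Fin m) F) {k : ℕ} (hk : m * m ≤ k) :
    rowMajor A k = 0 := by
  simp only [rowMajor, dif_neg (not_lt.2 hk)]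

/-- The guest's memory is all `0`. -/
def GuestZero (s : State F) : Prop := ∀ a, 20 ≤ a → s.w a = (fun _ => 0) ∧ s.f a = fun _ => 0

theorem mulGuest_exec {TM : ℕ}
    (hp : Multiplies p F W m TM) (h : BlockParams s S a m) (hW : S * S + 30 < W)
    (hz : GuestZero s) {src₁ src₂ : ℕ} (h₁ : src₁ < 5) (h₂ : src₂ < 5) (rb kb cb : Bool) :
    ∃ s' t, Exec ω W (mulGuest p src₁ src₂ rb kb cb) s s' t ∧ t ≤ 300 * (m * m + TM + 1) ∧
      ∀ i j, i < m → j < m → s'.f 22 (i * m + j) =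
        ∑ l ∈ Ico (offVal a m kb) (offVal a m kb + m),
          s.f src₁ ((offVal a m rb + i) * S + l) * s.f src₂ (l * S + (offVal a m cb + j)) := by
  obtain ⟨s₁, t₁, e₁, c₁, w₁, f₁, g₁, z₁⟩ :=
    loadBlock_halts (ω := ω) h hW (src := src₁) (dst := 20) (by omega) rb kb
  obtain ⟨s₂, t₂, e₂, c₂, w₂, f₂, g₂, z₂⟩ :=
    loadBlock_halts (ω := ω) (h.congr (w₁ 5 (by omega))) hW (src := src₂) (dst := 21)
      (by omega) kb cb
  have h' : BlockParams s₂ S a m := h.congr (by rw [w₂ 5 (by omega), w₁ 5 (by omega)])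
  set A : Matrix (Fin m) (Fin m) F := Matrix.of fun i j =>
    s.f src₁ ((offVal a m rb + i) * S + (offVal a m kb + j))
  set B : Matrix (Fin m) (Fin m) F := Matrix.of fun i j =>
    s.f src₂ ((offVal a m kb + i) * S + (offVal a m cb + j))
  set s₃ := s₂.putW 20 0 m with hs₃
  have e₃ : Exec ω W (.setW 20 (.const 0) (.cell 5 (.const 3))) s₂ s₃ 4 := by
    have := Exec.setW (ω := ω) (W := W) (s := s₂) (a := 20) (i := .const 0)
      (e := .cell 5 (.const 3)) (by exact (by omega : 0 < W)) (by exact (by omega : 3 < W))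
    simpa only [WExp.val, h'.hm, hs₃, WExp.cost] using this
  have hg : s₃.guest 20 =
      { w := fun a k => if a = 0 ∧ k = 0 then m else 0
        f := fun a => if a = 0 then rowMajor A else if a = 1 then rowMajor B else fun _ => 0 } := by
    apply State.ext'
    · intro b i
      simp only [State.guest, hs₃, State.putW_w, Nat.add_eq_right, w₂ 20 (by omega),
        w₁ 20 (by omega)]
      by_cases hb : b = 0
      · simp [hb, update_apply, (hz 20 le_rfl).1]
      · rw [if_neg hb, w₂ _ (by omega), w₁ _ (by omega)]
        simp [hb, (hz (b + 20) (by omega)).1]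
    · intro b i
      simp only [State.guest, hs₃, State.putW_f]
      by_cases hb : b = 0
      · simp only [hb, if_true, Nat.zero_add, f₂ 20 (by omega)]
        by_cases hi : i < m * m
        · rw [g₁ i hi, rowMajor_of_lt _ hi]
          rfl
        · rw [z₁ i (by omega), rowMajor_of_le _ (by omega), (hz 20 le_rfl).2]
      · by_cases hb1 : b = 1
        · simp only [hb1, one_ne_zero, if_false, if_true, Nat.reduceAdd]
          by_cases hi : i < m * m
          · rw [g₂ i hi, rowMajor_of_lt _ hi, f₁ _ (by omega)]
            rfl
          · rw [z₂ i (by omega), rowMajor_of_le _ (by omega), f₁ _ (by omega),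
              (hz 21 (by omega)).2]
        · rw [if_neg hb, if_neg hb1, f₂ _ (by omega), f₁ _ (by omega),
            (hz (b + 20) (by omega)).2]
  obtain ⟨g', t₄, e₄, c₄, p₄⟩ := hp A B (ω.guest 20)
  have e₅ := e₄.shift s₃ hg
  refine ⟨_, _, .seq e₁ (.seq e₂ (.seq e₃ e₅)), by omega, ?_⟩
  intro i j hi hj
  have := p₄ ⟨i, hi⟩ ⟨j, hj⟩
  have hw : (s₃.withGuest 20 g').f 22 = g'.f 2 := by simp [State.withGuest]
  rw [hw, this, Matrix.mul_apply, sum_Ico_eq_sum_range, Nat.add_sub_cancel_left,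
    ← Fin.sum_univ_eq_sum_range (fun l => s.f src₁ ((offVal a m rb + i) * S + (offVal a m kb + l)) *
      s.f src₂ ((offVal a m kb + l) * S + (offVal a m cb + j)))]
  rfl

theorem blockAddr_free {ca : ℕ} (hca : ¬ IsLog ca) (rb cb : Bool) : (blockAddr ca rb cb).Free := by
  have h5 : ¬ IsLog 5 := by decide
  cases rb <;> cases cb <;> simp [blockAddr, blockOff, WExp.Free, hca, h5]

theorem mulGuest_free (p : Cmd) {src₁ src₂ : ℕ} (h₁ : src₁ < 5) (h₂ : src₂ < 5)
    (rb kb cb : Bool) : (mulGuest p src₁ src₂ rb kb cb).Free := by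
  have f := Cmd.free_shift (K := 20) (by omega) p
  have h17 : ¬ IsLog 17 := by decide
  have h5 : ¬ IsLog 5 := by decide
  have h20 : ¬ IsLog 20 := by decide
  have h21 : ¬ IsLog 21 := by decide
  have h1 : ¬ IsLog src₁ := notLog (by omega)
  have h2 : ¬ IsLog src₂ := notLog (by omega)
  simp [mulGuest, loadBlock, forTo, Cmd.Free, WExp.Free, FExp.Free, blockLen, f, h17, h5, h20, h21,
    h1, h2, blockAddr_free h17]

theorem mulGuest_writes {src₁ src₂ : ℕ} {rb kb cb : Bool} {b : ℕ}
    (hb : b ∈ (mulGuest p src₁ src₂ rb kb cb).writes) : b = 17 ∨ 20 ≤ b := by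
  simp only [mulGuest, loadBlock, forTo, Cmd.writes, List.mem_append, List.mem_singleton] at hb
  rcases hb with (h | h | h) | (h | h | h) | h | h
  all_goals first | omega | exact .inr (Cmd.le_of_mem_writes_shift h)

/-- The constant in the time for multiplying blocks. -/
def mulConst (p : Cmd) : ℕ :=
  400 * ((restoreOne (mulGuest p 0 0 false false false).writes).cost + 60) + 100

theorem mulBlock_halts {TM : ℕ}
    (hp : Multiplies p F W m TM) (h : BlockParams s S a m)
    (hW : S * S + 30 < W) (hW' : 300 * (m * m + TM + 1) + 1 < W)
    (hpW : ∀ b ∈ (p.shift 20).writes, b < W)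
    (hz : GuestZero s) (h0 : s.w 13 0 = 0) {md : Mode} {dst src₁ src₂ : ℕ} (hd : dst < 5)
    (h₁ : src₁ < 5) (h₂ : src₂ < 5) (rb kb cb : Bool) :
    Halts ω W (mulBlock p md dst src₁ src₂ rb kb cb) s (mulConst p * (m * m + TM + 1)) fun s' =>
      (∀ b, b ≠ 6 → ¬ IsLog b → s'.w b = s.w b) ∧ (∀ b, b ≠ dst → ¬ IsLog b → s'.f b = s.f b) ∧
      s'.w 13 0 = 0 ∧
      ∀ i j, j < S → s'.f dst (i * S + j) =
        if (offVal a m rb ≤ i ∧ i < offVal a m rb + m) ∧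
          (offVal a m cb ≤ j ∧ j < offVal a m cb + m) then
          md.val (s.f dst (i * S + j)) (∑ l ∈ Ico (offVal a m kb) (offVal a m kb + m),
            s.f src₁ (i * S + l) * s.f src₂ (l * S + j))
        else s.f dst (i * S + j) := by
  obtain ⟨s₁, t₁, e₁, c₁, v₁⟩ := mulGuest_exec hp h hW hz h₁ h₂ rb kb cb (ω := ω)
  have hnot : ∀ b < 17, b ∉ (mulGuest p src₁ src₂ rb kb cb).writes := by
    intro b hb hmem
    have := mulGuest_writes hmem
    omega
  have hfr := fun b (hb : b ∉ (mulGuest p src₁ src₂ rb kb cb).writes) => e₁.frame hb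
  have hwW : ∀ b ∈ (mulGuest p src₁ src₂ rb kb cb).writes, b < W := by
    intro b hb
    simp only [mulGuest, loadBlock, forTo, Cmd.writes, List.mem_append, List.mem_singleton] at hb
    rcases hb with (h | h | h) | (h | h | h) | h | h
    all_goals first | omega | exact hpW b h
  have key := sandbox_halts (W := W) (q := storeBlock md dst rb cb) (B := (m * m + 1) * 100)
    e₁ (mulGuest_free p h₁ h₂ rb kb cb) hwW h0 (by omega)
    (Post := fun r₂ => (∀ b, b ≠ 6 → ¬ IsLog b → r₂.w b = s₁.w b) ∧
      (∀ b, b ≠ dst → ¬ IsLog b → r₂.f b = s₁.f b) ∧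
      ∀ i j, j < S → r₂.f dst (i * S + j) =
        if (offVal a m rb ≤ i ∧ i < offVal a m rb + m) ∧
          (offVal a m cb ≤ j ∧ j < offVal a m cb + m) then
          md.val (s₁.f dst (i * S + j))
            (s₁.f 22 ((i - offVal a m rb) * m + (j - offVal a m cb)))
        else s₁.f dst (i * S + j)) (fun r₁ hr₁ => by
      have hw : ∀ b, ¬ IsLog b → s₁.w b = r₁.w b := fun b hb => (hr₁ b hb).1
      have hf : ∀ b, ¬ IsLog b → s₁.f b = r₁.f b := fun b hb => (hr₁ b hb).2
      have hb : BlockParams r₁ S a m := h.congr (by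
        rw [← hw 5 (by decide), (hfr 5 (hnot 5 (by omega))).1])
      refine (storeBlock_halts (ω := ω) hb hW (md := md) (dst := dst) (by omega) rb cb).imp le_rfl ?_
      rintro r₂ ⟨q₁, q₂, q₃⟩
      refine ⟨?_, ?_, ?_, ?_⟩
      · intro b hb
        have hb' : b = 17 ∨ 20 ≤ b ∨ IsLog b := hb.elim
          (fun h => (mulGuest_writes h).elim .inl fun h => .inr (.inl h)) fun h => .inr (.inr h)
        have : b ≠ 6 ∧ b ≠ dst := by unfold IsLog at hb'; omega
        exact ⟨q₁ b this.1, q₂ b this.2⟩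
      · intro b hb hlb
        rw [q₁ b hb, hw b hlb]
      · intro b hb hlb
        rw [q₂ b hb, hf b hlb]
      · rw [hf dst (notLog (by omega)), hf 22 (by decide)]
        exact q₃)
  refine key.imp ?_ ?_
  · have hcw : (restoreOne (mulGuest p src₁ src₂ rb kb cb).writes).cost =
        (restoreOne (mulGuest p 0 0 false false false).writes).cost := rfl
    rw [hcw]
    unfold mulConst
    generalize (restoreOne (mulGuest p 0 0 false false false).writes).cost = c
    have : t₁ + 1 ≤ 400 * (m * m + TM + 1) := by omega
    have := Nat.mul_le_mul_right (c + 60) this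
    nlinarith
  · rintro s' ⟨k₁, k₂, r₂, ⟨q₁, q₂, q₃⟩, k₃⟩
    refine ⟨?_, ?_, k₂, ?_⟩
    · intro b hb hlb
      by_cases hm : b ∈ (mulGuest p src₁ src₂ rb kb cb).writes
      · exact (k₁ b hm).1
      · rw [(k₃ b hm hlb).1, q₁ b hb hlb, (hfr b hm).1]
    · intro b hb hlb
      by_cases hm : b ∈ (mulGuest p src₁ src₂ rb kb cb).writes
      · exact (k₁ b hm).2
      · rw [(k₃ b hm hlb).2, q₂ b hb hlb, (hfr b hm).2]
    · intro i j hj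
      have hdl : ¬ IsLog dst := notLog (by omega)
      rw [(k₃ dst (hnot dst (by omega)) hdl).2, q₃ i j hj, (hfr dst (hnot dst (by omega))).2]
      split_ifs with hb
      · rw [v₁ _ _ (by omega) (by omega), Nat.add_sub_cancel' hb.1.1, Nat.add_sub_cancel' hb.2.1]
      · rfl

end Blocks

end

section

/-- A matrix whose indices are all natural numbers. -/
abbrev NatMat (F : Type*) := ℕ → ℕ → F

section Elimination

variable {B G : NatMat F} {K D : Finset ℕ}

/-- The principal submatrix of `B` with the indices in `K` is nonsingular. -/
def Nonsing (B : NatMat F) (K : Finset ℕ) : Prop :=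
  ∀ z : ℕ → F, (∀ i ∈ K, ∑ j ∈ K, B i j * z j = 0) → ∀ j ∈ K, z j = 0

/-- Greedy elimination with diagonal pivots from the index set `D`: `K` is the set of pivots, `G` is
the inverse of the principal submatrix of `B` on `K`. -/
structure Elim (B G : NatMat F) (K D : Finset ℕ) : Prop where
  sub : K ⊆ D
  supp : ∀ i ∈ D, ∀ j ∈ D, (i ∉ K ∨ j ∉ K) → G i j = 0
  inv : ∀ i ∈ K, ∀ j ∈ D, ∑ l ∈ D, B i l * G l j = if i = j then 1 else 0
  greedy : ∀ x ∈ D, (x ∈ K ↔ Nonsing B (insert x (K.filter (· < x))))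

theorem Nonsing.congr {B' : NatMat F} (h : ∀ i ∈ K, ∀ j ∈ K, B i j = B' i j) :
    Nonsing B K ↔ Nonsing B' K := by
  refine forall_congr' fun z => imp_congr ?_ Iff.rfl
  refine forall₂_congr fun i hi => ?_
  rw [sum_congr rfl fun j hj => by rw [h i hi j hj]]

theorem Elim.congr {B' G' : NatMat F} (h : Elim B G K D)
    (hB : ∀ i ∈ D, ∀ j ∈ D, B i j = B' i j) (hG : ∀ i ∈ D, ∀ j ∈ D, G i j = G' i j) :
    Elim B' G' K D where
  sub := h.sub
  supp i hi j hj hk := by rw [← hG i hi j hj]; exact h.supp i hi j hj hk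
  inv i hi j hj := by
    rw [← h.inv i hi j hj]
    exact sum_congr rfl fun l hl => by rw [hB i (h.sub hi) l hl, hG l hl j hj]
  greedy x hx := by
    rw [h.greedy x hx]
    have : ∀ i ∈ insert x (K.filter (· < x)), i ∈ D := by
      intro i hi
      rcases mem_insert.1 hi with rfl | hi
      · exact hx
      · exact h.sub (mem_filter.1 hi).1
    exact Nonsing.congr fun i hi j hj => hB i (this i hi) j (this j hj)

theorem elim_singleton (B G : NatMat F) (a : ℕ) [Decidable (B a a = 0)]
    (hG : G a a = (B a a)⁻¹) : Elim B G (if B a a = 0 then ∅ else {a}) {a} where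
  sub := by split_ifs <;> simp
  supp i hi j hj h := by
    simp only [mem_singleton] at hi hj
    by_cases h0 : B a a = 0
    · rw [hi, hj, hG, h0, inv_zero]
    · simp [h0, hi, hj] at h
  inv i hi j hj := by
    by_cases h0 : B a a = 0
    · simp [h0] at hi
    · simp only [h0, if_false, mem_singleton] at hi hj
      subst hi hj
      simp [hG, h0]
  greedy x hx := by
    simp only [mem_singleton] at hx
    subst hx
    by_cases h0 : B x x = 0
    · simp only [h0, if_true, notMem_empty, filter_empty, false_iff, Nonsing,
        insert_empty_eq, mem_singleton, sum_singleton, forall_eq, not_forall]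
      exact ⟨fun _ => 1, by simp, one_ne_zero⟩
    · simp only [h0, if_false, mem_singleton, true_iff, Nonsing]
      have : ({x} : Finset ℕ).filter (· < x) = ∅ := by
        ext y
        simp only [mem_filter, mem_singleton, notMem_empty, iff_false]
        omega
      rw [this]
      simp [h0]

/-- A block as a matrix. -/
def blk (B : NatMat F) (D E : Finset ℕ) : Matrix D E F := Matrix.of fun i j => B i j

theorem blk_mul (B C : NatMat F) (D E H : Finset ℕ) (i : D) (j : H) :
    (blk B D E * blk C E H) i j = ∑ l ∈ E, B i l * C l j := by
  rw [Matrix.mul_apply, ← sum_coe_sort E]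
  rfl

/-- The projection to the coordinates in `K`. -/
def proj (F : Type*) [Field F] (K D : Finset ℕ) : Matrix D D F :=
  Matrix.diagonal fun i => if (i : ℕ) ∈ K then 1 else 0

theorem Elim.proj_inv (h : Elim B G K D) :
    proj F K D * (blk B D D * blk G D D) = proj F K D := by
  ext i j
  rw [proj, Matrix.diagonal_mul, Matrix.diagonal_apply, blk_mul]
  by_cases hi : (i : ℕ) ∈ K
  · rw [if_pos hi, one_mul, h.inv i hi j j.2]
    simp only [Subtype.coe_inj]
  · simp [hi]

theorem Elim.left_inv (h : Elim B G K D) {i j : ℕ} (hi : i ∈ K)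
    (hj : j ∈ K) : ∑ l ∈ K, G i l * B l j = if i = j then 1 else 0 := by
  have hm : blk B K K * blk G K K = 1 := by
    ext i j
    rw [blk_mul, Matrix.one_apply]
    have := h.inv i i.2 j (h.sub j.2)
    rw [← sum_subset h.sub (fun l hl hlK => by
      rw [h.supp l hl j (h.sub j.2) (.inl hlK), mul_zero])] at this
    simpa only [Subtype.coe_inj] using this
  have hm' : blk G K K * blk B K K = 1 := mul_eq_one_comm.1 hm
  have := congrFun (congrFun hm' ⟨i, hi⟩) ⟨j, hj⟩
  rw [blk_mul, Matrix.one_apply] at this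
  simpa only [Subtype.mk.injEq] using this

theorem Elim.right_inv (h : Elim B G K D) {i j : ℕ} (hi : i ∈ K)
    (hj : j ∈ K) : ∑ l ∈ K, B i l * G l j = if i = j then 1 else 0 := by
  have := h.inv i hi j (h.sub hj)
  rwa [← sum_subset h.sub (fun l hl hlK => by
      rw [h.supp l hl j (h.sub hj) (.inl hlK), mul_zero])] at this

/-- Principal submatrices and Schur complements. -/
theorem Elim.nonsing_union {T S : NatMat F} {J E : Finset ℕ} (h : Elim B G K D)
    (hJ : J ⊆ E) (hdisj : Disjoint D E) (hT : ∀ i ∈ D, ∀ j ∈ E, T i j = ∑ l ∈ D, G i l * B l j)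
    (hS : ∀ i ∈ E, ∀ j ∈ E, S i j = B i j - ∑ l ∈ D, B i l * T l j) :
    Nonsing B (K ∪ J) ↔ Nonsing S J := by
  have hKJ : Disjoint K J := hdisj.mono h.sub hJ
  have hT' : ∀ i ∈ D, ∀ j ∈ J, T i j = ∑ l ∈ K, G i l * B l j := by
    intro i hi j hj
    rw [hT i hi j (hJ hj)]
    exact (sum_subset h.sub fun l hl hlK => by
      rw [h.supp i hi l hl (.inr hlK), zero_mul]).symm
  have hT0 : ∀ i ∈ D, i ∉ K → ∀ j ∈ J, T i j = 0 := by
    intro i hi hiK j hj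
    rw [hT i hi j (hJ hj)]
    exact sum_eq_zero fun l hl => by rw [h.supp i hi l hl (.inl hiK), zero_mul]
  have hS' : ∀ i ∈ J, ∀ j ∈ J, S i j = B i j - ∑ l ∈ K, B i l * T l j := by
    intro i hi j hj
    rw [hS i (hJ hi) j (hJ hj)]
    congr 1
    exact (sum_subset h.sub fun l hl hlK => by
      rw [hT0 l hl hlK j hj, mul_zero]).symm
  have hBT : ∀ i ∈ K, ∀ j ∈ J, ∑ l ∈ K, B i l * T l j = B i j := by
    intro i hi j hj
    rw [sum_congr rfl fun l hl => by rw [hT' l (h.sub hl) j hj, mul_sum],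
      sum_comm]
    rw [sum_congr rfl fun k hk => show ∑ l ∈ K, B i l * (G l k * B k j) =
      (if i = k then 1 else 0) * B k j by
        rw [← h.right_inv hi hk, sum_mul]
        exact sum_congr rfl fun l _ => by ring]
    simp [hi]
  have hSz : ∀ z : ℕ → F, ∀ i ∈ J, ∑ j ∈ J, S i j * z j =
      ∑ j ∈ J, B i j * z j - ∑ l ∈ K, B i l * ∑ j ∈ J, T l j * z j := by
    intro z i hi
    rw [sum_congr rfl fun j hj => by rw [hS' i hi j hj, sub_mul], sum_sub_distrib]
    congr 1
    simp only [sum_mul, mul_sum]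
    rw [sum_comm]
    exact sum_congr rfl fun l _ => sum_congr rfl fun j _ => by ring
  constructor
  · intro hN z hz j hj
    have hjK : j ∉ K := fun hk => disjoint_left.1 hKJ hk hj
    have := hN (fun l => if l ∈ K then - ∑ j ∈ J, T l j * z j else z l) ?_ j
      (mem_union_right _ hj)
    · simpa [hjK] using this
    intro i hi
    rw [sum_union hKJ, sum_congr (s₁ := K) rfl fun l hl => by rw [if_pos hl],
      sum_congr (s₁ := J) rfl fun l hl => by
        rw [if_neg fun hk => disjoint_left.1 hKJ hk hl]]
    rcases mem_union.1 hi with hi | hi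
    · simp only [mul_neg, sum_neg_distrib, mul_sum]
      rw [sum_comm]
      rw [neg_add_eq_zero]
      refine sum_congr rfl fun j hj => ?_
      rw [← hBT i hi j hj, sum_mul]
      exact sum_congr rfl fun l _ => by ring
    · simp only [mul_neg, sum_neg_distrib]
      rw [← hz i hi, hSz z i hi]
      ring
  · intro hN z hz
    have hzK : ∀ l ∈ K, z l = - ∑ j ∈ J, T l j * z j := by
      intro l hl
      have e₁ : z l = ∑ k ∈ K, (if l = k then 1 else 0) * z k := by simp [hl]
      rw [e₁, sum_congr rfl fun k hk => by rw [← h.left_inv hl hk, sum_mul],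
        sum_comm]
      rw [sum_congr rfl fun i hi => show ∑ k ∈ K, G l i * B i k * z k =
        - (G l i * ∑ j ∈ J, B i j * z j) by
          have := hz i (mem_union_left _ hi)
          rw [sum_union hKJ] at this
          rw [← mul_neg, ← eq_neg_of_add_eq_zero_left this, mul_sum]
          exact sum_congr rfl fun k _ => by ring]
      rw [sum_neg_distrib]
      congr 1
      simp only [mul_sum]
      rw [sum_comm]
      refine sum_congr rfl fun j hj => ?_
      rw [hT' l (h.sub hl) j hj, sum_mul]
      exact sum_congr rfl fun k _ => by ring
    have hzJ : ∀ j ∈ J, z j = 0 := by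
      refine hN z fun i hi => ?_
      rw [hSz z i hi]
      have := hz i (mem_union_right _ hi)
      rw [sum_union hKJ, sum_congr (s₁ := K) rfl fun l hl => by rw [hzK l hl]] at this
      simp only [mul_neg, sum_neg_distrib] at this
      rw [← this]; ring
    intro j hj
    rcases mem_union.1 hj with hj | hj
    · rw [hzK j hj, sum_eq_zero fun k hk => by rw [hzJ k hk, mul_zero], neg_zero]
    · exact hzJ j hj

/-- Elimination for two blocks, one after the other. -/
theorem Elim.merge {G₁ T S G₂ V : NatMat F} {K₁ K₂ D₁ D₂ : Finset ℕ} (h₁ : Elim B G₁ K₁ D₁)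
    (hT : ∀ i ∈ D₁, ∀ j ∈ D₂, T i j = ∑ l ∈ D₁, G₁ i l * B l j)
    (hS : ∀ i ∈ D₂, ∀ j ∈ D₂, S i j = B i j - ∑ l ∈ D₁, B i l * T l j)
    (h₂ : Elim S G₂ K₂ D₂)
    (hV : ∀ i ∈ D₂, ∀ j ∈ D₁, V i j = ∑ l ∈ D₁, B i l * G₁ l j)
    (g₁₂ : ∀ i ∈ D₁, ∀ j ∈ D₂, G i j = 0 - ∑ l ∈ D₂, T i l * G₂ l j)
    (g₁₁ : ∀ i ∈ D₁, ∀ j ∈ D₁, G i j = G₁ i j - ∑ l ∈ D₂, G i l * V l j)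
    (g₂₁ : ∀ i ∈ D₂, ∀ j ∈ D₁, G i j = 0 - ∑ l ∈ D₂, G₂ i l * V l j)
    (g₂₂ : ∀ i ∈ D₂, ∀ j ∈ D₂, G i j = G₂ i j) (hlt : ∀ x ∈ D₁, ∀ y ∈ D₂, x < y) :
    Elim B G (K₁ ∪ K₂) (D₁ ∪ D₂) := by
  have hdisj : Disjoint D₁ D₂ := disjoint_left.2 fun x hx hx' => lt_irrefl _ (hlt x hx x hx')
  set P₁ := proj F K₁ D₁
  set P₂ := proj F K₂ D₂
  have mT : blk T D₁ D₂ = blk G₁ D₁ D₁ * blk B D₁ D₂ := by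
    ext i j; rw [blk_mul]; exact hT i i.2 j j.2
  have mS : blk S D₂ D₂ = blk B D₂ D₂ - blk B D₂ D₁ * blk T D₁ D₂ := by
    ext i j; rw [Matrix.sub_apply, blk_mul]; exact hS i i.2 j j.2
  have mV : blk V D₂ D₁ = blk B D₂ D₁ * blk G₁ D₁ D₁ := by
    ext i j; rw [blk_mul]; exact hV i i.2 j j.2
  have m12 : blk G D₁ D₂ = - (blk T D₁ D₂ * blk G₂ D₂ D₂) := by
    ext i j; rw [Matrix.neg_apply, blk_mul, ← zero_sub]; exact g₁₂ i i.2 j j.2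
  have m11 : blk G D₁ D₁ = blk G₁ D₁ D₁ - blk G D₁ D₂ * blk V D₂ D₁ := by
    ext i j; rw [Matrix.sub_apply, blk_mul]; exact g₁₁ i i.2 j j.2
  have m21 : blk G D₂ D₁ = - (blk G₂ D₂ D₂ * blk V D₂ D₁) := by
    ext i j; rw [Matrix.neg_apply, blk_mul, ← zero_sub]; exact g₂₁ i i.2 j j.2
  have m22 : blk G D₂ D₂ = blk G₂ D₂ D₂ := by
    ext i j; exact g₂₂ i i.2 j j.2
  have i₁ : P₁ * (blk B D₁ D₁ * blk G₁ D₁ D₁) = P₁ := h₁.proj_inv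
  have i₂ : P₂ * (blk S D₂ D₂ * blk G₂ D₂ D₂) = P₂ := h₂.proj_inv
  have hPT : P₁ * (blk B D₁ D₁ * blk T D₁ D₂) = P₁ * blk B D₁ D₂ := by
    rw [mT, ← Matrix.mul_assoc (blk B D₁ D₁), ← Matrix.mul_assoc P₁, i₁]
  have r11 : P₁ * (blk B D₁ D₁ * blk G D₁ D₁ + blk B D₁ D₂ * blk G D₂ D₁) = P₁ := by
    rw [m11, m12, m21, Matrix.mul_sub, Matrix.mul_add, Matrix.mul_sub, i₁]
    have : P₁ * (blk B D₁ D₁ * (-(blk T D₁ D₂ * blk G₂ D₂ D₂) * blk V D₂ D₁)) =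
        P₁ * (blk B D₁ D₂ * -(blk G₂ D₂ D₂ * blk V D₂ D₁)) := by
      simp only [Matrix.neg_mul, Matrix.mul_neg, neg_inj]
      rw [Matrix.mul_assoc (blk T D₁ D₂), ← Matrix.mul_assoc (blk B D₁ D₁), ← Matrix.mul_assoc P₁,
        hPT, Matrix.mul_assoc]
    rw [this]; abel
  have r12 : P₁ * (blk B D₁ D₁ * blk G D₁ D₂ + blk B D₁ D₂ * blk G D₂ D₂) = 0 := by
    rw [m12, m22, Matrix.mul_add, Matrix.mul_neg, Matrix.mul_neg, ← Matrix.mul_assoc (blk B D₁ D₁),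
      ← Matrix.mul_assoc P₁, hPT, Matrix.mul_assoc]
    abel
  have hST : P₂ * (blk B D₂ D₁ * blk T D₁ D₂ * blk G₂ D₂ D₂) =
      P₂ * (blk B D₂ D₂ * blk G₂ D₂ D₂) - P₂ := by
    have := i₂
    rw [mS, Matrix.sub_mul, Matrix.mul_sub] at this
    rw [eq_sub_iff_add_eq, ← eq_sub_iff_add_eq', this]
  have r22 : P₂ * (blk B D₂ D₁ * blk G D₁ D₂ + blk B D₂ D₂ * blk G D₂ D₂) = P₂ := by
    rw [m12, m22, Matrix.mul_neg, ← Matrix.mul_assoc, Matrix.mul_add, Matrix.mul_neg, hST]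
    abel
  have r21 : P₂ * (blk B D₂ D₁ * blk G D₁ D₁ + blk B D₂ D₂ * blk G D₂ D₁) = 0 := by
    rw [m11, m12, m21, Matrix.mul_sub, ← mV]
    have e₁ : blk B D₂ D₁ * (-(blk T D₁ D₂ * blk G₂ D₂ D₂) * blk V D₂ D₁) =
        -(blk B D₂ D₁ * blk T D₁ D₂ * blk G₂ D₂ D₂ * blk V D₂ D₁) := by
      simp only [Matrix.neg_mul, Matrix.mul_neg, Matrix.mul_assoc]
    have e₂ : blk B D₂ D₂ * -(blk G₂ D₂ D₂ * blk V D₂ D₁) =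
        -(blk B D₂ D₂ * blk G₂ D₂ D₂ * blk V D₂ D₁) := by
      simp only [Matrix.mul_neg, Matrix.mul_assoc]
    rw [e₁, e₂, Matrix.mul_add, Matrix.mul_sub, Matrix.mul_neg, Matrix.mul_neg,
      ← Matrix.mul_assoc P₂ (_ * _ * _), ← Matrix.mul_assoc P₂ (_ * _) (blk V D₂ D₁), hST,
      Matrix.sub_mul]
    abel
  have row : ∀ {D E D' : Finset ℕ} {K : Finset ℕ} {Z : Matrix D D' F}, K ⊆ D →
      proj F K D * (blk B D D * blk G D D' + blk B D E * blk G E D') = Z →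
      Disjoint D E → ∀ i (hi : i ∈ K) (hiD : i ∈ D) j (hj : j ∈ D'),
        ∑ l ∈ D ∪ E, B i l * G l j = Z ⟨i, hiD⟩ ⟨j, hj⟩ := by
    intro D E D' K Z _ hZ hDE i hi hiD j hj
    rw [← hZ, proj, Matrix.diagonal_mul, if_pos hi, one_mul, Matrix.add_apply, blk_mul, blk_mul,
      sum_union hDE]
  refine ⟨union_subset_union h₁.sub h₂.sub, ?_, ?_, ?_⟩
  · intro i hi j hj hij
    simp only [mem_union, not_or] at hi hj hij
    have V0 : ∀ l ∈ D₂, ∀ j ∈ D₁, j ∉ K₁ → V l j = 0 := fun l hl j hj hjK => by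
      rw [hV l hl j hj]
      exact sum_eq_zero fun q hq => by rw [h₁.supp q hq j hj (.inr hjK), mul_zero]
    have T0 : ∀ i ∈ D₁, i ∉ K₁ → ∀ l ∈ D₂, T i l = 0 := fun i hi hiK l hl => by
      rw [hT i hi l hl]
      exact sum_eq_zero fun q hq => by rw [h₁.supp i hi q hq (.inl hiK), zero_mul]
    have G12 : ∀ i ∈ D₁, i ∉ K₁ → ∀ l ∈ D₂, G i l = 0 := fun i hi hiK l hl => by
      rw [g₁₂ i hi l hl, sum_eq_zero fun q hq => by rw [T0 i hi hiK q hq, zero_mul],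
        sub_zero]
    rcases hi with hi | hi <;> rcases hj with hj | hj
    · rw [g₁₁ i hi j hj]
      rcases hij with ⟨h, -⟩ | ⟨h, -⟩
      · rw [h₁.supp i hi j hj (.inl h), sum_eq_zero fun q hq => by
          rw [G12 i hi h q hq, zero_mul], sub_zero]
      · rw [h₁.supp i hi j hj (.inr h), sum_eq_zero fun q hq => by
          rw [V0 q hq j hj h, mul_zero], sub_zero]
    · rcases hij with ⟨h, -⟩ | ⟨-, h⟩
      · exact G12 i hi h j hj
      · rw [g₁₂ i hi j hj, sum_eq_zero fun q hq => by
          rw [h₂.supp q hq j hj (.inr h), mul_zero], sub_zero]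
    · rw [g₂₁ i hi j hj]
      rcases hij with ⟨-, h⟩ | ⟨h, -⟩
      · rw [sum_eq_zero fun q hq => by rw [h₂.supp i hi q hq (.inl h), zero_mul], sub_zero]
      · rw [sum_eq_zero fun q hq => by rw [V0 q hq j hj h, mul_zero], sub_zero]
    · rw [g₂₂ i hi j hj]
      exact h₂.supp i hi j hj (hij.imp And.right And.right)
  · intro i hi j hj
    rcases mem_union.1 hi with hi | hi <;> rcases mem_union.1 hj with hj | hj
    · rw [row h₁.sub r11 hdisj i hi (h₁.sub hi) j hj, show P₁ = proj F K₁ D₁ from rfl, proj,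
        Matrix.diagonal_apply]
      simp [hi]
    · rw [row h₁.sub r12 hdisj i hi (h₁.sub hi) j hj, if_neg (hlt i (h₁.sub hi) j hj).ne]
      rfl
    · rw [union_comm, row h₂.sub ((congrArg _ (add_comm _ _)).trans r21) hdisj.symm i hi (h₂.sub hi) j hj,
        if_neg (hlt j hj i (h₂.sub hi)).ne']
      rfl
    · rw [union_comm, row h₂.sub ((congrArg _ (add_comm _ _)).trans r22) hdisj.symm i hi (h₂.sub hi) j hj,
        show P₂ = proj F K₂ D₂ from rfl, proj, Matrix.diagonal_apply]
      simp [hi]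
  · intro x hx
    rcases mem_union.1 hx with hx | hx
    · have e₁ : (K₁ ∪ K₂).filter (· < x) = K₁.filter (· < x) := by
        ext y
        simp only [mem_filter, mem_union]
        refine and_congr_left fun hy => or_iff_left fun h => ?_
        have := hlt x hx y (h₂.sub h)
        omega
      have e₂ : x ∈ K₁ ∪ K₂ ↔ x ∈ K₁ := by
        simp only [mem_union]
        exact or_iff_left fun h => lt_irrefl _ (hlt x hx x (h₂.sub h))
      rw [e₁, e₂, h₁.greedy x hx]
    · have e₁ : (K₁ ∪ K₂).filter (· < x) = K₁ ∪ K₂.filter (· < x) := by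
        ext y
        simp only [mem_filter, mem_union]
        have : y ∈ K₁ → y < x := fun h => hlt y (h₁.sub h) x hx
        tauto
      have e₂ : x ∈ K₁ ∪ K₂ ↔ x ∈ K₂ := by
        simp only [mem_union]
        exact or_iff_right fun h => lt_irrefl _ (hlt x (h₁.sub h) x hx)
      rw [e₁, e₂, ← union_insert, h₂.greedy x hx,
        h₁.nonsing_union (insert_subset hx ((filter_subset _ _).trans h₂.sub)) hdisj
          hT hS]

end Elimination

end

section

section EliminationProgram

variable {s : State F} {S a sp m W k : ℕ} {ω : Tape F} {p : Cmd}

/-- A cell of word array `5`, which holds parameters. -/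
def par (i : ℕ) : WExp := .cell 5 (.const i)

/-- Push a task. -/
def pushTask (x y : WExp) (k : ℕ) : Cmd :=
  .seq (.setW 10 (par 4) x) (.seq (.setW 11 (par 4) y) (.seq (.setW 12 (par 4) (.const k))
    (.setW 5 (.const 4) (.op .add (par 4) (.const 1)))))

/-- Pop a task. -/
def popTask : Cmd :=
  .seq (.setW 5 (.const 4) (.op .sub (par 4) (.const 1))) (.seq (.setW 5 (.const 2) (.cell 10 (par 4)))
    (.seq (.setW 5 (.const 3) (.cell 11 (par 4))) (.setW 5 (.const 5) (.cell 12 (par 4)))))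

/-- Elimination of a block of size `1`. -/
def leafTask : Cmd :=
  .seq (.setW 9 (par 2) (.const 1))
    (.seq (.ifZero (.cell 2 (.op .add (.op .mul (par 2) (par 1)) (par 2)))
      (.setW 9 (par 2) (.const 0)) .skip)
    (.setF 3 (.op .add (.op .mul (par 2) (par 1)) (par 2))
      (.div .one (.cell 2 (.op .add (.op .mul (par 2) (par 1)) (par 2))))))

/-- Divide a block: eliminate the first half, form the Schur complement, eliminate it, and merge. -/
def splitTask : Cmd :=
  .seq (.setW 5 (.const 3) (.op .div (par 3) (.const 2))) (.seq (pushTask (par 2) (par 3) 2)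
    (.seq (pushTask (.op .add (par 2) (par 3)) (par 3) 0) (.seq (pushTask (par 2) (par 3) 1)
      (pushTask (par 2) (par 3) 0))))

def schurTask (p : Cmd) : Cmd :=
  .seq (mulBlock p .set 3 3 2 false false true) (mulBlock p .sub 2 2 3 true false true)

def mergeTask (p : Cmd) : Cmd :=
  .seq (mulBlock p .neg 3 3 3 false true true) (.seq (mulBlock p .set 3 2 3 true false false)
    (.seq (mulBlock p .sub 3 3 3 false true false) (mulBlock p .neg 3 3 3 true true false)))

def elimBody (p : Cmd) : Cmd :=
  .seq popTask (.ite (par 5) (.ite (.op .eq (par 5) (.const 1)) (schurTask p) (mergeTask p))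
    (.ite (.op .eq (par 3) (.const 1)) leafTask splitTask))

/-- Elimination with a stack of tasks. -/
def elimLoop (p : Cmd) : Cmd := .loop (par 4) (elimBody p)

/-- The loop gets from `s` to `s'` in `T` steps. -/
def Steps (ω : Tape F) (W : ℕ) (c : WExp) (p : Cmd) (s s' : State F) (T : ℕ) : Prop :=
  ∀ s'' t'', Exec ω W (.loop c p) s' s'' t'' → ∃ t, Exec ω W (.loop c p) s s'' t ∧ t ≤ T + t''

theorem Steps.trans {c : WExp} {s₁ s₂ s₃ : State F} {T T' : ℕ}
    (h : Steps ω W c p s₁ s₂ T) (h' : Steps ω W c p s₂ s₃ T') :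
    Steps ω W c p s₁ s₃ (T + T') := by
  intro s'' t'' e
  obtain ⟨t, e₁, l₁⟩ := h' s'' t'' e
  obtain ⟨t', e₂, l₂⟩ := h s'' t e₁
  exact ⟨t', e₂, by omega⟩

theorem Halts.steps {c : WExp} {B : ℕ} {Q : State F → Prop} (h : Halts ω W p s B Q) (hf : c.Fits ω W s) (hc : c.val ω s ≠ 0) :
    ∃ s', Q s' ∧ Steps ω W c p s s' (B + c.cost + 1) := by
  obtain ⟨s', t, e, l, q⟩ := h
  exact ⟨s', q, fun s'' t'' e' => ⟨_, .loopStep hf hc e e', by omega⟩⟩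

/-- What the elimination leaves unchanged; of the stack, the first `sp` entries. -/
structure ElimFrame (s s' : State F) (sp : ℕ) : Prop where
  five : ∀ i, i < 2 ∨ 5 < i → s'.w 5 i = s.w 5 i
  stk : ∀ k < sp, s'.w 10 k = s.w 10 k ∧ s'.w 11 k = s.w 11 k ∧ s'.w 12 k = s.w 12 k
  w : ∀ b, b < 5 ∨ (6 < b ∧ b < 9) ∨ 12 < b → ¬ IsLog b → s'.w b = s.w b
  f : ∀ b, b ≠ 2 → b ≠ 3 → ¬ IsLog b → s'.f b = s.f b
  ptr : s'.w 13 0 = 0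

theorem ElimFrame.trans {s₁ s₂ s₃ : State F} {k' : ℕ} (h : ElimFrame s₁ s₂ k)
    (h' : ElimFrame s₂ s₃ k') : ElimFrame s₁ s₃ (min k k') where
  five i hi := by rw [h'.five i hi, h.five i hi]
  stk i hi := by
    have a := h.stk i (by omega)
    have b := h'.stk i (by omega)
    rw [b.1, b.2.1, b.2.2]
    exact a
  w b hb hl := by rw [h'.w b hb hl, h.w b hb hl]
  f b h2 h3 hl := by rw [h'.f b h2 h3 hl, h.f b h2 h3 hl]
  ptr := h'.ptr

theorem ElimFrame.mono {s' : State F} {k' : ℕ} (h : ElimFrame s s' k) (hk : k' ≤ k) :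
    ElimFrame s s' k' :=
  ⟨h.five, fun i hi => h.stk i (by omega), h.w, h.f, h.ptr⟩

/-- The task on top of the stack. -/
structure Task (s : State F) (S sp a m k : ℕ) : Prop where
  hS : s.w 5 1 = S
  hsp : s.w 5 4 = sp + 1
  ha : s.w 10 sp = a
  hm : s.w 11 sp = m
  hk : s.w 12 sp = k
  ptr : s.w 13 0 = 0
  zero : GuestZero s

theorem ElimFrame.task {s' : State F} {sp' : ℕ} (h : ElimFrame s s' sp') (hsp : sp < sp')
    (hs : s'.w 5 4 = sp + 1) (hS : s.w 5 1 = S) (ha : s.w 10 sp = a) (hm : s.w 11 sp = m)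
    (hk : s.w 12 sp = k) (hz : GuestZero s) : Task s' S sp a m k where
  hS := by rw [h.five 1 (by omega), hS]
  hsp := hs
  ha := by rw [(h.stk sp hsp).1, ha]
  hm := by rw [(h.stk sp hsp).2.1, hm]
  hk := by rw [(h.stk sp hsp).2.2, hk]
  ptr := h.ptr
  zero b hb := by
    have hl : ¬ IsLog b := notLog (by omega)
    rw [h.w b (by omega) hl, h.f b (by omega) (by omega) hl]
    exact hz b hb

/-- The memory after taking the task off the stack. -/
def afterPop (s : State F) (sp a m k : ℕ) : State F :=
  (((s.putW 5 4 sp).putW 5 2 a).putW 5 3 m).putW 5 5 k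

theorem popTask_ev (h : Task s S sp a m k) :
    popTask.ev ω s = afterPop s sp a m k := by
  simp [popTask, Cmd.ev, WExp.val, WOp.val, par, h.hsp, h.ha, h.hm, h.hk, afterPop]

theorem popTask_ok (h : Task s S sp a m k)
    (hW : 5 < W) (hsp : sp < W) : popTask.Ok ω W s := by
  simp [popTask, Cmd.Ok, WExp.Fits, WExp.val, WOp.val, par, h.hsp]
  omega

theorem afterPop_frame (h : Task s S sp a m k) :
    ElimFrame s (afterPop s sp a m k) sp where
  five i hi := by
    have h2 : i ≠ 2 := by omega
    have h3 : i ≠ 3 := by omega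
    have h4 : i ≠ 4 := by omega
    have h5 : i ≠ 5 := by omega
    simp [afterPop, h2, h3, h4, h5]
  stk i hi := by simp [afterPop]
  w b hb hl := by
    have : b ≠ 5 := by omega
    simp [afterPop, this]
  f b _ _ _ := by simp [afterPop]
  ptr := by simp [afterPop, h.ptr]

theorem afterPop_five (h : Task s S sp a m k) :
    (afterPop s sp a m k).w 5 1 = S ∧ (afterPop s sp a m k).w 5 2 = a ∧
    (afterPop s sp a m k).w 5 3 = m ∧ (afterPop s sp a m k).w 5 4 = sp ∧
    (afterPop s sp a m k).w 5 5 = k := by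
  simp [afterPop, h.hS]

/-- The entry `(i, j)` of the matrix in field array `b`. -/
def State.ent (s : State F) (b S i j : ℕ) : F := s.f b (i * S + j)

/-- What the elimination of the indices in `D` does. -/
structure ElimPost (S : ℕ) (s s' : State F) (D : Finset ℕ) : Prop where
  B : ∀ i j, j < S → ¬ (i ∈ D ∧ j ∈ D) → s'.ent 2 S i j = s.ent 2 S i j
  G : ∀ i j, j < S → ¬ (i ∈ D ∧ j ∈ D) → s'.ent 3 S i j = s.ent 3 S i j
  ind : ∀ x, x ∉ D → s'.w 9 x = s.w 9 x
  elim : ∃ K, (∀ x ∈ D, s'.w 9 x = if x ∈ K then 1 else 0) ∧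
    Elim (s.ent 2 S) (s'.ent 3 S) K D

theorem elimBody_halts {B : ℕ} {Q : State F → Prop} (h : Task s S sp a m k) (hW : 5 < W) (hsp : sp < W)
    (hQ : Halts ω W (if k = 0 then (if m = 1 then leafTask else splitTask)
      else if k = 1 then schurTask p else mergeTask p) (afterPop s sp a m k) B Q) :
    Halts ω W (elimBody p) s (B + 60) Q := by
  obtain ⟨r1, r2, r3, r4, r5⟩ := afterPop_five h
  have k1 : Halts ω W (.ite (.op .eq (par 3) (.const 1)) leafTask splitTask)
      (afterPop s sp a m k) ((WExp.op .eq (par 3) (.const 1)).cost + 1 +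
        if k = 0 then B else 0) (fun s' => k = 0 → Q s') ∨ k ≠ 0 := by
    by_cases hk : k = 0
    · left
      subst hk
      simp only [if_true] at hQ ⊢
      refine Halts.ite ⟨by exact (by omega : 3 < W), by exact (by omega : 1 < W), ?_⟩
        (fun hc => ?_) fun hc => ?_
      · simp only [WOp.val]; split_ifs <;> omega
      · simp only [WOp.val, WExp.val, par, r3] at hc
        have : m = 1 := by by_contra hne; simp [hne] at hc
        simp only [this, if_true] at hQ ⊢
        exact hQ.imp le_rfl fun _ h _ => h
      · simp only [WOp.val, WExp.val, par, r3] at hc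
        have : m ≠ 1 := by rintro rfl; simp at hc
        simp only [this, if_false] at hQ
        exact hQ.imp le_rfl fun _ h _ => h
    · exact .inr hk
  have k2 : k = 0 ∨ Halts ω W (.ite (.op .eq (par 5) (.const 1)) (schurTask p) (mergeTask p))
      (afterPop s sp a m k) ((WExp.op .eq (par 5) (.const 1)).cost + 1 + B) Q := by
    by_cases hk : k = 0
    · exact .inl hk
    · right
      simp only [hk, if_false] at hQ
      refine Halts.ite ⟨by exact (by omega : 5 < W), by exact (by omega : 1 < W), ?_⟩
        (fun hc => ?_) fun hc => ?_
      · simp only [WOp.val]; split_ifs <;> omega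
      · simp only [WOp.val, WExp.val, par, r5] at hc
        have : k = 1 := by by_contra hne; simp [hne] at hc
        simp only [this, if_true] at hQ ⊢
        exact hQ
      · simp only [WOp.val, WExp.val, par, r5] at hc
        have : k ≠ 1 := by rintro rfl; simp at hc
        simpa only [this, if_false] using hQ
  have k3 : Halts ω W (.ite (par 5) (.ite (.op .eq (par 5) (.const 1)) (schurTask p) (mergeTask p))
      (.ite (.op .eq (par 3) (.const 1)) leafTask splitTask)) (afterPop s sp a m k)
      ((par 5).cost + 1 + (5 + B)) Q := by
    refine Halts.ite (by exact (by omega : 5 < W)) (fun hc => ?_) fun hc => ?_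
    · rcases k2 with k2 | k2
      · exact absurd (r5.trans k2) hc
      · exact k2.imp (by simp [WExp.cost, par]) fun _ h => h
    · have hk : k = 0 := r5.symm.trans hc
      rcases k1 with k1 | k1
      · exact k1.imp (by simp [WExp.cost, par, hk]) fun _ h => h hk
      · exact absurd hk k1
  rw [← popTask_ev (ω := ω) h] at k3
  refine ((popTask_ok h hW hsp).halts_seq k3).imp ?_ fun _ h => h
  simp [popTask, par, Cmd.cost, WExp.cost]
  omega

theorem leaf_steps
    (h : Task s S sp a 1 0) (hW : S * S + 30 < W) (hsp : sp + 5 < W) (ha : a < S) :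
    ∃ s', Steps ω W (par 4) (elimBody p) s s' 200 ∧ ElimFrame s s' sp ∧ s'.w 5 4 = sp ∧
      ElimPost S s s' {a} := by
  classical
  have haS : a * S + a < S * S := by nlinarith
  have hSS : S ≤ S * S := Nat.le_mul_self S
  set r := afterPop s sp a 1 0 with hr
  obtain ⟨r1, r2, r3, r4, r5⟩ := afterPop_five h
  rw [← hr] at r1 r2 r3 r4 r5
  have hl : leafTask.Ok ω W r := by
    simp only [leafTask, Cmd.Ok, Cmd.ev, par, WExp.Fits, FExp.Fits, WExp.val, FExp.val, WOp.val,
      State.putW_w, State.putW_f, r1, r2, Nat.reduceEqDiff, if_false]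
    split_ifs <;> simp [r1, r2] <;> omega
  have hev : leafTask.ev ω r = ((r.putW 9 a (if r.f 2 (a * S + a) = 0 then 0 else 1)).putF 3
      (a * S + a) (r.f 2 (a * S + a))⁻¹) := by
    simp only [leafTask, Cmd.ev, par, WExp.val, FExp.val, WOp.val,
      State.putW_w, State.putW_f, r1, r2, Nat.reduceEqDiff, if_false]
    by_cases h0 : r.f 2 (a * S + a) = 0
    · simp only [h0, if_true, State.putW_w, State.putW_f, r1, r2, Nat.reduceEqDiff, if_false]
      apply State.ext' <;> intro b i <;> simp only [State.putW_w, State.putF_w, State.putF_f,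
        State.putW_f, if_true, one_div] <;> split_ifs <;>
        simp_all [update_apply]
    · simp [h0, r1, r2]
  have hH : Halts ω W (elimBody p) s (leafTask.cost + 60) fun s' => s' = leafTask.ev ω r := by
    refine elimBody_halts h (by omega) (by omega) ?_
    rw [← hr]
    simp only [if_true]
    exact hl.halts rfl
  obtain ⟨s', rfl, hst⟩ := hH.steps (c := par 4) (by exact (by omega : 4 < W))
    (by simp [par, WExp.val, h.hsp])
  have hrB : r.f = s.f := by simp [hr, afterPop]
  have hr9 : r.w 9 = s.w 9 := by simp [hr, afterPop]
  have hfr := afterPop_frame h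
  rw [← hr] at hfr
  refine ⟨leafTask.ev ω r, fun s'' t'' e => ?_, ?_, ?_, ?_⟩
  · obtain ⟨t, e₁, l₁⟩ := hst s'' t'' e
    exact ⟨t, e₁, l₁.trans (by simp [par, WExp.cost, FExp.cost, leafTask, Cmd.cost])⟩
  · rw [hev]
    refine ⟨fun i hi => ?_, fun i hi => ?_, fun b hb hl => ?_, fun b h2 h3 hl => ?_, ?_⟩
    · simpa using hfr.five i hi
    · simpa using hfr.stk i hi
    · have : b ≠ 9 := by omega
      simpa [this] using hfr.w b hb hl
    · simpa [h3] using hfr.f b h2 h3 hl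
    · simpa using hfr.ptr
  · rw [hev]; simpa using r4
  · rw [hev]
    refine ⟨fun i j hj _ => ?_, fun i j hj hij => ?_, fun x hx => ?_, _, ?_,
      elim_singleton (s.ent 2 S) _ a ?_⟩
    · simp [State.ent, hrB]
    · simp only [State.ent, State.putF_f, if_true, State.putW_f, hrB, update_apply]
      rw [if_neg]
      intro he
      obtain ⟨rfl, rfl⟩ := flat_inj hj ha he
      simp at hij
    · simp only [mem_singleton] at hx
      simp [hx, hr9]
    · intro x hx
      simp only [mem_singleton] at hx
      subst hx
      by_cases h0 : s.f 2 (x * S + x) = 0 <;> simp [State.ent, hrB, h0]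
    · simp [State.ent, hrB]

theorem split_steps
    (h : Task s S sp a (2 * m) 0) (hm : 1 ≤ m) (hW : S * S + 30 < W) (hsp : sp + 5 < W)
    (ha : a + 2 * m ≤ S) :
    ∃ s', Steps ω W (par 4) (elimBody p) s s' 400 ∧ ElimFrame s s' sp ∧ s'.f = s.f ∧
      s'.w 9 = s.w 9 ∧ s'.w 5 4 = sp + 4 ∧
      (s'.w 10 sp = a ∧ s'.w 11 sp = m ∧ s'.w 12 sp = 2) ∧
      (s'.w 10 (sp + 1) = a + m ∧ s'.w 11 (sp + 1) = m ∧ s'.w 12 (sp + 1) = 0) ∧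
      (s'.w 10 (sp + 2) = a ∧ s'.w 11 (sp + 2) = m ∧ s'.w 12 (sp + 2) = 1) ∧
      (s'.w 10 (sp + 3) = a ∧ s'.w 11 (sp + 3) = m ∧ s'.w 12 (sp + 3) = 0) := by
  have hSS : S ≤ S * S := Nat.le_mul_self S
  set r := afterPop s sp a (2 * m) 0 with hr
  obtain ⟨r1, r2, r3, r4, r5⟩ := afterPop_five h
  rw [← hr] at r1 r2 r3 r4 r5
  have hdiv : 2 * m / 2 = m := by omega
  have hl : splitTask.Ok ω W r := by
    simp [splitTask, pushTask, Cmd.Ok, Cmd.ev, par, WExp.Fits, WExp.val, WOp.val,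
      r2, r3, r4, hdiv]
    omega
  have hev : splitTask.ev ω r =
      ((((((((((((((((r.putW 5 3 m).putW 10 sp a).putW 11 sp m).putW 12 sp 2).putW 5 4 (sp
      + 1)).putW 10 (sp + 1) (a + m)).putW 11 (sp + 1) m).putW 12 (sp + 1) 0).putW 5 4 (sp
      + 2)).putW 10 (sp + 2) a).putW 11 (sp + 2) m).putW 12 (sp + 2) 1).putW 5 4 (sp +
      3)).putW 10 (sp + 3) a).putW 11 (sp + 3) m).putW 12 (sp + 3) 0).putW 5 4 (sp + 4) := by
    simp [splitTask, pushTask, Cmd.ev, par, WExp.val, WOp.val,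
      r2, r3, r4, hdiv]
  have hH : Halts ω W (elimBody p) s (splitTask.cost + 60) fun s' => s' = splitTask.ev ω r := by
    refine elimBody_halts h (by omega) (by omega) ?_
    rw [← hr]
    simp only [if_true, if_neg (show ¬ 2 * m = 1 by omega)]
    exact hl.halts rfl
  obtain ⟨s', rfl, hst⟩ := hH.steps (c := par 4) (by exact (by omega : 4 < W))
    (by simp [par, WExp.val, h.hsp])
  have hfr := afterPop_frame h
  rw [← hr] at hfr
  refine ⟨splitTask.ev ω r, fun s'' t'' e => ?_, ?_, ?_, ?_, ?_, ?_, ?_, ?_, ?_⟩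
  · obtain ⟨t, e₁, l₁⟩ := hst s'' t'' e
    exact ⟨t, e₁, l₁.trans (by simp [par, WExp.cost, splitTask, pushTask, Cmd.cost])⟩
  · rw [hev]
    refine ⟨fun i hi => ?_, fun i hi => ?_, fun b hb hl => ?_, fun b h2 h3 hl => ?_, ?_⟩
    · have h3 : i ≠ 3 := by omega
      have h4 : i ≠ 4 := by omega
      simpa [update_apply, h3, h4] using hfr.five i hi
    · have h1 : i ≠ sp := by omega
      have h2 : i ≠ sp + 1 := by omega
      have h3 : i ≠ sp + 2 := by omega
      have h4 : i ≠ sp + 3 := by omega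
      simpa [update_apply, h1, h2, h3, h4] using hfr.stk i hi
    · have h1 : b ≠ 5 := by omega
      have h2 : b ≠ 10 := by omega
      have h3 : b ≠ 11 := by omega
      have h4 : b ≠ 12 := by omega
      simpa [h1, h2, h3, h4] using hfr.w b hb hl
    · simpa using hfr.f b h2 h3 hl
    · simpa using hfr.ptr
  all_goals rw [hev]; simp [hr, afterPop]

theorem mulBlock_ent {TM : ℕ}
    (hp : Multiplies p F W m TM) (h : BlockParams s S a m)
    (hW : S * S + 30 < W) (hW' : 300 * (m * m + TM + 1) + 1 < W)
    (hpW : ∀ b ∈ (p.shift 20).writes, b < W)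
    (hz : GuestZero s) (h0 : s.w 13 0 = 0) {md : Mode} {dst src₁ src₂ : ℕ}
    (hd : dst = 2 ∨ dst = 3) (h₁ : src₁ < 5) (h₂ : src₂ < 5) (rb kb cb : Bool) {sp : ℕ} :
    Halts ω W (mulBlock p md dst src₁ src₂ rb kb cb) s (mulConst p * (m * m + TM + 1)) fun s' =>
      ElimFrame s s' sp ∧ BlockParams s' S a m ∧ GuestZero s' ∧ s'.w 13 0 = 0 ∧
      s'.w 9 = s.w 9 ∧ s'.w 5 4 = s.w 5 4 ∧
      (∀ b, b ≠ dst → ¬ IsLog b → s'.f b = s.f b) ∧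
      ∀ i j, j < S → s'.ent dst S i j =
        if (i ∈ Ico (offVal a m rb) (offVal a m rb + m)) ∧
          (j ∈ Ico (offVal a m cb) (offVal a m cb + m)) then
          md.val (s.ent dst S i j) (∑ l ∈ Ico (offVal a m kb) (offVal a m kb + m),
            s.ent src₁ S i l * s.ent src₂ S l j)
        else s.ent dst S i j := by
  refine (mulBlock_halts hp h hW hW' hpW hz h0 (by omega) h₁ h₂ rb kb cb).imp le_rfl ?_
  rintro s' ⟨w, f, ptr, e⟩
  have h5 := w 5 (by omega) (by decide)
  refine ⟨⟨fun i _ => by rw [h5], fun i _ => ?_, fun b hb hl => w b (by omega) hl,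
    fun b hb2 hb3 hl => f b (by omega) hl, ptr⟩, h.congr h5, fun b hb => ?_, ptr,
    w 9 (by omega) (by decide), by rw [h5], f, fun i j hj => ?_⟩
  · rw [w 10 (by omega) (by decide), w 11 (by omega) (by decide),
      w 12 (by omega) (by decide)]
    exact ⟨rfl, rfl, rfl⟩
  · have hl : ¬ IsLog b := notLog (by omega)
    rw [w b (by omega) hl, f b (by omega) hl]
    exact hz b hb
  · simp only [State.ent, mem_Ico]
    exact e i j hj

/-- The parameters under which the elimination runs. -/
structure ElimCtx (F : Type*) [Field F] (p : Cmd) (W S : ℕ) (TM : ℕ → ℕ) : Prop where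
  mul : ∀ m, 1 ≤ m → 2 * m ≤ S → Multiplies p F W m (TM m) ∧ 300 * (m * m + TM m + 1) + 1 < W
  hW : S * S + 30 < W
  writes : ∀ b ∈ (p.shift 20).writes, b < W

theorem afterPop_params (h : Task s S sp a m k) (hm : 1 ≤ m)
    (ha : a + 2 * m ≤ S) : BlockParams (afterPop s sp a m k) S a m ∧
      GuestZero (afterPop s sp a m k) ∧ (afterPop s sp a m k).w 13 0 = 0 := by
  obtain ⟨r1, r2, r3, r4, r5⟩ := afterPop_five h
  refine ⟨⟨r1, r2, r3, hm, ha⟩, fun b hb => ?_, by simp [afterPop, h.ptr]⟩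
  have : b ≠ 5 := by omega
  simpa [afterPop, this] using h.zero b hb

/-- What the Schur complement step does to the two matrices: `e` before, `e'` after. -/
def SchurSpec (S a m : ℕ) (e e' : ℕ → ℕ → ℕ → F) : Prop :=
  (∀ i j, j < S → ¬ (i ∈ Ico a (a + m) ∧ j ∈ Ico (a + m) (a + m + m)) → e' 3 i j = e 3 i j) ∧
  (∀ i j, j < S → ¬ (i ∈ Ico (a + m) (a + m + m) ∧ j ∈ Ico (a + m) (a + m + m)) →
    e' 2 i j = e 2 i j) ∧
  (∀ i ∈ Ico a (a + m), ∀ j ∈ Ico (a + m) (a + m + m),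
    e' 3 i j = ∑ l ∈ Ico a (a + m), e 3 i l * e 2 l j) ∧
  ∀ i ∈ Ico (a + m) (a + m + m), ∀ j ∈ Ico (a + m) (a + m + m),
    e' 2 i j = e 2 i j - ∑ l ∈ Ico a (a + m), e 2 i l * e' 3 l j

/-- What the merge step does to the two matrices. -/
def MergeSpec (S a m : ℕ) (e e' : ℕ → ℕ → ℕ → F) : Prop :=
  e' 2 = e 2 ∧
  (∀ i j, j < S → ¬ (i ∈ Ico a (a + m + m) ∧ j ∈ Ico a (a + m + m)) → e' 3 i j = e 3 i j) ∧
  ∃ V : NatMat F,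
  (∀ i ∈ Ico (a + m) (a + m + m), ∀ j ∈ Ico a (a + m),
    V i j = ∑ l ∈ Ico a (a + m), e 2 i l * e 3 l j) ∧
  (∀ i ∈ Ico a (a + m), ∀ j ∈ Ico (a + m) (a + m + m),
    e' 3 i j = 0 - ∑ l ∈ Ico (a + m) (a + m + m), e 3 i l * e 3 l j) ∧
  (∀ i ∈ Ico a (a + m), ∀ j ∈ Ico a (a + m),
    e' 3 i j = e 3 i j - ∑ l ∈ Ico (a + m) (a + m + m), e' 3 i l * V l j) ∧
  (∀ i ∈ Ico (a + m) (a + m + m), ∀ j ∈ Ico a (a + m),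
    e' 3 i j = 0 - ∑ l ∈ Ico (a + m) (a + m + m), e 3 i l * V l j) ∧
  ∀ i ∈ Ico (a + m) (a + m + m), ∀ j ∈ Ico (a + m) (a + m + m), e' 3 i j = e 3 i j

theorem task_steps {T : ℕ} {Q : (ℕ → ℕ → ℕ → F) → (ℕ → ℕ → ℕ → F) → Prop}
    (h : Task s S sp a m k) (hk : k ≠ 0) (hsp : sp + 5 < W)
    (hH : Halts ω W (if k = 1 then schurTask p else mergeTask p) (afterPop s sp a m k) T fun s' =>
      ElimFrame (afterPop s sp a m k) s' sp ∧ s'.w 5 4 = (afterPop s sp a m k).w 5 4 ∧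
      s'.w 9 = (afterPop s sp a m k).w 9 ∧
      Q (fun b => (afterPop s sp a m k).ent b S) fun b => s'.ent b S) :
    ∃ s', Steps ω W (par 4) (elimBody p) s s' (T + 100) ∧
      ElimFrame s s' sp ∧ s'.w 5 4 = sp ∧ s'.w 9 = s.w 9 ∧
      Q (fun b => s.ent b S) fun b => s'.ent b S := by
  obtain ⟨s', ⟨fr, q, i9, c⟩, hst⟩ := (elimBody_halts h (by omega) (by omega)
    (by rw [if_neg hk]; exact hH)).steps (c := par 4) (W := W)
    (show 4 < W by omega) (by simp [par, WExp.val, h.hsp])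
  refine ⟨s', fun s'' t'' e => ?_, ((afterPop_frame h).trans fr).mono (by simp),
    by rw [q, (afterPop_five h).2.2.2.1], by rw [i9]; simp [afterPop], c⟩
  obtain ⟨t, e₁, l₁⟩ := hst s'' t'' e
  refine ⟨t, e₁, l₁.trans ?_⟩
  simp only [par, WExp.cost]
  omega

theorem schur_steps {TM : ℕ → ℕ}
    (hc : ElimCtx F p W S TM) (h : Task s S sp a m 1) (hm : 1 ≤ m) (hsp : sp + 5 < W)
    (ha : a + 2 * m ≤ S) :
    ∃ s', Steps ω W (par 4) (elimBody p) s s' (2 * mulConst p * (m * m + TM m + 1) + 100) ∧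
      ElimFrame s s' sp ∧ s'.w 5 4 = sp ∧ s'.w 9 = s.w 9 ∧
      SchurSpec S a m (fun b => s.ent b S) fun b => s'.ent b S := by
  have hW := hc.hW
  obtain ⟨hmul, hmW⟩ := hc.mul m hm (by omega)
  have hSS : S ≤ S * S := Nat.le_mul_self S
  obtain ⟨hb, hz, hp0⟩ := afterPop_params h hm ha
  set c₀ := mulConst p * (m * m + TM m + 1) with hc₀
  have hT : 2 * mulConst p * (m * m + TM m + 1) = c₀ + c₀ := by rw [hc₀]; ring
  rw [hT]
  refine task_steps h (by omega) hsp ?_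
  set r := afterPop s sp a m 1
  dsimp only [SchurSpec]
  refine (mulBlock_ent hmul hb hW hmW hc.writes hz hp0 (md := .set) (dst := 3) (.inr rfl)
    (src₁ := 3) (src₂ := 2) (by omega) (by omega) false false true (sp := sp)).seq ?_
  rintro s₁ ⟨fr₁, b₁, z₁, p₁, i₁, q₁, f₁, e₁⟩
  refine (mulBlock_ent hmul b₁ hW hmW hc.writes z₁ p₁ (md := .sub) (dst := 2) (.inl rfl)
    (src₁ := 2) (src₂ := 3) (by omega) (by omega) true false true (sp := sp)).imp le_rfl ?_
  rintro s₂ ⟨fr₂, b₂, z₂, p₂, i₂, q₂, f₂, e₂⟩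
  simp only [offVal, if_true, Bool.false_eq_true, if_false, Mode.val] at e₁ e₂
  have h3 : ∀ i j, s₂.ent 3 S i j = s₁.ent 3 S i j := fun i j => by
    simp only [State.ent, f₂ 3 (by omega) (by decide)]
  have h2 : ∀ i j, s₁.ent 2 S i j = r.ent 2 S i j := fun i j => by
    simp only [State.ent, f₁ 2 (by omega) (by decide)]
  refine ⟨(fr₁.trans fr₂).mono (by simp), by rw [q₂, q₁], by rw [i₂, i₁], ?_, ?_, ?_, ?_⟩
  · intro i j hj hij
    rw [h3, e₁ i j hj, if_neg hij]
  · intro i j hj hij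
    rw [e₂ i j hj, if_neg hij, h2]
  · intro i hi j hj
    rw [h3, e₁ i j (by simp at hj; omega), if_pos ⟨hi, hj⟩]
  · intro i hi j hj
    rw [e₂ i j (by simp at hj; omega), if_pos ⟨hi, hj⟩]
    simp only [h2, h3]

theorem merge_steps {TM : ℕ → ℕ}
    (hc : ElimCtx F p W S TM) (h : Task s S sp a m 2) (hm : 1 ≤ m) (hsp : sp + 5 < W)
    (ha : a + 2 * m ≤ S) :
    ∃ s', Steps ω W (par 4) (elimBody p) s s' (4 * mulConst p * (m * m + TM m + 1) + 100) ∧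
      ElimFrame s s' sp ∧ s'.w 5 4 = sp ∧ s'.w 9 = s.w 9 ∧
      MergeSpec S a m (fun b => s.ent b S) fun b => s'.ent b S := by
  have hW := hc.hW
  obtain ⟨hmul, hmW⟩ := hc.mul m hm (by omega)
  have hSS : S ≤ S * S := Nat.le_mul_self S
  obtain ⟨hb, hz, hp0⟩ := afterPop_params h hm ha
  set c₀ := mulConst p * (m * m + TM m + 1) with hc₀
  have hT : 4 * mulConst p * (m * m + TM m + 1) = c₀ + (c₀ + (c₀ + c₀)) := by rw [hc₀]; ring
  rw [hT]
  refine task_steps h (by omega) hsp ?_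
  set r := afterPop s sp a m 2
  dsimp only [MergeSpec]
  refine (mulBlock_ent hmul hb hW hmW hc.writes hz hp0 (md := .neg) (dst := 3) (.inr rfl)
    (src₁ := 3) (src₂ := 3) (by omega) (by omega) false true true (sp := sp)).seq ?_
  rintro s₁ ⟨fr₁, b₁, z₁, p₁, i₁, q₁, f₁, e₁⟩
  refine (mulBlock_ent hmul b₁ hW hmW hc.writes z₁ p₁ (md := .set) (dst := 3) (.inr rfl)
    (src₁ := 2) (src₂ := 3) (by omega) (by omega) true false false (sp := sp)).seq ?_
  rintro s₂ ⟨fr₂, b₂, z₂, p₂, i₂, q₂, f₂, e₂⟩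
  refine (mulBlock_ent hmul b₂ hW hmW hc.writes z₂ p₂ (md := .sub) (dst := 3) (.inr rfl)
    (src₁ := 3) (src₂ := 3) (by omega) (by omega) false true false (sp := sp)).seq ?_
  rintro s₃ ⟨fr₃, b₃, z₃, p₃, i₃, q₃, f₃, e₃⟩
  refine (mulBlock_ent hmul b₃ hW hmW hc.writes z₃ p₃ (md := .neg) (dst := 3) (.inr rfl)
    (src₁ := 3) (src₂ := 3) (by omega) (by omega) true true false (sp := sp)).imp le_rfl ?_
  rintro s₄ ⟨fr₄, b₄, z₄, p₄, i₄, q₄, f₄, e₄⟩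
  simp only [offVal, if_true, Bool.false_eq_true, if_false, Mode.val] at e₁ e₂ e₃ e₄
  have hs : ∀ {u v : State F}, u.f 2 = v.f 2 → u.ent 2 S = v.ent 2 S := fun h => by
    funext i j; simp only [State.ent, h]
  have h21 := hs (f₁ 2 (by omega) (by decide))
  have h22 := hs (f₂ 2 (by omega) (by decide))
  have h23 := hs (f₃ 2 (by omega) (by decide))
  have h24 := hs (f₄ 2 (by omega) (by decide))
  set D₁ := Ico a (a + m) with hD₁
  set D₂ := Ico (a + m) (a + m + m) with hD₂
  have j1 : ∀ j ∈ D₁, j < S := fun j hj => by simp [hD₁] at hj; omega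
  have j2 : ∀ j ∈ D₂, j < S := fun j hj => by simp [hD₂] at hj; omega
  have n12 : ∀ j ∈ D₁, j ∉ D₂ := fun j hj => by simp [hD₁, hD₂] at hj ⊢; omega
  have n21 : ∀ j ∈ D₂, j ∉ D₁ := fun j hj => by simp [hD₁, hD₂] at hj ⊢; omega
  have hD : ∀ j, j ∉ Ico a (a + m + m) → j ∉ D₁ ∧ j ∉ D₂ := fun j hj => by
    simp [hD₁, hD₂] at hj ⊢; omega
  have hV : ∀ i ∈ D₂, ∀ j ∈ D₁, s₃.ent 3 S i j = s₂.ent 3 S i j := fun i hi j hj => by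
    rw [e₃ i j (j1 j hj), if_neg fun h => n21 i hi h.1]
  have c22 : ∀ i ∈ D₂, ∀ j ∈ D₂, s₁.ent 3 S i j = r.ent 3 S i j ∧
      s₂.ent 3 S i j = r.ent 3 S i j ∧ s₃.ent 3 S i j = r.ent 3 S i j ∧
      s₄.ent 3 S i j = r.ent 3 S i j := fun i hi j hj => by
    have a₁ := e₁ i j (j2 j hj)
    have a₂ := e₂ i j (j2 j hj)
    have a₃ := e₃ i j (j2 j hj)
    have a₄ := e₄ i j (j2 j hj)
    rw [if_neg fun h => n21 i hi h.1] at a₁ a₃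
    rw [if_neg fun h => n21 j hj h.2] at a₂ a₄
    rw [a₄, a₃, a₂, a₁]
    exact ⟨rfl, rfl, rfl, rfl⟩
  have c12 : ∀ i ∈ D₁, ∀ j ∈ D₂, s₂.ent 3 S i j = s₁.ent 3 S i j ∧
      s₄.ent 3 S i j = s₁.ent 3 S i j := fun i hi j hj => by
    have a₂ := e₂ i j (j2 j hj)
    have a₃ := e₃ i j (j2 j hj)
    have a₄ := e₄ i j (j2 j hj)
    rw [if_neg fun h => n21 j hj h.2] at a₂ a₃ a₄
    rw [a₄, a₃, a₂]
    exact ⟨rfl, rfl⟩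
  have c11 : ∀ i ∈ D₁, ∀ j ∈ D₁, s₁.ent 3 S i j = r.ent 3 S i j ∧
      s₂.ent 3 S i j = r.ent 3 S i j ∧
      s₄.ent 3 S i j = s₃.ent 3 S i j := fun i hi j hj => by
    have a₁ := e₁ i j (j1 j hj)
    have a₂ := e₂ i j (j1 j hj)
    have a₄ := e₄ i j (j1 j hj)
    rw [if_neg fun h => n12 j hj h.2] at a₁
    rw [if_neg fun h => n12 i hi h.1] at a₂ a₄
    rw [a₄, a₂, a₁]
    exact ⟨rfl, rfl, rfl⟩
  refine ⟨(((fr₁.trans fr₂).trans fr₃).trans fr₄).mono (by simp), by rw [q₄, q₃, q₂, q₁],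
    by rw [i₄, i₃, i₂, i₁], by rw [h24, h23, h22, h21], ?_, s₂.ent 3 S, ?_, ?_, ?_, ?_, ?_⟩
  · intro i j hj hij
    have k : ∀ {A B : Finset ℕ}, (A = D₁ ∨ A = D₂) → (B = D₁ ∨ B = D₂) → ¬ (i ∈ A ∧ j ∈ B) := by
      intro A B hA hB h
      refine hij ⟨?_, ?_⟩
      · by_contra hn
        have := hD i hn
        rcases hA with rfl | rfl
        exacts [this.1 h.1, this.2 h.1]
      · by_contra hn
        have := hD j hn
        rcases hB with rfl | rfl
        exacts [this.1 h.2, this.2 h.2]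
    rw [e₄ i j hj, if_neg (k (.inr rfl) (.inl rfl)), e₃ i j hj, if_neg (k (.inl rfl) (.inl rfl)),
      e₂ i j hj, if_neg (k (.inr rfl) (.inl rfl)), e₁ i j hj, if_neg (k (.inl rfl) (.inr rfl))]
  · intro i hi j hj
    rw [e₂ i j (j1 j hj), if_pos ⟨hi, hj⟩]
    exact sum_congr rfl fun l hl => by rw [h21, (c11 l hl j hj).1]
  · intro i hi j hj
    rw [(c12 i hi j hj).2, e₁ i j (j2 j hj), if_pos ⟨hi, hj⟩]
  · intro i hi j hj
    rw [(c11 i hi j hj).2.2, e₃ i j (j1 j hj), if_pos ⟨hi, hj⟩, (c11 i hi j hj).2.1]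
    congr 1
    exact sum_congr rfl fun l hl => by rw [(c12 i hi l hl).1, (c12 i hi l hl).2]
  · intro i hi j hj
    rw [e₄ i j (j1 j hj), if_pos ⟨hi, hj⟩]
    congr 1
    exact sum_congr rfl fun l hl => by rw [(c22 i hi l hl).2.2.1, hV l hl j hj]
  · intro i hi j hj
    exact (c22 i hi j hj).2.2.2

/-- The time for eliminating a block of size `2 ^ l`. -/
def elimTime (p : Cmd) (TM : ℕ → ℕ) : ℕ → ℕ
  | 0 => 200
  | l + 1 => 2 * elimTime p TM l + (6 * mulConst p + 600) * (2 ^ l * 2 ^ l + TM (2 ^ l) + 1)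

theorem elim_steps {TM : ℕ → ℕ} (hc : ElimCtx F p W S TM)
    (l : ℕ) : ∀ (s : State F) (sp a : ℕ), Task s S sp a (2 ^ l) 0 → sp + 3 * l + 5 < W →
      a + 2 ^ l ≤ S →
      ∃ s', Steps ω W (par 4) (elimBody p) s s' (elimTime p TM l) ∧ ElimFrame s s' sp ∧
        s'.w 5 4 = sp ∧ ElimPost S s s' (Ico a (a + 2 ^ l)) := by
  induction l with
  | zero =>
    intro s sp a h hsp ha
    have := leaf_steps (ω := ω) (p := p) h hc.hW (by omega) (by simpa using ha)
    simpa [elimTime] using this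
  | succ l ih =>
    intro s sp a h hsp ha
    have hm : 1 ≤ 2 ^ l := Nat.one_le_two_pow
    rw [pow_succ, Nat.mul_comm] at h ha ⊢
    set m := 2 ^ l with hml
    obtain ⟨s₁, st₁, fr₁, f₁, i₁, q₁, ⟨a0, b0, c0⟩, ⟨a1, b1, c1⟩, ⟨a2, b2, c2⟩, ⟨a3, b3, c3⟩⟩ :=
      split_steps (ω := ω) (p := p) h hm hc.hW (by omega) ha
    have hz₁ : GuestZero s₁ := fun b hb => by
      have hl : ¬ IsLog b := notLog (by omega)
      rw [fr₁.w b (by omega) hl, f₁]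
      exact h.zero b hb
    have S₁ : s₁.w 5 1 = S := by rw [fr₁.five 1 (by omega), h.hS]
    obtain ⟨s₂, st₂, fr₂, q₂, po₂⟩ := ih s₁ (sp + 3) a
      ⟨S₁, q₁, a3, b3, c3, fr₁.ptr, hz₁⟩ (by omega) (by omega)
    obtain ⟨s₃, st₃, fr₃, q₃, i₃, g₃, d₃, t₃, u₃⟩ := schur_steps (ω := ω) hc
      (fr₂.task (sp := sp + 2) (by omega) q₂ S₁ a2 b2 c2 hz₁) hm (by omega) ha
    dsimp only at g₃ d₃ t₃ u₃
    have fr₁₃ := fr₂.trans fr₃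
    obtain ⟨s₄, st₄, fr₄, q₄, po₄⟩ := ih s₃ (sp + 1) (a + m)
      (fr₁₃.task (sp := sp + 1) (by omega) q₃ S₁ a1 b1 c1 hz₁) (by omega) (by omega)
    have fr₁₄ := fr₁₃.trans fr₄
    obtain ⟨s₅, st₅, fr₅, q₅, i₅, d₅, g₅, V, v₅, x₁₂, x₁₁, x₂₁, x₂₂⟩ := merge_steps (ω := ω) hc
      (fr₁₄.task (sp := sp) (by omega) q₄ S₁ a0 b0 c0 hz₁) hm (by omega) ha
    dsimp only at d₅ g₅ v₅ x₁₂ x₁₁ x₂₁ x₂₂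
    refine ⟨s₅, ?_, ((fr₁.trans fr₁₄).trans fr₅).mono (by omega), q₅, ?_⟩
    · have := (((st₁.trans st₂).trans st₃).trans st₄).trans st₅
      intro s'' t'' e
      obtain ⟨t, e₁, l₁⟩ := this s'' t'' e
      refine ⟨t, e₁, l₁.trans ?_⟩
      simp only [elimTime, ← hml]
      have h1 : 1 ≤ m * m + TM m + 1 := by omega
      generalize m * m + TM m + 1 = y at *
      nlinarith
    · set D₁ := Ico a (a + m) with hD₁
      set D₂ := Ico (a + m) (a + m + m) with hD₂
      have j1 : ∀ j ∈ D₁, j < S := fun j hj => by simp [hD₁] at hj; omega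
      have j2 : ∀ j ∈ D₂, j < S := fun j hj => by simp [hD₂] at hj; omega
      have n12 : ∀ j ∈ D₁, j ∉ D₂ := fun j hj => by simp [hD₁, hD₂] at hj ⊢; omega
      have n21 : ∀ j ∈ D₂, j ∉ D₁ := fun j hj => by simp [hD₁, hD₂] at hj ⊢; omega
      have hD : Ico a (a + m + m) = D₁ ∪ D₂ := by
        ext x; simp [hD₁, hD₂]; omega
      have hD' : Ico a (a + 2 * m) = D₁ ∪ D₂ := by
        rw [← hD, Nat.two_mul, Nat.add_assoc]
      have e1 : ∀ b i j, s₁.ent b S i j = s.ent b S i j := fun b i j => by simp [State.ent, f₁]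
      rw [hD']
      rw [hD] at g₅
      obtain ⟨K₁, ik₁, el₁⟩ := po₂.elim
      obtain ⟨K₂, ik₂, el₂⟩ := po₄.elim
      have B2 : ∀ i j, j < S → ¬ (i ∈ D₁ ∧ j ∈ D₁) → s₂.ent 2 S i j = s.ent 2 S i j :=
        fun i j hj h => by rw [po₂.B i j hj h, e1]
      have B4 : ∀ i j, j < S → ¬ (i ∈ D₁ ∧ j ∈ D₁) → ¬ (i ∈ D₂ ∧ j ∈ D₂) →
          s₄.ent 2 S i j = s.ent 2 S i j := fun i j hj h h' => by
        rw [po₄.B i j hj h', d₃ i j hj h', B2 i j hj h]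
      have G4 : ∀ i ∈ D₁, ∀ j, j < S → s₄.ent 3 S i j = s₃.ent 3 S i j := fun i hi j hj =>
        po₄.G i j hj fun h => n12 i hi h.1
      have G43 : ∀ i ∈ D₁, ∀ j ∈ D₁, s₄.ent 3 S i j = s₂.ent 3 S i j := fun i hi j hj => by
        rw [G4 i hi j (j1 j hj), g₃ i j (j1 j hj) fun h => n12 j hj h.2]
      refine ⟨fun i j hj hij => ?_, fun i j hj hij => ?_, fun x hx => ?_, K₁ ∪ K₂, ?_, ?_⟩
      · simp only [mem_union] at hij
        rw [d₅, B4 i j hj (by tauto) (by tauto)]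
      · have hij' := hij
        simp only [mem_union] at hij
        rw [g₅ i j hj hij', po₄.G i j hj (by tauto), g₃ i j hj (by tauto),
          po₂.G i j hj (by tauto), e1]
      · simp only [mem_union, not_or] at hx
        rw [i₅, po₄.ind x hx.2, i₃, po₂.ind x hx.1, i₁]
      · intro x hx
        rw [i₅]
        rcases mem_union.1 hx with hx | hx
        · rw [po₄.ind x (n12 x hx), i₃, ik₁ x hx]
          have : x ∉ K₂ := fun h => n12 x hx (el₂.sub h)
          simp [this]
        · rw [ik₂ x hx]
          have : x ∉ K₁ := fun h => n21 x hx (el₁.sub h)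
          simp [this]
      · have el₁' : Elim (s.ent 2 S) (s₂.ent 3 S) K₁ D₁ :=
          el₁.congr (fun i _ j _ => e1 2 i j) fun i _ j _ => rfl
        refine el₁'.merge (T := s₃.ent 3 S) (S := s₃.ent 2 S) (G₂ := s₄.ent 3 S) (V := V)
          (fun i hi j hj => ?_) (fun i hi j hj => ?_) el₂ (fun i hi j hj => ?_)
          (fun i hi j hj => ?_) (fun i hi j hj => ?_) x₂₁ x₂₂ (fun x hx y hy => ?_)
        · rw [t₃ i hi j hj]
          exact sum_congr rfl fun l hl => by rw [B2 l j (j2 j hj) fun h => n21 j hj h.2]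
        · rw [u₃ i hi j hj, B2 i j (j2 j hj) fun h => n21 j hj h.2]
          congr 1
          exact sum_congr rfl fun l hl => by rw [B2 i l (j1 l hl) fun h => n21 i hi h.1]
        · rw [v₅ i hi j hj]
          exact sum_congr rfl fun l hl => by
            rw [B4 i l (j1 l hl) (fun h => n21 i hi h.1) fun h => n12 l hl h.2, G43 l hl j hj]
        · rw [x₁₂ i hi j hj]
          congr 1
          exact sum_congr rfl fun l hl => by rw [G4 i hi l (j2 l hl)]
        · rw [x₁₁ i hi j hj, G43 i hi j hj]
        · simp [hD₁, hD₂] at hx hy; omega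

end EliminationProgram

end

section

section Bordered

variable {H : ℕ} {I : Finset ℕ} {B R : NatMat F}

/-! ### Rows -/

/-- Row `x` of the `H × H` matrix `B`. -/
def rowv (H : ℕ) (B : NatMat F) (x : ℕ) : Fin H → F := fun j => B x j

theorem exists_right_inverse
    (h : LinearIndepOn F (rowv H B) (I : Set ℕ)) :
    ∃ R : NatMat F, ∀ x ∈ I, ∀ y ∈ I,
      ∑ j ∈ range H, B x j * R j y = if x = y then 1 else 0 := by
  classical
  let M : Matrix I (Fin H) F := Matrix.of fun x j => B x j
  have hli : LinearIndependent F M.row := h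
  have hs : Function.Surjective M.mulVec := by
    have h1 : LinearMap.range M.mulVecLin = ⊤ := by
      apply Submodule.eq_top_of_finrank_eq
      have := hli.rank_matrix
      rw [Matrix.rank] at this
      rw [this, Module.finrank_fintype_fun_eq_card]
    intro v
    obtain ⟨w, hw⟩ := LinearMap.range_eq_top.1 h1 v
    exact ⟨w, hw⟩
  obtain ⟨C, hC⟩ := Matrix.mulVec_surjective_iff_exists_right_inverse.1 hs
  refine ⟨fun j y => if h : j < H ∧ y ∈ I then C ⟨j, h.1⟩ ⟨y, h.2⟩ else 0, fun x hx y hy => ?_⟩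
  have := congrFun (congrFun hC ⟨x, hx⟩) ⟨y, hy⟩
  rw [Matrix.mul_apply, Matrix.one_apply] at this
  rw [sum_range]
  simp only [hy, and_true, Fin.is_lt, dif_pos]
  simp only [Subtype.mk.injEq] at this
  exact this

/-- A linear system with fewer equations than unknowns has a nonzero solution. -/
theorem exists_ne_zero_of_card_lt {J : Finset ℕ} (h : I.card < J.card) (T : NatMat F) :
    ∃ z : ℕ → F, (∀ x ∈ I, ∑ j ∈ J, T x j * z j = 0) ∧ (∀ j ∉ J, z j = 0) ∧ ∃ j ∈ J, z j ≠ 0 := by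
  classical
  let M : Matrix I J F := Matrix.of fun x j => T x j
  have hk : LinearMap.ker M.mulVecLin ≠ ⊥ := by
    apply LinearMap.ker_ne_bot_of_finrank_lt
    rw [Module.finrank_fintype_fun_eq_card, Module.finrank_fintype_fun_eq_card]
    simpa using h
  obtain ⟨v, hv, hv0⟩ := Submodule.exists_mem_ne_zero_of_ne_bot hk
  obtain ⟨j, hj⟩ := Function.ne_iff.1 hv0
  refine ⟨fun j => if h : j ∈ J then v ⟨j, h⟩ else 0, fun x hx => ?_, fun j hj => by simp [hj],
    j, j.2, by simpa using hj⟩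
  have := congrFun (LinearMap.mem_ker.1 hv) ⟨x, hx⟩
  rw [← sum_coe_sort J]
  simpa [Matrix.mulVec, dotProduct, M] using this

/-- If a combination of the rows in `J` vanishes, then a product with `B` is singular there. -/
theorem exists_ne_zero_of_dependent {J : Finset ℕ}
    (h : ¬ LinearIndepOn F (rowv H B) (J : Set ℕ)) :
    ∃ z : ℕ → F, (∀ x ∈ J, ∑ i ∈ range H, B x i * ∑ j ∈ J, R i j * z j = 0) ∧
      (∀ j ∉ J, z j = 0) ∧ ∃ j ∈ J, z j ≠ 0 := by
  classical
  rw [linearIndepOn_finset_iff] at h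
  push Not at h
  obtain ⟨c, hc, x₀, hx₀, hne⟩ := h
  obtain ⟨z, hz, hz0, hzn⟩ := exists_ne_zero_of_card_lt (I := J.erase x₀) (J := J)
    (by rw [card_erase_of_mem hx₀]; have := card_pos.2 ⟨x₀, hx₀⟩; omega)
    (fun x j => ∑ i ∈ range H, B x i * R i j)
  have hz' : ∀ x ∈ J.erase x₀, ∑ i ∈ range H, B x i * ∑ j ∈ J, R i j * z j = 0 := by
    intro x hx
    rw [← hz x hx]
    simp only [mul_sum, sum_mul]
    rw [sum_comm]
    exact sum_congr rfl fun j _ => sum_congr rfl fun i _ => by ring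
  refine ⟨z, fun x hx => ?_, hz0, hzn⟩
  by_cases hxx : x = x₀
  · subst hxx
    have h1 : ∑ y ∈ J, c y * ∑ i ∈ range H, B y i * ∑ j ∈ J, R i j * z j = 0 := by
      simp only [mul_sum (s := range H)]
      rw [sum_comm]
      refine sum_eq_zero fun i hi => ?_
      have h2 := congrFun hc ⟨i, mem_range.1 hi⟩
      simp only [Finset.sum_apply, Pi.smul_apply, smul_eq_mul, rowv, Pi.zero_apply] at h2
      rw [← zero_mul (∑ j ∈ J, R i j * z j), ← h2, sum_mul]
      exact sum_congr rfl fun y _ => by ring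
    rw [← add_sum_erase J _ hx, sum_eq_zero (s := J.erase x), add_zero] at h1
    · exact (mul_eq_zero.1 h1).resolve_left hne
    · intro y hy
      rw [hz' y hy, mul_zero]
  · exact hz' x (mem_erase.2 ⟨hxx, hx⟩)

/-! ### The bordered matrix -/

/-- A matrix, two diagonals, and a block for tests. -/
structure Cfg (F : Type*) where
  B : NatMat F
  al : ℕ → F
  be : ℕ → F
  Q : NatMat F

/-- The random block of the bordered matrix. -/
def randR (H : ℕ) (ρ : ℕ → F) (x y : ℕ) : F := ρ ((H + x) * (4 * H) + (2 * H + y))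

/-- The random lower triangular block of the bordered matrix. -/
def randL (H : ℕ) (ρ : ℕ → F) (x y : ℕ) : F :=
  if y ≤ x then ρ ((3 * H + x) * (4 * H) + (H + y)) else 0

/-- The bordered matrix, with `4 × 4` blocks
`[B, 1, 0, 0; 1, 0, R, 0; 0, al, be, Q; 0, L, 0, 1]`. -/
def Cfg.blk (c : Cfg F) (H : ℕ) (ρ : ℕ → F) (a b x y : ℕ) : F :=
  match a, b with
  | 0, 0 => c.B x y
  | 0, 1 => if x = y then 1 else 0
  | 1, 0 => if x = y then 1 else 0
  | 1, 2 => randR H ρ x y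
  | 2, 1 => if x = y then c.al x else 0
  | 2, 2 => if x = y then c.be x else 0
  | 2, 3 => c.Q x y
  | 3, 1 => randL H ρ x y
  | 3, 3 => if x = y then 1 else 0
  | _, _ => 0

def Cfg.ent (c : Cfg F) (H : ℕ) (ρ : ℕ → F) (i j : ℕ) : F :=
  c.blk H ρ (i / H) (j / H) (i % H) (j % H)

theorem block_div {b x : ℕ} (hx : x < H) : (b * H + x) / H = b := by
  rw [Nat.mul_comm, Nat.mul_add_div (by omega), Nat.div_eq_of_lt hx, add_zero]

theorem block_mod {b x : ℕ} (hx : x < H) : (b * H + x) % H = x := by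
  rw [Nat.mul_comm, Nat.mul_add_mod, Nat.mod_eq_of_lt hx]

/-- The product of `B`, `R` and a vector. -/
def brz (H : ℕ) (B R : NatMat F) (z : ℕ → F) (x : ℕ) : F :=
  ∑ i ∈ range H, B x i * ∑ j ∈ range H, R i j * z j

/-- The reduced linear system of the bordered matrix has only the trivial solution. -/
def Cfg.Reduced (c : Cfg F) (H : ℕ) (R L : NatMat F) : Prop :=
  ∀ z : ℕ → F, (∀ x < H, c.al x * brz H c.B R z x + c.be x * z x -
    ∑ k ∈ range H, c.Q x k * ∑ y ∈ range H, L k y * brz H c.B R z y = 0) →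
    ∀ x < H, z x = 0

theorem sum_range_four (H : ℕ) (f : ℕ → F) : ∑ j ∈ range (4 * H), f j =
    ∑ y ∈ range H, f (0 * H + y) + ∑ y ∈ range H, f (1 * H + y) +
    ∑ y ∈ range H, f (2 * H + y) + ∑ y ∈ range H, f (3 * H + y) := by
  rw [show 4 * H = H + H + H + H by ring, sum_range_add, sum_range_add,
    sum_range_add]
  simp only [zero_mul, one_mul, zero_add]
  rw [show H + H = 2 * H by ring, show 2 * H + H = 3 * H by ring]

theorem forall_lt_four {p : ℕ → Prop} (h : ∀ b < 4, ∀ x < H, p (b * H + x)) :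
    ∀ i < 4 * H, p i := by
  intro i hi
  have hH : 0 < H := by omega
  have := h (i / H) (by rw [Nat.div_lt_iff_lt_mul hH]; exact hi) (i % H) (Nat.mod_lt _ hH)
  rwa [Nat.div_add_mod' i H] at this

theorem Cfg.ent_block (c : Cfg F) (ρ : ℕ → F) {a b x y : ℕ} (hx : x < H) (hy : y < H) :
    c.ent H ρ (a * H + x) (b * H + y) = c.blk H ρ a b x y := by
  simp only [Cfg.ent, block_div hx, block_mod hx, block_div hy, block_mod hy]

theorem Cfg.row {c : Cfg F} {ρ : ℕ → F} (u : ℕ → F) {x : ℕ} (hx : x < H) :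
    (∑ j ∈ range (4 * H), c.ent H ρ (0 * H + x) j * u j =
      ∑ y ∈ range H, c.B x y * u (0 * H + y) + u (1 * H + x)) ∧
    (∑ j ∈ range (4 * H), c.ent H ρ (1 * H + x) j * u j =
      u (0 * H + x) + ∑ y ∈ range H, randR H ρ x y * u (2 * H + y)) ∧
    (∑ j ∈ range (4 * H), c.ent H ρ (2 * H + x) j * u j =
      c.al x * u (1 * H + x) + c.be x * u (2 * H + x) +
        ∑ y ∈ range H, c.Q x y * u (3 * H + y)) ∧
    (∑ j ∈ range (4 * H), c.ent H ρ (3 * H + x) j * u j =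
      ∑ y ∈ range H, randL H ρ x y * u (1 * H + y) + u (3 * H + x)) := by
  have d : ∀ (a : F) (w : ℕ → F), ∑ y ∈ range H, (if x = y then a else 0) * w y = a * w x := by
    intro a w
    rw [sum_eq_single x]
    · simp
    · intro y _ hy; simp [hy.symm]
    · intro h; exact absurd (mem_range.2 hx) h
  have e : ∀ a b, ∑ y ∈ range H, c.ent H ρ (a * H + x) (b * H + y) * u (b * H + y) =
      ∑ y ∈ range H, c.blk H ρ a b x y * u (b * H + y) := fun a b =>
    sum_congr rfl fun y hy => by rw [c.ent_block ρ hx (mem_range.1 hy)]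
  refine ⟨?_, ?_, ?_, ?_⟩ <;> rw [sum_range_four, e, e, e, e] <;>
    simp only [Cfg.blk, d, zero_mul, one_mul, sum_const_zero, add_zero, zero_add]

theorem Cfg.nonsing_iff {c : Cfg F} {ρ : ℕ → F} :
    Nonsing (c.ent H ρ) (range (4 * H)) ↔ c.Reduced H (randR H ρ) (randL H ρ) := by
  constructor
  · intro h z hz x hx
    set s := brz H c.B (randR H ρ) z with hs
    let u : ℕ → F := fun i => match i / H with
      | 0 => -∑ j ∈ range H, randR H ρ (i % H) j * z j
      | 1 => s (i % H)
      | 2 => z (i % H)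
      | _ => -∑ y ∈ range H, randL H ρ (i % H) y * s y
    have u0 : ∀ y < H, u (0 * H + y) = -∑ j ∈ range H, randR H ρ y j * z j := fun y hy => by
      simp only [u, block_div hy, block_mod hy]
    have u1 : ∀ y < H, u (1 * H + y) = s y := fun y hy => by
      simp only [u, block_div hy, block_mod hy]
    have u2 : ∀ y < H, u (2 * H + y) = z y := fun y hy => by
      simp only [u, block_div hy, block_mod hy]
    have u3 : ∀ y < H, u (3 * H + y) = -∑ j ∈ range H, randL H ρ y j * s j := fun y hy => by
      simp only [u, block_div hy, block_mod hy]
    have key := h u (by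
      intro i hi
      rw [mem_range] at hi
      revert i
      refine forall_lt_four fun b hb x hx => ?_
      obtain ⟨r0, r1, r2, r3⟩ := c.row (ρ := ρ) u hx
      interval_cases b
      · rw [r0, u1 x hx, sum_congr rfl fun y hy => by rw [u0 y (mem_range.1 hy)], hs,
          brz]
        simp
      · rw [r1, u0 x hx, sum_congr rfl fun y hy =>
          congrArg (randR H ρ x y * ·) (u2 y (mem_range.1 hy))]
        exact neg_add_cancel _
      · rw [r2, u1 x hx, u2 x hx, sum_congr rfl fun y hy => by
          rw [u3 y (mem_range.1 hy)]]
        rw [← hz x hx]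
        simp [sub_eq_add_neg]
      · rw [r3, u3 x hx, sum_congr rfl fun y hy => by rw [u1 y (mem_range.1 hy)]]
        simp) (2 * H + x) (by rw [mem_range]; omega)
    rwa [u2 x hx] at key
  · intro h u hu i hi
    rw [mem_range] at hi
    let z : ℕ → F := fun y => u (2 * H + y)
    have w0 : ∀ x < H, u (0 * H + x) = -∑ y ∈ range H, randR H ρ x y * z y := fun x hx => by
      have := hu (1 * H + x) (by rw [mem_range]; omega)
      rw [(c.row u hx).2.1] at this
      exact eq_neg_of_add_eq_zero_left this
    have w1 : ∀ x < H, u (1 * H + x) = brz H c.B (randR H ρ) z x := fun x hx => by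
      have := hu (0 * H + x) (by rw [mem_range]; omega)
      rw [(c.row u hx).1, sum_congr rfl fun y hy => by
        rw [w0 y (mem_range.1 hy), mul_neg], sum_neg_distrib] at this
      exact (neg_add_eq_zero.1 this).symm
    have w3 : ∀ x < H, u (3 * H + x) =
        -∑ y ∈ range H, randL H ρ x y * brz H c.B (randR H ρ) z y := fun x hx => by
      have := hu (3 * H + x) (by rw [mem_range]; omega)
      rw [(c.row u hx).2.2.2, sum_congr rfl fun y hy => by
        rw [w1 y (mem_range.1 hy)]] at this
      exact eq_neg_of_add_eq_zero_right this
    have hz := h z fun x hx => by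
      have := hu (2 * H + x) (by rw [mem_range]; omega)
      rw [(c.row u hx).2.2.1, w1 x hx, sum_congr rfl fun y hy => by
        rw [w3 y (mem_range.1 hy)]] at this
      rw [← this]
      simp [z, sub_eq_add_neg]
    have hb : ∀ x, brz H c.B (randR H ρ) z x = 0 := fun x => by
      rw [brz]
      refine sum_eq_zero fun i _ => ?_
      rw [sum_eq_zero fun j hj => by rw [hz j (mem_range.1 hj), mul_zero], mul_zero]
    revert i
    refine forall_lt_four fun b hb' x hx => ?_
    interval_cases b
    · rw [w0 x hx, sum_eq_zero fun j hj => by rw [hz j (mem_range.1 hj), mul_zero],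
        neg_zero]
    · rw [w1 x hx, hb]
    · exact hz x hx
    · rw [w3 x hx]; simp [hb]

theorem exists_rand (H : ℕ) (R L : NatMat F) : ∃ ρ : ℕ → F,
    (∀ x < H, ∀ y < H, randR H ρ x y = R x y) ∧
    ∀ x < H, ∀ y < H, randL H ρ x y = if y ≤ x then L x y else 0 := by
  refine ⟨fun k => if k / (4 * H) / H = 1 then R (k / (4 * H) % H) (k % (4 * H) % H)
    else L (k / (4 * H) % H) (k % (4 * H) % H), fun x hx y hy => ?_, fun x hx y hy => ?_⟩
  · have h1 : 2 * H + y < 4 * H := by omega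
    have e1 := block_div (b := H + x) h1
    have e2 := block_mod (b := H + x) h1
    have e3 := block_div (b := 1) hx
    have e4 := block_mod (b := 1) hx
    rw [one_mul] at e3 e4
    simp only [randR, e1, e2, e3, e4, if_true, block_mod hy]
  · have h1 : H + y < 4 * H := by omega
    have e1 := block_div (b := 3 * H + x) h1
    have e2 := block_mod (b := 3 * H + x) h1
    have e4 := block_mod (b := 1) hy
    rw [one_mul] at e4
    simp only [randL, e1, e2, block_div hx, block_mod hx, e4]
    simp

theorem Cfg.Reduced.congr {c : Cfg F} {L R' L' : NatMat F}
    (hR : ∀ x < H, ∀ y < H, R x y = R' x y) (hL : ∀ x < H, ∀ y < H, L x y = L' x y)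
    (h : c.Reduced H R L) : c.Reduced H R' L' := by
  have e : ∀ z x, brz H c.B R z x = brz H c.B R' z x := fun z x =>
    sum_congr rfl fun i hi => by
      congr 1
      exact sum_congr rfl fun j hj => by
        rw [hR i (mem_range.1 hi) j (mem_range.1 hj)]
  intro z hz
  refine h z fun x hx => ?_
  rw [← hz x hx, e]
  congr 1
  refine sum_congr rfl fun k hk => ?_
  congr 1
  exact sum_congr rfl fun y hy => by
    rw [hL k (mem_range.1 hk) y (mem_range.1 hy), e]

/-- The bordered matrix is nonsingular for some choice of the random elements. -/
def Cfg.Ideal (c : Cfg F) (H : ℕ) : Prop :=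
  ∃ ρ : ℕ → F, Nonsing (c.ent H ρ) (range (4 * H))

theorem Cfg.ideal_iff {c : Cfg F} :
    c.Ideal H ↔ ∃ R L : NatMat F, (∀ x y, x < y → L x y = 0) ∧ c.Reduced H R L := by
  constructor
  · rintro ⟨ρ, h⟩
    refine ⟨_, _, fun x y hxy => ?_, Cfg.nonsing_iff.1 h⟩
    rw [randL, if_neg (by omega)]
  · rintro ⟨R, L, hL, h⟩
    obtain ⟨ρ, h₁, h₂⟩ := exists_rand H R L
    refine ⟨ρ, Cfg.nonsing_iff.2 (h.congr (fun x hx y hy => (h₁ x hx y hy).symm)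
      fun x hx y hy => ?_)⟩
    rw [h₂ x hx y hy]
    split_ifs with h
    · rfl
    · exact hL x y (by omega)

theorem brz_of_right_inverse (hI : ∀ x ∈ I, x < H)
    (hR : ∀ x ∈ I, ∀ y ∈ I, ∑ j ∈ range H, B x j * R j y = if x = y then 1 else 0)
    (T : NatMat F) (g : ℕ → ℕ) (J : Finset ℕ) (hJ : ∀ y ∈ J, y < H ∧ g y ∈ I)
    (hT : ∀ i y, T i y = if y ∈ J then R i (g y) else 0) (z : ℕ → F) {x : ℕ} (hx : x ∈ I) :
    brz H B T z x = ∑ y ∈ J, if x = g y then z y else 0 := by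
  have h1 : ∀ i, ∑ j ∈ range H, T i j * z j = ∑ y ∈ J, R i (g y) * z y := by
    intro i
    rw [← sum_subset (s₁ := J) (fun y hy => mem_range.2 (hJ y hy).1)]
    · exact sum_congr rfl fun y hy => by rw [hT, if_pos hy]
    · intro y _ hy; rw [hT, if_neg hy, zero_mul]
  simp only [brz, h1, mul_sum]
  rw [sum_comm]
  refine sum_congr rfl fun y hy => ?_
  rw [sum_congr rfl fun i _ => (mul_assoc (B x i) (R i (g y)) (z y)).symm,
    ← sum_mul, hR x hx _ (hJ y hy).2]
  split_ifs <;> simp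

theorem Cfg.ideal_of_indep {c : Cfg F} {J : Finset ℕ} (hI : ∀ x ∈ I, x < H) (hJ : J ⊆ I)
    (h : LinearIndepOn F (rowv H c.B) (I : Set ℕ)) (hal : ∀ x < H, c.al x = if x ∈ I then 1 else 0)
    (hbe : ∀ x < H, c.be x = if x ∈ J then 0 else 1) : c.Ideal H := by
  obtain ⟨R, hR⟩ := exists_right_inverse h
  refine Cfg.ideal_iff.2 ⟨fun i y => if y ∈ J then R i y else 0, fun _ _ => 0, fun _ _ _ => rfl,
    fun z hz x hx => ?_⟩
  have := hz x hx
  rw [hal x hx, hbe x hx] at this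
  simp only [zero_mul, sum_const_zero, mul_zero, sub_zero] at this
  by_cases hxI : x ∈ I
  · rw [if_pos hxI, brz_of_right_inverse hI hR (g := id) (J := J) (hJ := fun y hy => ⟨hI y (hJ hy), hJ hy⟩)
      (T := fun i y => if y ∈ J then R i y else 0) (hT := fun _ _ => rfl) (z := z) (hx := hxI)] at this
    by_cases hxJ : x ∈ J
    · simpa [hxJ] using this
    · simpa [hxJ] using this
  · have hxJ : x ∉ J := fun h => hxI (hJ h)
    simpa [hxI, hxJ] using this

theorem brz_mem_span {I : Set ℕ} {z : ℕ → F}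
    (h : ∀ x ∈ I, brz H B R z x = 0) {x : ℕ}
    (hx : rowv H B x ∈ span F (rowv H B '' I)) : brz H B R z x = 0 := by
  let φ : (Fin H → F) →ₗ[F] F := Fintype.linearCombination F fun i : Fin H => ∑ j ∈ range H, R i j * z j
  have hφ : ∀ y, φ (rowv H B y) = brz H B R z y := by
    intro y
    simp only [φ, Fintype.linearCombination_apply, rowv, brz, smul_eq_mul, sum_range]
  have : span F (rowv H B '' I) ≤ LinearMap.ker φ := by
    rw [Submodule.span_le]
    rintro _ ⟨y, hy, rfl⟩
    rw [SetLike.mem_coe, LinearMap.mem_ker, hφ, h y hy]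
  rw [← hφ]
  exact this hx

theorem Cfg.ideal_test_iff {c : Cfg F} {N k : ℕ} (hI : ∀ x ∈ I, x < H)
    (hN : N < H) (hNI : N ∉ I) (hk : k < H)
    (h : LinearIndepOn F (rowv H c.B) (I : Set ℕ)) (hal : ∀ x < H, c.al x = if x ∈ I then 1 else 0)
    (hbe : ∀ x < H, c.be x = if x ∈ I ∨ x = N then 0 else 1)
    (hQ : ∀ x < H, ∀ y < H, c.Q x y = if x = N ∧ y = k then 1 else 0) :
    c.Ideal H ↔ ∃ x ≤ k, rowv H c.B x ∉ span F (rowv H c.B '' (I : Set ℕ)) := by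
  classical
  have hQs : ∀ x < H, ∀ w : ℕ → F, ∑ y ∈ range H, c.Q x y * w y = if x = N then w k else 0 := by
    intro x hx w
    rw [sum_congr rfl fun y hy => by rw [hQ x hx y (mem_range.1 hy)]]
    by_cases hxN : x = N
    · simp only [hxN, true_and, if_true, ite_mul, one_mul, zero_mul, sum_ite_eq',
        mem_range, hk]
    · simp [hxN]
  constructor
  · intro hid
    by_contra hsp
    push Not at hsp
    obtain ⟨R, L, hL, hr⟩ := Cfg.ideal_iff.1 hid
    obtain ⟨z, hz, hz0, j, hj, hjz⟩ := exists_ne_zero_of_card_lt (I := I) (J := insert N I)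
      (by rw [card_insert_of_notMem hNI]; omega)
      (fun x j => ∑ i ∈ range H, c.B x i * R i j)
    have hJH : ∀ j ∈ insert N I, j < H := fun j hj => by
      rcases mem_insert.1 hj with rfl | hj
      · exact hN
      · exact hI j hj
    have hb : ∀ x ∈ I, brz H c.B R z x = 0 := by
      intro x hx
      rw [← hz x hx]
      have h1 : ∀ i, ∑ j ∈ range H, R i j * z j = ∑ j ∈ insert N I, R i j * z j := fun i =>
        (sum_subset (fun y hy => mem_range.2 (hJH y hy)) fun y _ hy => by
          rw [hz0 y hy, mul_zero]).symm
      simp only [brz, h1, mul_sum, sum_mul]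
      rw [sum_comm]
      exact sum_congr rfl fun j _ => sum_congr rfl fun i _ => by ring
    refine hjz (hr z (fun x hx => ?_) j (hJH j hj))
    rw [hQs x hx, hal x hx, hbe x hx]
    by_cases hxI : x ∈ I
    · have : x ≠ N := fun h => hNI (h ▸ hxI)
      simp [hxI, this, hb x hxI]
    · by_cases hxN : x = N
      · subst hxN
        simp only [hxI, or_true, if_true, if_false, zero_mul, zero_add, zero_sub, neg_eq_zero]
        refine sum_eq_zero fun y hy => ?_
        by_cases hyk : y ≤ k
        · rw [brz_mem_span (I := (I : Set ℕ)) hb (hsp y hyk), mul_zero]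
        · rw [hL k y (by omega), zero_mul]
      · have : z x = 0 := hz0 x (by simp [hxI, hxN])
        simp [hxI, hxN, this]
  · rintro ⟨x₀, hx₀k, hx₀⟩
    have hx₀I : x₀ ∉ I := fun hm => hx₀ (Submodule.subset_span ⟨x₀, hm, rfl⟩)
    have hli : LinearIndepOn F (rowv H c.B) (insert x₀ I : Finset ℕ) := by
      rw [coe_insert]
      exact (linearIndepOn_insert (by simpa using hx₀I)).2 ⟨h, hx₀⟩
    have hI' : ∀ x ∈ insert x₀ I, x < H := fun j hj => by
      rcases mem_insert.1 hj with rfl | hj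
      · omega
      · exact hI j hj
    obtain ⟨R, hR⟩ := exists_right_inverse hli
    let g : ℕ → ℕ := fun y => if y = N then x₀ else y
    have hg : ∀ y ∈ I, g y = y := fun y hy => if_neg fun h : y = N => hNI (h ▸ hy)
    have hgN : g N = x₀ := if_pos rfl
    have hJ : ∀ y ∈ insert N I, y < H ∧ g y ∈ insert x₀ I := fun y hy => by
      rcases mem_insert.1 hy with rfl | hy
      · exact ⟨hN, by simp [hgN]⟩
      · exact ⟨hI y hy, by simp [hg y hy, hy]⟩
    refine Cfg.ideal_iff.2 ⟨fun i y => if y ∈ insert N I then R i (g y) else 0,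
      fun a b => if a = k ∧ b = x₀ then 1 else 0, fun a b hab => ?_, fun z hz x hx => ?_⟩
    · exact if_neg (by omega)
    have hb : ∀ x ∈ insert x₀ I, _ := fun x hx => brz_of_right_inverse hI' hR _ g (insert N I) hJ
      (fun _ _ => rfl) z hx
    have hzx := hz x hx
    rw [hQs x hx, hal x hx, hbe x hx] at hzx
    by_cases hxI : x ∈ I
    · have hxN : x ≠ N := fun h => hNI (h ▸ hxI)
      have hxx : x ≠ x₀ := fun h => hx₀I (h ▸ hxI)
      rw [hb x (by simp [hxI]), sum_insert hNI, hgN, if_neg hxx, zero_add,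
        sum_congr rfl fun y hy => by rw [hg y hy]] at hzx
      simpa [hxI, hxN] using hzx
    · by_cases hxN : x = N
      · subst hxN
        rw [sum_congr rfl fun y _ => by rw [ite_mul, one_mul, zero_mul]] at hzx
        have hm : x₀ ∈ range H := mem_range.2 (by omega)
        simp only [true_and, sum_ite_eq', hm, if_true] at hzx
        rw [hb x₀ (by simp), sum_insert hNI, hgN, if_pos rfl,
          sum_eq_zero fun y hy => by
            rw [hg y hy, if_neg fun h : x₀ = y => hx₀I (h ▸ hy)]] at hzx
        simpa [hxI] using hzx
      · simpa [hxI, hxN] using hzx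

end Bordered

end

section

section GreedyBasis

variable {H : ℕ} {B G : NatMat F} {ρ : ℕ → F} {J K : Finset ℕ}

/-! ### The matrix of the elimination -/

/-- The matrix `[1, R; -B, 0]`, whose Schur complement is `B R`. -/
def xent (H : ℕ) (B : NatMat F) (ρ : ℕ → F) (i j : ℕ) : F :=
  match i / H, j / H with
  | 0, 0 => if i % H = j % H then 1 else 0
  | 0, 1 => randR H ρ (i % H) (j % H)
  | 1, 0 => -B (i % H) (j % H)
  | _, _ => 0

/-- The first half of the indices, and those in the second half that are given by `J`. -/
def lowerAnd (H : ℕ) (J : Finset ℕ) : Finset ℕ := range H ∪ J.image (H + ·)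

theorem mem_lowerAnd {i : ℕ} :
    i ∈ lowerAnd H J ↔ i < H ∨ ∃ x ∈ J, H + x = i := by
  simp [lowerAnd]

theorem sum_lowerAnd (H : ℕ) (J : Finset ℕ) (f : ℕ → F) : ∑ j ∈ lowerAnd H J, f j =
    ∑ j ∈ range H, f j + ∑ j ∈ J, f (H + j) := by
  rw [lowerAnd, sum_union, sum_image]
  · intro x _ y _ h; simpa using h
  · rw [disjoint_left]
    intro x hx hx'
    obtain ⟨y, -, rfl⟩ := mem_image.1 hx'
    simp at hx

theorem xent_row (hJ : ∀ x ∈ J, x < H)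
    (u : ℕ → F) {x : ℕ} (hx : x < H) :
    (∑ j ∈ lowerAnd H J, xent H B ρ x j * u j =
      u x + ∑ j ∈ J, randR H ρ x j * u (H + j)) ∧
    (∑ j ∈ lowerAnd H J, xent H B ρ (H + x) j * u j = -∑ j ∈ range H, B x j * u j) := by
  have a0 : x / H = 0 := Nat.div_eq_of_lt hx
  have a1 : x % H = x := Nat.mod_eq_of_lt hx
  have b0 := block_div (b := 1) hx
  have b1 := block_mod (b := 1) hx
  rw [one_mul] at b0 b1
  constructor <;> rw [sum_lowerAnd]
  · congr 1
    · rw [sum_eq_single x]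
      · simp only [xent, a0, a1, if_true, one_mul]
      · intro y hy hyx
        rw [mem_range] at hy
        simp only [xent, a0, a1, Nat.div_eq_of_lt hy, Nat.mod_eq_of_lt hy, if_neg hyx.symm, zero_mul]
      · intro h; exact absurd (mem_range.2 hx) h
    · refine sum_congr rfl fun y hy => ?_
      have c0 := block_div (b := 1) (hJ y hy)
      have c1 := block_mod (b := 1) (hJ y hy)
      rw [one_mul] at c0 c1
      simp only [xent, a0, a1, c0, c1]
  · rw [sum_eq_zero (s := J), add_zero, ← sum_neg_distrib]
    · refine sum_congr rfl fun y hy => ?_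
      rw [mem_range] at hy
      simp only [xent, b0, b1, Nat.div_eq_of_lt hy, Nat.mod_eq_of_lt hy, neg_mul]
    · intro y hy
      have c0 := block_div (b := 1) (hJ y hy)
      rw [one_mul] at c0
      simp only [xent, b0, c0, zero_mul]

theorem nonsing_xent_iff (hJ : ∀ x ∈ J, x < H) :
    Nonsing (xent H B ρ) (lowerAnd H J) ↔ ∀ z : ℕ → F,
      (∀ x ∈ J, ∑ i ∈ range H, B x i * ∑ j ∈ J, randR H ρ i j * z j = 0) →
      ∀ j ∈ J, z j = 0 := by
  constructor
  · intro h z hz j hj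
    let u : ℕ → F := fun i => if i < H then -∑ j ∈ J, randR H ρ i j * z j else z (i - H)
    have u0 : ∀ x < H, u x = -∑ j ∈ J, randR H ρ x j * z j := fun x hx => if_pos hx
    have u1 : ∀ x, u (H + x) = z x := fun x => by simp [u]
    have := h u (by
      intro i hi
      rcases mem_lowerAnd.1 hi with hi | ⟨x, hx, rfl⟩
      · rw [(xent_row hJ u hi).1, u0 i hi]; simp [u1]
      · rw [(xent_row hJ u (hJ x hx)).2, neg_eq_zero, sum_congr rfl fun y hy => by
          rw [u0 y (mem_range.1 hy), mul_neg], sum_neg_distrib, hz x hx, neg_zero])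
      (H + j) (mem_lowerAnd.2 (.inr ⟨j, hj, rfl⟩))
    rwa [u1] at this
  · intro h u hu
    have w0 : ∀ x < H, u x = -∑ j ∈ J, randR H ρ x j * u (H + j) := fun x hx => by
      have := hu x (mem_lowerAnd.2 (.inl hx))
      rw [(xent_row hJ u hx).1] at this
      exact eq_neg_of_add_eq_zero_left this
    have hz := h (fun j => u (H + j)) (fun x hx => by
      have := hu (H + x) (mem_lowerAnd.2 (.inr ⟨x, hx, rfl⟩))
      rw [(xent_row hJ u (hJ x hx)).2, neg_eq_zero, sum_congr rfl fun y hy => by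
        rw [w0 y (mem_range.1 hy), mul_neg], sum_neg_distrib, neg_eq_zero] at this
      exact this)
    intro i hi
    rcases mem_lowerAnd.1 hi with hi | ⟨x, hx, rfl⟩
    · rw [w0 i hi, sum_eq_zero fun j hj => by rw [hz j hj, mul_zero], neg_zero]
    · exact hz x hx

theorem linearIndepOn_of_nonsing
    (hJ : ∀ x ∈ J, x < H) (h : Nonsing (xent H B ρ) (lowerAnd H J)) :
    LinearIndepOn F (rowv H B) (J : Set ℕ) := by
  by_contra hd
  obtain ⟨z, hz, -, j, hj, hne⟩ := exists_ne_zero_of_dependent (R := randR H ρ) hd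
  exact hne ((nonsing_xent_iff hJ).1 h z hz j hj)

theorem exists_nonsing_xent
    (hJ : ∀ x ∈ J, x < H) (h : LinearIndepOn F (rowv H B) (J : Set ℕ)) :
    ∃ ρ : ℕ → F, Nonsing (xent H B ρ) (lowerAnd H J) := by
  obtain ⟨R, hR⟩ := exists_right_inverse h
  obtain ⟨ρ, h₁, -⟩ := exists_rand H R (fun _ _ => 0)
  refine ⟨ρ, (nonsing_xent_iff hJ).2 fun z hz x hx => ?_⟩
  rw [← hz x hx]
  have : ∀ i ∈ range H, B x i * ∑ j ∈ J, randR H ρ i j * z j = ∑ j ∈ J, B x i * R i j * z j := by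
    intro i hi
    rw [mul_sum]
    exact sum_congr rfl fun j hj => by
      rw [h₁ i (mem_range.1 hi) j (hJ j hj), mul_assoc]
  rw [sum_congr rfl this, sum_comm, sum_eq_single x]
  · rw [← sum_mul, hR x hx x hx, if_pos rfl, one_mul]
  · intro y hy hyx
    rw [← sum_mul, hR x hx y hy, if_neg hyx.symm, zero_mul]
  · intro hn; exact absurd hx hn

theorem Elim.nonsing {D : Finset ℕ} (h : Elim B G K D) : Nonsing B K := by
  intro z hz j hj
  have : z j = ∑ l ∈ K, G j l * ∑ i ∈ K, B l i * z i := by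
    simp only [mul_sum]
    rw [sum_comm, sum_eq_single j]
    · rw [sum_congr rfl fun l _ => (mul_assoc (G j l) (B l j) (z j)).symm, ← sum_mul,
        h.left_inv hj hj, if_pos rfl, one_mul]
    · intro y hy hyj
      rw [sum_congr rfl fun l _ => (mul_assoc (G j l) (B l y) (z y)).symm, ← sum_mul,
        h.left_inv hj hy, if_neg hyj.symm, zero_mul]
    · intro hn; exact absurd hj hn
  rw [this, sum_eq_zero fun l hl => by rw [hz l hl, mul_zero]]

theorem nonsing_range {x : ℕ} (hx : x ≤ H) :
    Nonsing (xent H B ρ) (range x) := by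
  intro z hz i hi
  rw [← hz i hi, sum_eq_single i]
  · have : i < H := by have := mem_range.1 hi; omega
    simp only [xent, Nat.div_eq_of_lt this, if_true, one_mul]
  · intro y hy hyi
    have h1 : i < H := by have := mem_range.1 hi; omega
    have h2 : y < H := by have := mem_range.1 hy; omega
    simp only [xent, Nat.div_eq_of_lt h1, Nat.mod_eq_of_lt h1, Nat.div_eq_of_lt h2,
      Nat.mod_eq_of_lt h2, if_neg hyi.symm, zero_mul]
  · intro hn; exact absurd hi hn

/-- The pivots in the second half. -/
def upperPart (H : ℕ) (K : Finset ℕ) : Finset ℕ := (range H).filter (H + · ∈ K)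

theorem mem_upperPart {x : ℕ} : x ∈ upperPart H K ↔ x < H ∧ H + x ∈ K := by
  simp [upperPart]

theorem elim_xent
    (h : Elim (xent H B ρ) G K (Ico 0 (2 * H))) :
    K = lowerAnd H (upperPart H K) ∧
    ∀ x < H, (x ∈ upperPart H K ↔ Nonsing (xent H B ρ)
      (lowerAnd H (insert x ((upperPart H K).filter (· < x))))) := by
  have low : ∀ x < H, x ∈ K := by
    intro x
    induction x using Nat.strong_induction_on with
    | _ x ih =>
      intro hx
      rw [h.greedy x (by rw [mem_Ico]; omega)]
      have : insert x (K.filter (· < x)) = range (x + 1) := by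
        ext y
        simp only [mem_insert, mem_filter, mem_range]
        constructor
        · rintro (rfl | ⟨-, h⟩) <;> omega
        · intro hy
          rcases Nat.lt_or_ge y x with h | h
          · exact .inr ⟨ih y h (by omega), h⟩
          · exact .inl (by omega)
      rw [this]
      exact nonsing_range (by omega)
  have hK : K = lowerAnd H (upperPart H K) := by
    ext y
    rw [mem_lowerAnd]
    constructor
    · intro hy
      have := mem_Ico.1 (h.sub hy)
      by_cases hyH : y < H
      · exact .inl hyH
      · exact .inr ⟨y - H, mem_upperPart.2 ⟨by omega, by rwa [Nat.add_sub_cancel' (by omega)]⟩,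
          by omega⟩
    · rintro (hy | ⟨x, hx, rfl⟩)
      · exact low y hy
      · exact (mem_upperPart.1 hx).2
  refine ⟨hK, fun x hx => ?_⟩
  rw [mem_upperPart, h.greedy (H + x) (by rw [mem_Ico]; omega)]
  have : insert (H + x) (K.filter (· < H + x)) =
      lowerAnd H (insert x ((upperPart H K).filter (· < x))) := by
    ext y
    simp only [mem_lowerAnd, mem_insert, mem_filter, mem_upperPart]
    constructor
    · rintro (rfl | ⟨hy, hyx⟩)
      · exact .inr ⟨x, .inl rfl, rfl⟩
      · by_cases hyH : y < H
        · exact .inl hyH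
        · refine .inr ⟨y - H, .inr ⟨⟨by omega, by rwa [Nat.add_sub_cancel' (by omega)]⟩, by omega⟩,
            by omega⟩
    · rintro (hy | ⟨z, rfl | ⟨⟨hz, hzK⟩, hzx⟩, rfl⟩)
      · exact .inr ⟨low y hy, by omega⟩
      · exact .inl rfl
      · exact .inr ⟨hzK, by omega⟩
  rw [this]
  simp [hx]

/-! ### Row bases -/

/-- `I` indexes a basis of the row space. -/
structure RowBasis (H : ℕ) (B : NatMat F) (I : Finset ℕ) : Prop where
  lt : ∀ x ∈ I, x < H
  indep : LinearIndepOn F (rowv H B) (I : Set ℕ)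
  span : ∀ x < H, rowv H B x ∈ span F (rowv H B '' (I : Set ℕ))

open Classical in
/-- The lexicographically first row basis. -/
noncomputable def firstBasis (H : ℕ) (B : NatMat F) : Finset ℕ :=
  (range H).filter fun x => rowv H B x ∉ span F (rowv H B '' {y | y < x})

theorem firstBasis_span (x : ℕ) (hx : x ≤ H) :
    span F (rowv H B '' {y | y < x}) =
      span F (rowv H B '' {y | y ∈ firstBasis H B ∧ y < x}) := by
  induction x with
  | zero => simp
  | succ x ih =>
    have e1 : {y | y < x + 1} = insert x {y | y < x} := by ext y; simp; omega
    by_cases hxB : x ∈ firstBasis H B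
    · have e2 : {y | y ∈ firstBasis H B ∧ y < x + 1} = insert x {y | y ∈ firstBasis H B ∧ y < x} := by
        ext y
        simp only [Set.mem_setOf_eq, Set.mem_insert_iff]
        constructor
        · rintro ⟨h, h'⟩
          by_cases hyx : y = x
          · exact .inl hyx
          · exact .inr ⟨h, by omega⟩
        · rintro (rfl | ⟨h, h'⟩)
          · exact ⟨hxB, by omega⟩
          · exact ⟨h, by omega⟩
      rw [e1, e2, Set.image_insert_eq, Set.image_insert_eq, Submodule.span_insert,
        Submodule.span_insert, ih (by omega)]
    · have e2 : {y | y ∈ firstBasis H B ∧ y < x + 1} = {y | y ∈ firstBasis H B ∧ y < x} := by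
        ext y
        simp only [Set.mem_setOf_eq]
        refine and_congr_right fun h => ⟨fun h' => ?_, fun h' => by omega⟩
        by_contra h''
        have : y = x := by omega
        exact hxB (this ▸ h)
      rw [e1, e2, Set.image_insert_eq, ← ih (by omega)]
      apply Submodule.span_insert_eq_span
      by_contra hn
      exact hxB (by simp [firstBasis, hn]; omega)

theorem firstBasis_indep (x : ℕ) (hx : x ≤ H) :
    LinearIndepOn F (rowv H B) {y | y ∈ firstBasis H B ∧ y < x} := by
  induction x with
  | zero => simp
  | succ x ih =>
    have ih := ih (by omega)
    by_cases hxB : x ∈ firstBasis H B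
    · have e2 : {y | y ∈ firstBasis H B ∧ y < x + 1} = insert x {y | y ∈ firstBasis H B ∧ y < x} := by
        ext y
        simp only [Set.mem_setOf_eq, Set.mem_insert_iff]
        constructor
        · rintro ⟨h, h'⟩
          by_cases hyx : y = x
          · exact .inl hyx
          · exact .inr ⟨h, by omega⟩
        · rintro (rfl | ⟨h, h'⟩)
          · exact ⟨hxB, by omega⟩
          · exact ⟨h, by omega⟩
      rw [e2]
      refine ih.insert ?_
      rw [← firstBasis_span x (by omega)]
      simp only [firstBasis, mem_filter] at hxB
      exact hxB.2
    · refine ih.mono fun y hy => ⟨hy.1, ?_⟩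
      have := hy.2
      by_contra h''
      have : y = x := by omega
      exact hxB (this ▸ hy.1)

theorem firstBasis_rowBasis (H : ℕ) (B : NatMat F) : RowBasis H B (firstBasis H B) := by
  have hlt : ∀ x ∈ firstBasis H B, x < H := fun x hx => by simp [firstBasis] at hx; exact hx.1
  have e : {y | y ∈ firstBasis H B ∧ y < H} = (firstBasis H B : Set ℕ) := by
    ext y
    exact ⟨fun h => h.1, fun h => ⟨h, hlt y h⟩⟩
  refine ⟨hlt, ?_, fun x hx => ?_⟩
  · rw [← e]; exact firstBasis_indep H le_rfl
  · rw [← e, ← firstBasis_span H le_rfl]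
    exact Submodule.subset_span ⟨x, hx, rfl⟩

/-- If the pivots agree with the first row basis as far as random choices could make them, then
they are the first row basis. -/
theorem upperPart_eq_firstBasis
    (h : Elim (xent H B ρ) G K (Ico 0 (2 * H)))
    (hρ : ∀ x ∈ firstBasis H B, Nonsing (xent H B ρ)
      (lowerAnd H (insert x ((firstBasis H B).filter (· < x))))) :
    upperPart H K = firstBasis H B := by
  have hlt := (firstBasis_rowBasis H B).lt
  ext x
  induction x using Nat.strong_induction_on with
  | _ x ih =>
    by_cases hx : x < H
    · have e : (upperPart H K).filter (· < x) = (firstBasis H B).filter (· < x) := by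
        ext y
        simp only [mem_filter]
        exact ⟨fun h => ⟨(ih y h.2).1 h.1, h.2⟩, fun h => ⟨(ih y h.2).2 h.1, h.2⟩⟩
      rw [(elim_xent h).2 x hx, e]
      refine ⟨fun hn => ?_, hρ x⟩
      have hli := linearIndepOn_of_nonsing (fun y hy => by
        simp only [mem_insert, mem_filter] at hy
        rcases hy with rfl | hy <;> omega) hn
      have e' : ((insert x ((firstBasis H B).filter (· < x)) : Finset ℕ) : Set ℕ) =
          insert x {y | y ∈ firstBasis H B ∧ y < x} := by
        ext y; simp
      rw [e', linearIndepOn_insert (by simp), ← firstBasis_span x hx.le] at hli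
      simp [firstBasis, hx, hli.2]
    · have h1 : x ∉ upperPart H K := fun hm => hx (mem_upperPart.1 hm).1
      have h2 : x ∉ firstBasis H B := fun hm => hx (hlt x hm)
      simp [h1, h2]

/-- The configuration in which `I` is the current basis. -/
def stdCfg (B : NatMat F) (I : Finset ℕ) : Cfg F where
  B := B
  al x := if x ∈ I then 1 else 0
  be x := if x ∈ I then 0 else 1
  Q _ _ := 0

theorem stdCfg_nonsing {I : Finset ℕ} (hI : ∀ x ∈ I, x < H)
    (h : Nonsing (xent H B ρ) (lowerAnd H I)) :
    Nonsing ((stdCfg B I).ent H ρ) (range (4 * H)) := by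
  rw [Cfg.nonsing_iff]
  intro z hz
  simp only [stdCfg, zero_mul, sum_const_zero, sub_zero] at hz
  have hz0 : ∀ x < H, x ∉ I → z x = 0 := fun x hx hxI => by simpa [hxI] using hz x hx
  have key := (nonsing_xent_iff hI).1 h z fun x hx => by
    have := hz x (hI x hx)
    simp only [hx, if_true, one_mul, zero_mul, add_zero] at this
    rw [← this, brz]
    refine sum_congr rfl fun i _ => ?_
    congr 1
    refine sum_subset (fun y hy => mem_range.2 (hI y hy)) fun y hy hyI => ?_
    rw [hz0 y (mem_range.1 hy) hyI, mul_zero]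
  intro x hx
  by_cases hxI : x ∈ I
  · exact key x hxI
  · exact hz0 x hx hxI

theorem upperPart_nonsing
    (h : Elim (xent H B ρ) G K (Ico 0 (2 * H))) :
    Nonsing ((stdCfg B (upperPart H K)).ent H ρ) (range (4 * H)) := by
  refine stdCfg_nonsing (fun x hx => (mem_upperPart.1 hx).1) ?_
  rw [← (elim_xent h).1]
  exact h.nonsing

end GreedyBasis

end

section

section Probability

/-! ### Independence -/

theorem map_restrict_infinitePi {ι E : Type*} [MeasurableSpace E] (μ : Measure E)
    [IsProbabilityMeasure μ] {σ τ : ι → ι} (hστ : ∀ i, τ (σ i) = i) (S : Finset ι)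
    (hS : ∀ i, σ i ∉ S) (t : ι → Set E) (ht : ∀ i, MeasurableSet (t i))
    (h0 : ∏ i ∈ S, μ (t i) ≠ 0) :
    ((Measure.infinitePi fun _ : ι => μ).restrict (Set.pi S t)).map (fun x i => x (σ i)) =
      (∏ i ∈ S, μ (t i)) • Measure.infinitePi fun _ : ι => μ := by
  classical
  set c := ∏ i ∈ S, μ (t i) with hc
  have hct : c ≠ ∞ := by
    rw [hc]
    exact ENNReal.prod_ne_top fun i _ => measure_ne_top μ _
  have hmeas : Measurable fun (x : ι → E) i => x (σ i) :=
    measurable_pi_lambda _ fun i => measurable_pi_apply (σ i)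
  have key : c⁻¹ • ((Measure.infinitePi fun _ : ι => μ).restrict (Set.pi S t)).map
      (fun x i => x (σ i)) = Measure.infinitePi fun _ : ι => μ := by
    refine Measure.eq_infinitePi (μ := fun _ : ι => μ) fun s t' ht' => ?_
    have hms : MeasurableSet (Set.pi (s : Set ι) t') :=
      MeasurableSet.pi s.countable_toSet fun i _ => ht' i
    rw [Measure.smul_apply, Measure.map_apply hmeas hms, Measure.restrict_apply (hmeas hms)]
    have hset : (fun (x : ι → E) i => x (σ i)) ⁻¹' Set.pi (s : Set ι) t' ∩ Set.pi (S : Set ι) t =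
        Set.pi ((s.image σ ∪ S : Finset ι) : Set ι) fun i => if i ∈ S then t i else t' (τ i) := by
      ext x
      simp only [Set.mem_inter_iff, Set.mem_preimage, Set.mem_pi, mem_coe,
        mem_union, mem_image]
      constructor
      · rintro ⟨h₁, h₂⟩ i (⟨j, hj, rfl⟩ | hi)
        · rw [if_neg (hS j), hστ]; exact h₁ j hj
        · rw [if_pos hi]; exact h₂ i hi
      · intro h
        refine ⟨fun i hi => ?_, fun i hi => ?_⟩
        · have := h (σ i) (.inl ⟨i, hi, rfl⟩)
          rwa [if_neg (hS i), hστ] at this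
        · have := h i (.inr hi)
          rwa [if_pos hi] at this
    rw [hset, Measure.infinitePi_pi, prod_union, prod_image]
    · rw [prod_congr rfl fun i _ => by rw [if_neg (hS i), hστ],
        prod_congr (s₁ := S) rfl fun i hi => by rw [if_pos hi], ← hc, smul_eq_mul,
        mul_comm, mul_assoc, ENNReal.mul_inv_cancel h0 hct, mul_one]
    · intro i _ j _ h
      simpa [hστ] using congrArg τ h
    · rw [disjoint_left]
      intro i hi
      obtain ⟨j, -, rfl⟩ := mem_image.1 hi
      exact hS j
    · intro i _
      split_ifs
      · exact ht i
      · exact ht' _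
  conv_rhs => rw [← key, smul_smul, ENNReal.mul_inv_cancel h0 hct, one_smul]

variable {F : Type*} [Field F] [Fintype F]

theorem tapeProb_mono {E E' : Set (Tape F)} (h : E ⊆ E') : tapeProb E ≤ tapeProb E' := by
  unfold tapeProb
  exact measure_mono fun x hx => h hx

theorem tapeProb_union_le (E E' : Set (Tape F)) : tapeProb (E ∪ E') ≤ tapeProb E + tapeProb E' := by
  unfold tapeProb
  exact measure_union_le _ _

theorem tapeProb_biUnion_le {ι : Type*} (s : Finset ι) (E : ι → Set (Tape F)) :
    tapeProb {ω | ∃ i ∈ s, ω ∈ E i} ≤ ∑ i ∈ s, tapeProb (E i) := by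
  unfold tapeProb
  refine le_trans (measure_mono fun x hx => ?_) (measure_biUnion_finset_le s _)
  obtain ⟨i, hi, hx⟩ := hx
  exact Set.mem_biUnion hi hx

theorem tapeProb_univ : tapeProb (Set.univ : Set (Tape F)) = 1 := by
  let _ : MeasurableSpace F := ⊤
  unfold tapeProb
  exact measure_univ

/-- The first `V` random field elements of array `0`. -/
def Tape.front (V : ℕ) (ω : Tape F) : Fin V → F := fun k => ω.elt (0, k)

theorem tapeProb_front_guest {V K : ℕ} (hK : 1 ≤ K) (f : Fin V → F) (E : Set (Tape F)) :
    tapeProb {ω : Tape F | ω.front V = f ∧ ω.guest K ∈ E} ≤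
      ((Fintype.card F : ℝ≥0∞) ^ V)⁻¹ * tapeProb E := by
  classical
  let _ : MeasurableSpace F := ⊤
  let σ : ℕ × ℕ → ℕ × ℕ := fun i => (i.1 + K, i.2)
  let τ : ℕ × ℕ → ℕ × ℕ := fun i => (i.1 - K, i.2)
  have hστ : ∀ i, τ (σ i) = i := fun i => by simp [σ, τ]
  let S : Finset (ℕ × ℕ) := (univ : Finset (Fin V)).image fun k : Fin V => (0, (k : ℕ))
  have hS : ∀ i, σ i ∉ S := by
    intro i hi
    obtain ⟨k, -, hk⟩ := mem_image.1 hi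
    have := congrArg Prod.fst hk
    simp only [σ] at this
    omega
  let t : ℕ × ℕ → Set F := fun i => if h : i.2 < V then {f ⟨i.2, h⟩} else Set.univ
  set μF := (PMF.uniformOfFintype F).toMeasure with hμF
  set μB := (PMF.uniformOfFintype Bool).toMeasure with hμB
  have ht : ∀ i, MeasurableSet (t i) := fun i => by trivial
  have hprod : ∏ i ∈ S, μF (t i) = ((Fintype.card F : ℝ≥0∞) ^ V)⁻¹ := by
    rw [prod_image]
    · have : ∀ k : Fin V, μF (t (0, (k : ℕ))) = (Fintype.card F : ℝ≥0∞)⁻¹ := fun k => by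
        simp only [t, k.2, dif_pos]
        rw [hμF, PMF.toMeasure_apply_singleton _ _ (by trivial), PMF.uniformOfFintype_apply]
      simp only [this, prod_const, card_univ, Fintype.card_fin, ENNReal.inv_pow]
    · intro a _ b _ h
      exact Fin.ext (congrArg Prod.snd h)
  have h0 : ∏ i ∈ S, μF (t i) ≠ 0 := by
    rw [hprod, Ne, ENNReal.inv_eq_zero]
    exact ENNReal.pow_ne_top (ENNReal.natCast_ne_top _)
  have hE := map_restrict_infinitePi μF hστ S hS t ht h0
  have hB := map_restrict_infinitePi μB hστ ∅ (by simp) (fun _ => Set.univ) (by simp) (by simp)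
  simp only [coe_empty, Set.empty_pi, Measure.restrict_univ, prod_empty, one_smul] at hB
  set PB := Measure.infinitePi fun _ : ℕ × ℕ => μB with hPB
  set PF := Measure.infinitePi fun _ : ℕ × ℕ => μF with hPF
  let g : ((ℕ × ℕ → Bool) × (ℕ × ℕ → F)) → ((ℕ × ℕ → Bool) × (ℕ × ℕ → F)) :=
    Prod.map (fun x i => x (σ i)) (fun x i => x (σ i))
  have m1 : Measurable fun (x : ℕ × ℕ → Bool) i => x (σ i) :=
    measurable_pi_lambda _ fun i => measurable_pi_apply (σ i)
  have m2 : Measurable fun (x : ℕ × ℕ → F) i => x (σ i) :=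
    measurable_pi_lambda _ fun i => measurable_pi_apply (σ i)
  have hg : Measurable g := m1.prodMap m2
  have hC : MeasurableSet (Set.pi (S : Set (ℕ × ℕ)) t) :=
    MeasurableSet.pi S.countable_toSet fun i _ => ht i
  have hmap : ((PB.prod PF).restrict (Set.univ ×ˢ Set.pi (S : Set (ℕ × ℕ)) t)).map g =
      ((Fintype.card F : ℝ≥0∞) ^ V)⁻¹ • PB.prod PF := by
    rw [← Measure.prod_restrict, Measure.restrict_univ, ← Measure.map_prod_map _ _ m1 m2, hB, hE,
      hprod, Measure.prod_smul_right]
  set E' : Set ((ℕ × ℕ → Bool) × (ℕ × ℕ → F)) := {x | (⟨x.1, x.2⟩ : Tape F) ∈ E} with hE'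
  have goal : (PB.prod PF) {x | (⟨x.1, x.2⟩ : Tape F) ∈
      {ω : Tape F | ω.front V = f ∧ ω.guest K ∈ E}} ≤
      ((Fintype.card F : ℝ≥0∞) ^ V)⁻¹ * (PB.prod PF) E' := by
    rw [← measure_toMeasurable E', ← smul_eq_mul, ← Measure.smul_apply, ← hmap,
      Measure.map_apply hg (measurableSet_toMeasurable _ _),
      Measure.restrict_apply (hg (measurableSet_toMeasurable _ _))]
    refine measure_mono fun x hx => ⟨subset_toMeasurable _ _ hx.2, Set.mem_univ _, ?_⟩
    intro i hi
    obtain ⟨k, -, rfl⟩ := mem_image.1 hi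
    have := congrFun hx.1 k
    simpa [t, Tape.front] using this
  exact goal

theorem tapeProb_le_of_front {V K : ℕ} (hK : 1 ≤ K) (E : (Fin V → F) → Set (Tape F)) {ε : ℝ≥0∞}
    (h : ∀ f, tapeProb (E f) ≤ ε) : tapeProb {ω : Tape F | ω.guest K ∈ E (ω.front V)} ≤ ε := by
  classical
  refine (tapeProb_mono (E' := {ω | ∃ f ∈ (univ : Finset (Fin V → F)),
    ω ∈ {ω : Tape F | ω.front V = f ∧ ω.guest K ∈ E f}}) fun ω hω =>
      ⟨_, mem_univ _, rfl, hω⟩).trans ((tapeProb_biUnion_le _ _).trans ?_)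
  refine (sum_le_sum fun f _ => (tapeProb_front_guest hK f (E f)).trans
    (mul_le_mul_right (h f) _)).trans ?_
  rw [sum_const, card_univ, Fintype.card_fun, Fintype.card_fin, nsmul_eq_mul,
    ← mul_assoc, Nat.cast_pow, ENNReal.mul_inv_cancel, one_mul]
  · exact pow_ne_zero _ (by exact_mod_cast Fintype.card_ne_zero)
  · exact ENNReal.pow_ne_top (ENNReal.natCast_ne_top _)

theorem tapeProb_front_le {V : ℕ} (Φ : (Fin V → F) → Prop) [DecidablePred Φ] :
    tapeProb {ω : Tape F | Φ (ω.front V)} ≤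
      (univ.filter Φ).card * ((Fintype.card F : ℝ≥0∞) ^ V)⁻¹ := by
  classical
  refine (tapeProb_mono (E' := {ω | ∃ f ∈ univ.filter Φ,
    ω ∈ {ω : Tape F | ω.front V = f ∧ ω.guest 1 ∈ Set.univ}}) fun ω hω =>
      ⟨ω.front V, by simpa using hω, rfl, trivial⟩).trans ((tapeProb_biUnion_le _ _).trans ?_)
  refine (sum_le_sum fun f _ => (tapeProb_front_guest le_rfl f Set.univ)).trans ?_
  rw [tapeProb_univ, mul_one, sum_const, nsmul_eq_mul]

end Probability

/-! ### Random matrices -/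

section RandomMatrix

theorem nonsing_iff_det {B : NatMat F} {K : Finset ℕ} : Nonsing B K ↔ (blk B K K).det ≠ 0 := by
  rw [Ne, ← Matrix.exists_mulVec_eq_zero_iff, not_exists]
  constructor
  · rintro h v ⟨hv, hBv⟩
    refine hv (funext fun j => ?_)
    have := h (fun j => if h : j ∈ K then v ⟨j, h⟩ else 0) (fun i hi => ?_) j j.2
    · simpa using this
    · have := congrFun hBv ⟨i, hi⟩
      rw [← sum_coe_sort K]
      simpa [Matrix.mulVec, dotProduct, blk] using this
  · intro h z hz j hj
    by_contra hne
    refine h (fun j : K => z j) ⟨fun h0 => hne (congrFun h0 ⟨j, hj⟩), funext fun i => ?_⟩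
    have := hz i i.2
    rw [← sum_coe_sort K] at this
    simpa [Matrix.mulVec, dotProduct, blk] using this

theorem det_ne_zero_iff {m : ℕ} {M : Matrix (Fin m) (Fin m) F} {e : NatMat F}
    (h : ∀ i j : Fin m, M i j = e i j) : M.det ≠ 0 ↔ Nonsing e (range m) := by
  rw [Ne, ← Matrix.exists_mulVec_eq_zero_iff, not_exists]
  constructor
  · intro hM z hz j hj
    rw [mem_range] at hj
    by_contra hne
    refine hM (fun j : Fin m => z j) ⟨fun h0 => hne (congrFun h0 ⟨j, hj⟩), funext fun i => ?_⟩
    have := hz i (by simp)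
    rw [sum_range] at this
    simpa [Matrix.mulVec, dotProduct, h] using this
  · rintro hn v ⟨hv, hMv⟩
    refine hv (funext fun j => ?_)
    have := hn (fun j => if h : j < m then v ⟨j, h⟩ else 0) (fun i hi => ?_) j (by simp)
    · simpa using this
    · have := congrFun hMv ⟨i, mem_range.1 hi⟩
      rw [sum_range]
      simpa [Matrix.mulVec, dotProduct, h] using this

/-- Each entry is fixed, or one of the first `V` of the parameters. -/
def Sampled (V : ℕ) (N : (ℕ → F) → ℕ → ℕ → F) : Prop :=
  ∀ i j, (∃ c, ∀ ρ, N ρ i j = c) ∨ ∃ k < V, ∀ ρ, N ρ i j = ρ k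

theorem totalDegree_det_le {V : ℕ} {K : Type*} [Fintype K] [DecidableEq K]
    (M : Matrix K K (MvPolynomial (Fin V) F)) (h : ∀ i j, (M i j).totalDegree ≤ 1) :
    M.det.totalDegree ≤ Fintype.card K := by
  rw [Matrix.det_apply]
  refine (MvPolynomial.totalDegree_finsetSum _ _).trans (Finset.sup_le fun σ _ => ?_)
  have : (Equiv.Perm.sign σ • ∏ i, M (σ i) i).totalDegree ≤ (∏ i, M (σ i) i).totalDegree := by
    rcases Int.units_eq_one_or (Equiv.Perm.sign σ) with hs | hs <;> rw [hs] <;> simp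
  refine this.trans ((MvPolynomial.totalDegree_finsetProd _ _).trans ?_)
  refine (sum_le_sum fun i _ => h (σ i) i).trans ?_
  simp

theorem nat_mul_le_of_div_le {a d q V : ℕ} (hq : 0 < q)
    (h : (a : ℚ≥0) / (q : ℚ≥0) ^ V ≤ (d : ℚ≥0) / q) : a * q ≤ d * q ^ V := by
  rw [div_le_div_iff₀ (by positivity) (by positivity)] at h
  exact_mod_cast h

theorem card_roots_mul_card_le [Fintype F] {V : ℕ} {p : MvPolynomial (Fin V) F} (hp : p ≠ 0)
    [DecidablePred fun f : Fin V → F => MvPolynomial.eval f p = 0] :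
    (univ.filter fun f : Fin V → F => MvPolynomial.eval f p = 0).card * Fintype.card F ≤
      p.totalDegree * Fintype.card F ^ V := by
  classical
  have hsz := MvPolynomial.schwartz_zippel_totalDegree hp (univ : Finset F)
  have e : (univ.filter fun f : Fin V → F => MvPolynomial.eval f p = 0) =
      (Fintype.piFinset fun _ : Fin V => (univ : Finset F)).filter
        fun f => MvPolynomial.eval f p = 0 := by
    ext f
    simp
  rw [e]
  refine nat_mul_le_of_div_le Fintype.card_pos (le_trans (le_of_eq ?_)
    (hsz.trans (le_of_eq ?_)))
  · rw [card_univ]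
    congr!
  · rw [card_univ]

/-- The Schwartz–Zippel bound for a matrix with random entries. -/
theorem tapeProb_singular_le [Fintype F] {V : ℕ} {N : (ℕ → F) → ℕ → ℕ → F} (hN : Sampled V N)
    {K : Finset ℕ} (h : ∃ ρ, Nonsing (N ρ) K) :
    tapeProb {ω : Tape F | ¬ Nonsing (N fun k => ω.elt (0, k)) K} ≤
      K.card / (Fintype.card F : ℝ≥0∞) := by
  classical
  have hP : ∀ i j, ∃ P : MvPolynomial (Fin V) F, P.totalDegree ≤ 1 ∧
      ∀ ρ : ℕ → F, MvPolynomial.eval (fun k : Fin V => ρ k) P = N ρ i j := by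
    intro i j
    rcases hN i j with ⟨c, hc⟩ | ⟨k, hk, hc⟩
    · exact ⟨.C c, by simp, fun ρ => by simp [hc]⟩
    · exact ⟨.X ⟨k, hk⟩, by simp, fun ρ => by simp [hc]⟩
  choose P hP₁ hP₂ using hP
  set p := (Matrix.of fun i j : K => P i j).det with hp
  have hev : ∀ ρ : ℕ → F, MvPolynomial.eval (fun k : Fin V => ρ k) p = (blk (N ρ) K K).det := by
    intro ρ
    rw [hp, RingHom.map_det]
    congr 1
    ext i j
    simp [blk, hP₂]
  have hp0 : p ≠ 0 := by
    rintro h0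
    obtain ⟨ρ, hρ⟩ := h
    rw [nonsing_iff_det, ← hev, h0] at hρ
    simp at hρ
  have hdeg : p.totalDegree ≤ K.card := by
    have := totalDegree_det_le (Matrix.of fun i j : K => P i j) fun i j => hP₁ i j
    simpa using this
  clear_value p
  have hcF : 0 < Fintype.card F := Fintype.card_pos
  have hcount : ∀ A : ℕ, A * Fintype.card F ≤ p.totalDegree * Fintype.card F ^ V →
      (A : ℝ≥0∞) * ((Fintype.card F : ℝ≥0∞) ^ V)⁻¹ ≤ K.card / (Fintype.card F : ℝ≥0∞) := by
    intro A hA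
    have hA' := hA.trans (Nat.mul_le_mul_right _ hdeg)
    generalize Fintype.card F = q at *
    generalize K.card = d at *
    rw [ENNReal.le_div_iff_mul_le (.inl (by exact_mod_cast hcF.ne'))
      (.inl (ENNReal.natCast_ne_top _)), mul_right_comm, ← div_eq_mul_inv]
    refine ENNReal.div_le_of_le_mul ?_
    exact_mod_cast hA'
  refine (tapeProb_mono (E' := {ω | MvPolynomial.eval (ω.front V) p = 0}) fun ω hω => ?_).trans
    ((tapeProb_front_le fun f => MvPolynomial.eval f p = 0).trans
      (hcount _ (card_roots_mul_card_le hp0)))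
  have hω' : ¬ Nonsing (N fun k => ω.elt (0, k)) K := hω
  rw [nonsing_iff_det, not_not, ← hev] at hω'
  exact hω'

theorem Cfg.sampled (c : Cfg F) {H : ℕ} (hH : 0 < H) :
    Sampled (4 * H * (4 * H)) (fun ρ i j => if i < 4 * H ∧ j < 4 * H then c.ent H ρ i j else 0) := by
  intro i j
  by_cases hij : i < 4 * H ∧ j < 4 * H
  · simp only [hij, and_self, if_true]
    have hi : i / H < 4 := by rw [Nat.div_lt_iff_lt_mul hH]; exact hij.1
    have hj : j / H < 4 := by rw [Nat.div_lt_iff_lt_mul hH]; exact hij.2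
    have hxi := Nat.mod_lt i hH
    have hxj := Nat.mod_lt j hH
    unfold Cfg.ent Cfg.blk
    generalize i / H = a at *
    generalize j / H = b at *
    generalize i % H = x at *
    generalize j % H = y at *
    interval_cases a <;> interval_cases b <;> simp only [] <;>
      first
      | exact .inl ⟨_, fun _ => rfl⟩
      | skip
    · refine .inr ⟨_, ?_, fun _ => rfl⟩
      nlinarith
    · by_cases hyx : y ≤ x
      · refine .inr ⟨_, ?_, fun _ => by rw [randL, if_pos hyx]⟩
        nlinarith
      · exact .inl ⟨0, fun _ => by rw [randL, if_neg hyx]⟩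
  · exact .inl ⟨0, fun ρ => if_neg hij⟩

theorem xent_sampled (B : NatMat F) {H : ℕ} (hH : 0 < H) :
    Sampled (4 * H * (4 * H)) (fun ρ i j => xent H B ρ i j) := by
  intro i j
  have hxi := Nat.mod_lt i hH
  have hxj := Nat.mod_lt j hH
  simp only [xent]
  generalize i % H = x at *
  generalize j % H = y at *
  split
  · exact .inl ⟨_, fun _ => rfl⟩
  · refine .inr ⟨_, ?_, fun _ => rfl⟩
    nlinarith
  · exact .inl ⟨_, fun _ => rfl⟩
  · exact .inl ⟨_, fun _ => rfl⟩

end RandomMatrix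

end

section

section Queries

/-! ### Computations with queries -/

/-- A computation that asks yes-no questions. -/
inductive Comp (Q α : Type*)
  | ret (a : α)
  | ask (q : Q) (k : Bool → Comp Q α)

namespace Comp

variable {Q α β : Type*}

/-- The result when the questions are answered by `T`. -/
def run (T : Q → Bool) : Comp Q α → α
  | ret a => a
  | ask q k => (k (T q)).run T

/-- The questions that are asked when `T` answers. -/
def trace (T : Q → Bool) : Comp Q α → List Q
  | ret _ => []
  | ask q k => q :: (k (T q)).trace T

def bind (c : Comp Q α) (f : α → Comp Q β) : Comp Q β :=
  match c with
  | ret a => f a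
  | ask q k => ask q fun b => (k b).bind f

@[simp] theorem run_ret (T : Q → Bool) (a : α) : (ret a : Comp Q α).run T = a := rfl

@[simp] theorem run_ask (T : Q → Bool) (q : Q) (k : Bool → Comp Q α) :
    (ask q k).run T = (k (T q)).run T := rfl

@[simp] theorem run_bind (T : Q → Bool) (c : Comp Q α) (f : α → Comp Q β) :
    (c.bind f).run T = (f (c.run T)).run T := by
  induction c with
  | ret a => rfl
  | ask q k ih => exact ih _

@[simp] theorem trace_ret (T : Q → Bool) (a : α) : (ret a : Comp Q α).trace T = [] := rfl

@[simp] theorem trace_ask (T : Q → Bool) (q : Q) (k : Bool → Comp Q α) :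
    (ask q k).trace T = q :: (k (T q)).trace T := rfl

@[simp] theorem trace_bind (T : Q → Bool) (c : Comp Q α) (f : α → Comp Q β) :
    (c.bind f).trace T = c.trace T ++ (f (c.run T)).trace T := by
  induction c with
  | ret a => rfl
  | ask q k ih => simp only [bind, trace_ask, run_ask, List.cons_append, ih]

theorem run_congr {T T' : Q → Bool} {c : Comp Q α} (h : ∀ q ∈ c.trace T, T' q = T q) :
    c.run T' = c.run T := by
  induction c with
  | ret a => rfl
  | ask q k ih =>
    rw [run_ask, run_ask, h q (by simp)]
    exact ih _ fun q' hq' => h q' (by simp [hq'])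

end Comp

/-- Binary search for the least `k` that passes the test. -/
def search {Q : Type*} (test : ℕ → Comp Q Bool) : ℕ → ℕ → ℕ → Comp Q ℕ
  | 0, lo, _ => .ret lo
  | L + 1, lo, hi => if lo < hi then
      (test ((lo + hi) / 2)).bind fun b =>
        if b then search test L lo ((lo + hi) / 2) else search test L ((lo + hi) / 2 + 1) hi
    else .ret lo

theorem search_spec {Q : Type*} {test : ℕ → Comp Q Bool} {T : Q → Bool} {P : ℕ → Prop} {n : ℕ}
    (hP : ∀ j k, j ≤ k → k < n → P j → P k) (ht : ∀ k < n, (test k).run T = true ↔ P k) (L : ℕ) :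
    ∀ lo hi, lo ≤ hi → hi ≤ n → hi - lo < 2 ^ L → (∀ j < lo, ¬ P j) → (hi < n → P hi) →
      (search test L lo hi).run T ≤ n ∧ (∀ j < (search test L lo hi).run T, ¬ P j) ∧
      ((search test L lo hi).run T < n → P ((search test L lo hi).run T)) := by
  induction L with
  | zero =>
    intro lo hi h1 h2 h3 h4 h5
    have : lo = hi := by omega
    subst this
    exact ⟨h2, h4, h5⟩
  | succ L ih =>
    intro lo hi h1 h2 h3 h4 h5
    rw [search]
    by_cases h : lo < hi
    · have hm : (lo + hi) / 2 < n := by omega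
      rw [if_pos h, Comp.run_bind]
      rw [pow_succ] at h3
      by_cases hb : (test ((lo + hi) / 2)).run T = true
      · rw [if_pos hb]
        exact ih _ _ (by omega) (by omega) (by omega) h4 fun _ => (ht _ hm).1 hb
      · rw [if_neg hb]
        refine ih _ _ (by omega) h2 (by omega) (fun j hj hPj => ?_) h5
        exact hb ((ht _ hm).2 (hP j _ (by omega) hm hPj))
    · have : lo = hi := by omega
      subst this
      rw [if_neg h]
      exact ⟨h2, h4, h5⟩

theorem search_trace {Q : Type*} {test : ℕ → Comp Q Bool} {T : Q → Bool} {p : Q → Prop}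
    (h1 : ∀ k, ((test k).trace T).length ≤ 1) (hp : ∀ k, ∀ q ∈ (test k).trace T, p q) (L : ℕ) :
    ∀ lo hi, ((search test L lo hi).trace T).length ≤ L ∧
      ∀ q ∈ (search test L lo hi).trace T, p q := by
  induction L with
  | zero => intro lo hi; simp [search]
  | succ L ih =>
    intro lo hi
    rw [search]
    split_ifs
    · have a1 := h1 ((lo + hi) / 2)
      have a2 := hp ((lo + hi) / 2)
      simp only [Comp.trace_bind, List.length_append, List.mem_append]
      split_ifs
      · have b := ih lo ((lo + hi) / 2)
        exact ⟨by omega, fun q hq => hq.elim (a2 q) (b.2 q)⟩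
      · have b := ih ((lo + hi) / 2 + 1) hi
        exact ⟨by omega, fun q hq => hq.elim (a2 q) (b.2 q)⟩
    · simp

/-! ### Lists with positions -/

/-- A list without repetitions of numbers, with the positions of its elements (plus `1`). -/
structure Lst where
  cnt : ℕ
  lst : ℕ → ℕ
  pos : ℕ → ℕ

namespace Lst

def empty : Lst := ⟨0, fun _ => 0, fun _ => 0⟩

def insert (l : Lst) (k : ℕ) : Lst where
  cnt := l.cnt + 1
  lst := update l.lst l.cnt k
  pos := update l.pos k (l.cnt + 1)

/-- Remove an element; the last element of the list takes its place. -/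
def remove (l : Lst) (x : ℕ) : Lst where
  cnt := l.cnt - 1
  lst := update l.lst (l.pos x - 1) (l.lst (l.cnt - 1))
  pos := update (update l.pos (l.lst (l.cnt - 1)) (l.pos x)) x 0

structure Ok (n : ℕ) (l : Lst) : Prop where
  lst : ∀ k < l.cnt, l.lst k < n ∧ l.pos (l.lst k) = k + 1
  pos : ∀ x < n, l.pos x ≠ 0 → l.pos x ≤ l.cnt ∧ l.lst (l.pos x - 1) = x

theorem empty_ok (n : ℕ) : empty.Ok n := ⟨fun k hk => by simp [empty] at hk, fun x _ h => by
  simp [empty] at h⟩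

theorem Ok.inj {n : ℕ} {l : Lst} (h : l.Ok n) {j k : ℕ} (hj : j < l.cnt) (hk : k < l.cnt)
    (he : l.lst j = l.lst k) : j = k := by
  have h1 := (h.lst j hj).2
  have h2 := (h.lst k hk).2
  rw [he] at h1
  omega

theorem Ok.cnt_le {n : ℕ} {l : Lst} (h : l.Ok n) : l.cnt ≤ n := by
  have := card_le_card_of_injOn (s := range l.cnt) (t := range n) l.lst
    (fun k hk => by simpa using (h.lst k (by simpa using hk)).1)
    (fun j hj k hk he => h.inj (by simpa using hj) (by simpa using hk) he)
  simpa using this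

theorem Ok.insert {n : ℕ} {l : Lst} (h : l.Ok n) {k : ℕ} (hk : k < n) (hp : l.pos k = 0) :
    (l.insert k).Ok n := by
  refine ⟨fun j hj => ?_, fun x hx hne => ?_⟩
  · simp only [Lst.insert, update_apply] at hj ⊢
    by_cases hjc : j = l.cnt
    · simp [hjc, hk]
    · have := h.lst j (by omega)
      have hne : l.lst j ≠ k := fun he => by rw [he, hp] at this; omega
      simp [hjc, hne, this]
  · simp only [Lst.insert, update_apply] at hne ⊢
    by_cases hxk : x = k
    · simp [hxk]
    · simp only [hxk, if_false] at hne ⊢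
      have := h.pos x hx hne
      rw [if_neg (by omega)]
      exact ⟨by omega, this.2⟩

theorem insert_pos {l : Lst} {k x : ℕ} : (l.insert k).pos x ≠ 0 ↔ x = k ∨ l.pos x ≠ 0 := by
  simp only [Lst.insert, update_apply]
  by_cases h : x = k <;> simp [h]

theorem Ok.remove {n : ℕ} {l : Lst} (h : l.Ok n) {x : ℕ} (hx : x < n) (hp : l.pos x ≠ 0) :
    (l.remove x).Ok n ∧ ∀ y < n, ((l.remove x).pos y ≠ 0 ↔ y ≠ x ∧ l.pos y ≠ 0) := by
  obtain ⟨hx1, hx2⟩ := h.pos x hx hp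
  have hlast := h.lst (l.cnt - 1) (by omega)
  constructor
  · refine ⟨fun j hj => ?_, fun y hy hne => ?_⟩
    · simp only [Lst.remove, update_apply] at hj ⊢
      by_cases hjp : j = l.pos x - 1
      · have hne : l.lst (l.cnt - 1) ≠ x := fun he => by rw [he] at hlast; omega
        simp only [hjp, if_true, hne, if_false]
        exact ⟨hlast.1, by omega⟩
      · have hj' := h.lst j (by omega)
        have h1 : l.lst j ≠ x := fun he => by rw [he] at hj'; omega
        have h2 : l.lst j ≠ l.lst (l.cnt - 1) := fun he => by
          have := h.inj (by omega) (by omega) he; omega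
        simp [hjp, h1, h2, hj']
    · simp only [Lst.remove, update_apply] at hne ⊢
      by_cases hyx : y = x
      · simp [hyx] at hne
      · simp only [hyx, if_false] at hne ⊢
        by_cases hyl : y = l.lst (l.cnt - 1)
        · simp only [hyl, if_true] at hne ⊢
          refine ⟨?_, trivial⟩
          by_contra hc
          have : l.pos x - 1 = l.cnt - 1 := by omega
          rw [this] at hx2
          exact hyx (hyl.trans hx2)
        · simp only [hyl, if_false] at hne ⊢
          have := h.pos y hy hne
          have h3 : l.pos y ≠ l.cnt := fun he => by
            rw [he] at this; exact hyl this.2.symm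
          rw [if_neg]
          · exact ⟨by omega, this.2⟩
          · intro he
            rw [he, hx2] at this
            exact hyx this.2.symm
  · intro y hy
    simp only [Lst.remove, update_apply]
    by_cases hyx : y = x
    · simp [hyx]
    · simp only [hyx, if_false, ne_eq, not_false_eq_true, true_and]
      by_cases hyl : y = l.lst (l.cnt - 1)
      · rw [if_pos hyl]
        rw [← hyl] at hlast
        constructor <;> intro <;> omega
      · rw [if_neg hyl]

end Lst

/-! ### The algorithm, as a computation with queries -/

/-- An update of the guest's matrix. -/
structure GuestUpdate (F : Type*) where
  row : ℕ
  col : ℕ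
  val : F

abbrev Updates (F : Type*) := List (GuestUpdate F)

/-- The updates given to the guest, the most recent one first, and two lists. -/
structure Book (F : Type*) where
  us : Updates F
  ls : ℕ → Lst

variable {d : Book F} {n ℓ h H : ℕ} {T : Updates F → Bool}

def setB (x y : ℕ) (v : F) : GuestUpdate F := ⟨x, y, v⟩
def setAl (H x : ℕ) (v : F) : GuestUpdate F := ⟨2 * H + x, H + x, v⟩
def setBe (H x : ℕ) (v : F) : GuestUpdate F := ⟨2 * H + x, 2 * H + x, v⟩
def setQ (H x k : ℕ) (v : F) : GuestUpdate F := ⟨2 * H + x, 3 * H + k, v⟩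

/-- Update the guest's matrix, unless the guest then reports a singular matrix. -/
def commit (u : GuestUpdate F) (d : Book F) : Comp (Updates F) (Book F) :=
  .ask (u :: d.us) fun b => .ret (if b then { d with us := u :: d.us } else d)

/-- Is one of the first rows, up to row `k`, not in the span of the basis? -/
def testRow (H n : ℕ) (d : Book F) (k : ℕ) : Comp (Updates F) Bool :=
  .ask (setBe H (2 * n) 0 :: setQ H (2 * n) k 1 :: d.us) .ret

def Book.insert (d : Book F) (h k : ℕ) : Book F :=
  { d with ls := update d.ls h ((d.ls h).insert k) }

def Book.remove (d : Book F) (h x : ℕ) : Book F :=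
  { d with ls := update d.ls h ((d.ls h).remove x) }

/-- Add one element to list `h`, if possible. -/
def augment (H n h : ℕ) (d : Book F) : Comp (Updates F) (Book F) :=
  (search (fun k => testRow H n d (h * n + k)) n.size 0 n).bind fun k =>
    if k < n ∧ (d.ls h).pos k = 0 then
      (commit (setAl H (h * n + k) 1) d).bind fun d =>
        (commit (setBe H (h * n + k) 0) d).bind fun d => .ret (d.insert h k)
    else .ret d

def release (H n h x : ℕ) (d : Book F) : Comp (Updates F) (Book F) :=
  if (d.ls h).pos x ≠ 0 then
    (commit (setBe H (h * n + x) 1) d).bind fun d =>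
      (commit (setAl H (h * n + x) 0) d).bind fun d => .ret (d.remove h x)
  else .ret d

/-- Change entry `(x, y)` of block `h`. -/
def halfStep (H n h x y : ℕ) (v : F) (d : Book F) : Comp (Updates F) (Book F) :=
  (release H n h x d).bind fun d =>
    (commit (setB (h * n + x) (h * n + y) v) d).bind fun d =>
      (augment H n h d).bind fun d => augment H n h d

def fullStep (H n i j : ℕ) (v : F) (d : Book F) : Comp (Updates F) (Book F) :=
  .ask d.us fun b => if b then
    (halfStep H n 0 i j v d).bind fun d => halfStep H n 1 j i v d else .ret d

/-! #### Bounds -/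

/-- `d'` comes from `d` by at most `a` guest updates, and the lists are in order. -/
structure Book.Next (n a : ℕ) (d d' : Book F) : Prop where
  len : d'.us.length ≤ d.us.length + a
  ok : (∀ h, (d.ls h).Ok n) → ∀ h, (d'.ls h).Ok n

theorem Book.Next.trans {a b : ℕ} {d' d'' : Book F} (h : Book.Next n a d d')
    (h' : Book.Next n b d' d'') : Book.Next n (a + b) d d'' :=
  ⟨by have := h.len; have := h'.len; omega, fun o => h'.ok (h.ok o)⟩

theorem Book.Next.rfl {a : ℕ} : Book.Next n a d d := ⟨by omega, fun o => o⟩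

/-- The computation asks at most `b` queries, of lengths at most `ℓ`. -/
def Asks {α : Type*} (T : Updates F → Bool) (c : Comp (Updates F) α)
    (b ℓ : ℕ) : Prop :=
  (c.trace T).length ≤ b ∧ ∀ q ∈ c.trace T, q.length ≤ ℓ

theorem Asks.bind {α β : Type*} {c : Comp (Updates F) α} {f : α → Comp (Updates F) β} {b b' : ℕ}
    (h : Asks T c b ℓ) (h' : Asks T (f (c.run T)) b' ℓ) : Asks T (c.bind f) (b + b') ℓ := by
  constructor
  · rw [Comp.trace_bind, List.length_append]; have := h.1; have := h'.1; omega
  · intro q hq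
    rw [Comp.trace_bind, List.mem_append] at hq
    exact hq.elim (h.2 q) (h'.2 q)

theorem Asks.ret {α : Type*} {a : α} {b : ℕ} :
    Asks T (.ret a : Comp (Updates F) α) b ℓ := by
  simp [Asks]

theorem commit_bound {u : GuestUpdate F}
    (hℓ : d.us.length + 1 ≤ ℓ) :
    Asks T (commit u d) 1 ℓ ∧ Book.Next n 1 d ((commit u d).run T) := by
  refine ⟨by simpa [Asks, commit] using hℓ, ?_⟩
  simp only [commit, Comp.run_ask, Comp.run_ret]
  split_ifs
  · exact ⟨by simp, fun o => o⟩
  · exact .rfl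

theorem Book.insert_ok {k : ℕ} (hk : k < n) (hp : (d.ls h).pos k = 0)
    (o : ∀ h, (d.ls h).Ok n) (h' : ℕ) : ((d.insert h k).ls h').Ok n := by
  simp only [Book.insert, update_apply]
  split_ifs with e
  · exact (o h).insert hk hp
  · exact o h'

theorem Book.remove_ok {x : ℕ} (hx : x < n) (hp : (d.ls h).pos x ≠ 0)
    (o : ∀ h, (d.ls h).Ok n) (h' : ℕ) : ((d.remove h x).ls h').Ok n := by
  simp only [Book.remove, update_apply]
  split_ifs with e
  · exact ((o h).remove hx hp).1
  · exact o h'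

theorem commit_ls {u : GuestUpdate F} :
    ((commit u d).run T).ls = d.ls := by
  simp only [commit, Comp.run_ask, Comp.run_ret]
  split_ifs <;> rfl

theorem augment_bound
    (hℓ : d.us.length + 2 ≤ ℓ) :
    Asks T (augment H n h d) (n.size + 2) ℓ ∧ Book.Next n 2 d ((augment H n h d).run T) := by
  have hs : ∀ lo hi, Asks T (search (fun k => testRow H n d (h * n + k)) n.size lo hi) n.size ℓ :=
    fun lo hi => search_trace (T := T) (test := fun k => testRow H n d (h * n + k))
      (p := fun q : Updates F => q.length ≤ ℓ) (fun k => by simp [testRow])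
      (fun k q hq => by simp [testRow] at hq; subst hq; simp; omega) _ lo hi
  rw [augment]
  set k := (search (fun k => testRow H n d (h * n + k)) n.size 0 n).run T with hk
  by_cases hc : k < n ∧ (d.ls h).pos k = 0
  · set d₁ := (commit (setAl H (h * n + k) 1) d).run T with hd₁
    set d₂ := (commit (setBe H (h * n + k) 0) d₁).run T with hd₂
    have b₁ := commit_bound (T := T) (n := n) (ℓ := ℓ) (u := setAl H (h * n + k) 1) (d := d)
      (by omega)
    have l₁ := b₁.2.len
    rw [← hd₁] at l₁
    have b₂ := commit_bound (T := T) (n := n) (ℓ := ℓ) (u := setBe H (h * n + k) 0) (d := d₁)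
      (by omega)
    constructor
    · refine (hs 0 n).bind ?_
      rw [if_pos hc]
      exact b₁.1.bind (b' := 1) (b₂.1.bind (b' := 0) .ret)
    · rw [Comp.run_bind, ← hk, if_pos hc, Comp.run_bind, Comp.run_bind, Comp.run_ret, ← hd₁, ← hd₂]
      refine ⟨(b₁.2.trans b₂.2).len, fun o => ?_⟩
      refine Book.insert_ok hc.1 ?_ ((b₁.2.trans b₂.2).ok o)
      rw [hd₂, commit_ls, hd₁, commit_ls]
      exact hc.2
  · constructor
    · refine (hs 0 n).bind ?_
      rw [if_neg hc]
      exact .ret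
    · rw [Comp.run_bind, ← hk, if_neg hc]
      exact .rfl

theorem release_bound {x : ℕ} (hx : x < n)
    (hℓ : d.us.length + 2 ≤ ℓ) :
    Asks T (release H n h x d) 2 ℓ ∧ Book.Next n 2 d ((release H n h x d).run T) := by
  rw [release]
  by_cases hc : (d.ls h).pos x ≠ 0
  · set d₁ := (commit (setBe H (h * n + x) 1) d).run T with hd₁
    set d₂ := (commit (setAl H (h * n + x) 0) d₁).run T with hd₂
    have b₁ := commit_bound (T := T) (n := n) (ℓ := ℓ) (u := setBe H (h * n + x) 1) (d := d)
      (by omega)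
    have l₁ := b₁.2.len
    rw [← hd₁] at l₁
    have b₂ := commit_bound (T := T) (n := n) (ℓ := ℓ) (u := setAl H (h * n + x) 0) (d := d₁)
      (by omega)
    rw [if_pos hc]
    constructor
    · exact b₁.1.bind (b' := 1) (b₂.1.bind (b' := 0) .ret)
    · rw [Comp.run_bind, Comp.run_bind, Comp.run_ret, ← hd₁, ← hd₂]
      refine ⟨(b₁.2.trans b₂.2).len, fun o => ?_⟩
      refine Book.remove_ok hx ?_ ((b₁.2.trans b₂.2).ok o)
      rw [hd₂, commit_ls, hd₁, commit_ls]
      exact hc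
  · rw [if_neg hc]
    exact ⟨.ret, .rfl⟩

theorem halfStep_bound {x y : ℕ} {v : F}
    (hx : x < n) (hℓ : d.us.length + 7 ≤ ℓ) :
    Asks T (halfStep H n h x y v d) (2 * n.size + 7) ℓ ∧
      Book.Next n 7 d ((halfStep H n h x y v d).run T) := by
  have b₁ := release_bound (T := T) (H := H) (h := h) (ℓ := ℓ) (d := d) hx (by omega)
  set d₁ := (release H n h x d).run T with hd₁
  have l₁ := b₁.2.len
  have b₂ := commit_bound (T := T) (n := n) (ℓ := ℓ) (u := setB (h * n + x) (h * n + y) v) (d := d₁)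
    (by omega)
  set d₂ := (commit (setB (h * n + x) (h * n + y) v) d₁).run T with hd₂
  have l₂ := b₂.2.len
  have b₃ := augment_bound (T := T) (H := H) (n := n) (h := h) (ℓ := ℓ) (d := d₂) (by omega)
  set d₃ := (augment H n h d₂).run T with hd₃
  have l₃ := b₃.2.len
  have b₄ := augment_bound (T := T) (H := H) (n := n) (h := h) (ℓ := ℓ) (d := d₃) (by omega)
  constructor
  · have := b₁.1.bind (f := fun d => (commit (setB (h * n + x) (h * n + y) v) d).bind fun d =>
      (augment H n h d).bind fun d => augment H n h d) (b₂.1.bind (b₃.1.bind b₄.1))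
    exact ⟨by have := this.1; rw [halfStep]; omega, this.2⟩
  · have := ((b₁.2.trans b₂.2).trans b₃.2).trans b₄.2
    rw [halfStep, Comp.run_bind, Comp.run_bind, Comp.run_bind]
    exact ⟨by have := this.len; omega, this.ok⟩

theorem fullStep_bound {i j : ℕ} {v : F}
    (hi : i < n) (hj : j < n) (hℓ : d.us.length + 14 ≤ ℓ) :
    Asks T (fullStep H n i j v d) (4 * n.size + 15) ℓ ∧
      Book.Next n 14 d ((fullStep H n i j v d).run T) := by
  have b₁ := halfStep_bound (T := T) (H := H) (h := 0) (y := j) (v := v) (ℓ := ℓ) (d := d) hi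
    (by omega)
  set d₁ := (halfStep H n 0 i j v d).run T with hd₁
  have l₁ := b₁.2.len
  have b₂ := halfStep_bound (T := T) (H := H) (h := 1) (y := i) (v := v) (ℓ := ℓ) (d := d₁) hj
    (by omega)
  have b := b₁.1.bind (f := fun d => halfStep H n 1 j i v d) b₂.1
  rw [fullStep]
  by_cases hT : T d.us = true
  · constructor
    · refine ⟨?_, fun q hq => ?_⟩
      · rw [Comp.trace_ask, if_pos hT, List.length_cons]; have := b.1; omega
      · rw [Comp.trace_ask, if_pos hT, List.mem_cons] at hq
        rcases hq with rfl | hq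
        · omega
        · exact b.2 q hq
    · rw [Comp.run_ask, if_pos hT, Comp.run_bind]
      exact b₁.2.trans b₂.2
  · constructor
    · refine ⟨?_, fun q hq => ?_⟩
      · rw [Comp.trace_ask, if_neg hT]; simp
      · rw [Comp.trace_ask, if_neg hT] at hq
        simp at hq
        subst hq
        omega
    · rw [Comp.run_ask, if_neg hT]
      exact .rfl

end Queries

end

section

section IdealRun

variable {H x n y h : ℕ} {c₀ c : Cfg F} {v : F} {us : Updates F} {B : NatMat F}
  {d : Book F} {I : Finset ℕ}

/-! ### Updates of the bordered matrix -/

/-- The update of an `m × m` matrix; indices are reduced modulo `m`. -/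
def GuestUpdate.apply (m : ℕ) (u : GuestUpdate F) (e : NatMat F) (i j : ℕ) : F :=
  if i = u.row % m ∧ j = u.col % m then u.val else e i j

def applyGuest (m : ℕ) (e : NatMat F) (us : Updates F) : NatMat F :=
  us.foldr (GuestUpdate.apply m) e

@[simp] theorem applyGuest_cons (m : ℕ) (e : NatMat F) (u : GuestUpdate F) (us : Updates F) :
    applyGuest m e (u :: us) = u.apply m (applyGuest m e us) := rfl

/-- After the updates, the bordered matrix is that of the configuration `c`. -/
def Reps (H : ℕ) (c₀ c : Cfg F) (us : Updates F) : Prop :=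
  ∀ ρ, ∀ i < 4 * H, ∀ j < 4 * H, applyGuest (4 * H) (c₀.ent H ρ) us i j = c.ent H ρ i j

theorem Reps.ideal (h : Reps H c₀ c us) :
    (∃ ρ, Nonsing (applyGuest (4 * H) (c₀.ent H ρ) us) (range (4 * H))) ↔ c.Ideal H :=
  exists_congr fun ρ => Nonsing.congr fun i hi j hj =>
    h ρ i (mem_range.1 hi) j (mem_range.1 hj)

theorem block_inj {a a' x' : ℕ} (hx : x < H) (hx' : x' < H) :
    a' * H + x' = a * H + x ↔ a' = a ∧ x' = x := by
  constructor
  · intro h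
    obtain ⟨h₁, h₂⟩ := flat_inj hx' hx h
    exact ⟨h₁, h₂⟩
  · rintro ⟨rfl, rfl⟩; rfl

/-- Replace one entry. -/
def setEntry (B : NatMat F) (x y : ℕ) (v : F) (i j : ℕ) : F := if i = x ∧ j = y then v else B i j

theorem Reps.cons {a b : ℕ} {c' : Cfg F}
    (h : Reps H c₀ c us) (ha : a < 4) (hb : b < 4) (hx : x < H) (hy : y < H)
    (hc : ∀ ρ, ∀ a' < 4, ∀ b' < 4, ∀ x' y', c'.blk H ρ a' b' x' y' =
      if (a' = a ∧ x' = x) ∧ (b' = b ∧ y' = y) then v else c.blk H ρ a' b' x' y') :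
    Reps H c₀ c' (⟨a * H + x, b * H + y, v⟩ :: us) := by
  intro ρ
  refine forall_lt_four fun a' ha' x' hx' => forall_lt_four fun b' hb' y' hy' => ?_
  rw [applyGuest_cons, GuestUpdate.apply, c'.ent_block ρ hx' hy', hc ρ a' ha' b' hb', ← c.ent_block ρ hx' hy',
    Nat.mod_eq_of_lt (show a * H + x < 4 * H by nlinarith),
    Nat.mod_eq_of_lt (show b * H + y < 4 * H by nlinarith)]
  simp only [block_inj hx hx', block_inj hy hy']
  congr 1
  exact h ρ _ (by nlinarith) _ (by nlinarith)

theorem Reps.setB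
    (h : Reps H c₀ c us) (hx : x < H) (hy : y < H) :
    Reps H c₀ { c with B := setEntry c.B x y v } (DynRAM.setB x y v :: us) := by
  have := h.cons (a := 0) (b := 0) (v := v) (c' := { c with B := setEntry c.B x y v }) (by omega) (by omega) hx hy
    (by
      intro ρ a' ha' b' hb' x' y'
      interval_cases a' <;> interval_cases b' <;> simp [Cfg.blk, setEntry])
  simpa [DynRAM.setB] using this

theorem Reps.setAl
    (h : Reps H c₀ c us) (hx : x < H) :
    Reps H c₀ { c with al := update c.al x v } (DynRAM.setAl H x v :: us) := by
  have := h.cons (a := 2) (b := 1) (v := v) (c' := { c with al := update c.al x v }) (by omega) (by omega) hx hx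
    (by
      intro ρ a' ha' b' hb' x' y'
      interval_cases a' <;> interval_cases b' <;> simp [Cfg.blk, update_apply]
      by_cases h1 : x' = y' <;> by_cases h2 : x' = x <;> simp [h1, h2] <;> grind)
  simpa [DynRAM.setAl] using this

theorem Reps.setBe
    (h : Reps H c₀ c us) (hx : x < H) :
    Reps H c₀ { c with be := update c.be x v } (DynRAM.setBe H x v :: us) := by
  have := h.cons (a := 2) (b := 2) (v := v) (c' := { c with be := update c.be x v }) (by omega) (by omega) hx hx
    (by
      intro ρ a' ha' b' hb' x' y'
      interval_cases a' <;> interval_cases b' <;> simp [Cfg.blk, update_apply]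
      by_cases h1 : x' = y' <;> by_cases h2 : x' = x <;> simp [h1, h2] <;> grind)
  simpa [DynRAM.setBe] using this

theorem Reps.setQ {k : ℕ}
    (h : Reps H c₀ c us) (hx : x < H) (hk : k < H) :
    Reps H c₀ { c with Q := setEntry c.Q x k v } (DynRAM.setQ H x k v :: us) := by
  have := h.cons (a := 2) (b := 3) (v := v) (c' := { c with Q := setEntry c.Q x k v }) (by omega) (by omega) hx hk
    (by
      intro ρ a' ha' b' hb' x' y'
      interval_cases a' <;> interval_cases b' <;> simp [Cfg.blk, setEntry])
  simpa [DynRAM.setQ] using this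

open Classical in
/-- The answers of a guest that never errs, for random elements in general position. -/
noncomputable def idealT (H : ℕ) (c₀ : Cfg F) (us : Updates F) : Bool :=
  decide (∀ us', us' <:+ us →
    ∃ ρ, Nonsing (applyGuest (4 * H) (c₀.ent H ρ) us') (range (4 * H)))

theorem idealT_cons {u : GuestUpdate F}
    (h : idealT H c₀ us = true) (hr : Reps H c₀ c (u :: us)) :
    idealT H c₀ (u :: us) = true ↔ c.Ideal H := by
  rw [← hr.ideal]
  simp only [idealT, decide_eq_true_eq, List.suffix_cons_iff, forall_eq_or_imp] at h ⊢
  exact ⟨fun h' => h'.1, fun h' => ⟨h', h⟩⟩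

/-! ### The run with ideal answers -/

/-- The lists describe the independent set `I` of rows of `B`. -/
structure Good (H n : ℕ) (c₀ : Cfg F) (B : NatMat F) (I : Finset ℕ) (d : Book F) : Prop where
  reps : Reps H c₀ (stdCfg B I) d.us
  acc : idealT H c₀ d.us = true
  lt : ∀ x ∈ I, x < 2 * n
  indep : LinearIndepOn F (rowv H B) (I : Set ℕ)
  ok : ∀ h, (d.ls h).Ok n
  mem : ∀ h < 2, ∀ x < n, (h * n + x ∈ I ↔ (d.ls h).pos x ≠ 0)

theorem commit_ideal {u : GuestUpdate F}
    (h : idealT H c₀ d.us = true) (hr : Reps H c₀ c (u :: d.us)) (hc : c.Ideal H) :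
    (commit u d).run (idealT H c₀) = { d with us := u :: d.us } ∧
      idealT H c₀ (u :: d.us) = true := by
  have := (idealT_cons h hr).2 hc
  refine ⟨?_, this⟩
  rw [commit, Comp.run_ask, this]
  rfl

theorem testRow_ideal {k : ℕ}
    (h : Good H n c₀ B I d) (hn : 2 * n < H) (hk : k < 2 * n) :
    (testRow H n d k).run (idealT H c₀) = true ↔
      ∃ x ≤ k, rowv H B x ∉ span F (rowv H B '' (I : Set ℕ)) := by
  have hIH : ∀ x ∈ I, x < H := fun x hx => by have := h.lt x hx; omega
  have hNI : 2 * n ∉ I := fun hm => by have := h.lt _ hm; omega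
  have r₁ := h.reps.setQ (v := 1) hn (show k < H by omega)
  have r₂ := r₁.setBe (v := 0) hn
  have i₁ := (idealT_cons h.acc r₁).2 (Cfg.ideal_of_indep hIH (J := I) (fun _ h => h) h.indep
    (fun x _ => rfl) fun x _ => rfl)
  rw [testRow, Comp.run_ask, Comp.run_ret, idealT_cons i₁ r₂]
  refine Cfg.ideal_test_iff hIH hn hNI (by omega) h.indep (fun x _ => rfl) (fun x _ => ?_)
    fun x _ y _ => ?_
  · simp only [stdCfg, update_apply]
    by_cases h1 : x = 2 * n <;> by_cases h2 : x ∈ I <;> simp [h1, h2]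
  · simp [stdCfg, setEntry]

theorem ind_insert (I : Finset ℕ) (x : ℕ) (a b : F) :
    update (fun y => if y ∈ I then a else b) x a =
      fun y => if y ∈ insert x I then a else b := by
  funext y
  simp only [update_apply, mem_insert]
  by_cases h1 : y = x <;> by_cases h2 : y ∈ I <;> simp [h1, h2]

theorem ind_erase (I : Finset ℕ) (x : ℕ) (a b : F) :
    update (fun y => if y ∈ I then a else b) x b =
      fun y => if y ∈ I.erase x then a else b := by
  funext y
  simp only [update_apply, mem_erase]
  by_cases h1 : y = x <;> by_cases h2 : y ∈ I <;> simp [h1, h2]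

theorem index_inj {h' x' : ℕ} (hx : x < n) (hx' : x' < n) :
    h' * n + x' = h * n + x ↔ h' = h ∧ x' = x := block_inj hx hx'

theorem augment_ideal
    (hg : Good H n c₀ B I d) (hn : 2 * n < H) (hh : h < 2)
    (hsp : ∀ x < h * n, rowv H B x ∈ span F (rowv H B '' (I : Set ℕ))) :
    ∃ I', Good H n c₀ B I' ((augment H n h d).run (idealT H c₀)) ∧
      ((I' = I ∧ ∀ x < (h + 1) * n, rowv H B x ∈ span F (rowv H B '' (I : Set ℕ))) ∨
      ∃ k < n, I' = insert (h * n + k) I ∧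
        rowv H B (h * n + k) ∉ span F (rowv H B '' (I : Set ℕ))) := by
  have hhn : h * n ≤ n := by nlinarith
  set P : ℕ → Prop := fun k => ∃ x ≤ h * n + k,
    rowv H B x ∉ span F (rowv H B '' (I : Set ℕ)) with hP
  obtain ⟨s1, s2, s3⟩ := search_spec (T := idealT H c₀) (P := P) (n := n)
    (test := fun k => testRow H n d (h * n + k))
    (fun j k hjk _ => fun ⟨x, hx, hx'⟩ => ⟨x, by omega, hx'⟩)
    (fun k hk => testRow_ideal hg hn (by omega)) n.size 0 n (by omega) le_rfl
    (by simpa using Nat.lt_size_self n) (by simp) (by simp)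
  rw [augment, Comp.run_bind]
  set k := (search (fun k => testRow H n d (h * n + k)) n.size 0 n).run (idealT H c₀) with hk
  by_cases hkn : k < n
  · have hrow : rowv H B (h * n + k) ∉ span F (rowv H B '' (I : Set ℕ)) := by
      obtain ⟨x, hx, hx'⟩ := s3 hkn
      have : x = h * n + k := by
        by_contra hne
        rcases Nat.lt_or_ge x (h * n) with h1 | h1
        · exact hx' (hsp x h1)
        · exact s2 (x - h * n) (by omega) ⟨x, by omega, hx'⟩
      rwa [← this]
    have hkI : h * n + k ∉ I := fun hm => hrow (Submodule.subset_span ⟨_, hm, rfl⟩)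
    have hpos : (d.ls h).pos k = 0 := by
      by_contra hne
      exact hkI ((hg.mem h hh k hkn).2 hne)
    have hgH : h * n + k < H := by omega
    have hind : LinearIndepOn F (rowv H B) ((insert (h * n + k) I : Finset ℕ) : Set ℕ) := by
      rw [coe_insert]
      exact hg.indep.insert hrow
    have hlt : ∀ x ∈ insert (h * n + k) I, x < 2 * n := fun x hx => by
      rcases mem_insert.1 hx with rfl | hx
      · omega
      · exact hg.lt x hx
    have r₁ := hg.reps.setAl (v := 1) hgH
    have c₁ := commit_ideal hg.acc r₁ (Cfg.ideal_of_indep (I := insert (h * n + k) I) (J := I)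
      (fun x hx => by have := hlt x hx; omega) (subset_insert _ _) hind
      (fun x _ => by simp only [stdCfg]; rw [ind_insert]) fun x _ => rfl)
    have e : { { stdCfg B I with al := update (stdCfg B I).al (h * n + k) 1 } with
        be := update (stdCfg B I).be (h * n + k) 0 } = stdCfg B (insert (h * n + k) I) := by
      simp only [stdCfg, ind_insert]
    have r₂ := r₁.setBe (v := 0) hgH
    have r₂' : Reps H c₀ (stdCfg B (insert (h * n + k) I)) _ := e ▸ r₂
    have c₂ := commit_ideal (d := { d with us := setAl H (h * n + k) 1 :: d.us }) c₁.2 r₂'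
      (Cfg.ideal_of_indep (I := insert (h * n + k) I) (J := insert (h * n + k) I)
      (fun x hx => by have := hlt x hx; omega) (fun _ h => h) hind (fun x _ => rfl) fun x _ => rfl)
    refine ⟨insert (h * n + k) I, ?_, .inr ⟨k, hkn, rfl, hrow⟩⟩
    rw [if_pos ⟨hkn, hpos⟩, Comp.run_bind, Comp.run_bind, Comp.run_ret, c₁.1, c₂.1]
    refine ⟨r₂', c₂.2, hlt, hind, Book.insert_ok hkn hpos hg.ok, fun h' hh' x hx => ?_⟩
    rw [mem_insert, index_inj hkn hx, hg.mem h' hh' x hx]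
    simp only [Book.insert, update_apply]
    by_cases hhh : h' = h
    · subst hhh
      simp [Lst.insert_pos]
    · simp [hhh]
  · refine ⟨I, ?_, .inl ⟨rfl, fun x hx => ?_⟩⟩
    · rw [if_neg (fun h => hkn h.1)]
      exact hg
    · by_contra hx'
      rcases Nat.lt_or_ge x (h * n) with h1 | h1
      · exact hx' (hsp x h1)
      · exact s2 (x - h * n) (by rw [Nat.add_mul] at hx; omega) ⟨x, by omega, hx'⟩

theorem release_ideal
    (hg : Good H n c₀ B I d) (hn : 2 * n < H) (hh : h < 2) (hx : x < n) :
    Good H n c₀ B (I.erase (h * n + x)) ((release H n h x d).run (idealT H c₀)) := by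
  have hhn : h * n ≤ n := by nlinarith
  have hgH : h * n + x < H := by omega
  have hIH : ∀ x ∈ I, x < H := fun x hx => by have := hg.lt x hx; omega
  rw [release]
  by_cases hpos : (d.ls h).pos x ≠ 0
  · have hxI := (hg.mem h hh x hx).2 hpos
    have hind : LinearIndepOn F (rowv H B) ((I.erase (h * n + x) : Finset ℕ) : Set ℕ) :=
      hg.indep.mono (by simpa using erase_subset _ _)
    have eb : update (stdCfg B I).be (h * n + x) 1 =
        fun y => if y ∈ I.erase (h * n + x) then 0 else 1 := ind_erase I _ 0 1
    have ea : update (stdCfg B I).al (h * n + x) 0 =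
        fun y => if y ∈ I.erase (h * n + x) then 1 else 0 := ind_erase I _ 1 0
    have r₁ := hg.reps.setBe (v := 1) hgH
    have c₁ := commit_ideal hg.acc r₁ (Cfg.ideal_of_indep (I := I) (J := I.erase (h * n + x))
      hIH (erase_subset _ _) hg.indep (fun x _ => rfl) fun x _ => by simp only [eb])
    have r₂ := r₁.setAl (v := 0) hgH
    have e : { { stdCfg B I with be := update (stdCfg B I).be (h * n + x) 1 } with
        al := update (stdCfg B I).al (h * n + x) 0 } =
        stdCfg B (I.erase (h * n + x)) := by
      rw [eb, ea]; rfl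
    have r₂' : Reps H c₀ (stdCfg B (I.erase (h * n + x))) _ := e ▸ r₂
    have c₂ := commit_ideal (d := { d with us := setBe H (h * n + x) 1 :: d.us }) c₁.2 r₂'
      (Cfg.ideal_of_indep (I := I.erase (h * n + x)) (J := I.erase (h * n + x))
      (fun y hy => hIH y (mem_of_mem_erase hy)) (fun _ h => h) hind (fun x _ => rfl)
      fun x _ => rfl)
    rw [if_pos hpos, Comp.run_bind, Comp.run_bind, Comp.run_ret, c₁.1, c₂.1]
    refine ⟨r₂', c₂.2, fun y hy => hg.lt y (mem_of_mem_erase hy), hind,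
      Book.remove_ok hx hpos hg.ok, fun h' hh' y hy => ?_⟩
    rw [mem_erase, Ne, index_inj hx hy, hg.mem h' hh' y hy]
    simp only [Book.remove, update_apply]
    by_cases hhh : h' = h
    · subst hhh
      simp only [true_and, if_true]
      rw [((hg.ok h').remove hx hpos).2 y hy]
    · simp [hhh]
  · have hxI : h * n + x ∉ I := fun hm => hpos ((hg.mem h hh x hx).1 hm)
    rw [if_neg hpos, erase_eq_of_notMem hxI]
    exact hg

theorem setB_ideal
    (hg : Good H n c₀ B I d) (hn : 2 * n < H) (hx : x < 2 * n) (hy : y < 2 * n) (hxI : x ∉ I) :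
    Good H n c₀ (setEntry B x y v) I ((commit (setB x y v) d).run (idealT H c₀)) := by
  have r₁ := hg.reps.setB (v := v) (show x < H by omega) (show y < H by omega)
  have hind : LinearIndepOn F (rowv H (setEntry B x y v)) (I : Set ℕ) := by
    refine (linearIndepOn_congr fun z hz => ?_).1 hg.indep
    have : z ≠ x := fun h => hxI (h ▸ hz)
    funext j
    simp [rowv, setEntry, this]
  have r₁' : Reps H c₀ (stdCfg (setEntry B x y v) I) _ := r₁
  have c₁ := commit_ideal hg.acc r₁' (Cfg.ideal_of_indep (I := I) (J := I)
    (fun x hx => by have := hg.lt x hx; omega) (fun _ h => h) hind (fun x _ => rfl) fun x _ => rfl)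
  rw [c₁.1]
  exact ⟨r₁', c₁.2, hg.lt, hind, hg.ok, hg.mem⟩

/-! ### Blocks -/

/-- `B` consists of two diagonal blocks of size `n`. -/
def Blocky (n : ℕ) (B : NatMat F) : Prop :=
  ∀ x y, B x y ≠ 0 → (x < n ∧ y < n) ∨ ((n ≤ x ∧ x < 2 * n) ∧ (n ≤ y ∧ y < 2 * n))

theorem span_of_projection {V : Type*} [AddCommGroup V] [Module F V] {v : ℕ → V} {I : Set ℕ} {S : Set ℕ} (π : V →ₗ[F] V) (h1 : ∀ x ∈ S, π (v x) = v x) (h0 : ∀ x ∈ I, x ∉ S → π (v x) = 0)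
    {x : ℕ} (hx : x ∈ S) (h : v x ∈ span F (v '' I)) :
    v x ∈ span F (v '' (I ∩ S)) := by
  rw [← h1 x hx]
  have : span F (v '' I) ≤ (span F (v '' (I ∩ S))).comap π := by
    rw [Submodule.span_le]
    rintro _ ⟨y, hy, rfl⟩
    rw [SetLike.mem_coe, Submodule.mem_comap]
    by_cases hyS : y ∈ S
    · rw [h1 y hyS]
      exact Submodule.subset_span ⟨y, ⟨hy, hyS⟩, rfl⟩
    · rw [h0 y hy hyS]
      exact Submodule.zero_mem _
  exact this h

/-- Forget the coordinates outside a set. -/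
noncomputable def keep (F : Type*) [Field F] (H : ℕ) (q : ℕ → Prop) [DecidablePred q] :
    (Fin H → F) →ₗ[F] (Fin H → F) where
  toFun v j := if q j then v j else 0
  map_add' v w := by funext j; simp only [Pi.add_apply]; split_ifs <;> simp
  map_smul' a v := by
    funext j; simp only [Pi.smul_apply, smul_eq_mul, RingHom.id_apply]; split_ifs <;> simp

theorem Blocky.span_inter (hB : Blocky n B) {I : Set ℕ} {x : ℕ}
    (h : rowv H B x ∈ span F (rowv H B '' I)) :
    rowv H B x ∈ span F (rowv H B '' (I ∩ {y | y < n ↔ x < n})) := by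
  refine span_of_projection (S := {y | y < n ↔ x < n}) (keep F H fun j => j < n ↔ x < n)
    (fun y hy => ?_) (fun y _ hy => ?_) (Iff.rfl : x < n ↔ x < n) h
  · funext j
    have hy' : y < n ↔ x < n := hy
    simp only [keep, LinearMap.coe_mk, AddHom.coe_mk, rowv]
    split_ifs with hj
    · rfl
    · by_contra hne
      have := hB y j (Ne.symm hne)
      omega
  · funext j
    have hy' : ¬ (y < n ↔ x < n) := hy
    simp only [keep, LinearMap.coe_mk, AddHom.coe_mk, rowv, Pi.zero_apply]
    split_ifs with hj
    · by_contra hne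
      have := hB y j hne
      omega
    · rfl

theorem Blocky.setEntry (hB : Blocky n B) (hh : h < 2)
    (hx : x < n) (hy : y < n) : Blocky n (setEntry B (h * n + x) (h * n + y) v) := by
  intro i j hij
  simp only [DynRAM.setEntry] at hij
  split_ifs at hij with hc
  · obtain ⟨rfl, rfl⟩ := hc
    interval_cases h <;> omega
  · exact hB i j hij

theorem halfStep_ideal (hg : Good H n c₀ B I d) (hn : 2 * n < H) (hh : h < 2) (hx : x < n) (hy : y < n)
    (hB : Blocky n B)
    (hsp : ∀ z, rowv H B z ∈ span F (rowv H B '' (I : Set ℕ))) :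
    ∃ I', Good H n c₀ (setEntry B (h * n + x) (h * n + y) v) I'
        ((halfStep H n h x y v d).run (idealT H c₀)) ∧
      ∀ z, rowv H (setEntry B (h * n + x) (h * n + y) v) z ∈ span F
        (rowv H (setEntry B (h * n + x) (h * n + y) v) '' (I' : Set ℕ)) := by
  classical
  have hhn : h * n ≤ n := by nlinarith
  set g := h * n + x with hgdef
  set B' := setEntry B g (h * n + y) v with hB'def
  have hB' : Blocky n B' := hB.setEntry hh hx hy
  set I₁ := I.erase g with hI₁
  have g₁ := release_ideal hg hn hh hx
  have g₂ := setB_ideal (v := v) g₁ hn (x := g) (y := h * n + y) (by omega) (by omega)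
    (notMem_erase _ _)
  rw [← hI₁, ← hB'def] at g₂
  set d₂ := (commit (setB g (h * n + y) v) ((release H n h x d).run (idealT H c₀))).run
    (idealT H c₀) with hd₂
  have row_eq : ∀ z, z ≠ g → rowv H B' z = rowv H B z := fun z hz => by
    funext j
    simp [rowv, hB'def, setEntry, hz]
  have img : rowv H B' '' (I₁ : Set ℕ) = rowv H B '' (I₁ : Set ℕ) :=
    Set.image_congr fun z hz => row_eq z (ne_of_mem_erase hz)
  set W := span F (rowv H B' '' (I₁ : Set ℕ)) with hW
  -- rows outside the block stay in the span
  have other : ∀ z, ¬ (h * n ≤ z ∧ z < (h + 1) * n) → rowv H B' z ∈ W := by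
    intro z hz
    have hzg : z ≠ g := fun hzg => hz (by rw [Nat.add_mul]; omega)
    rw [row_eq z hzg, hW, img]
    by_cases hz2 : z < 2 * n
    · refine Submodule.span_mono (Set.image_mono ?_) (hB.span_inter (hsp z))
      intro w hw
      have hw2 : w < n ↔ z < n := hw.2
      have hwI : w ∈ I := hw.1
      refine mem_coe.2 (mem_erase.2 ⟨?_, hwI⟩)
      rintro rfl
      interval_cases h <;> omega
    · have : rowv H B z = 0 := by
        funext j
        by_contra hne
        have := hB z j hne
        omega
      rw [this]
      exact Submodule.zero_mem _
  have final : ∀ I' : Finset ℕ, I₁ ⊆ I' → (∀ z < (h + 1) * n, rowv H B' z ∈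
      span F (rowv H B' '' (I' : Set ℕ))) → ∀ z, rowv H B' z ∈
      span F (rowv H B' '' (I' : Set ℕ)) := by
    intro I' hI' hz z
    by_cases hzn : z < (h + 1) * n
    · exact hz z hzn
    · exact Submodule.span_mono (Set.image_mono (by exact_mod_cast hI')) (other z (by omega))
  have run_eq : (halfStep H n h x y v d).run (idealT H c₀) =
      (augment H n h ((augment H n h d₂).run (idealT H c₀))).run (idealT H c₀) := by
    rw [halfStep, Comp.run_bind, Comp.run_bind, Comp.run_bind]
  rw [run_eq]
  obtain ⟨I₂, g₃, c₃⟩ := augment_ideal g₂ hn hh fun z hz => other z (by omega)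
  have sub₂ : I₁ ⊆ I₂ := by
    rcases c₃ with ⟨rfl, -⟩ | ⟨k, -, rfl, -⟩
    · exact fun _ h => h
    · exact subset_insert _ _
  obtain ⟨I₃, g₄, c₄⟩ := augment_ideal g₃ hn hh fun z hz =>
    Submodule.span_mono (Set.image_mono (by exact_mod_cast sub₂)) (other z (by omega))
  refine ⟨I₃, g₄, ?_⟩
  rcases c₄ with ⟨rfl, h4⟩ | ⟨k', hk', e₃, n₃⟩
  · exact final _ sub₂ h4
  rcases c₃ with ⟨rfl, h3⟩ | ⟨k, hk, e₂, n₂⟩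
  · exact absurd (h3 _ (by rw [Nat.add_mul]; omega)) n₃
  -- two rows were added: compare dimensions
  let s : Finset (Fin H → F) := I₁.image (rowv H B') ∪ {rowv H B g, rowv H B' g}
  have hall : ∀ z, rowv H B' z ∈ span F (s : Set (Fin H → F)) := by
    intro z
    by_cases hz : z = g
    · subst hz; exact Submodule.subset_span (by simp [s])
    · rw [row_eq z hz]
      refine (Submodule.span_le.2 ?_ : span F (rowv H B '' (I : Set ℕ)) ≤ _) (hsp z)
      rintro _ ⟨w, hw, rfl⟩
      by_cases hwg : w = g
      · subst hwg; exact Submodule.subset_span (by simp [s])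
      · rw [← row_eq w hwg]
        refine Submodule.subset_span ?_
        have : w ∈ I₁ := mem_erase.2 ⟨hwg, hw⟩
        simp only [s, coe_union, Set.mem_union, mem_coe]
        exact .inl (mem_image_of_mem _ this)
  have hcard : s.card ≤ I₃.card := by
    have h1 : s.card ≤ I₁.card + 2 := (card_union_le _ _).trans
      (Nat.add_le_add card_image_le card_le_two)
    have h2 : I₂.card = I₁.card + 1 := by
      rw [e₂, card_insert_of_notMem fun hm => n₂ (Submodule.subset_span ⟨_, hm, rfl⟩)]
    have h3 : I₃.card = I₂.card + 1 := by
      rw [e₃, card_insert_of_notMem fun hm => n₃ (Submodule.subset_span ⟨_, hm, rfl⟩)]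
    omega
  have hle : span F (rowv H B' '' (I₃ : Set ℕ)) ≤ span F (s : Set (Fin H → F)) := by
    rw [Submodule.span_le]
    rintro _ ⟨w, -, rfl⟩
    exact hall w
  have hfr : Module.finrank F (span F (rowv H B' '' (I₃ : Set ℕ))) = I₃.card := by
    have := finrank_span_eq_card g₄.indep
    rw [← Set.image_eq_range] at this
    rw [this]
    simp
  have heq := Submodule.eq_of_le_of_finrank_le hle
    (by rw [hfr]; exact (finrank_span_finset_le_card s).trans hcard)
  intro z
  rw [heq]
  exact hall z

end IdealRun

end

section

section Output

variable {n H : ℕ} {c₀ : Cfg F} {I : Finset ℕ}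

/-! ### The matrix and its transpose as diagonal blocks -/

/-- The diagonal blocks `A` and `Aᵀ`. -/
def blockMat {n : ℕ} (A : Matrix (Fin n) (Fin n) F) (x y : ℕ) : F :=
  if h : x < n ∧ y < n then A ⟨x, h.1⟩ ⟨y, h.2⟩
  else if h : (n ≤ x ∧ x < 2 * n) ∧ (n ≤ y ∧ y < 2 * n) then
    A ⟨y - n, by omega⟩ ⟨x - n, by omega⟩ else 0

theorem blocky_blockMat (A : Matrix (Fin n) (Fin n) F) : Blocky n (blockMat A) := by
  intro x y h
  simp only [blockMat] at h
  split_ifs at h with h1 h2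
  · exact .inl h1
  · exact .inr h2
  · exact absurd rfl h

theorem blockMat_update (A : Matrix (Fin n) (Fin n) F) (u : Update n F) :
    setEntry (setEntry (blockMat A) (0 * n + u.row) (0 * n + u.col) u.value) (1 * n + u.col)
      (1 * n + u.row) u.value = blockMat (u.apply A) := by
  funext x y
  have hr := u.row.2
  have hc := u.col.2
  simp only [setEntry, blockMat, Update.apply, Matrix.of_apply, Fin.ext_iff]
  by_cases h1 : x < n ∧ y < n
  · rw [if_neg (by omega)]
    simp [h1]
  · by_cases h2 : (n ≤ x ∧ x < 2 * n) ∧ (n ≤ y ∧ y < 2 * n)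
    · simp only [h1, h2, dif_neg, dif_pos, not_false_eq_true, and_self]
      have e : (x = 1 * n + ↑u.col ∧ y = 1 * n + ↑u.row) ↔ (y - n = ↑u.row ∧ x - n = ↑u.col) := by
        omega
      have e' : ¬ (x = 0 * n + ↑u.row ∧ y = 0 * n + ↑u.col) := by omega
      rw [if_neg e']
      simp only [e]
    · rw [if_neg (by omega), if_neg (by omega), dif_neg h1, dif_neg h2, dif_neg h1, dif_neg h2]

/-- The book describes a basis of the rows of `A` and a basis of its columns. -/
def Sound {n : ℕ} (H : ℕ) (c₀ : Cfg F) (A : Matrix (Fin n) (Fin n) F) (d : Book F) : Prop :=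
  ∃ I, Good H n c₀ (blockMat A) I d ∧
    ∀ z, rowv H (blockMat A) z ∈ span F (rowv H (blockMat A) '' (I : Set ℕ))

theorem Sound.fullStep {A : Matrix (Fin n) (Fin n) F} {d : Book F}
    (h : Sound H c₀ A d) (hn : 2 * n < H) (u : Update n F) :
    Sound H c₀ (u.apply A) ((fullStep H n u.row u.col u.value d).run (idealT H c₀)) := by
  obtain ⟨I, hg, hsp⟩ := h
  have hB := blocky_blockMat A
  obtain ⟨I₁, g₁, s₁⟩ := halfStep_ideal (h := 0) (v := u.value) hg hn (by omega) u.row.2 u.col.2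
    hB hsp
  obtain ⟨I₂, g₂, s₂⟩ := halfStep_ideal (h := 1) (v := u.value) g₁ hn (by omega) u.col.2 u.row.2
    (hB.setEntry (by omega) u.row.2 u.col.2) s₁
  rw [DynRAM.fullStep, Comp.run_ask, if_pos hg.acc, Comp.run_bind]
  rw [blockMat_update] at g₂ s₂
  exact ⟨I₂, g₂, s₂⟩

/-! ### Bases of the rows and the columns -/

theorem det_ne_zero_of_bases {r : ℕ} {A : Matrix (Fin n) (Fin n) F} {f g : Fin r → Fin n}
    (hf : ∀ i, A i ∈ span F (Set.range fun k => A (f k)))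
    (hg : LinearIndependent F fun k => A.transpose (g k)) : (A.submatrix f g).det ≠ 0 := by
  rw [Ne, ← Matrix.exists_mulVec_eq_zero_iff]
  rintro ⟨v, hv, h0⟩
  let φ : (Fin n → F) →ₗ[F] F := Fintype.linearCombination F fun j => ∑ k, if g k = j then v k else 0
  have hφ : ∀ i, φ (A i) = ∑ k, A i (g k) * v k := by
    intro i
    simp only [φ, Fintype.linearCombination_apply, smul_eq_mul, mul_sum]
    rw [sum_comm]
    refine sum_congr rfl fun k _ => ?_
    simp
  have hz : ∀ i, ∑ k, A i (g k) * v k = 0 := by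
    intro i
    rw [← hφ]
    have : span F (Set.range fun k => A (f k)) ≤ LinearMap.ker φ := by
      rw [Submodule.span_le]
      rintro _ ⟨l, rfl⟩
      rw [SetLike.mem_coe, LinearMap.mem_ker, hφ]
      have := congrFun h0 l
      simpa [Matrix.mulVec, dotProduct] using this
    exact this (hf i)
  refine hv (funext fun k => ?_)
  refine Fintype.linearIndependent_iff.1 hg v (funext fun i => ?_) k
  rw [Finset.sum_apply, Pi.zero_apply, ← hz i]
  exact sum_congr rfl fun k _ => by simp [mul_comm]

theorem rank_eq_of_basis {r : ℕ} {A : Matrix (Fin n) (Fin n) F} {f : Fin r → Fin n}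
    (hli : LinearIndependent F fun k => A (f k))
    (hf : ∀ i, A i ∈ span F (Set.range fun k => A (f k))) : A.rank = r := by
  rw [Matrix.rank_eq_finrank_span_row]
  have : span F (Set.range A.row) = span F (Set.range fun k => A (f k)) := by
    apply le_antisymm
    · rw [Submodule.span_le]
      rintro _ ⟨i, rfl⟩
      exact hf i
    · refine Submodule.span_mono ?_
      rintro _ ⟨k, rfl⟩
      exact ⟨f k, rfl⟩
  rw [this, finrank_span_eq_card hli, Fintype.card_fin]

theorem block_basis {h : ℕ} {B : NatMat F} {d : Book F}
    (hg : Good H n c₀ B I d) (hn : 2 * n < H) (hh : h < 2) (hB : Blocky n B)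
    (hsp : ∀ z, rowv H B z ∈ span F (rowv H B '' (I : Set ℕ)))
    {M : Matrix (Fin n) (Fin n) F} (hM : ∀ x y : Fin n, B (h * n + x) (h * n + y) = M x y) :
    ∃ f : Fin (d.ls h).cnt → Fin n, Function.Injective f ∧ (∀ k, (f k : ℕ) = (d.ls h).lst k) ∧
      LinearIndependent F (fun k => M (f k)) ∧
      ∀ i, M i ∈ span F (Set.range fun k => M (f k)) := by
  have hok := hg.ok h
  have hhn : h * n = 0 ∨ h * n = n := by interval_cases h <;> simp
  let f : Fin (d.ls h).cnt → Fin n := fun k => ⟨(d.ls h).lst k, (hok.lst k k.2).1⟩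
  have hinj : Function.Injective f := fun a b hab =>
    Fin.ext (hok.inj a.2 b.2 (congrArg Fin.val hab))
  have hmem : ∀ k, h * n + f k ∈ I := fun k => by
    rw [hg.mem h hh _ (f k).2]
    have := (hok.lst k k.2).2
    show (d.ls h).pos ((d.ls h).lst k) ≠ 0
    omega
  let E : (Fin n → F) →ₗ[F] (Fin H → F) :=
    { toFun := fun v j => if hj : h * n ≤ j ∧ (j : ℕ) < h * n + n then v ⟨j - h * n, by omega⟩ else 0
      map_add' := fun v w => by funext j; simp only [Pi.add_apply]; split_ifs <;> simp
      map_smul' := fun a v => by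
        funext j; simp only [Pi.smul_apply, smul_eq_mul, RingHom.id_apply]; split_ifs <;> simp }
  have hE : ∀ x : Fin n, rowv H B (h * n + x) = E (M x) := by
    intro x
    funext j
    simp only [E, LinearMap.coe_mk, AddHom.coe_mk, rowv]
    split_ifs with hj
    · rw [← hM]
      congr 1
      simp only []
      omega
    · by_contra hne
      have := hB _ _ hne
      have := x.2
      omega
  let π : (Fin H → F) →ₗ[F] (Fin n → F) := LinearMap.funLeft F F fun j => ⟨h * n + j, by omega⟩
  have hπ : ∀ x : Fin n, π (rowv H B (h * n + x)) = M x := by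
    intro x
    funext j
    simp only [π, LinearMap.funLeft_apply, rowv]
    exact hM x j
  refine ⟨f, hinj, fun k => rfl, ?_, fun i => ?_⟩
  · refine LinearIndependent.of_comp E ?_
    have := hg.indep.comp (fun k : Fin (d.ls h).cnt => (⟨h * n + f k, hmem k⟩ : (I : Set ℕ)))
      (fun a b hab => hinj (Fin.ext (by
        have := congrArg Subtype.val hab
        simpa using this)))
    convert this using 1
    funext k
    exact (hE (f k)).symm
  · have := Submodule.mem_map_of_mem (f := π) (hB.span_inter (hsp (h * n + i)))
    rw [hπ, Submodule.map_span] at this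
    refine Submodule.span_mono ?_ this
    rintro _ ⟨_, ⟨z, ⟨hzI, hz⟩, rfl⟩, rfl⟩
    have hz' : z < n ↔ h * n + (i : ℕ) < n := hz
    have hz2 := hg.lt z hzI
    have hi := i.2
    obtain ⟨x, hx, rfl⟩ : ∃ x < n, z = h * n + x := ⟨z - h * n, by omega, by omega⟩
    have hpos := (hg.mem h hh x hx).1 hzI
    obtain ⟨p1, p2⟩ := hok.pos x hx hpos
    refine ⟨⟨(d.ls h).pos x - 1, by omega⟩, ?_⟩
    have e : f ⟨(d.ls h).pos x - 1, by omega⟩ = ⟨x, hx⟩ := Fin.ext p2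
    simp only [e]
    exact (hπ ⟨x, hx⟩).symm

/-- The two lists that are given out. -/
def Book.out (d : Book F) : List ℕ × List ℕ :=
  ((List.range (d.ls 0).cnt).map (d.ls 0).lst, (List.range (d.ls 0).cnt).map (d.ls 1).lst)

theorem map_range_eq_ofFn {c : ℕ} {l : ℕ → ℕ} {f : Fin c → Fin n} (h : ∀ k, (f k : ℕ) = l k) :
    (List.range c).map l = List.ofFn fun k => (f k : ℕ) := by
  apply List.ext_getElem <;> simp [h]

theorem Sound.correct {A : Matrix (Fin n) (Fin n) F} {d : Book F}
    (h : Sound H c₀ A d) (hn : 2 * n < H) : (maxFullRankSubmatrix F).Correct A d.out := by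
  obtain ⟨I, hg, hsp⟩ := h
  obtain ⟨f, fi, fl, fli, fsp⟩ := block_basis hg hn (h := 0) (by omega) (blocky_blockMat A) hsp
    (M := A) (fun x y => by simp [blockMat])
  obtain ⟨g, gi, gl, gli, gsp⟩ := block_basis hg hn (h := 1) (by omega) (blocky_blockMat A) hsp
    (M := A.transpose) (fun x y => by
      have := x.2; have := y.2
      simp only [blockMat]
      rw [dif_neg (by omega), dif_pos (by omega)]
      simp)
  have r₀ := rank_eq_of_basis fli fsp
  have r₁ := rank_eq_of_basis gli gsp
  rw [Matrix.rank_transpose] at r₁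
  have e : List.range (d.ls 0).cnt = List.range A.rank := by rw [r₀]
  refine ⟨f ∘ Fin.cast r₀, g ∘ Fin.cast r₁, fi.comp (Fin.cast_injective _),
    gi.comp (Fin.cast_injective _), ?_, ?_, det_ne_zero_of_bases (fun i => ?_) ?_⟩
  · rw [Book.out, e]
    exact map_range_eq_ofFn (f := f ∘ Fin.cast r₀) fun k => fl _
  · rw [Book.out, e]
    exact map_range_eq_ofFn (f := g ∘ Fin.cast r₁) fun k => gl _
  · refine Submodule.span_mono ?_ (fsp i)
    rintro _ ⟨k, rfl⟩
    exact ⟨Fin.cast r₀.symm k, rfl⟩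
  · exact gli.comp _ (Fin.cast_injective _)

/-! ### The initial lists -/

/-- Insert the elements of block `h` of `I` one after the other. -/
def initLst (n h : ℕ) (I : Finset ℕ) : ℕ → Lst
  | 0 => .empty
  | k + 1 => if h * n + k ∈ I then (initLst n h I k).insert k else initLst n h I k

theorem initLst_spec {h : ℕ} : ∀ k ≤ n, (initLst n h I k).Ok n ∧
    ∀ x, ((initLst n h I k).pos x ≠ 0 ↔ x < k ∧ h * n + x ∈ I) := by
  intro k
  induction k with
  | zero => exact fun _ => ⟨Lst.empty_ok n, fun x => by simp [initLst, Lst.empty]⟩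
  | succ k ih =>
    intro hk
    obtain ⟨ok, mem⟩ := ih (by omega)
    have h0 : (initLst n h I k).pos k = 0 := by
      by_contra hne
      have := (mem k).1 hne
      omega
    rw [initLst]
    split_ifs with hc
    · refine ⟨ok.insert (by omega) h0, fun x => ?_⟩
      rw [Lst.insert_pos, mem]
      constructor
      · rintro (rfl | hx)
        · exact ⟨by omega, hc⟩
        · exact ⟨by omega, hx.2⟩
      · rintro ⟨h1, h2⟩
        by_cases hxk : x = k
        · exact .inl hxk
        · exact .inr ⟨by omega, h2⟩
    · refine ⟨ok, fun x => ?_⟩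
      rw [mem]
      constructor
      · rintro hx; exact ⟨by omega, hx.2⟩
      · rintro ⟨h1, h2⟩
        have : x ≠ k := fun h => hc (h ▸ h2)
        exact ⟨by omega, h2⟩

def initBook (F : Type*) (n : ℕ) (I : Finset ℕ) : Book F := ⟨[], fun h => initLst n h I n⟩

theorem initBook_ok (n : ℕ) (I : Finset ℕ) (h : ℕ) : ((initBook F n I).ls h).Ok n :=
  (initLst_spec n le_rfl).1

theorem sound_init {A : Matrix (Fin n) (Fin n) F} (hn : 2 * n < H)
    (hI : RowBasis H (blockMat A) I) : Sound H (stdCfg (blockMat A) I) A (initBook F n I) := by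
  have hzero : ∀ z, 2 * n ≤ z → rowv H (blockMat A) z = 0 := by
    intro z hz
    funext j
    by_contra hne
    have := blocky_blockMat A z j hne
    omega
  have hr : Reps H (stdCfg (blockMat A) I) (stdCfg (blockMat A) I) [] := fun _ _ _ _ _ => rfl
  have hlt : ∀ x ∈ I, x < 2 * n := by
    intro x hx
    by_contra hge
    exact hI.indep.ne_zero (i := x) hx (hzero x (by omega))
  refine ⟨I, ⟨hr, ?_, hlt, hI.indep, initBook_ok n I, fun h hh x hx => ?_⟩, fun z => ?_⟩
  · have := hr.ideal.2 (Cfg.ideal_of_indep (I := I) (J := I) hI.lt (fun _ h => h) hI.indep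
      (fun x _ => rfl) fun x _ => rfl)
    simp only [idealT, decide_eq_true_eq]
    intro us' h
    rw [initBook] at h
    rw [List.suffix_nil.1 h]
    exact this
  · rw [initBook, (initLst_spec n le_rfl).2]
    simp [hx]
  · by_cases hz : z < H
    · exact hI.span z hz
    · rw [hzero z (by omega)]
      exact Submodule.zero_mem _

/-! ### Trajectories -/

/-- The updates, the outputs and the book after some updates that are chosen by `adv`. -/
structure Traj (n : ℕ) (F : Type*) where
  us : List (Update n F)
  os : List (List ℕ × List ℕ)
  d : Book F

def traj {n : ℕ} (H : ℕ) (T : Updates F → Bool) (d₀ : Book F)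
    (adv : List (List ℕ × List ℕ) → Update n F) : ℕ → Traj n F
  | 0 => ⟨[], [d₀.out], d₀⟩
  | t + 1 =>
    let r := traj H T d₀ adv t
    let u := adv r.os
    let d := (fullStep H n u.row u.col u.value r.d).run T
    ⟨u :: r.us, d.out :: r.os, d⟩

theorem traj_sound {A : Matrix (Fin n) (Fin n) F} {d₀ : Book F}
    (h : Sound H c₀ A d₀) (hn : 2 * n < H) (adv : List (List ℕ × List ℕ) → Update n F) (t : ℕ) :
    Sound H c₀ (applyAll A (traj H (idealT H c₀) d₀ adv t).us) (traj H (idealT H c₀) d₀ adv t).d := by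
  induction t with
  | zero => exact h
  | succ t ih => exact ih.fullStep hn _

theorem traj_next {T : Updates F → Bool} {d₀ : Book F} {adv : List (List ℕ × List ℕ) → Update n F} (t : ℕ) :
    Book.Next n (14 * t) d₀ (traj H T d₀ adv t).d := by
  induction t with
  | zero => exact .rfl
  | succ t ih =>
    exact ih.trans (fullStep_bound (T := T) (H := H) (ℓ := _) (adv (traj H T d₀ adv t).os).row.2
      (adv (traj H T d₀ adv t).os).col.2 le_rfl).2

/-- All queries up to time `L`. -/
def queries {n : ℕ} (H : ℕ) (T : Updates F → Bool) (d₀ : Book F)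
    (adv : List (List ℕ × List ℕ) → Update n F) (L : ℕ) : List (Updates F) :=
  (List.range L).flatMap fun t =>
    let r := traj H T d₀ adv t
    (fullStep H n (adv r.os).row (adv r.os).col (adv r.os).value r.d).trace T

theorem queries_bound {T : Updates F → Bool} {adv : List (List ℕ × List ℕ) → Update n F} (L : ℕ) :
    (queries H T (initBook F n I) adv L).length ≤ L * (4 * n.size + 15) ∧
    ∀ q ∈ queries H T (initBook F n I) adv L, q.length ≤ 14 * L := by
  have key : ∀ t, Asks T (fullStep H n (adv (traj H T (initBook F n I) adv t).os).row
      (adv (traj H T (initBook F n I) adv t).os).col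
      (adv (traj H T (initBook F n I) adv t).os).value (traj H T (initBook F n I) adv t).d)
      (4 * n.size + 15) (14 * (t + 1)) := by
    intro t
    have hl := (traj_next (T := T) (H := H) (d₀ := initBook F n I) (adv := adv) t).len
    refine (fullStep_bound (T := T) (H := H) (adv (traj H T (initBook F n I) adv t).os).row.2
      (adv (traj H T (initBook F n I) adv t).os).col.2 ?_).1
    simp only [initBook, List.length_nil] at hl ⊢
    omega
  constructor
  · rw [queries, List.length_flatMap]
    refine (List.sum_le_card_nsmul _ (4 * n.size + 15) ?_).trans ?_
    · intro x hx
      obtain ⟨t, -, rfl⟩ := List.mem_map.1 hx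
      exact (key t).1
    · simp
  · intro q hq
    obtain ⟨t, ht, hq⟩ := List.mem_flatMap.1 hq
    have := (key t).2 q hq
    have := List.mem_range.1 ht
    omega

theorem traj_congr {T T' : Updates F → Bool} {d₀ : Book F} {adv : List (List ℕ × List ℕ) → Update n F} {L : ℕ}
    (h : ∀ q ∈ queries H T d₀ adv L, T' q = T q) (t : ℕ) (ht : t ≤ L) :
    traj H T' d₀ adv t = traj H T d₀ adv t := by
  induction t with
  | zero => rfl
  | succ t ih =>
    have ih := ih (by omega)
    have e : (fullStep H n (adv (traj H T d₀ adv t).os).row (adv (traj H T d₀ adv t).os).col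
        (adv (traj H T d₀ adv t).os).value (traj H T d₀ adv t).d).run T' = _ :=
      Comp.run_congr (T := T) fun q hq => h q (List.mem_flatMap.2 ⟨t, by simpa using ht, hq⟩)
    simp only [traj, ih, e]

end Output

end

section

section Guest

/-! ### The guest algorithm on the bordered matrix -/

def borderMat (m : ℕ) (e : NatMat F) : Matrix (Fin m) (Fin m) F := Matrix.of fun i j => e i j

def GuestUpdate.toUpdate (m : ℕ) [NeZero m] (u : GuestUpdate F) : Update m F :=
  ⟨Fin.ofNat m u.row, Fin.ofNat m u.col, u.val⟩

theorem applyAll_borderMat {m : ℕ} [NeZero m] (e : NatMat F) (us : Updates F) :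
    applyAll (borderMat m e) (us.map (GuestUpdate.toUpdate m)) = borderMat m (applyGuest m e us) := by
  induction us with
  | nil => rfl
  | cons u us ih =>
    have : applyAll (borderMat m e) ((u :: us).map (GuestUpdate.toUpdate m)) =
      (u.toUpdate m).apply (applyAll (borderMat m e) (us.map (GuestUpdate.toUpdate m))) := rfl
    rw [this, ih]
    ext i j
    simp only [Update.apply, borderMat, Matrix.of_apply, applyGuest_cons, GuestUpdate.apply,
      GuestUpdate.toUpdate, Fin.ext_iff, Fin.val_ofNat]

theorem Runs.length {n : ℕ} {pr : Problem F} {D : DynAlg} {ω : Tape F} {W : ℕ}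
    {A : Matrix (Fin n) (Fin n) F} {us : List (Update n F)} {os : List pr.Out} {s : State F}
    (h : Runs pr D ω W A us os s) : os.length = us.length + 1 := by
  induction h with
  | prep => rfl
  | upd _ _ _ _ ih => simp [ih]

theorem Runs.det {n : ℕ} {pr : Problem F} {D : DynAlg} {ω : Tape F} {W : ℕ}
    {A : Matrix (Fin n) (Fin n) F} {us : List (Update n F)} {os : List pr.Out} {s : State F}
    (h : Runs pr D ω W A us os s) : ∀ {os' s'}, Runs pr D ω W A us os' s' → os' = os ∧ s' = s := by
  induction h with
  | prep h =>
    intro os' s' h'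
    cases h' with
    | prep h' =>
      obtain ⟨rfl, -⟩ := h.det h'
      exact ⟨rfl, rfl⟩
  | upd h hc u hu ih =>
    intro os' s' h'
    cases h' with
    | upd h' hc' _ hu' =>
      obtain ⟨rfl, rfl⟩ := ih h'
      obtain ⟨rfl, -⟩ := hu.det hu'
      exact ⟨rfl, rfl⟩

/-- The guest accepts the updates: its run on them ends without a report of singularity. -/
def Accepts (D : DynAlg) (ω : Tape F) (W : ℕ) {m : ℕ} [NeZero m] (M : Matrix (Fin m) (Fin m) F)
    (us : Updates F) : Prop :=
  ∃ os s, Runs (firstSingular F) D ω W M (us.map (GuestUpdate.toUpdate m)) os s ∧ s.w 2 0 = 0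

open Classical in
noncomputable def acceptT (D : DynAlg) (ω : Tape F) (W : ℕ) {m : ℕ} [NeZero m]
    (M : Matrix (Fin m) (Fin m) F) (us : Updates F) : Bool := decide (Accepts D ω W M us)

/-- The sequence of updates `q`, as an oblivious adversary. -/
def GuestUpdate.schedule (m : ℕ) [NeZero m] (q : Updates F) (k : ℕ) : Update m F :=
  ((q.reverse)[k - 1]?.getD ⟨0, 0, 0⟩).toUpdate m

theorem schedule_suffix {m : ℕ} [NeZero m] {q us : Updates F} {u : GuestUpdate F}
    (h : u :: us <:+ q) : GuestUpdate.schedule m q (us.length + 1) = u.toUpdate m := by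
  obtain ⟨l, rfl⟩ := h
  have e : (l ++ u :: us).reverse[us.length]? = some u := by
    rw [List.reverse_append, List.reverse_cons, List.append_assoc,
      List.getElem?_append_right (by simp)]
    simp
  simp [GuestUpdate.schedule]

theorem follows_schedule {m : ℕ} [NeZero m] {D : DynAlg} {ω : Tape F} {W : ℕ}
    {M : Matrix (Fin m) (Fin m) F} {q : Updates F} :
    ∀ {us : Updates F} {os : List (firstSingular F).Out} {s : State F}, us <:+ q →
    Runs (firstSingular F) D ω W M (us.map (GuestUpdate.toUpdate m)) os s →
    Follows (fun os => GuestUpdate.schedule m q os.length) (us.map (GuestUpdate.toUpdate m)) os := by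
  intro us
  induction us with
  | nil => intros; trivial
  | cons u us ih =>
    intro os s hq h
    rw [List.map_cons] at h
    cases h with
    | upd h _ _ _ =>
      refine ⟨?_, ih ((List.suffix_cons u us).trans hq) h⟩
      show _ = GuestUpdate.schedule m q _
      rw [h.length, List.length_map, schedule_suffix hq]

/-- A guest that does not err gives the ideal answers, if random elements are in general position. -/
theorem accepts_iff {H L : ℕ} [NeZero (4 * H)] {D : DynAlg} {ω : Tape F} {W : ℕ} {c : Cfg F}
    {ρ : ℕ → F} {TP TU : ℝ} {q : Updates F}
    (htime : TimeBound (firstSingular F) D ω W L (borderMat (4 * H) (c.ent H ρ)) TP TU)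
    (hlen : q.length ≤ L)
    (herr : ¬ Errs (firstSingular F) D ω W L (borderMat (4 * H) (c.ent H ρ))
      fun os => GuestUpdate.schedule (4 * H) q os.length)
    (hgen : ∀ us, us <:+ q → (∃ ρ, Nonsing (applyGuest (4 * H) (c.ent H ρ) us) (range (4 * H))) →
      Nonsing (applyGuest (4 * H) (c.ent H ρ) us) (range (4 * H))) :
    Accepts D ω W (borderMat (4 * H) (c.ent H ρ)) q ↔ idealT H c q = true := by
  have hcor : ∀ us, us <:+ q → ∀ os s, Runs (firstSingular F) D ω W (borderMat (4 * H) (c.ent H ρ))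
      (us.map (GuestUpdate.toUpdate (4 * H))) os s →
      (s.w 2 0 = 0 ↔ Nonsing (applyGuest (4 * H) (c.ent H ρ) us) (range (4 * H))) := by
    intro us hus os s hr
    by_contra hne
    refine herr ⟨_, os, s, ?_, hr, follows_schedule hus hr, fun hc => hne ?_⟩
    · rw [List.length_map]
      exact hus.length_le.trans hlen
    · rw [applyAll_borderMat] at hc
      have hd : (borderMat (4 * H) (applyGuest (4 * H) (c.ent H ρ) us)).det ≠ 0 ↔
        Nonsing (applyGuest (4 * H) (c.ent H ρ) us) (range (4 * H)) :=
        det_ne_zero_iff fun i j => rfl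
      rw [← hd]
      exact not_iff_not.1 (by simpa [firstSingular] using hc)
  simp only [idealT, decide_eq_true_eq]
  have key : ∀ us, us <:+ q → (Accepts D ω W (borderMat (4 * H) (c.ent H ρ)) us ↔ ∀ us', us' <:+ us →
      ∃ ρ, Nonsing (applyGuest (4 * H) (c.ent H ρ) us') (range (4 * H))) := by
    intro us
    induction us with
    | nil =>
      intro hus
      obtain ⟨s, t, hs, -⟩ := htime.1
      have hr := Runs.prep (pr := firstSingular F) hs
      constructor
      · rintro ⟨os, s', hr', h0⟩ us' hus'
        rw [List.suffix_nil.1 hus']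
        exact ⟨ρ, (hcor [] hus os s' hr').1 h0⟩
      · intro h
        exact ⟨_, s, hr, (hcor [] hus _ s hr).2 (hgen [] hus (h [] (List.suffix_refl _)))⟩
    | cons u us ih =>
      intro hus
      have hus0 := (List.suffix_cons u us).trans hus
      have ih := ih hus0
      constructor
      · rintro ⟨os, s', hr', h0⟩ us' hus'
        rcases List.suffix_cons_iff.1 hus' with rfl | hus'
        · exact ⟨ρ, (hcor _ hus os s' hr').1 h0⟩
        · rw [List.map_cons] at hr'
          cases hr' with
          | upd h hc _ _ => exact ih.1 ⟨_, _, h, hc⟩ us' hus'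
      · intro h
        obtain ⟨os, s, hr, h0⟩ := ih.2 fun us' hus' => h us' (hus'.trans (List.suffix_cons u us))
        obtain ⟨s', t, hs', -⟩ := htime.2 _ os s (by
          rw [List.length_map]
          have := hus.length_le
          rw [List.length_cons] at this
          omega) hr h0 (u.toUpdate (4 * H))
        have hr' := hr.upd h0 _ hs'
        exact ⟨_, s', hr', (hcor _ hus _ s' hr').2 (hgen _ hus (h _ (List.suffix_refl _)))⟩
  exact key q (List.suffix_refl q)

theorem sampled_applyGuest {V m : ℕ} {N : (ℕ → F) → ℕ → ℕ → F} (h : Sampled V N)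
    (us : Updates F) : Sampled V fun ρ => applyGuest m (N ρ) us := by
  induction us with
  | nil => exact h
  | cons u us ih =>
    intro i j
    simp only [applyGuest_cons, GuestUpdate.apply]
    split_ifs
    · exact .inl ⟨_, fun _ => rfl⟩
    · exact ih i j

theorem applyGuest_congr {m : ℕ} {e e' : NatMat F} (h : ∀ i < m, ∀ j < m, e i j = e' i j)
    (us : Updates F) : ∀ i < m, ∀ j < m, applyGuest m e us i j = applyGuest m e' us i j := by
  induction us with
  | nil => exact h
  | cons u us ih =>
    intro i hi j hj
    simp only [applyGuest_cons, GuestUpdate.apply, ih i hi j hj]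

variable [Fintype F]

theorem tapeProb_applyGuest_le {H : ℕ} (hH : 0 < H) (c : Cfg F) (us : Updates F)
    (h : ∃ ρ, Nonsing (applyGuest (4 * H) (c.ent H ρ) us) (range (4 * H))) :
    tapeProb {ω : Tape F | ¬ Nonsing (applyGuest (4 * H) (c.ent H fun k => ω.elt (0, k)) us)
      (range (4 * H))} ≤ (4 * H : ℕ) / (Fintype.card F : ℝ≥0∞) := by
  have hc : ∀ ρ, Nonsing (applyGuest (4 * H) (c.ent H ρ) us) (range (4 * H)) ↔
      Nonsing (applyGuest (4 * H) (fun i j => if i < 4 * H ∧ j < 4 * H then c.ent H ρ i j else 0) us)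
        (range (4 * H)) := fun ρ =>
    Nonsing.congr fun i hi j hj => applyGuest_congr (fun i hi j hj => by simp [hi, hj]) us i
      (mem_range.1 hi) j (mem_range.1 hj)
  have := tapeProb_singular_le (sampled_applyGuest (m := 4 * H) (c.sampled hH) us)
    (K := range (4 * H)) (h.imp fun ρ => (hc ρ).1)
  rw [card_range] at this
  refine le_trans (le_of_eq ?_) this
  congr 1
  ext ω
  exact not_congr (hc _)

/-! ### The probability of an error -/

/-- The configuration that the preprocessing sets up. -/
noncomputable abbrev startCfg (H : ℕ) {n : ℕ} (A : Matrix (Fin n) (Fin n) F) : Cfg F :=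
  stdCfg (blockMat A) (firstBasis H (blockMat A))

/-- The random elements are not in general position, or the guest errs on one of the queries. -/
def Unlucky (D : DynAlg) (W L' : ℕ) {n : ℕ} (H : ℕ) [NeZero (4 * H)] (A : Matrix (Fin n) (Fin n) F)
    (Q : List (Updates F)) : Set (Tape F) :=
  {ω | (∃ x ∈ firstBasis H (blockMat A), ¬ Nonsing (xent H (blockMat A) fun k => ω.elt (0, k))
      (lowerAnd H (insert x ((firstBasis H (blockMat A)).filter (· < x))))) ∨
    ∃ q ∈ Q, (Nonsing ((startCfg H A).ent H fun k => ω.elt (0, k))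
          (range (4 * H)) ∧
        Errs (firstSingular F) D (ω.guest 20) W L'
          (borderMat (4 * H) ((startCfg H A).ent H
            fun k => ω.elt (0, k)))
          fun os => GuestUpdate.schedule (4 * H) q os.length) ∨
      ∃ us, us <:+ q ∧
        (∃ ρ, Nonsing (applyGuest (4 * H) ((startCfg H A).ent H ρ) us)
          (range (4 * H))) ∧
        ¬ Nonsing (applyGuest (4 * H) ((startCfg H A).ent H
            fun k => ω.elt (0, k)) us) (range (4 * H))}

theorem tapeProb_exists_mem_list_le {β : Type*} (l : List β) (E : β → Set (Tape F)) {ε : ℝ≥0∞}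
    (h : ∀ x ∈ l, tapeProb (E x) ≤ ε) : tapeProb {ω | ∃ x ∈ l, ω ∈ E x} ≤ l.length * ε := by
  induction l with
  | nil =>
    have : tapeProb (∅ : Set (Tape F)) = 0 := by unfold tapeProb; exact measure_empty
    simpa using this.le
  | cons x l ih =>
    refine (tapeProb_mono (E' := E x ∪ {ω | ∃ x ∈ l, ω ∈ E x}) fun ω hω => ?_).trans
      ((tapeProb_union_le _ _).trans ?_)
    · obtain ⟨y, hy, hω⟩ := hω
      rcases List.mem_cons.1 hy with rfl | hy
      · exact .inl hω
      · exact .inr ⟨y, hy, hω⟩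
    · rw [List.length_cons, Nat.cast_succ, add_mul, one_mul, add_comm]
      exact add_le_add (ih fun y hy => h y (List.mem_cons_of_mem _ hy)) (h x (by simp))

/-- The border matrix depends on the first `16 H²` random elements only. -/
theorem Cfg.ent_front {H : ℕ} (hH : 0 < H) (c : Cfg F) (ρ : ℕ → F) :
    borderMat (4 * H) (c.ent H fun k => if h : k < 4 * H * (4 * H) then ρ k else 0) =
      borderMat (4 * H) (c.ent H ρ) := by
  ext i j
  simp only [borderMat, Matrix.of_apply]
  have := c.sampled hH i j
  simp only [i.2, j.2, and_self, if_true] at this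
  rcases this with ⟨c', h⟩ | ⟨k, hk, h⟩
  · rw [h, h]
  · rw [h, h, dif_pos hk]

theorem tapeProb_unlucky_le {D : DynAlg} {W L' n H : ℕ} [NeZero (4 * H)] (hH : 0 < H)
    {A : Matrix (Fin n) (Fin n) F} {Q : List (Updates F)} {N ℓ : ℕ} {ε : ℝ≥0∞}
    (hN : Q.length ≤ N) (hℓ : ∀ q ∈ Q, q.length ≤ ℓ)
    (hε : ∀ M : Matrix (Fin (4 * H)) (Fin (4 * H)) F, M.det ≠ 0 → ∀ q : Updates F,
      tapeProb {ω | Errs (firstSingular F) D ω W L' M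
        fun os => GuestUpdate.schedule (4 * H) q os.length} ≤ ε) :
    tapeProb (Unlucky D W L' H A Q) ≤ H * ((2 * H : ℕ) / (Fintype.card F : ℝ≥0∞)) +
      N * (ε + (ℓ + 1 : ℕ) * ((4 * H : ℕ) / (Fintype.card F : ℝ≥0∞))) := by
  classical
  have hlt := (firstBasis_rowBasis H (blockMat A)).lt
  refine (tapeProb_union_le {ω | _} {ω | _}).trans (add_le_add ?_ ?_)
  · refine (tapeProb_biUnion_le _ _).trans ((sum_le_card_nsmul _ _
      ((2 * H : ℕ) / (Fintype.card F : ℝ≥0∞)) fun x hx => ?_).trans ?_)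
    · have hJ : ∀ y ∈ insert x ((firstBasis H (blockMat A)).filter (· < x)), y < H := by
        intro y hy
        simp only [mem_insert, mem_filter] at hy
        rcases hy with rfl | hy
        · exact hlt y hx
        · exact hlt y hy.1
      have hind : LinearIndepOn F (rowv H (blockMat A))
          ((insert x ((firstBasis H (blockMat A)).filter (· < x)) : Finset ℕ) : Set ℕ) := by
        refine (firstBasis_indep (F := F) (B := blockMat A) H le_rfl).mono ?_
        intro y hy
        simp only [coe_insert, coe_filter, Set.mem_insert_iff, Set.mem_ofPred_eq] at hy ⊢
        rcases hy with rfl | hy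
        · exact ⟨hx, hlt y hx⟩
        · exact ⟨hy.1, hlt y hy.1⟩
      refine (tapeProb_singular_le (xent_sampled (blockMat A) hH) (exists_nonsing_xent hJ hind)).trans ?_
      refine ENNReal.div_le_div_right ?_ _
      have : (lowerAnd H (insert x ((firstBasis H (blockMat A)).filter (· < x)))).card ≤ 2 * H := by
        refine (card_le_card (t := range (2 * H)) fun i hi => ?_).trans (by simp)
        rcases mem_lowerAnd.1 hi with h | ⟨y, hy, rfl⟩
        · exact mem_range.2 (by omega)
        · have := hJ y hy
          exact mem_range.2 (by omega)
      exact_mod_cast this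
    · rw [nsmul_eq_mul]
      refine mul_le_mul_left ?_ _
      have : (firstBasis H (blockMat A)).card ≤ H := by
        refine (card_le_card (t := range H) fun i hi => ?_).trans (by simp)
        exact mem_range.2 (hlt i hi)
      exact_mod_cast this
  · refine (tapeProb_exists_mem_list_le Q (fun q => {ω | _} ∪ {ω | _}) fun q hq =>
      (tapeProb_union_le _ _).trans (add_le_add ?_ ?_)).trans
      (mul_le_mul_left (by exact_mod_cast hN) _)
    · set c := startCfg H A
      have := tapeProb_le_of_front (V := 4 * H * (4 * H)) (K := 20) (F := F) (by omega)
        (fun f => {ω | (borderMat (4 * H) (c.ent H fun k =>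
            if h : k < 4 * H * (4 * H) then f ⟨k, h⟩ else 0)).det ≠ 0 ∧
          Errs (firstSingular F) D ω W L' (borderMat (4 * H) (c.ent H fun k =>
            if h : k < 4 * H * (4 * H) then f ⟨k, h⟩ else 0))
            fun os => GuestUpdate.schedule (4 * H) q os.length}) (ε := ε) (fun f => by
          by_cases hd : (borderMat (4 * H) (c.ent H fun k =>
            if h : k < 4 * H * (4 * H) then f ⟨k, h⟩ else 0)).det ≠ 0
          · refine (tapeProb_mono fun ω hω => hω.2).trans (hε _ hd q)
          · refine (tapeProb_mono (E' := {ω | ∃ x ∈ ([] : List ℕ), ω ∈ (Set.univ : Set (Tape F))})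
              fun ω hω => absurd hω.1 hd).trans
              ((tapeProb_exists_mem_list_le (ε := 0) _ _ (by simp)).trans (by simp)))
      refine (tapeProb_mono fun ω hω => ?_).trans this
      have e : borderMat (4 * H) (c.ent H fun k =>
          if h : k < 4 * H * (4 * H) then ω.front (4 * H * (4 * H)) ⟨k, h⟩ else 0) =
          borderMat (4 * H) (c.ent H fun k => ω.elt (0, k)) :=
        c.ent_front hH fun k => ω.elt (0, k)
      simp only [Set.mem_ofPred_eq, e]
      exact ⟨(det_ne_zero_iff fun i j => rfl).2 hω.1, hω.2⟩
    · have h2 := tapeProb_exists_mem_list_le (F := F) q.tails (fun us => {ω : Tape F |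
          (∃ ρ, Nonsing (applyGuest (4 * H) ((startCfg H A).ent H ρ) us) (range (4 * H))) ∧
          ¬ Nonsing (applyGuest (4 * H) ((startCfg H A).ent H
            fun k => ω.elt (0, k)) us) (range (4 * H))})
          (ε := (4 * H : ℕ) / (Fintype.card F : ℝ≥0∞)) (fun us _ => by
          by_cases hρ : ∃ ρ, Nonsing (applyGuest (4 * H) ((startCfg H A).ent H ρ) us) (range (4 * H))
          · exact (tapeProb_mono fun ω hω => hω.2).trans (tapeProb_applyGuest_le hH _ us hρ)
          · refine (tapeProb_mono (E' := {ω | ∃ x ∈ ([] : List ℕ), ω ∈ (Set.univ : Set (Tape F))})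
              fun ω hω => absurd hω.1 hρ).trans
              ((tapeProb_exists_mem_list_le (ε := 0) _ _ (by simp)).trans (by simp)))
      refine (tapeProb_mono fun ω hω => ?_).trans (h2.trans (mul_le_mul_left ?_ _))
      · obtain ⟨us, hus, h⟩ := hω
        exact ⟨us, (List.mem_tails _ _).2 hus, h⟩
      · rw [List.length_tails]
        exact_mod_cast Nat.succ_le_succ (hℓ q hq)

end Guest

end

section

section Preprocessing

variable {ω : Tape F} {W : ℕ} {s : State F}

/-! ### Filling arrays -/

/-- Store the first of the elements of the list whose condition is satisfied. -/
def pick (arr : ℕ) (i : WExp) : List (WExp × FExp) → Cmd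
  | [] => .setF arr i .zero
  | (c, e) :: l => .ite c (.setF arr i e) (pick arr i l)

def pickVal (ω : Tape F) (s : State F) : List (WExp × FExp) → F
  | [] => 0
  | (c, e) :: l => if c.val ω s = 0 then pickVal ω s l else e.val ω s

theorem pick_ok {arr : ℕ} {i : WExp} (hi : i.Fits ω W s) :
    ∀ {l : List (WExp × FExp)}, (∀ x ∈ l, x.1.Fits ω W s ∧ x.2.Fits ω W s) →
    (pick arr i l).Ok ω W s ∧ (pick arr i l).ev ω s = s.putF arr (i.val ω s) (pickVal ω s l)
  | [], _ => ⟨⟨hi, trivial⟩, rfl⟩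
  | (c, e) :: l, h => by
    have h0 := h (c, e) (by simp)
    have ih := pick_ok (arr := arr) hi (l := l) fun x hx => h x (List.mem_cons_of_mem _ hx)
    refine ⟨⟨h0.1, fun _ => ⟨hi, h0.2⟩, fun _ => ih.1⟩, ?_⟩
    simp only [pick, Cmd.ev, pickVal]
    split_ifs
    · exact ih.2
    · rfl

def ctr : WExp := .cell 6 (.const 0)

/-- Fill the first `len` cells of a field array. -/
def fillPick (arr : ℕ) (len : WExp) (l : List (WExp × FExp)) : Cmd := forTo 6 0 len (pick arr ctr l)

theorem fillPick_halts {len arr : ℕ} {e : WExp} {l : List (WExp × FExp)}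
    (v : ℕ → F) (hlen : len < W) (hW : 1 < W)
    (he : ∀ s' : State F, (∀ b, b ≠ 6 → s'.w b = s.w b) → e.Fits ω W s' ∧ e.val ω s' = len)
    (hl : ∀ k < len, ∀ s' : State F, (∀ b, b ≠ 6 → s'.w b = s.w b) →
      (∀ b, b ≠ arr → s'.f b = s.f b) → s'.w 6 0 = k →
      (∀ x ∈ l, x.1.Fits ω W s' ∧ x.2.Fits ω W s') ∧ pickVal ω s' l = v k) :
    Halts ω W (fillPick arr e l) s ((len + 1) * ((pick arr ctr l).cost + e.cost + 20)) fun s' =>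
      (∀ b, b ≠ 6 → s'.w b = s.w b) ∧ (∀ b, b ≠ arr → s'.f b = s.f b) ∧
      (∀ k < len, s'.f arr k = v k) ∧ ∀ k, len ≤ k → s'.f arr k = s.f arr k := by
  refine (fill_halts (fun k => k) v (fun _ _ _ _ h => h) hlen hW he fun k hk s' h1 h2 h3 _ => ?_).imp
    le_rfl fun s' h => ⟨h.1, h.2.1, h.2.2.1, fun k hk => h.2.2.2 k fun j hj => by omega⟩
  obtain ⟨g1, g2⟩ := hl k hk s' h1 h2 h3
  have hc : ctr.Fits ω W s' := by
    simp only [ctr, WExp.Fits]; omega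
  have hv : ctr.val ω s' = k := h3
  obtain ⟨o1, o2⟩ := pick_ok (arr := arr) hc g1
  refine ⟨o1, ?_⟩
  rw [o2, hv, g2]

/-! ### The sizes -/

/-- The smallest power of two that is at least `2 * n + 1`, and its double. -/
def initSizes : Cmd :=
  .seq (.setW 5 (.const 0) (.cell 0 (.const 0))) (.seq (.setW 5 (.const 6) (.const 1))
    (.seq (.loop (.op .lt (par 6) (.op .add (.op .mul (.const 2) (par 0)) (.const 1)))
      (.setW 5 (.const 6) (.op .mul (.const 2) (par 6))))
    (.setW 5 (.const 1) (.op .mul (.const 2) (par 6)))))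

theorem initSizes_halts {n d : ℕ} (hn : s.w 0 0 = n)
    (hd : 2 * n + 1 ≤ 2 ^ d) (hd' : ∀ j < d, 2 ^ j < 2 * n + 1) (hW : 2 * 2 ^ d + 10 < W) :
    Halts ω W initSizes s (40 * (d + 1)) fun s' =>
      s' = ((s.putW 5 0 n).putW 5 6 (2 ^ d)).putW 5 1 (2 * 2 ^ d) := by
  have hloop := Halts.loop (ω := ω) (W := W)
    (c := .op .lt (par 6) (.op .add (.op .mul (.const 2) (par 0)) (.const 1)))
    (p := .setW 5 (.const 6) (.op .mul (.const 2) (par 6))) (B := 6)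
    (fun k s' => k ≤ d ∧ s' = (s.putW 5 0 n).putW 5 6 (2 ^ (d - k)))
    (by
      rintro k s' ⟨hk, rfl⟩
      simp [WExp.Fits, par, WOp.val, WExp.val]
      split_ifs <;> omega)
    (by
      rintro s' ⟨hk, rfl⟩
      simp [par, WOp.val, WExp.val]
      omega)
    (by
      rintro k s' ⟨hk, rfl⟩ hc
      have e1 : d - k = (d - (k + 1)) + 1 := by omega
      have hlt := hd' (d - (k + 1)) (by omega)
      refine (Cmd.Ok.halts (p := .setW 5 (.const 6) (.op .mul (.const 2) (par 6))) ?_ ?_).imp ?_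
        fun _ h => h
      · simp [Cmd.Ok, WExp.Fits, par, WOp.val, WExp.val]
        omega
      · refine ⟨by omega, ?_⟩
        rw [e1, pow_succ]
        apply State.ext' <;> intro a i <;>
          simp [Cmd.ev, par, WOp.val, WExp.val]
        split_ifs <;> simp_all [mul_comm]
      · simp [Cmd.cost, WExp.cost, par]) d
  have h1 : (Cmd.setW 5 (.const 0) (.cell 0 (.const 0))).Ok ω W s := by
    simp [Cmd.Ok, WExp.Fits]; omega
  refine (h1.halts_seq (B := 4 + ((d + 1) * (6 + 9 + 1) + 6)) ?_).imp ?_ fun _ h => h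
  · have h2 : (Cmd.setW 5 (.const 6) (.const 1)).Ok ω W (Cmd.ev ω (.setW 5 (.const 0) (.cell 0 (.const 0))) s) := by
      simp [Cmd.Ok, WExp.Fits]; omega
    refine (h2.halts_seq (B := (d + 1) * (6 + 9 + 1) + 6) ?_).imp ?_ fun _ h => h
    · refine ((hloop _ ⟨le_rfl, ?_⟩).imp ?_ fun _ h => h).seq ?_
      · simp [Cmd.ev, WExp.val, hn]
      · simp [WExp.cost, par]
      · rintro s₁ ⟨⟨j, hj, -, rfl⟩, hc⟩
        have hj0 : j = 0 := by
          by_contra hne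
          have := hd' (d - j) (by omega)
          simp [par, WOp.val, WExp.val] at hc
          omega
        subst hj0
        refine (Cmd.Ok.halts ?_ ?_).imp ?_ fun _ h => h
        · simp [Cmd.Ok, WExp.Fits, par, WOp.val, WExp.val]
          omega
        · simp [Cmd.ev, par, WOp.val, WExp.val]
        · simp [Cmd.cost, WExp.cost, par]
    · simp [Cmd.cost, WExp.cost]
  · simp [Cmd.cost, WExp.cost]; omega

/-! ### The diagonal blocks -/

def andE (x y : WExp) : WExp := .op .mul x y
def ltE (x y : WExp) : WExp := .op .lt x y
def eqE (x y : WExp) : WExp := .op .eq x y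
def addE (x y : WExp) : WExp := .op .add x y
def subE (x y : WExp) : WExp := .op .sub x y
def mulE (x y : WExp) : WExp := .op .mul x y
def divE (x y : WExp) : WExp := .op .div x y
def modE (x y : WExp) : WExp := .op .mod x y

theorem mul_ite_one {p q : Prop} [Decidable p] [Decidable q] :
    (if p then 1 else 0) * (if q then 1 else 0) = if p ∧ q then 1 else 0 := by
  split_ifs <;> simp_all

/-- The entries of the diagonal blocks `A` and `Aᵀ`. -/
def diagList : List (WExp × FExp) :=
  let x := divE ctr (par 6)
  let y := modE ctr (par 6)
  [(andE (ltE x (par 0)) (ltE y (par 0)), .cell 0 (addE (mulE x (par 0)) y)),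
   (ltE x (par 0), .zero), (ltE y (par 0), .zero),
   (andE (ltE x (mulE (.const 2) (par 0))) (ltE y (mulE (.const 2) (par 0))),
    .cell 0 (addE (mulE (subE y (par 0)) (par 0)) (subE x (par 0))))]

def fillDiag : Cmd := fillPick 4 (mulE (par 6) (par 6)) diagList

theorem rowMajor_mk {n : ℕ} (A : Matrix (Fin n) (Fin n) F) {x y : ℕ} (hx : x < n) (hy : y < n) :
    rowMajor A (x * n + y) = A ⟨x, hx⟩ ⟨y, hy⟩ := by
  rw [rowMajor_of_lt A (show x * n + y < n * n by nlinarith)]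
  congr 1
  · apply Fin.ext
    simp only
    rw [add_comm, Nat.add_mul_div_right _ _ (by omega), Nat.div_eq_of_lt hy, zero_add]
  · apply Fin.ext
    simp only
    rw [add_comm, Nat.add_mul_mod_self_right, Nat.mod_eq_of_lt hy]

theorem fillDiag_halts {n H : ℕ} (A : Matrix (Fin n) (Fin n) F)
    (hn : s.w 5 0 = n) (hH : s.w 5 6 = H) (hnH : 2 * n < H) (hA : s.f 0 = rowMajor A)
    (hW : 4 * H * (4 * H) + 30 < W) :
    Halts ω W fillDiag s ((H * H + 1) * ((pick 4 ctr diagList).cost + 30)) fun s' =>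
      (∀ b, b ≠ 6 → s'.w b = s.w b) ∧ (∀ b, b ≠ 4 → s'.f b = s.f b) ∧
      ∀ x < H, ∀ y < H, s'.f 4 (x * H + y) = blockMat A x y := by
  refine (fillPick_halts (len := H * H) (fun k => blockMat A (k / H) (k % H)) (by nlinarith) (by nlinarith)
    (fun s' h => ?_) fun k hk s' h1 h2 h3 => ?_).imp (Nat.mul_le_mul_left _ ?_) fun s' h => ⟨h.1, h.2.1, fun x hx y hy => ?_⟩
  · simp only [mulE, WExp.Fits, WExp.val, WOp.val, par, h 5 (by omega), hH]
    refine ⟨⟨?_, ?_, ?_⟩, trivial⟩ <;> nlinarith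
  · have e0 : s'.w 5 0 = n := by rw [h1 5 (by omega), hn]
    have e6 : s'.w 5 6 = H := by rw [h1 5 (by omega), hH]
    have eA : s'.f 0 = rowMajor A := by rw [h2 0 (by omega), hA]
    have hx : k / H < H := Nat.div_lt_of_lt_mul hk
    have hy : k % H < H := Nat.mod_lt _ (by omega)
    have b1 : k / H * n + k % H < W := by nlinarith
    have b2 : k / H * n < W := by nlinarith
    have b3 : (k % H - n) * n + (k / H - n) < W := by
      have : k % H - n < H := by omega
      have : k / H - n < H := by omega
      nlinarith
    have b4 : (k % H - n) * n < W := by omega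
    have b5 : 2 * n < W := by nlinarith
    have b6 : k / H < W := by nlinarith
    have b7 : k % H < W := by nlinarith
    have b8 : (30 : ℕ) < W := by omega
    simp only [List.mem_cons, List.not_mem_nil, or_false, forall_eq_or_imp, forall_eq, diagList, andE, ltE, addE,
      mulE, subE, divE, modE, ctr, par, WExp.Fits, FExp.Fits, WExp.val, WOp.val, h3, e0, e6, pickVal,
      FExp.val, eA, mul_ite_one]
    generalize hxx : k / H = x at *
    generalize hyy : k % H = y at *
    refine ⟨?_, ?_⟩
    · refine ⟨?_, ?_, ?_, ?_⟩ <;> (repeat' apply And.intro) <;> first | trivial | (split_ifs <;> omega) | omega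
    · unfold blockMat
      by_cases c1 : x < n <;> by_cases c2 : y < n <;> simp only [c1, c2, if_true, if_false, and_self, and_true, and_false, one_ne_zero, dif_pos, dif_neg, not_false_eq_true]
      · exact rowMajor_mk A c1 c2
      · rw [dif_neg (by omega)]
      · rw [dif_neg (by omega)]
      · by_cases c3 : x < 2 * n ∧ y < 2 * n
        · rw [dif_pos (by omega), if_pos c3]
          exact rowMajor_mk A (by omega) (by omega)
        · rw [dif_neg (by omega), if_neg c3]; rfl
  · simp [mulE, WExp.cost, par]
  · have := h.2.2.1 (x * H + y) (by nlinarith)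
    rw [this, block_div hy, block_mod hy]

end Preprocessing

end

section Preprocessing

/-- The entries of the matrix for the elimination. -/
def elimList : List (WExp × FExp) :=
  let i := divE ctr (par 1)
  let j := modE ctr (par 1)
  [(andE (ltE i (par 6)) (eqE i j), .one), (andE (ltE i (par 6)) (ltE j (par 6)), .zero),
   (ltE i (par 6), .rand 0 (addE (mulE (addE (par 6) i) (mulE (.const 4) (par 6))) (addE (par 6) j))),
   (ltE j (par 6), .sub .zero (.cell 4 (addE (mulE (subE i (par 6)) (par 6)) j)))]

def fillElim : Cmd := fillPick 2 (mulE (par 1) (par 1)) elimList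

theorem fillElim_halts {ω : Tape F} {W H : ℕ} {s : State F} {B : NatMat F}
    (hS : s.w 5 1 = 2 * H) (hH : s.w 5 6 = H) (hH0 : 0 < H)
    (hB : ∀ x < H, ∀ y < H, s.f 4 (x * H + y) = B x y)
    (hW : 4 * H * (4 * H) + 30 < W) :
    Halts ω W fillElim s ((2 * H * (2 * H) + 1) * ((pick 2 ctr elimList).cost + 30)) fun s' =>
      (∀ b, b ≠ 6 → s'.w b = s.w b) ∧ (∀ b, b ≠ 2 → s'.f b = s.f b) ∧
      ∀ i < 2 * H, ∀ j < 2 * H, s'.f 2 (i * (2 * H) + j) = xent H B (fun k => ω.elt (0, k)) i j := by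
  refine (fillPick_halts (len := 2 * H * (2 * H))
    (fun k => xent H B (fun k => ω.elt (0, k)) (k / (2 * H)) (k % (2 * H))) (by nlinarith) (by omega)
    (fun s' h => ?_) fun k hk s' h1 h2 h3 => ?_).imp (Nat.mul_le_mul_left _ ?_)
    fun s' h => ⟨h.1, h.2.1, fun x hx y hy => ?_⟩
  · simp only [mulE, WExp.Fits, WExp.val, WOp.val, par, h 5 (by omega), hS]
    refine ⟨⟨?_, ?_, ?_⟩, trivial⟩ <;> nlinarith
  · have e0 : s'.w 5 1 = 2 * H := by rw [h1 5 (by omega), hS]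
    have e6 : s'.w 5 6 = H := by rw [h1 5 (by omega), hH]
    have hi : k / (2 * H) < 2 * H := Nat.div_lt_of_lt_mul hk
    have hj : k % (2 * H) < 2 * H := Nat.mod_lt _ (by omega)
    have eB : ∀ x < H, ∀ y < H, s'.f 4 (x * H + y) = B x y := by
      rw [h2 4 (by omega)]; exact hB
    have b0 : 0 < H * H := by positivity
    simp only [List.mem_cons, List.not_mem_nil, or_false, forall_eq_or_imp, forall_eq, elimList, andE,
      ltE, eqE, addE, mulE, subE, divE, modE, ctr, par, WExp.Fits, FExp.Fits, WExp.val, WOp.val, h3, e0, e6,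
      pickVal, FExp.val, mul_ite_one]
    generalize k / (2 * H) = i at *
    generalize k % (2 * H) = j at *
    have b1 : (H + i) * (4 * H) + (H + j) < W := by nlinarith
    have b2 : (i - H) * H + j < W := by
      have : i - H < H := by omega
      nlinarith
    have b8 : 4 * H < W := by nlinarith
    refine ⟨?_, ?_⟩
    · have b9 : (30 : ℕ) < W := by omega
      refine ⟨?_, ?_, ?_, ?_⟩ <;> (repeat' apply And.intro) <;>
        first | trivial | omega | (split_ifs <;> omega)
    · by_cases c1 : i < H <;> by_cases c2 : j < H
      · rw [xent, Nat.div_eq_of_lt c1, Nat.div_eq_of_lt c2, Nat.mod_eq_of_lt c1, Nat.mod_eq_of_lt c2]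
        by_cases c3 : i = j <;> simp [c1, c2, c3]
      · obtain ⟨y, rfl⟩ := Nat.exists_eq_add_of_le (not_lt.1 c2)
        have hy : y < H := by omega
        have e := block_div (b := 1) hy
        have e' := block_mod (b := 1) hy
        rw [one_mul] at e e'
        have c3 : i ≠ H + y := by omega
        rw [xent, Nat.div_eq_of_lt c1, e, Nat.mod_eq_of_lt c1, e']
        simp only [c1, c2, c3, if_true, if_false, and_false, one_ne_zero, randR]
        congr 2
        ring
      · obtain ⟨x, rfl⟩ := Nat.exists_eq_add_of_le (not_lt.1 c1)
        have hx : x < H := by omega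
        have e := block_div (b := 1) hx
        have e' := block_mod (b := 1) hx
        rw [one_mul] at e e'
        rw [xent, Nat.div_eq_of_lt c2, e, Nat.mod_eq_of_lt c2, e']
        simp only [c1, c2, if_true, if_false, and_true, false_and, one_ne_zero, add_tsub_cancel_left,
          eB x hx j c2, zero_sub]
      · obtain ⟨y, rfl⟩ := Nat.exists_eq_add_of_le (not_lt.1 c2)
        obtain ⟨x, rfl⟩ := Nat.exists_eq_add_of_le (not_lt.1 c1)
        have hx : x < H := by omega
        have hy : y < H := by omega
        have e := block_div (b := 1) hx
        have e2 := block_div (b := 1) hy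
        rw [one_mul] at e e2
        rw [xent, e, e2]
        simp
  · simp [mulE, WExp.cost, par]
  · have := h.2.2.1 (x * (2 * H) + y) (by nlinarith)
    rw [this, block_div hy, block_mod hy]

def codeE : WExp :=
  addE (mulE (divE (divE ctr (mulE (.const 4) (par 6))) (par 6)) (.const 4))
    (divE (modE ctr (mulE (.const 4) (par 6))) (par 6))

/-- The entries of the guest's matrix. -/
def borderList : List (WExp × FExp) :=
  let x := modE (divE ctr (mulE (.const 4) (par 6))) (par 6)
  let y := modE (modE ctr (mulE (.const 4) (par 6))) (par 6)
  let is := fun c => eqE codeE (.const c)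
  let ind := .cell 9 (addE (par 6) x)
  [(is 0, .cell 4 (addE (mulE x (par 6)) y)), (is 6, .rand 0 ctr),
   (andE (is 13) (ltE x y), .zero), (is 13, .rand 0 ctr), (ltE x y, .zero), (ltE y x, .zero),
   (is 1, .one), (is 4, .one), (is 15, .one), (andE (is 9) ind, .one), (is 9, .zero),
   (andE (is 10) ind, .zero), (is 10, .one)]

def fillBorder : Cmd :=
  fillPick 20 (mulE (mulE (.const 4) (par 6)) (mulE (.const 4) (par 6))) borderList

set_option maxHeartbeats 1000000 in
theorem fillBorder_halts {ω : Tape F} {W H : ℕ} {s : State F} {B : NatMat F} {I : Finset ℕ}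
    (hH : s.w 5 6 = H) (hH0 : 0 < H)
    (hB : ∀ x < H, ∀ y < H, s.f 4 (x * H + y) = B x y)
    (hI : ∀ x < H, s.w 9 (H + x) = if x ∈ I then 1 else 0)
    (hW : 4 * H * (4 * H) + 30 < W) :
    Halts ω W fillBorder s ((4 * H * (4 * H) + 1) * ((pick 20 ctr borderList).cost + 40)) fun s' =>
      (∀ b, b ≠ 6 → s'.w b = s.w b) ∧ (∀ b, b ≠ 20 → s'.f b = s.f b) ∧
      (∀ k < 4 * H * (4 * H), s'.f 20 k = (stdCfg B I).ent H (fun k => ω.elt (0, k)) (k / (4 * H)) (k % (4 * H))) ∧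
      ∀ k, 4 * H * (4 * H) ≤ k → s'.f 20 k = s.f 20 k := by
  refine (fillPick_halts (len := 4 * H * (4 * H))
    (fun k => (stdCfg B I).ent H (fun k => ω.elt (0, k)) (k / (4 * H)) (k % (4 * H))) (by omega) (by omega)
    (fun s' h => ?_) fun k hk s' h1 h2 h3 => ?_).imp (Nat.mul_le_mul_left _ ?_) fun s' h => h
  · simp only [mulE, WExp.Fits, WExp.val, WOp.val, par, h 5 (by omega), hH]
    refine ⟨⟨⟨?_, ?_, ?_⟩, ⟨?_, ?_, ?_⟩, ?_⟩, trivial⟩ <;> nlinarith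
  · have e6 : s'.w 5 6 = H := by rw [h1 5 (by omega), hH]
    have hi : k / (4 * H) < 4 * H := Nat.div_lt_of_lt_mul hk
    have hj : k % (4 * H) < 4 * H := Nat.mod_lt _ (by omega)
    have hk' : k = k / (4 * H) * (4 * H) + k % (4 * H) := (Nat.div_add_mod' _ _).symm
    have eB : ∀ x < H, ∀ y < H, s'.f 4 (x * H + y) = B x y := by
      rw [h2 4 (by omega)]; exact hB
    have eI : ∀ x < H, s'.w 9 (H + x) = if x ∈ I then 1 else 0 := by
      rw [h1 9 (by omega)]; exact hI
    simp only [List.mem_cons, List.not_mem_nil, or_false, forall_eq_or_imp, forall_eq, borderList, codeE, andE,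
      ltE, eqE, addE, mulE, divE, modE, ctr, par, WExp.Fits, FExp.Fits, WExp.val, WOp.val, h3, e6,
      pickVal, FExp.val]
    have a4 : k / (4 * H) / H < 4 := by rw [Nat.div_lt_iff_lt_mul hH0]; exact hi
    have b4 : k % (4 * H) / H < 4 := by rw [Nat.div_lt_iff_lt_mul hH0]; exact hj
    have hx : k / (4 * H) % H < H := Nat.mod_lt _ hH0
    have hy : k % (4 * H) % H < H := Nat.mod_lt _ hH0
    have hik : k / (4 * H) = k / (4 * H) / H * H + k / (4 * H) % H := (Nat.div_add_mod' _ _).symm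
    have hjk : k % (4 * H) = k % (4 * H) / H * H + k % (4 * H) % H := (Nat.div_add_mod' _ _).symm
    rw [eI _ hx, eB _ hx _ hy]
    simp only [mul_ite_one]
    unfold Cfg.ent Cfg.blk
    generalize hi' : k / (4 * H) = i at *
    generalize hj' : k % (4 * H) = j at *
    generalize i / H = a at *
    generalize j / H = b at *
    generalize i % H = x at *
    generalize j % H = y at *
    have c1 : H + x < W := by nlinarith
    have c2 : x * H + y < W := by nlinarith
    have c3 : 4 * H < W := by nlinarith
    refine ⟨?_, ?_⟩
    · have c4 : (30 : ℕ) < W := by omega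
      have d1 : ∀ p : Prop, [Decidable p] → (if p then 1 else 0) < W := fun p _ => by
        split_ifs <;> omega
      simp only [d1]
      refine ⟨?_, ?_, ?_, ?_, ?_, ?_, ?_, ?_, ?_, ?_, ?_, ?_, ?_⟩ <;> (repeat' apply And.intro) <;>
        first | trivial | omega
    · subst hik
      subst hjk
      rcases lt_trichotomy x y with h | h | h
      · have hne : x ≠ y := by omega
        have hnle : ¬ y ≤ x := by omega
        have hnlt : ¬ y < x := by omega
        interval_cases a <;> interval_cases b <;>
          simp [h, hne, hnle, stdCfg, randL, randR]
        rw [hk']; congr 2; ring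
      · subst h
        interval_cases a <;> interval_cases b <;>
          simp [stdCfg, randL, randR]
        · rw [hk']; congr 2; ring
        · rw [hk']; congr 2; ring
      · have hne : x ≠ y := by omega
        have hle : y ≤ x := by omega
        have hnlt : ¬ x < y := by omega
        interval_cases a <;> interval_cases b <;>
          simp [h, hne, hle, hnlt, stdCfg, randL, randR]
        · rw [hk']; congr 2; ring
        · rw [hk']; congr 2; ring
  · simp [mulE, WExp.cost, par]

end Preprocessing

section

section Preprocessing

variable {ω : Tape F} {W : ℕ} {s : State F}

/-! ### Lists in the memory -/

/-- List `h`, as it is stored. -/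
def State.lst (s : State F) (h : ℕ) : Lst := ⟨s.w 2 h, s.w (3 + h), s.w (7 + h)⟩

def insertCmd (h : ℕ) (x : WExp) : Cmd :=
  .seq (.setW (3 + h) (.cell 2 (.const h)) x) (.seq (.setW 2 (.const h) (addE (.cell 2 (.const h)) (.const 1)))
    (.setW (7 + h) x (.cell 2 (.const h))))

/-- Arrays outside of the lists are unchanged. -/
def ListFrame (s s' : State F) : Prop :=
  (∀ b, b < 2 ∨ 5 ≤ b → b ≠ 7 → b ≠ 8 → s'.w b = s.w b) ∧ s'.f = s.f

theorem insertCmd_ev {h k a i : ℕ} (hh : h < 2)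
    (ha : 5 ≤ a) (ha7 : a ≠ 7) (ha8 : a ≠ 8) (hk : s.w a i = k) (hi : i < W)
    (hW : (s.lst h).cnt + 1 < W) (hW' : 10 < W) :
    (insertCmd h (.cell a (.const i))).Ok ω W s ∧
    ∀ s', s' = (insertCmd h (.cell a (.const i))).ev ω s → ListFrame s s' ∧
      s'.lst h = (s.lst h).insert k ∧ ∀ h' < 2, h' ≠ h → s'.lst h' = s.lst h' := by
  have e2 : a ≠ 2 := by omega
  have e3 : a ≠ 3 + h := by omega
  refine ⟨?_, ?_⟩
  · simp only [State.lst] at hW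
    simp [insertCmd, Cmd.Ok, Cmd.ev, WExp.Fits, WExp.val, WOp.val, addE, show ¬ 2 = 3 + h by omega]
    omega
  · rintro s' rfl
    refine ⟨⟨fun b hb h7 h8 => ?_, rfl⟩, ?_, fun h' hh' hne => ?_⟩
    · simp [insertCmd, Cmd.ev]
      rw [if_neg (by omega), if_neg (by omega), if_neg (by omega)]
    · simp [insertCmd, Cmd.ev, WExp.val, WOp.val, addE, State.lst, Lst.insert, e2, e3, hk,
        show ¬ 2 = 3 + h by omega, show ¬ 2 = 7 + h by omega, 
        show ¬ 3 + h = 2 by omega, show ¬ 7 + h = 2 by omega]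
    · simp [insertCmd, Cmd.ev, WExp.val, WOp.val, addE, State.lst, e2, e3, hk, hne,
        show ¬ 2 = 3 + h by omega, show ¬ 2 = 7 + h by omega, show ¬ 3 + h' = 7 + h by omega,
        show ¬ 3 + h' = 2 by omega, show ¬ 7 + h' = 2 by omega, show ¬ 7 + h' = 3 + h by omega]

def buildStep (h : ℕ) (e : WExp) : Cmd := .ite (.cell 9 e) (insertCmd h ctr) .skip

theorem buildStep_ev {h k y : ℕ} {e : WExp} {I : Finset ℕ} (hh : h < 2)
    (hk : s.w 6 0 = k) (he : e.Fits ω W s) (hv : s.w 9 (e.val ω s) = if y ∈ I then 1 else 0)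
    (hW : (s.lst h).cnt + 1 < W) (hW' : 10 < W) :
    (buildStep h e).Ok ω W s ∧
    ∀ s', s' = (buildStep h e).ev ω s → ListFrame s s' ∧
      s'.lst h = (if y ∈ I then (s.lst h).insert k else s.lst h) ∧
      ∀ h' < 2, h' ≠ h → s'.lst h' = s.lst h' := by
  obtain ⟨o, p⟩ := insertCmd_ev (ω := ω) (W := W) (h := h) (a := 6) (i := 0) hh (by omega) (by omega)
    (by omega) hk (by omega) hW hW'
  refine ⟨⟨he, fun _ => o, fun _ => trivial⟩, ?_⟩
  rintro s' rfl
  simp only [buildStep, Cmd.ev, WExp.val, hv]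
  by_cases hy : y ∈ I
  · simp only [hy, if_true, one_ne_zero, if_false]
    exact p _ rfl
  · simp only [hy, if_true, if_false]
    exact ⟨⟨fun _ _ _ _ => rfl, rfl⟩, by simp, by simp⟩

def buildBody : Cmd :=
  .seq (buildStep 0 (addE (par 6) ctr)) (buildStep 1 (addE (par 6) (addE (par 0) ctr)))

def buildLists : Cmd := forTo 6 0 (par 0) buildBody

theorem buildLists_halts {n H : ℕ} {I : Finset ℕ} (hn : s.w 5 0 = n)
    (hH : s.w 5 6 = H) (hnH : 2 * n < H) (hI : ∀ x < H, s.w 9 (H + x) = if x ∈ I then 1 else 0)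
    (h0 : ∀ h < 2, s.lst h = .empty) (hW : 4 * H * (4 * H) + 30 < W) :
    Halts ω W buildLists s ((n + 1) * (buildBody.cost + 30)) fun s' =>
      (∀ b, b < 2 ∨ 5 ≤ b → b ≠ 6 → b ≠ 7 → b ≠ 8 → s'.w b = s.w b) ∧ s'.f = s.f ∧
      ∀ h < 2, s'.lst h = initLst n h I n := by
  have b1 : 2 * H + 2 * H < W := by nlinarith
  refine (Halts.forTo (ω := ω) (W := W) (a := 6) (x := 0) (e := par 0) (p := buildBody) (B := buildBody.cost)
    (len := n) (fun k s' => (∀ b, b < 2 ∨ 5 ≤ b → b ≠ 6 → b ≠ 7 → b ≠ 8 → s'.w b = s.w b) ∧ s'.f = s.f ∧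
      s'.w 6 0 = k ∧ ∀ h < 2, s'.lst h = initLst n h I k)
    (by omega) (by omega) (by omega) ?_ ?_ ?_).imp ?_ ?_
  · refine ⟨fun b hb h6 h7 h8 => by simp [h6], rfl, by simp, fun h hh => ?_⟩
    have := h0 h hh
    simp only [State.lst, State.putW_w] at this ⊢
    rw [if_neg (by omega), if_neg (by omega), if_neg (by omega)]
    exact this
  · rintro k s' ⟨h1, h2, h3, h4⟩
    refine ⟨by simp [par, WExp.Fits]; omega, ?_, h3⟩
    simp only [par, WExp.val]
    rw [h1 5 (by omega) (by omega) (by omega) (by omega), hn]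
  · rintro k s₀ hk ⟨h1, h2, h3, h4⟩
    have w5 : s₀.w 5 = s.w 5 := h1 5 (by omega) (by omega) (by omega) (by omega)
    have w9 : s₀.w 9 = s.w 9 := h1 9 (by omega) (by omega) (by omega) (by omega)
    have hcnt : ∀ h < 2, (s₀.lst h).cnt + 1 < W := fun h hh => by
      rw [h4 h hh]
      have := (initLst_spec (n := n) (h := h) (I := I) k (by omega)).1.cnt_le
      omega
    obtain ⟨o1, p1⟩ := buildStep_ev (ω := ω) (W := W) (h := 0) (k := k) (y := k) (I := I)
      (e := addE (par 6) ctr) (s := s₀) (by omega) h3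
      (by simp [addE, par, ctr, WExp.Fits, WOp.val, WExp.val, w5, hH, h3]; omega)
      (by
        simp only [addE, par, ctr, WOp.val, WExp.val, w5, hH, h3, w9]
        exact hI k (by omega)) (hcnt 0 (by omega)) (by omega)
    obtain ⟨r, hr⟩ : ∃ r, r = (buildStep 0 (addE (par 6) ctr)).ev ω s₀ := ⟨_, rfl⟩
    obtain ⟨⟨f1, f2⟩, l0, l1⟩ := p1 r hr
    have v5 : r.w 5 = s.w 5 := by rw [f1 5 (by omega) (by omega) (by omega), w5]
    have v6 : r.w 6 0 = k := by rw [f1 6 (by omega) (by omega) (by omega), h3]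
    have v9 : r.w 9 = s.w 9 := by rw [f1 9 (by omega) (by omega) (by omega), w9]
    obtain ⟨o2, p2⟩ := buildStep_ev (ω := ω) (W := W) (h := 1) (k := k) (y := n + k) (I := I)
      (e := addE (par 6) (addE (par 0) ctr)) (s := r) (by omega) v6
      (by simp [addE, par, ctr, WExp.Fits, WOp.val, WExp.val, v5, hH, v6, hn]; omega)
      (by
        simp only [addE, par, ctr, WOp.val, WExp.val, v5, hH, v6, v9, hn]
        exact hI (n + k) (by omega)) (by rw [l1 1 (by omega) (by omega)]; exact hcnt 1 (by omega)) (by omega)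
    have eb : buildBody.ev ω s₀ = (buildStep 1 (addE (par 6) (addE (par 0) ctr))).ev ω r := by
      rw [hr]; rfl
    obtain ⟨⟨g1, g2⟩, m1, m0⟩ := p2 _ eb
    refine Cmd.Ok.halts (p := buildBody) ⟨o1, hr ▸ o2⟩ ⟨?_, fun b hb h6 h7 h8 => ?_, ?_, by simp, ?_⟩
    · rw [g1 6 (by omega) (by omega) (by omega), v6]
    · rw [State.putW_w, if_neg h6, g1 b (by omega) h7 h8, f1 b (by omega) h7 h8, h1 b hb h6 h7 h8]
    · rw [State.putW_f, g2, f2, h2]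
    · intro h hh
      have e : ((buildBody.ev ω s₀).putW 6 0 (k + 1)).lst h = (buildBody.ev ω s₀).lst h := by
        simp only [State.lst, State.putW_w]
        rw [if_neg (by omega), if_neg (by omega), if_neg (by omega)]
      rw [e, initLst]
      interval_cases h
      · rw [m0 0 (by omega) (by omega), l0, h4 0 (by omega), zero_mul, zero_add]
      · rw [m1, l1 1 (by omega) (by omega), h4 1 (by omega), one_mul]
  · refine Nat.mul_le_mul_left _ ?_
    simp [par, WExp.cost]
  · rintro s' ⟨h1, h2, h3, h4⟩
    exact ⟨h1, h2, h4⟩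

/-! ### The preprocessing -/

def prepCmd (p : Cmd) (D : DynAlg) : Cmd :=
  .seq initSizes (.seq fillDiag (.seq fillElim (.seq (pushTask (.const 0) (par 1) 0) (.seq (elimLoop p)
    (.seq fillBorder (.seq (.setW 20 (.const 0) (mulE (.const 4) (par 6))) (.seq (D.prep.shift 20)
      buildLists)))))))

def prepSum (x₁ x₂ x₃ x₄ : ℕ) : ℕ := 200 + 2 * x₁ + 5 * x₂ + 17 * x₃ + x₄

def prepConst : ℕ :=
  prepSum ((pick 4 ctr diagList).cost + 30) ((pick 2 ctr elimList).cost + 30)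
    ((pick 20 ctr borderList).cost + 40) (buildBody.cost + 30)

theorem prep_time {d H n E T : ℕ} (x₁ x₂ x₃ x₄ : ℕ) (hH0 : 0 < H) (hdH : d < H) (hnH : 2 * n < H) :
    40 * (d + 1) + ((H * H + 1) * x₁ + ((2 * H * (2 * H) + 1) * x₂ + (40 + (E + 4 +
      ((4 * H * (4 * H) + 1) * x₃ + (10 + (T + (n + 1) * x₄))))))) ≤
    prepSum x₁ x₂ x₃ x₄ * (H * H) + E + T := by
  have hHH : H ≤ H * H := by nlinarith
  have y₁ : (H * H + 1) * x₁ ≤ 2 * (H * H) * x₁ := Nat.mul_le_mul_right _ (by omega)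
  have y₂ : (2 * H * (2 * H) + 1) * x₂ ≤ 5 * (H * H) * x₂ := Nat.mul_le_mul_right _ (by nlinarith)
  have y₃ : (4 * H * (4 * H) + 1) * x₃ ≤ 17 * (H * H) * x₃ := Nat.mul_le_mul_right _ (by nlinarith)
  have y₄ : (n + 1) * x₄ ≤ (H * H) * x₄ := Nat.mul_le_mul_right _ (by omega)
  have e : prepSum x₁ x₂ x₃ x₄ * (H * H) = 200 * (H * H) + 2 * (H * H) * x₁ +
      5 * (H * H) * x₂ + 17 * (H * H) * x₃ + (H * H) * x₄ := by rw [prepSum]; ring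
  rw [e]
  omega

theorem elimLoop_halts {p : Cmd} {S l : ℕ} {TM : ℕ → ℕ}
    (hc : ElimCtx F p W S TM) (ht : Task s S 0 0 (2 ^ l) 0) (hl : 3 * l + 5 < W) (hS : 2 ^ l = S) :
    Halts ω W (elimLoop p) s (elimTime p TM l + 4) fun s' =>
      ElimFrame s s' 0 ∧ ElimPost S s s' (Ico 0 S) := by
  obtain ⟨s', h1, h2, h3, h4⟩ := elim_steps (ω := ω) hc l s 0 0 ht (by omega) (by omega)
  rw [zero_add, hS] at h4
  have hlast : Exec ω W (elimLoop p) s' s' ((par 4).cost + 1) :=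
    .loopStop (by simp only [par, WExp.Fits]; omega) (by simp [par, WExp.val, h3])
  obtain ⟨t, e, hle⟩ := h1 _ _ hlast
  exact ⟨s', t, e, by simp [par, WExp.cost] at hle; omega, h2, h4⟩

/-- The initial matrix of the guest. -/
abbrev guestMat {n : ℕ} (A : Matrix (Fin n) (Fin n) F) (H : ℕ) (ω : Tape F) (I : Finset ℕ) :
    Matrix (Fin (4 * H)) (Fin (4 * H)) F :=
  borderMat (4 * H) ((stdCfg (blockMat A) I).ent H fun k => ω.elt (0, k))

set_option maxHeartbeats 1000000 in
theorem prepCmd_halts {WD n d H TD : ℕ} {p : Cmd} {D : DynAlg} {TM : ℕ → ℕ}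
    (A : Matrix (Fin n) (Fin n) F) (hHd : H = 2 ^ d) (hnH : 2 * n < H) (hd' : ∀ j < d, 2 ^ j < 2 * n + 1)
    (hc : ElimCtx F p W (2 * H) TM) (hW : 4 * H * (4 * H) + 30 < W) (hWD : WD ≤ W)
    (hD : ∀ I : Finset ℕ, (guestMat A H ω I).det ≠ 0 →
      ∃ g t, Exec (ω.guest 20) WD D.prep
        (initState (guestMat A H ω I)) g t ∧ t ≤ TD) :
    Halts ω W (prepCmd p D) (initState A) (prepConst * (H * H) + elimTime p TM (d + 1) + TD) fun s' =>
      s'.w 5 0 = n ∧ s'.w 5 6 = H ∧ s'.w 13 0 = 0 ∧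
      ∃ I, (∃ G K, Elim (xent H (blockMat A) fun k => ω.elt (0, k)) G K (Ico 0 (2 * H)) ∧
          I = upperPart H K) ∧
        (∀ h < 2, s'.lst h = initLst n h I n) ∧
        ∃ t, Exec (ω.guest 20) WD D.prep
          (initState (guestMat A H ω I))
          (s'.guest 20) t := by
  have hH0 : 0 < H := by omega
  have hdH : d < H := by rw [hHd]; exact Nat.lt_two_pow_self
  have q1 : 2 * H + 2 * H < W := by nlinarith
  -- the sizes
  have step1 := initSizes_halts (ω := ω) (W := W) (n := n) (d := d) (s := initState A) (by simp [initState])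
    (by omega) hd' (by omega)
  rw [← hHd] at step1
  set s₁ := (((initState A).putW 5 0 n).putW 5 6 H).putW 5 1 (2 * H) with hs₁
  have w1 : ∀ b, b ≠ 0 → b ≠ 5 → s₁.w b = fun _ => 0 := by
    intro b h0 h5
    funext k
    simp [hs₁, h5, initState, h0]
  have f1 : ∀ b, b ≠ 0 → s₁.f b = fun _ => 0 := by
    intro b h0
    simp [hs₁, initState, h0]
  have c50 : s₁.w 5 0 = n := by simp [hs₁]
  have c56 : s₁.w 5 6 = H := by simp [hs₁]
  have c51 : s₁.w 5 1 = 2 * H := by simp [hs₁]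
  have c54 : s₁.w 5 4 = 0 := by simp [hs₁, initState]
  have f10 : s₁.f 0 = rowMajor A := by simp [hs₁, initState]
  clear_value s₁
  -- the diagonal blocks
  have step2 := fillDiag_halts (ω := ω) (W := W) A c50 c56 hnH f10 hW
  have htime := prep_time (E := elimTime p TM (d + 1)) (T := TD) ((pick 4 ctr diagList).cost + 30)
    ((pick 2 ctr elimList).cost + 30) ((pick 20 ctr borderList).cost + 40) (buildBody.cost + 30) hH0 hdH hnH
  refine Halts.imp (step1.seq ?_) htime fun _ h => h
  intro s' hs'
  rw [hs']
  clear hs' s'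
  refine step2.seq ?_
  rintro s₂ ⟨w2, f2, f24⟩
  -- the matrix for the elimination
  refine (fillElim_halts (ω := ω) (W := W) (B := blockMat A) (by rw [w2 5 (by omega), c51])
    (by rw [w2 5 (by omega), c56]) hH0 f24 hW).seq ?_
  rintro s₃ ⟨w3, f3, f32⟩
  have w3' : ∀ b, b ≠ 6 → s₃.w b = s₁.w b := fun b hb => by rw [w3 b hb, w2 b hb]
  have hpush : (pushTask (.const 0) (par 1) 0).Ok ω W s₃ := by
    simp [pushTask, Cmd.Ok, Cmd.ev, WExp.Fits, WExp.val, WOp.val, par, w3' 5, c54]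
    omega
  obtain ⟨s₄, hs₄⟩ : ∃ s₄, s₄ = (pushTask (.const 0) (par 1) 0).ev ω s₃ := ⟨_, rfl⟩
  have es₄ : s₄ = (((s₃.putW 10 0 0).putW 11 0 (2 * H)).putW 12 0 0).putW 5 4 1 := by
    rw [hs₄]
    simp [pushTask, Cmd.ev, WExp.val, WOp.val, par, w3' 5, c54, c51]
  refine (hpush.halts (Q := fun s => s = s₄) hs₄.symm).imp (by simp [pushTask, Cmd.cost, WExp.cost, par]) (fun _ h => h) |>.seq ?_
  intro s' hs'
  rw [hs']
  clear hs' s'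
  have w4 : ∀ b, b ≠ 5 → b ≠ 6 → b ≠ 10 → b ≠ 11 → b ≠ 12 → s₄.w b = s₁.w b := by
    intro b h5 h6 h10 h11 h12
    rw [es₄]
    simp [h5, h10, h11, h12, w3' b h6]
  have w45 : ∀ i, i ≠ 4 → s₄.w 5 i = s₁.w 5 i := by
    intro i hi
    rw [es₄]
    simp [hi, w3' 5]
  have f4 : s₄.f = s₃.f := by rw [es₄]; rfl
  -- the elimination
  have htask : Task s₄ (2 * H) 0 0 (2 ^ (d + 1)) 0 := by
    refine ⟨by rw [w45 1 (by omega), c51], by rw [es₄]; simp, by rw [es₄]; simp,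
      by rw [es₄, hHd]; simp [pow_succ, mul_comm], by rw [es₄]; simp, ?_, fun b hb => ⟨?_, ?_⟩⟩
    · rw [w4 13 (by omega) (by omega) (by omega) (by omega) (by omega), w1 13 (by omega) (by omega)]
    · rw [w4 b (by omega) (by omega) (by omega) (by omega) (by omega), w1 b (by omega) (by omega)]
    · rw [f4, f3 b (by omega), f2 b (by omega), f1 b (by omega)]
  refine (elimLoop_halts (ω := ω) hc htask (by omega) (by rw [hHd, pow_succ, mul_comm])).seq ?_
  rintro s₅ ⟨efr, epost⟩
  obtain ⟨K, hind, helim⟩ := epost.elim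
  have w5 : ∀ b, b < 5 ∨ (6 < b ∧ b < 9) ∨ 12 < b → ¬ IsLog b → b ≠ 0 → s₅.w b = fun _ => 0 := by
    intro b hb hl h0
    rw [efr.w b hb hl, w4 b (by omega) (by omega) (by omega) (by omega) (by omega), w1 b (by omega) (by omega)]
  have f5 : ∀ b, b ≠ 2 → b ≠ 3 → ¬ IsLog b → b ≠ 4 → b ≠ 0 → s₅.f b = fun _ => 0 := by
    intro b h2 h3 hl h4 h0
    rw [efr.f b h2 h3 hl, f4, f3 b h2, f2 b h4, f1 b h0]
  have c550 : s₅.w 5 0 = n := by rw [efr.five 0 (by omega), w45 0 (by omega), c50]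
  have c556 : s₅.w 5 6 = H := by rw [efr.five 6 (by omega), w45 6 (by omega), c56]
  have f54 : ∀ x < H, ∀ y < H, s₅.f 4 (x * H + y) = blockMat A x y := by
    rw [efr.f 4 (by omega) (by omega) (notLog (by omega)), f4, f3 4 (by omega)]
    exact f24
  set I := upperPart H K with hI
  have hI5 : ∀ x < H, s₅.w 9 (H + x) = if x ∈ I then 1 else 0 := by
    intro x hx
    rw [hind (H + x) (mem_Ico.2 ⟨by omega, by omega⟩)]
    simp [hI, mem_upperPart, hx]
  have helim' : Elim (xent H (blockMat A) fun k => ω.elt (0, k)) (s₅.ent 3 (2 * H)) K (Ico 0 (2 * H)) := by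
    refine helim.congr (fun i hi j hj => ?_) fun _ _ _ _ => rfl
    rw [State.ent, f4]
    exact f32 i (mem_Ico.1 hi).2 j (mem_Ico.1 hj).2
  -- the guest's matrix
  refine (fillBorder_halts (ω := ω) (W := W) (B := blockMat A) (I := I) c556 hH0 f54 hI5 hW).seq ?_
  rintro s₆ ⟨w6, f6, f620, f620'⟩
  have c656 : s₆.w 5 6 = H := by rw [w6 5 (by omega), c556]
  have hset : (Cmd.setW 20 (.const 0) (mulE (.const 4) (par 6))).Ok ω W s₆ := by
    simp [Cmd.Ok, mulE, WExp.Fits, WExp.val, WOp.val, par, c656]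
    omega
  refine ((hset.halts (Q := fun s => s = s₆.putW 20 0 (4 * H)) ?_).imp ?_ (fun _ h => h)).seq ?_
  · simp [Cmd.ev, mulE, WExp.val, WOp.val, par, c656]
  · simp [Cmd.cost, mulE, WExp.cost, par]
  rintro _ rfl
  set M := guestMat A H ω I with hM
  have hguest : (s₆.putW 20 0 (4 * H)).guest 20 = initState M := by
    apply State.ext'
    · intro a i
      simp only [State.guest, State.putW_w, initState]
      by_cases ha : a = 0
      · subst ha
        by_cases hi : i = 0
        · simp [hi]
        · simp only [zero_add, if_true, hi, and_false, if_false]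
          rw [update_of_ne hi, w6 20 (by omega), w5 20 (by omega) (notLog (by omega)) (by omega)]
      · rw [if_neg (by omega), w6 _ (by omega), w5 _ (by omega) (notLog (by omega)) (by omega)]
        simp [ha]
    · intro a i
      simp only [State.guest, State.putW_f, initState]
      by_cases ha : a = 0
      · subst ha
        simp only [zero_add, if_true]
        by_cases hi : i < 4 * H * (4 * H)
        · rw [f620 i hi, rowMajor_of_lt M hi]
          rfl
        · rw [f620' i (by omega), rowMajor_of_le M (by omega),
            f5 20 (by omega) (by omega) (notLog (by omega)) (by omega) (by omega)]
      · rw [if_neg ha, f6 _ (by omega), f5 _ (by omega) (by omega) (notLog (by omega)) (by omega) (by omega)]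
  obtain ⟨g, t, hg, htD⟩ := hD I ((det_ne_zero_iff fun i j => rfl).2 (upperPart_nonsing helim'))
  refine Halts.seq (Q₁ := fun s => s = (s₆.putW 20 0 (4 * H)).withGuest 20 g)
    ⟨_, t, (hg.mono hWD).shift _ hguest, htD, rfl⟩ ?_
  rintro _ rfl
  set s₇ := (s₆.putW 20 0 (4 * H)).withGuest 20 g with hs₇
  have w7 : ∀ b, b < 20 → b ≠ 6 → s₇.w b = s₅.w b := by
    intro b hb h6
    rw [hs₇]
    simp only [State.withGuest, if_pos hb, State.putW_w]
    rw [if_neg (by omega), w6 b h6]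
  have hg7 : s₇.guest 20 = g := by rw [hs₇, State.guest_withGuest]
  clear_value s₇
  -- the lists
  refine (buildLists_halts (ω := ω) (W := W) (I := I) (by rw [w7 5 (by omega) (by omega), c550])
    (by rw [w7 5 (by omega) (by omega), c556]) hnH
    (fun x hx => by rw [w7 9 (by omega) (by omega)]; exact hI5 x hx) (fun h hh => ?_) hW).imp le_rfl ?_
  · have hl : ∀ b, b = 2 ∨ b = 3 + h ∨ b = 7 + h → ¬ IsLog b := fun b hb h => by
      have := h.1; omega
    simp only [State.lst, Lst.empty]
    rw [w7 2 (by omega) (by omega), w7 (3 + h) (by omega) (by omega), w7 (7 + h) (by omega) (by omega),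
      w5 2 (by omega) (hl _ (by omega)) (by omega), w5 (3 + h) (by omega) (hl _ (by omega)) (by omega),
      w5 (7 + h) (by omega) (hl _ (by omega)) (by omega)]
  · rintro s₈ ⟨w8, f8, l8⟩
    refine ⟨?_, ?_, ?_, I, ⟨_, K, helim', hI⟩, l8, t, ?_⟩
    · rw [w8 5 (by omega) (by omega) (by omega) (by omega), w7 5 (by omega) (by omega), c550]
    · rw [w8 5 (by omega) (by omega) (by omega) (by omega), w7 5 (by omega) (by omega), c556]
    · rw [w8 13 (by omega) (by omega) (by omega) (by omega), w7 13 (by omega) (by omega), efr.ptr]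
    · have e : s₈.guest 20 = g := by
        rw [← hg7]
        apply State.ext'
        · intro a i
          simp only [State.guest]
          rw [w8 _ (by omega) (by omega) (by omega) (by omega)]
        · intro a i
          simp only [State.guest, f8]
      rw [e]
      exact hg

end Preprocessing

end

section

section UpdateProgram

variable {s : State F} {r c : WExp} {v : FExp} {u : GuestUpdate F} {us : Updates F}

/-! ### Calls of the guest -/

/-- A guest that runs on an `4H × 4H` matrix and works in time `TU`. -/
structure Env (F : Type*) [Field F] where
  D : DynAlg
  ω : Tape F
  (W WD n H L TU : ℕ)
  M : Matrix (Fin (4 * H)) (Fin (4 * H)) F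
  hn : 2 * n < H
  time : ∀ us os s, us.length < L → Runs (firstSingular F) D (ω.guest 20) WD M us os s → s.w 2 0 = 0 →
    ∀ u : Update (4 * H) F, ∃ s' t, Exec (ω.guest 20) WD D.upd (s.feed u) s' t ∧ t ≤ TU
  le : WD ≤ W
  hW : 4 * H * (4 * H) + 30 < W
  hT : 2 * TU + 200 < W
  writes : ∀ b ∈ (D.upd.shift 20).writes, b < W

namespace Env

variable (E : Env F)

instance : NeZero (4 * E.H) := ⟨by have := E.hn; omega⟩

noncomputable def T : Updates F → Bool := acceptT E.D (E.ω.guest 20) E.WD E.M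

def At (us : Updates F) (g : State F) : Prop :=
  ∃ os, Runs (firstSingular F) E.D (E.ω.guest 20) E.WD E.M (us.map (GuestUpdate.toUpdate (4 * E.H))) os g

theorem T_eq {E : Env F} {g : State F} (h : E.At us g) :
    E.T us = true ↔ g.w 2 0 = 0 := by
  obtain ⟨os, h⟩ := h
  simp only [T, acceptT, decide_eq_true_eq]
  constructor
  · rintro ⟨os', s', h', h0⟩
    obtain ⟨-, rfl⟩ := h.det h'
    exact h0
  · exact fun h0 => ⟨os, g, h, h0⟩

theorem step {E : Env F} {g : State F} (h : E.At us g) (h0 : g.w 2 0 = 0)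
    (hL : us.length < E.L) (u : GuestUpdate F) :
    ∃ g' t, Exec (E.ω.guest 20) E.WD E.D.upd (g.feed (u.toUpdate (4 * E.H))) g' t ∧ t ≤ E.TU ∧
      E.At (u :: us) g' := by
  obtain ⟨os, h⟩ := h
  obtain ⟨g', t, e, l⟩ := E.time _ os g (by simpa using hL) h h0 (u.toUpdate (4 * E.H))
  exact ⟨g', t, e, l, _, h.upd h0 _ e⟩

theorem not_T {E : Env F} {g : State F} (h : E.At us g) (h0 : g.w 2 0 ≠ 0)
    (u : GuestUpdate F) : E.T (u :: us) = false := by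
  obtain ⟨os, h⟩ := h
  simp only [T, acceptT, decide_eq_false_iff_not]
  rintro ⟨os', s', h', -⟩
  rw [List.map_cons] at h'
  cases h' with
  | upd h' hc _ _ =>
    obtain ⟨-, rfl⟩ := h.det h'
    exact h0 hc

end Env

/-- Hand over an update to the guest and run it. -/
def guestCmd (D : DynAlg) (r c : WExp) (v : FExp) : Cmd :=
  .seq (.seq (.setW 21 (.const 0) r) (.seq (.setW 21 (.const 1) c) (.setF 21 (.const 0) v)))
    (D.upd.shift 20)

def SameHost (s s' : State F) : Prop := ∀ b < 20, s'.w b = s.w b ∧ s'.f b = s.f b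

/-- The expressions evaluate to the entries of `u` and do not use the guest's memory. -/
structure HostExps (E : Env F) (s : State F) (r c : WExp) (v : FExp) (u : GuestUpdate F) : Prop where
  row : ∀ s', SameHost s s' → r.Fits E.ω E.W s' ∧ r.val E.ω s' = u.row
  col : ∀ s', SameHost s s' → c.Fits E.ω E.W s' ∧ c.val E.ω s' = u.col
  val : ∀ s', SameHost s s' → v.Fits E.ω E.W s' ∧ v.val E.ω s' = u.val
  lt : u.row < 4 * E.H ∧ u.col < 4 * E.H
  cost : r.cost + c.cost + v.cost ≤ 60
  free : r.Free ∧ c.Free ∧ v.Free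

theorem HostExps.congr {E : Env F} {s' : State F}
    (h : HostExps E s r c v u) (hs : SameHost s s') : HostExps E s' r c v u :=
  have ht : ∀ s'', SameHost s' s'' → SameHost s s'' := fun s'' h b hb =>
    ⟨(h b hb).1.trans (hs b hb).1, (h b hb).2.trans (hs b hb).2⟩
  ⟨fun _ h' => h.row _ (ht _ h'), fun _ h' => h.col _ (ht _ h'), fun _ h' => h.val _ (ht _ h'), h.lt,
    h.cost, h.free⟩

theorem sameHost_withGuest (s g : State F) : SameHost s (s.withGuest 20 g) := fun b hb => by
  simp [State.withGuest, hb]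

theorem guestCmd_exec {E : Env F} {g' : State F} {t : ℕ}
    (h : HostExps E s r c v u)
    (he : Exec (E.ω.guest 20) E.WD E.D.upd ((s.guest 20).feed (u.toUpdate (4 * E.H))) g' t)
    (ht : t ≤ E.TU) :
    ∃ t', Exec E.ω E.W (guestCmd E.D r c v) s (s.withGuest 20 g') t' ∧ t' ≤ E.TU + 70 := by
  have hW := E.hW
  obtain ⟨hr, er⟩ := h.row s fun b hb => ⟨rfl, rfl⟩
  have h1 : SameHost s (s.putW 21 0 u.row) := fun b hb => by
    simp [show b ≠ 21 by omega]
  obtain ⟨hc, ec⟩ := h.col _ h1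
  have h2 : SameHost s ((s.putW 21 0 u.row).putW 21 1 u.col) := fun b hb => by
    simp [show b ≠ 21 by omega]
  obtain ⟨hv, ev⟩ := h.val _ h2
  have hf : (Cmd.seq (.setW 21 (.const 0) r) (.seq (.setW 21 (.const 1) c) (.setF 21 (.const 0) v))).Ok
      E.ω E.W s := by
    simp only [Cmd.Ok, Cmd.ev, WExp.Fits, WExp.val, er, ec]
    exact ⟨⟨by omega, hr⟩, ⟨by omega, hc⟩, by omega, hv⟩
  obtain ⟨t₁, e₁, l₁⟩ := hf.exec
  have e0 : (Cmd.seq (.setW 21 (.const 0) r) (.seq (.setW 21 (.const 1) c) (.setF 21 (.const 0) v))).ev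
      E.ω s = ((s.putW 21 0 u.row).putW 21 1 u.col).putF 21 0 u.val := by
    simp only [Cmd.ev, WExp.val, er, ec, ev]
  rw [e0] at e₁
  set s₁ := ((s.putW 21 0 u.row).putW 21 1 u.col).putF 21 0 u.val with hs₁
  have hg : s₁.guest 20 = (s.guest 20).feed (u.toUpdate (4 * E.H)) := by
    have m1 : u.row % (4 * E.H) = u.row := Nat.mod_eq_of_lt h.lt.1
    have m2 : u.col % (4 * E.H) = u.col := Nat.mod_eq_of_lt h.lt.2
    apply State.ext' <;> intro a i <;>
      simp only [hs₁, State.guest, State.feed, GuestUpdate.toUpdate, State.putW_w, State.putW_f, State.putF_w, State.putF_f,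
        Fin.val_ofNat, m1, m2, Nat.reduceEqDiff]
  have hw : s₁.withGuest 20 g' = s.withGuest 20 g' := by
    apply State.ext' <;> intro a i <;> simp only [hs₁, State.withGuest] <;> split_ifs with ha
    · simp [show a ≠ 21 by omega]
    · rfl
    · simp [show a ≠ 21 by omega]
    · rfl
  refine ⟨_, .seq e₁ (hw ▸ (he.mono E.le).shift _ hg), ?_⟩
  have := h.cost
  simp only [Cmd.cost, WExp.cost] at l₁
  omega

def guestWrites (D : DynAlg) : List ℕ := 21 :: 21 :: 21 :: (D.upd.shift 20).writes

theorem guestCmd_writes (D : DynAlg) (r c : WExp) (v : FExp) :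
    (guestCmd D r c v).writes = guestWrites D := rfl

theorem guestWrites_ge {D : DynAlg} {b : ℕ} (hb : b ∈ guestWrites D) : 20 ≤ b := by
  simp only [guestWrites, List.mem_cons] at hb
  rcases hb with rfl | rfl | rfl | hb
  · norm_num
  · norm_num
  · norm_num
  · exact Cmd.le_of_mem_writes_shift hb

theorem guestCmd_free {E : Env F}
    (h : HostExps E s r c v u) : (guestCmd E.D r c v).Free := by
  have := h.free
  refine ⟨⟨?_, ?_, ?_⟩, Cmd.free_shift (by omega) _⟩ <;> simp [Cmd.Free, WExp.Free, IsLog, this]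

theorem Env.guestWrites_lt (E : Env F) {b : ℕ} (hb : b ∈ guestWrites E.D) : b < E.W := by
  have := E.hW
  simp only [guestWrites, List.mem_cons] at hb
  rcases hb with rfl | rfl | rfl | hb
  · omega
  · omega
  · omega
  · exact E.writes b hb

/-! ### Commits and tests -/

def commitCmd (D : DynAlg) (r c : WExp) (v : FExp) : Cmd :=
  trial (guestCmd D r c v) (.cell 22 (.const 0))

def commitTime (D : DynAlg) (TU : ℕ) : ℕ := (TU + 71) * ((restoreOne (guestWrites D)).cost + 72)

/-- The arrays of the host, other than the log, are unchanged. -/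
def HostFrame (s s' : State F) : Prop := ∀ b < 20, ¬ IsLog b → s'.w b = s.w b ∧ s'.f b = s.f b

theorem commit_halts {E : Env F} {d : Book F}
    (h : HostExps E s r c v u) (hp : s.w 13 0 = 0) (hg : E.At d.us (s.guest 20)) (h0 : s.w 22 0 = 0)
    (hL : d.us.length < E.L) :
    Halts E.ω E.W (commitCmd E.D r c v) s (commitTime E.D E.TU) fun s' =>
      s'.w 13 0 = 0 ∧ E.At ((commit u d).run E.T).us (s'.guest 20) ∧ s'.w 22 0 = 0 ∧ HostFrame s s' := by
  obtain ⟨g', t, e, l, hA⟩ := Env.step hg h0 hL u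
  obtain ⟨t', e', l'⟩ := guestCmd_exec h e l
  have hT := E.hT
  refine (trial_halts (c := .cell 22 (.const 0)) e' (guestCmd_free h)
    (fun a ha => E.guestWrites_lt (by rwa [guestCmd_writes] at ha)) hp (by omega)
    (by simp [WExp.Free, IsLog]) (by simp only [WExp.Fits]; omega)).imp ?_ ?_
  · rw [guestCmd_writes]
    simp only [WExp.cost]
    exact Nat.mul_le_mul (by omega) (by omega)
  · rintro s' ⟨hp', hs'⟩
    have hv : (WExp.cell 22 (.const 0)).val E.ω (s.withGuest 20 g') = g'.w 2 0 := by
      simp [WExp.val, State.withGuest]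
    rw [hv] at hs'
    have hguest : ∀ r : State F, SameMem r s' → s'.guest 20 = r.guest 20 := fun r hr => by
      have hn : ∀ a, ¬ IsLog (a + 20) := fun a h => by have := h.2; omega
      exact State.ext' (fun a i => congrFun (hr _ (hn a)).1.symm i) fun a i => congrFun (hr _ (hn a)).2.symm i
    refine ⟨hp', ?_⟩
    simp only [commit, Comp.run_ask, Comp.run_ret]
    by_cases hz : g'.w 2 0 = 0
    · rw [if_pos hz] at hs'
      have e1 : s'.guest 20 = g' := by rw [hguest _ hs', State.guest_withGuest]
      rw [if_pos ((Env.T_eq hA).2 hz), e1]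
      refine ⟨hA, ?_, fun b hb hl => ?_⟩
      · have : (s'.guest 20).w 2 0 = 0 := by rw [e1]; exact hz
        exact this
      · have h1 := hs' b hl
        have h2 := sameHost_withGuest s g' b hb
        exact ⟨h1.1.symm.trans h2.1, h1.2.symm.trans h2.2⟩
    · rw [if_neg hz] at hs'
      have e1 := hguest _ hs'
      rw [if_neg (fun h => hz ((Env.T_eq hA).1 h)), e1]
      refine ⟨hg, ?_, fun b hb hl => ⟨(hs' b hl).1.symm, (hs' b hl).2.symm⟩⟩
      rw [← (hs' 22 (notLog (by omega))).1, h0]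

def testCmd (D : DynAlg) (r c : WExp) (v : FExp) (r' c' : WExp) (v' : FExp) : Cmd :=
  sandbox (.seq (guestCmd D r c v) (.ite (.cell 22 (.const 0)) .skip (guestCmd D r' c' v')))
    (.setW 6 (.const 1) (.op .eq (.cell 22 (.const 0)) (.const 0)))

def testTime (D : DynAlg) (TU : ℕ) : ℕ :=
  10 + (2 * TU + 145) * ((restoreOne (guestWrites D ++ ([] ++ guestWrites D))).cost + 60)

theorem test_halts {E : Env F} {r' c' : WExp} {v' : FExp} {u' : GuestUpdate F} (h : HostExps E s r c v u) (h' : HostExps E s r' c' v' u')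
    (hp : s.w 13 0 = 0) (hg : E.At us (s.guest 20)) (h0 : s.w 22 0 = 0) (hL : us.length + 1 < E.L) :
    Halts E.ω E.W (testCmd E.D r c v r' c' v') s (testTime E.D E.TU) fun s' =>
      s'.w 13 0 = 0 ∧ s'.guest 20 = s.guest 20 ∧ s'.w 6 1 = (if E.T (u' :: u :: us) = true then 1 else 0) ∧
      ∀ b < 20, ¬ IsLog b → b ≠ 6 → s'.w b = s.w b ∧ s'.f b = s.f b := by
  have hT := E.hT
  obtain ⟨g₁, t₁, e₁, l₁, hA₁⟩ := Env.step hg h0 (by omega) u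
  obtain ⟨t₁', e₁', l₁'⟩ := guestCmd_exec h e₁ l₁
  set p := Cmd.seq (guestCmd E.D r c v) (.ite (.cell 22 (.const 0)) .skip (guestCmd E.D r' c' v')) with hpdef
  have hwr : p.writes = guestWrites E.D ++ ([] ++ guestWrites E.D) := rfl
  have hmem : ∀ b ∈ p.writes, b ∈ guestWrites E.D := by
    intro b hb
    rw [hwr] at hb
    simpa using hb
  obtain ⟨g₂, t₂, e₂, l₂, hres⟩ : ∃ g₂ t, Exec E.ω E.W p s (s.withGuest 20 g₂) t ∧ t ≤ 2 * E.TU + 144 ∧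
      (E.T (u' :: u :: us) = true ↔ g₂.w 2 0 = 0) := by
    have hfit : (WExp.cell 22 (.const 0)).Fits E.ω E.W (s.withGuest 20 g₁) := by
      simp only [WExp.Fits]; omega
    have hv : (WExp.cell 22 (.const 0)).val E.ω (s.withGuest 20 g₁) = g₁.w 2 0 := by
      simp [WExp.val, State.withGuest]
    by_cases hz : g₁.w 2 0 = 0
    · obtain ⟨g₂, t₂, e₂, l₂, hA₂⟩ := Env.step hA₁ hz (by simpa using hL) u'
      obtain ⟨t₂', e₂', l₂'⟩ := guestCmd_exec (s := s.withGuest 20 g₁)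
        (h'.congr (sameHost_withGuest s g₁)) (by rw [State.guest_withGuest]; exact e₂) l₂
      rw [State.withGuest_withGuest] at e₂'
      refine ⟨g₂, _, .seq e₁' (.iteFalse hfit (by rw [hv, hz]) e₂'), ?_, Env.T_eq hA₂⟩
      simp only [WExp.cost]; omega
    · refine ⟨g₁, _, .seq e₁' (.iteTrue hfit (by rw [hv]; exact hz) (.skip _)), ?_, ?_⟩
      · simp only [WExp.cost]; omega
      · simp [Env.not_T hA₁ hz u', hz]
  have hg22 : ∀ g : State F, (s.withGuest 20 g).w 22 0 = g.w 2 0 := fun g => by simp [State.withGuest]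
  refine (sandbox_halts (B := 8) (q := .setW 6 (.const 1) (.op .eq (.cell 22 (.const 0)) (.const 0))) e₂
    (by
      have f1 := guestCmd_free h
      have f2 := guestCmd_free h'
      exact ⟨f1, by simp [WExp.Free, IsLog], trivial, f2⟩)
    (fun a ha => E.guestWrites_lt (hmem a ha)) hp (by omega)
    (Post := fun r₂ => r₂.w 6 1 = (if E.T (u' :: u :: us) = true then 1 else 0) ∧
      ∀ b, b ∉ p.writes → ¬ IsLog b → b ≠ 6 → r₂.w b = s.w b ∧ r₂.f b = s.f b)
    (fun r₁ hr₁ => ?_)).imp ?_ ?_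
  · have hb : r₁.w 22 = (s.withGuest 20 g₂).w 22 := ((hr₁ 22 (notLog (by omega))).1).symm
    refine (Cmd.Ok.halts (p := .setW 6 (.const 1) (.op .eq (.cell 22 (.const 0)) (.const 0))) ?_ ?_).imp ?_
      fun _ h => h
    · simp only [Cmd.Ok, WExp.Fits, WOp.val]
      refine ⟨by omega, ⟨by omega, by omega, ?_⟩⟩
      split_ifs <;> omega
    · refine ⟨fun a ha => ?_, ?_, fun b hb hl h6 => ?_⟩
      · have : a ≠ 6 := by
          rcases ha with ha | ha
          · have := guestWrites_ge (hmem a ha); omega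
          · have := ha.1; omega
        simp [Cmd.ev, this]
      · simp [Cmd.ev, WExp.val, WOp.val, hb, hg22, hres]
      · have h1 := hr₁ b hl
        have h2 := e₂.frame hb
        simp only [Cmd.ev, State.putW_w, if_neg h6, State.putW_f]
        exact ⟨h1.1.symm.trans h2.1, h1.2.symm.trans h2.2⟩
    · simp [Cmd.cost, WExp.cost]
  · rw [testTime, hwr]
    exact Nat.add_le_add (by omega) (Nat.mul_le_mul_right _ (by omega))
  · rintro r₃ ⟨hw, hp₃, r₂, ⟨hr6, hrest⟩, hoth⟩
    have hnw : ∀ b < 20, b ∉ p.writes := fun b hb hm => by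
      have := guestWrites_ge (hmem b hm); omega
    refine ⟨hp₃, ?_, ?_, fun b hb hl h6 => ?_⟩
    · have key : ∀ a, r₃.w (a + 20) = s.w (a + 20) ∧ r₃.f (a + 20) = s.f (a + 20) := fun a => by
        by_cases ha : a + 20 ∈ p.writes
        · exact hw _ ha
        · have hl : ¬ IsLog (a + 20) := notLog (by omega)
          have h1 := hoth _ ha hl
          have h2 := hrest _ ha hl (by omega)
          exact ⟨h1.1.trans h2.1, h1.2.trans h2.2⟩
      exact State.ext' (fun a i => congrFun (key a).1 i) fun a i => congrFun (key a).2 i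
    · rw [(hoth 6 (hnw 6 (by omega)) (by simp [IsLog])).1, hr6]
    · have := hoth b (hnw b hb) hl
      exact ⟨this.1.trans (hrest b (hnw b hb) hl h6).1, this.2.trans (hrest b (hnw b hb) hl h6).2⟩

end UpdateProgram

end

section

section UpdateProgram

/-! ### The memory of the update program -/

/-- The memory holds the book `d` and the update `(i, j, v)`. -/
structure Rep (E : Env F) (i j : ℕ) (v : F) (s : State F) (d : Book F) : Prop where
  n : s.w 5 0 = E.n
  H : s.w 5 6 = E.H
  i : s.w 5 8 = i
  j : s.w 5 9 = j
  v : s.f 1 0 = v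
  ptr : s.w 13 0 = 0
  at' : E.At d.us (s.guest 20)
  flag : s.w 22 0 = 0
  ls : ∀ h < 2, s.lst h = d.ls h
  ok : ∀ h, (d.ls h).Ok E.n

variable {E : Env F} {i j : ℕ} {v : F} {s s' : State F} {d d' : Book F}

theorem Rep.next (h : Rep E i j v s d) (h5 : ∀ k < 10, s'.w 5 k = s.w 5 k) (h1 : s'.f 1 = s.f 1)
    (hp : s'.w 13 0 = 0) (ha : E.At d'.us (s'.guest 20)) (h0 : s'.w 22 0 = 0)
    (hl : ∀ h < 2, s'.lst h = d'.ls h) (ok : ∀ h, (d'.ls h).Ok E.n) : Rep E i j v s' d' where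
  n := by rw [h5 0 (by omega), h.n]
  H := by rw [h5 6 (by omega), h.H]
  i := by rw [h5 8 (by omega), h.i]
  j := by rw [h5 9 (by omega), h.j]
  v := by rw [h1, h.v]
  ptr := hp
  at' := ha
  flag := h0
  ls := hl
  ok := ok

theorem lst_congr {h : ℕ} (hh : h < 2) (hw : ∀ b, b = 2 ∨ b = 3 + h ∨ b = 7 + h → s'.w b = s.w b) :
    s'.lst h = s.lst h := by
  simp only [State.lst, hw 2 (by omega), hw (3 + h) (by omega), hw (7 + h) (by omega)]

/-- A change of the scratch cells. -/
theorem Rep.scratch (h : Rep E i j v s d) (h5 : ∀ k < 10, s'.w 5 k = s.w 5 k)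
    (hw : ∀ b, b ≠ 5 → b ≠ 6 → s'.w b = s.w b) (hf : s'.f = s.f) : Rep E i j v s' d :=
  h.next h5 (by rw [hf]) (by rw [hw 13 (by omega) (by omega), h.ptr])
    (by
      have : s'.guest 20 = s.guest 20 := State.ext' (fun a i => congrFun (hw _ (by omega) (by omega)) i)
        fun a i => by simp only [State.guest, hf]
      rw [this]; exact h.at')
    (by rw [hw 22 (by omega) (by omega), h.flag])
    (fun k hk => by rw [lst_congr hk fun b hb => hw b (by omega) (by omega), h.ls k hk]) h.ok

theorem Rep.lists (h : Rep E i j v s d) (hf : ListFrame s s') (hl : ∀ h < 2, s'.lst h = d'.ls h)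
    (hu : d'.us = d.us) (ok : ∀ h, (d'.ls h).Ok E.n) : Rep E i j v s' d' := by
  have hw := hf.1
  refine h.next (fun k _ => by rw [hw 5 (by omega) (by omega) (by omega)]) (by rw [hf.2])
    (by rw [hw 13 (by omega) (by omega) (by omega), h.ptr]) ?_
    (by rw [hw 22 (by omega) (by omega) (by omega), h.flag]) hl ok
  have : s'.guest 20 = s.guest 20 :=
    State.ext' (fun a i => congrFun (hw _ (by omega) (by omega) (by omega)) i)
      fun a i => by simp only [State.guest, hf.2]
  rw [this, hu]
  exact h.at'

/-- The index `m * H + (h * n + e)`. -/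
def rowE (m h : ℕ) (e : WExp) : WExp := addE (mulE (.const m) (par 6)) (addE (mulE (.const h) (par 0)) e)

theorem Rep.rowE (hR : Rep E i j v s d) {m h x : ℕ} {e : WExp} (hm : m < 4) (hh : h < 3)
    (he : ∀ s', SameHost s s' → e.Fits E.ω E.W s' ∧ e.val E.ω s' = x)
    (hx : m * E.H + (h * E.n + x) < 4 * E.H) (s' : State F) (hs : SameHost s s') :
    (DynRAM.rowE m h e).Fits E.ω E.W s' ∧ (DynRAM.rowE m h e).val E.ω s' = m * E.H + (h * E.n + x) := by
  have hW := E.hW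
  have hn := E.hn
  have b : 4 * E.H < E.W := by nlinarith
  obtain ⟨f, ev⟩ := he s' hs
  have e0 : s'.w 5 0 = E.n := by rw [(hs 5 (by omega)).1, hR.n]
  have e6 : s'.w 5 6 = E.H := by rw [(hs 5 (by omega)).1, hR.H]
  simp only [DynRAM.rowE, addE, mulE, par, WExp.Fits, WExp.val, WOp.val, e0, e6, ev]
  refine ⟨⟨⟨by omega, by omega, by omega⟩, ⟨⟨by omega, by omega, by omega⟩, f, by omega⟩, by omega⟩, trivial⟩

theorem par_host {E : Env F} {s : State F} {c x : ℕ} (hx : s.w 5 c = x)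
    (hc : c < 30 := by omega) (s' : State F) (hs : SameHost s s') : (par c).Fits E.ω E.W s' ∧ (par c).val E.ω s' = x := by
  have := E.hW
  refine ⟨by simp only [par, WExp.Fits]; omega, ?_⟩
  simp only [par, WExp.val, (hs 5 (by omega)).1, hx]

theorem Rep.hostExps (hR : Rep E i j v s d) {m m' h h' x x' : ℕ} {e e' : WExp} {z : FExp} {y : F}
    (he : ∀ s', SameHost s s' → e.Fits E.ω E.W s' ∧ e.val E.ω s' = x)
    (he' : ∀ s', SameHost s s' → e'.Fits E.ω E.W s' ∧ e'.val E.ω s' = x')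
    (hz : ∀ s', SameHost s s' → z.Fits E.ω E.W s' ∧ z.val E.ω s' = y)
    (hf : e.Free ∧ e'.Free ∧ z.Free) (hc : e.cost + e'.cost + z.cost ≤ 20) (hm : m < 4 := by omega)
    (hm' : m' < 4 := by omega) (hh : h < 3 := by omega) (hh' : h' < 3 := by omega)
    (hx : m * E.H + (h * E.n + x) < 4 * E.H := by omega)
    (hx' : m' * E.H + (h' * E.n + x') < 4 * E.H := by omega) :
    HostExps E s (DynRAM.rowE m h e) (DynRAM.rowE m' h' e') z
      ⟨m * E.H + (h * E.n + x), m' * E.H + (h' * E.n + x'), y⟩ where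
  row := hR.rowE hm hh he hx
  col := hR.rowE hm' hh' he' hx'
  val := hz
  lt := ⟨hx, hx'⟩
  cost := by simp [DynRAM.rowE, addE, mulE, par, WExp.cost]; omega
  free := by simp [DynRAM.rowE, addE, mulE, par, WExp.Free, IsLog, hf]

theorem Rep.commit (hR : Rep E i j v s d) {r c : WExp} {z : FExp} {u : GuestUpdate F}
    (h : HostExps E s r c z u) (hL : d.us.length < E.L) :
    Halts E.ω E.W (commitCmd E.D r c z) s (commitTime E.D E.TU) fun s' =>
      Rep E i j v s' ((DynRAM.commit u d).run E.T) ∧ HostFrame s s' := by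
  refine (commit_halts h hR.ptr hR.at' hR.flag hL).imp le_rfl ?_
  rintro s' ⟨h1, h2, h3, h4⟩
  have hl : ∀ b < 10, s'.w b = s.w b := fun b hb => (h4 b (by omega) (notLog (by omega))).1
  refine ⟨hR.next (fun k _ => by rw [hl 5 (by omega)])
    (h4 1 (by omega) (notLog (by omega))).2 h1 h2 h3 (fun h hh => ?_) ?_, h4⟩
  · rw [commit_ls, lst_congr hh fun b hb => hl b (by omega), hR.ls h hh]
  · rw [commit_ls]; exact hR.ok

/-- Change a parameter of the element that the cell `c` holds. -/
def paramCmd (D : DynAlg) (m h c : ℕ) (z : FExp) : Cmd :=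
  commitCmd D (rowE 2 h (par c)) (rowE m h (par c)) z

theorem Rep.param (hR : Rep E i j v s d) {h c x : ℕ} (m : ℕ) {z : FExp} {y : F} (hh : h < 2)
    (hx : s.w 5 c = x) (hxn : x < E.n) (hL : d.us.length < E.L)
    (hz : z = .one ∧ y = 1 ∨ z = .zero ∧ y = 0)
    (hm : m < 3 := by omega) (hc : c < 13 := by omega) :
    Halts E.ω E.W (paramCmd E.D m h c z) s (commitTime E.D E.TU) fun s' => s'.w 5 c = x ∧
      ∃ d', d' = (DynRAM.commit ⟨2 * E.H + (h * E.n + x), m * E.H + (h * E.n + x), y⟩ d).run E.T ∧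
        d'.us.length ≤ d.us.length + 1 ∧ d'.ls = d.ls ∧ Rep E i j v s' d' := by
  have hW := E.hW
  have hn := E.hn
  have hhn : h * E.n + x < 2 * E.n := by interval_cases h <;> omega
  have hmx : m * E.H + (h * E.n + x) < 4 * E.H := by interval_cases m <;> omega
  have hz : (z.Free ∧ z.cost = 1) ∧ ∀ s', z.Fits E.ω E.W s' ∧ z.val E.ω s' = y := by
    rcases hz with ⟨rfl, rfl⟩ | ⟨rfl, rfl⟩ <;> exact ⟨⟨trivial, rfl⟩, fun _ => ⟨trivial, rfl⟩⟩
  have e := hR.hostExps (m := 2) (m' := m) (h := h) (h' := h) (par_host hx) (par_host hx)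
    (fun s' _ => hz.2 s') (by simp [par, WExp.Free, IsLog, hz.1])
    (by simp [par, WExp.cost, hz.1])
  refine (hR.commit e hL).imp le_rfl fun s₁ ⟨hR₁, hf₁⟩ => ⟨?_, _, rfl, ?_, commit_ls .., hR₁⟩
  · rw [(hf₁ 5 (by omega) (by simp [IsLog])).1, hx]
  · exact (commit_bound (n := E.n) le_rfl).2.len

/-! ### Releasing an element -/

def removeCmd (h cx : ℕ) : Cmd :=
  .seq (.setW (3 + h) (subE (.cell (7 + h) (par cx)) (.const 1))
    (.cell (3 + h) (subE (.cell 2 (.const h)) (.const 1))))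
  (.seq (.setW (7 + h) (.cell (3 + h) (subE (.cell 2 (.const h)) (.const 1))) (.cell (7 + h) (par cx)))
  (.seq (.setW (7 + h) (par cx) (.const 0)) (.setW 2 (.const h) (subE (.cell 2 (.const h)) (.const 1)))))

theorem removeCmd_ev {ω : Tape F} {W h cx x : ℕ} (hh : h < 2) (hx : s.w 5 cx = x) (hcx : cx < W)
    (hp : (s.lst h).pos x < W) (hc : (s.lst h).cnt < W) (hW : 10 < W) :
    (removeCmd h cx).Ok ω W s ∧ ∀ s', s' = (removeCmd h cx).ev ω s → ListFrame s s' ∧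
      s'.lst h = (s.lst h).remove x ∧ ∀ h' < 2, h' ≠ h → s'.lst h' = s.lst h' := by
  simp only [State.lst] at hp hc
  have i1 : ¬ 3 + h = 7 + h := by omega
  have i2 : ¬ 7 + h = 3 + h := by omega
  have i3 : ¬ 2 = 3 + h := by omega
  have i4 : ¬ 2 = 7 + h := by omega
  have i5 : ¬ 5 = 3 + h := by omega
  have i6 : ¬ 5 = 7 + h := by omega
  have i7 : ¬ 3 + h = 2 := by omega
  have i8 : ¬ 7 + h = 2 := by omega
  refine ⟨?_, ?_⟩
  · simp [removeCmd, Cmd.Ok, Cmd.ev, WExp.Fits, WExp.val, WOp.val, subE, par, hx, i3, i4, i5, i6]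
    omega
  · rintro s' rfl
    refine ⟨⟨fun b hb h7 h8 => ?_, rfl⟩, ?_, fun h' hh' hne => ?_⟩
    · simp only [removeCmd, Cmd.ev, State.putW_w]
      rw [if_neg (by omega), if_neg (by omega), if_neg (by omega), if_neg (by omega)]
    · have hlast : update (s.w (3 + h)) (s.w (7 + h) x - 1) (s.w (3 + h) (s.w 2 h - 1)) (s.w 2 h - 1) =
          s.w (3 + h) (s.w 2 h - 1) := by
        rw [update_apply]
        split_ifs <;> rfl
      simp [removeCmd, Cmd.ev, WExp.val, WOp.val, subE, par, State.lst, Lst.remove, hx, i3, i4, i5,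
        i6, i7, i8, hlast]
    · simp [removeCmd, Cmd.ev, State.lst, WExp.val, hne, i3, i4, show ¬ 3 + h' = 7 + h by omega,
        show ¬ 3 + h' = 2 by omega, show ¬ 7 + h' = 2 by omega, show ¬ 7 + h' = 3 + h by omega]

def releaseCmd (D : DynAlg) (h cx : ℕ) : Cmd :=
  .ite (.cell (7 + h) (par cx))
    (.seq (paramCmd D 2 h cx .one) (.seq (paramCmd D 1 h cx .zero) (removeCmd h cx))) .skip

theorem Rep.release (hR : Rep E i j v s d) {h cx x : ℕ} (hh : h < 2) (hcx : cx = 8 ∨ cx = 9)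
    (hx : s.w 5 cx = x) (hxn : x < E.n) (hL : d.us.length + 2 ≤ E.L) :
    Halts E.ω E.W (releaseCmd E.D h cx) s (2 * commitTime E.D E.TU + 40) fun s' =>
      Rep E i j v s' ((DynRAM.release E.H E.n h x d).run E.T) := by
  have hW := E.hW
  have hn := E.hn
  have bW : 4 * E.H < E.W := by nlinarith
  have hhn : h * E.n + x < 2 * E.n := by interval_cases h <;> omega
  have hval : (WExp.cell (7 + h) (par cx)).val E.ω s = (d.ls h).pos x := by
    rw [← hR.ls h hh]
    simp [State.lst, WExp.val, par, hx]
  have hok := hR.ok h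
  refine (Halts.ite (B := 2 * commitTime E.D E.TU + 34) (by simp only [WExp.Fits, par]; omega)
    (fun hc => ?_) fun hc => ?_).imp ?_ fun _ h => h
  · rw [hval] at hc
    rw [DynRAM.release, if_pos hc, Comp.run_bind, Comp.run_bind, Comp.run_ret]
    refine ((hR.param 2 hh hx hxn (by omega) (.inl ⟨rfl, rfl⟩)).seq (B₂ := commitTime E.D E.TU + 34)
      fun s₁ ⟨hx₁, d₁, e₁, hlen₁, hls₁, hR₁⟩ => ?_).imp (by omega) fun _ h => h
    refine (hR₁.param 1 hh hx₁ hxn (by omega) (.inr ⟨rfl, rfl⟩)).seq (B₂ := 34)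
      fun s₂ ⟨hx₂, d₂, e₂, _, hls, hR₂⟩ => ?_
    rw [hls₁] at hls
    rw [one_mul] at e₂
    rw [show (DynRAM.commit (setBe E.H (h * E.n + x) 1) d).run E.T = d₁ from e₁.symm,
      show (DynRAM.commit (setAl E.H (h * E.n + x) 0) d₁).run E.T = d₂ from e₂.symm]
    have hl₂ : s₂.lst h = d.ls h := by rw [← hls]; exact hR₂.ls h hh
    have hcnt := hok.cnt_le
    have hpos := (hok.pos x hxn hc).1
    obtain ⟨o, p⟩ := removeCmd_ev (ω := E.ω) (W := E.W) hh hx₂ (by omega) (by rw [hl₂]; omega)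
      (by rw [hl₂]; omega) (by omega)
    refine (o.halts ?_).imp ?_ fun _ h => h
    · obtain ⟨pf, pl, po⟩ := p _ rfl
      refine hR₂.lists pf (fun h' hh' => ?_) rfl (Book.remove_ok hxn (by rw [hls]; exact hc) hR₂.ok)
      simp only [Book.remove, update_apply]
      split_ifs with e
      · rw [e, pl, hl₂, hls]
      · rw [po h' hh' e, hR₂.ls h' hh']
    · simp [removeCmd, Cmd.cost, WExp.cost, subE, par]
  · rw [hval] at hc
    rw [DynRAM.release, if_neg (by simpa using hc)]
    exact ⟨s, 1, .skip s, by omega, hR⟩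
  · simp only [WExp.cost, par]; omega

/-! ### Adding an element -/

def rowTest (D : DynAlg) (h : ℕ) : Cmd :=
  testCmd D (rowE 2 2 (.const 0)) (rowE 3 h (par 12)) .one (rowE 2 2 (.const 0)) (rowE 2 2 (.const 0)) .zero

def searchStep (D : DynAlg) (h : ℕ) : Cmd :=
  .seq (.setW 5 (.const 12) (divE (addE (par 10) (par 11)) (.const 2))) (.seq (rowTest D h)
    (.ite (.cell 6 (.const 1)) (.setW 5 (.const 11) (par 12))
      (.setW 5 (.const 10) (addE (par 12) (.const 1)))))

def searchCmd (D : DynAlg) (h : ℕ) : Cmd :=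
  .seq (.seq (.setW 5 (.const 10) (.const 0)) (.setW 5 (.const 11) (par 0)))
    (.loop (ltE (par 10) (par 11)) (searchStep D h))

theorem Rep.searchStep (hR : Rep E i j v s d) {h lo hi : ℕ} (hh : h < 2) (hlo : s.w 5 10 = lo)
    (hhi : s.w 5 11 = hi) (hlt : lo < hi) (hhn : hi ≤ E.n) (hL : d.us.length + 2 ≤ E.L) :
    Halts E.ω E.W (DynRAM.searchStep E.D h) s (testTime E.D E.TU + 40) fun s' => Rep E i j v s' d ∧
      s'.w 5 10 = (if (testRow E.H E.n d (h * E.n + (lo + hi) / 2)).run E.T = true then lo else (lo + hi) / 2 + 1) ∧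
      s'.w 5 11 = (if (testRow E.H E.n d (h * E.n + (lo + hi) / 2)).run E.T = true then (lo + hi) / 2 else hi) := by
  have hW := E.hW
  have hn := E.hn
  have bW : 4 * E.H < E.W := by nlinarith
  set mid := (lo + hi) / 2 with hmid
  have hmn : mid < E.n := by omega
  have hhm : h * E.n + mid < 2 * E.n := by interval_cases h <;> omega
  have ok1 : (Cmd.setW 5 (.const 12) (divE (addE (par 10) (par 11)) (.const 2))).Ok E.ω E.W s := by
    simp only [Cmd.Ok, divE, addE, par, WExp.Fits, WExp.val, WOp.val, hlo, hhi]
    omega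
  have ev1 : (Cmd.setW 5 (.const 12) (divE (addE (par 10) (par 11)) (.const 2))).ev E.ω s = s.putW 5 12 mid := by
    simp only [Cmd.ev, divE, addE, par, WExp.val, WOp.val, hlo, hhi, hmid]
  refine (ok1.halts_seq (B := testTime E.D E.TU + 23) ?_).imp ?_ fun _ h => h
  swap
  · simp only [Cmd.cost, divE, addE, par, WExp.cost]; omega
  rw [ev1]
  have hR₁ : Rep E i j v (s.putW 5 12 mid) d :=
    hR.scratch (fun k hk => by simp [show k ≠ 12 by omega]) (fun b h5 _ => by simp [h5]) rfl
  have hc0 : ∀ s' : State F, SameHost (s.putW 5 12 mid) s' → (WExp.const 0).Fits E.ω E.W s' ∧ (WExp.const 0).val E.ω s' = 0 :=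
    fun _ _ => ⟨by simp only [WExp.Fits]; omega, rfl⟩
  have e1 := hR₁.hostExps (m := 2) (m' := 3) (h := 2) (h' := h) (z := .one) (y := 1) hc0
    (par_host (c := 12) (x := mid) (by simp)) (fun _ _ => ⟨trivial, rfl⟩)
    (by simp [par, WExp.Free, FExp.Free, IsLog]) (by simp [par, WExp.cost, FExp.cost])
  have e2 := hR₁.hostExps (m := 2) (m' := 2) (h := 2) (h' := 2) (z := .zero) (y := 0) hc0 hc0
    (fun _ _ => ⟨trivial, rfl⟩) (by simp [WExp.Free, FExp.Free]) (by simp [WExp.cost, FExp.cost])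
  refine ((test_halts e1 e2 hR₁.ptr hR₁.at' hR₁.flag (by omega)).seq (B₂ := 23) ?_)
  rintro s₂ ⟨p₂, g₂, r₂, f₂⟩
  have hb : E.T ((⟨2 * E.H + (2 * E.n + 0), 2 * E.H + (2 * E.n + 0), 0⟩ : GuestUpdate F) ::
      ⟨2 * E.H + (2 * E.n + 0), 3 * E.H + (h * E.n + mid), 1⟩ :: d.us) =
      (testRow E.H E.n d (h * E.n + mid)).run E.T := rfl
  rw [hb] at r₂
  generalize (testRow E.H E.n d (h * E.n + mid)).run E.T = b at r₂ ⊢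
  have w₂ : ∀ b < 10, b ≠ 6 → s₂.w b = (s.putW 5 12 mid).w b := fun b hb h6 =>
    (f₂ b (by omega) (notLog (by omega)) h6).1
  have hR₂ : Rep E i j v s₂ d := hR₁.next (fun k _ => by rw [w₂ 5 (by omega) (by omega)])
    (f₂ 1 (by omega) (by simp [IsLog]) (by omega)).2 p₂ (by rw [g₂]; exact hR₁.at')
    (by
      have : (s₂.guest 20).w 2 0 = 0 := by rw [g₂]; exact hR₁.flag
      exact this)
    (fun k hk => by rw [lst_congr hk fun b hb => w₂ b (by omega) (by omega), hR₁.ls k hk]) hR.ok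
  have h12 : s₂.w 5 12 = mid := by rw [w₂ 5 (by omega) (by omega)]; simp
  have h10 : s₂.w 5 10 = lo := by rw [w₂ 5 (by omega) (by omega)]; simp [hlo]
  have h11 : s₂.w 5 11 = hi := by rw [w₂ 5 (by omega) (by omega)]; simp [hhi]
  refine (Cmd.Ok.halts (p := .ite (.cell 6 (.const 1)) (.setW 5 (.const 11) (par 12))
    (.setW 5 (.const 10) (addE (par 12) (.const 1)))) ?_ ?_).imp ?_ fun _ h => h
  · simp only [Cmd.Ok, addE, par, WExp.Fits, WExp.val, WOp.val, h12]
    omega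
  · simp only [Cmd.ev, addE, par, WExp.val, WOp.val, h12, r₂]
    cases b
    · simp only [Bool.false_eq_true, if_false, if_true]
      exact ⟨hR₂.scratch (fun k hk => by simp [show k ≠ 10 by omega]) (fun b h5 _ => by simp [h5]) rfl,
        by simp, by simp [h11]⟩
    · simp only [if_true, one_ne_zero, if_false]
      exact ⟨hR₂.scratch (fun k hk => by simp [show k ≠ 11 by omega]) (fun b h5 _ => by simp [h5]) rfl,
        by simp [h10], by simp⟩
  · simp [Cmd.cost, addE, par, WExp.cost]

theorem Rep.search (hR : Rep E i j v s d) {h : ℕ} (hh : h < 2) (hL : d.us.length + 2 ≤ E.L) :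
    Halts E.ω E.W (searchCmd E.D h) s ((E.n.size + 1) * (testTime E.D E.TU + 60)) fun s' => Rep E i j v s' d ∧
      s'.w 5 10 = (DynRAM.search (fun k => testRow E.H E.n d (h * E.n + k)) E.n.size 0 E.n).run E.T := by
  have hW := E.hW
  have hn := E.hn
  have bW : 4 * E.H < E.W := by nlinarith
  set test := fun k => testRow E.H E.n d (h * E.n + k) with htest
  have hc : ∀ s' : State F, (ltE (par 10) (par 11)).val E.ω s' = if s'.w 5 10 < s'.w 5 11 then 1 else 0 := fun s' => rfl
  have hloop := Halts.loop (ω := E.ω) (W := E.W) (c := ltE (par 10) (par 11)) (p := DynRAM.searchStep E.D h)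
    (B := testTime E.D E.TU + 40)
    (fun k s' => Rep E i j v s' d ∧ s'.w 5 11 ≤ E.n ∧ s'.w 5 11 - s'.w 5 10 < 2 ^ k ∧
      (DynRAM.search test k (s'.w 5 10) (s'.w 5 11)).run E.T = (DynRAM.search test E.n.size 0 E.n).run E.T)
    (fun k s' h => by
      simp only [ltE, par, WExp.Fits, WOp.val]
      refine ⟨by omega, by omega, ?_⟩
      split_ifs <;> omega)
    (fun s' h => by
      rw [hc, if_neg]
      have := h.2.2.1
      omega)
    (fun k s' ⟨hR', h1, h2, h3⟩ hcv => by
      rw [hc] at hcv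
      have hlt : s'.w 5 10 < s'.w 5 11 := by by_contra hge; simp [hge] at hcv
      refine (hR'.searchStep hh rfl rfl hlt h1 hL).imp le_rfl fun s'' ⟨hR'', e1, e2⟩ => ⟨hR'', ?_⟩
      rw [DynRAM.search, if_pos hlt, Comp.run_bind] at h3
      rw [pow_succ] at h2
      simp only [htest] at h3
      rw [e1, e2]
      split_ifs with hb
      · rw [if_pos hb] at h3
        exact ⟨by omega, by omega, h3⟩
      · rw [if_neg hb] at h3
        exact ⟨h1, by omega, h3⟩) E.n.size
  have ok0 : (Cmd.seq (.setW 5 (.const 10) (.const 0)) (.setW 5 (.const 11) (par 0))).Ok E.ω E.W s := by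
    simp only [Cmd.Ok, par, WExp.Fits]; omega
  have ev0 : (Cmd.seq (.setW 5 (.const 10) (.const 0)) (.setW 5 (.const 11) (par 0))).ev E.ω s =
      (s.putW 5 10 0).putW 5 11 E.n := by
    simp [Cmd.ev, par, WExp.val, hR.n]
  have h0 := hloop ((s.putW 5 10 0).putW 5 11 E.n) ⟨hR.scratch (fun k hk => by
      simp [show k ≠ 10 by omega, show k ≠ 11 by omega]) (fun b h5 _ => by simp [h5]) rfl, by simp,
      by simpa using Nat.lt_size_self E.n, by simp⟩
  refine (ok0.halts_seq (B := _) (by rw [ev0]; exact h0)).imp ?_ ?_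
  · simp only [Cmd.cost, ltE, par, WExp.cost]
    nlinarith
  · rintro s' ⟨⟨k, hk, hR', h1, h2, h3⟩, h4⟩
    refine ⟨hR', ?_⟩
    rw [hc] at h4
    have hge : ¬ s'.w 5 10 < s'.w 5 11 := by intro hlt; simp [hlt] at h4
    rw [← h3]
    cases k with
    | zero => rfl
    | succ k => rw [DynRAM.search, if_neg hge, Comp.run_ret]

end UpdateProgram

end

section

section UpdateStep

variable {F : Type*} [Field F] {E : Env F} {i j : ℕ} {v : F} {s s' : State F} {d d' : Book F}

def augmentCmd (D : DynAlg) (h : ℕ) : Cmd :=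
  .seq (searchCmd D h) (.ite (ltE (par 10) (par 0)) (.ite (.cell (7 + h) (par 10)) .skip
    (.seq (paramCmd D 1 h 10 .one) (.seq (paramCmd D 2 h 10 .zero)
      (insertCmd h (.cell 5 (.const 10))))))
    .skip)

def augTime (D : DynAlg) (n TU : ℕ) : ℕ :=
  (n.size + 1) * (testTime D TU + 60) + (2 * commitTime D TU + 60)

theorem Rep.augment (hR : Rep E i j v s d) {h : ℕ} (hh : h < 2) (hL : d.us.length + 2 ≤ E.L) :
    Halts E.ω E.W (augmentCmd E.D h) s (augTime E.D E.n E.TU) fun s' =>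
      Rep E i j v s' ((DynRAM.augment E.H E.n h d).run E.T) := by
  have hW := E.hW
  have hn := E.hn
  have bW : 4 * E.H < E.W := by nlinarith
  refine ((hR.search hh hL).seq fun s₀ ⟨hR₀, hx⟩ => ?_).imp le_rfl fun _ h => h
  rw [DynRAM.augment, Comp.run_bind]
  set x := (DynRAM.search (fun k => testRow E.H E.n d (h * E.n + k)) E.n.size 0 E.n).run E.T with hxd
  have hc0 : (ltE (par 10) (par 0)).val E.ω s₀ = if x < E.n then 1 else 0 := by
    simp only [ltE, par, WExp.val, WOp.val, hx, hR₀.n]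
  refine (Halts.ite (B := 2 * commitTime E.D E.TU + 50) ?_ (fun hc => ?_) fun hc => ?_).imp ?_ fun _ h => h
  · simp only [ltE, par, WExp.Fits, WOp.val]
    refine ⟨by omega, by omega, ?_⟩
    split_ifs <;> omega
  · rw [hc0] at hc
    have hxn : x < E.n := by by_contra hge; simp [hge] at hc
    have hhn : h * E.n + x < 2 * E.n := by interval_cases h <;> omega
    have hval : (WExp.cell (7 + h) (par 10)).val E.ω s₀ = (d.ls h).pos x := by
      rw [← hR₀.ls h hh]
      simp [State.lst, WExp.val, par, hx]
    refine (Halts.ite (B := 2 * commitTime E.D E.TU + 40) (by simp only [WExp.Fits, par]; omega)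
      (fun hc => ?_) fun hc => ?_).imp ?_ fun _ h => h
    · rw [hval] at hc
      rw [if_neg (fun h => hc h.2)]
      exact ⟨s₀, 1, .skip s₀, by omega, hR₀⟩
    · rw [hval] at hc
      rw [if_pos ⟨hxn, hc⟩, Comp.run_bind, Comp.run_bind, Comp.run_ret]
      refine ((hR₀.param 1 hh hx hxn (by omega) (.inl ⟨rfl, rfl⟩)).seq (B₂ := commitTime E.D E.TU + 40)
        fun s₁ ⟨hx₁, d₁, e₁, hlen₁, hls₁, hR₁⟩ => ?_).imp (by omega) fun _ h => h
      refine (hR₁.param 2 hh hx₁ hxn (by omega) (.inr ⟨rfl, rfl⟩)).seq (B₂ := 40)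
        fun s₂ ⟨hx₂, d₂, e₂, _, hls, hR₂⟩ => ?_
      rw [hls₁] at hls
      rw [one_mul] at e₁
      rw [show (DynRAM.commit (setAl E.H (h * E.n + x) 1) d).run E.T = d₁ from e₁.symm,
        show (DynRAM.commit (setBe E.H (h * E.n + x) 0) d₁).run E.T = d₂ from e₂.symm]
      have hl₂ : s₂.lst h = d.ls h := by rw [← hls]; exact hR₂.ls h hh
      have hcnt := (hR.ok h).cnt_le
      obtain ⟨o, p⟩ := insertCmd_ev (ω := E.ω) (W := E.W) (h := h) (a := 5) (i := 10) hh (by omega)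
        (by omega) (by omega) hx₂ (by omega) (by rw [hl₂]; omega) (by omega)
      refine (o.halts ?_).imp ?_ fun _ h => h
      · obtain ⟨pf, pl, po⟩ := p _ rfl
        refine hR₂.lists pf (fun h' hh' => ?_) rfl (Book.insert_ok hxn (by rw [hls]; exact hc) hR₂.ok)
        simp only [Book.insert, update_apply]
        split_ifs with e
        · rw [e, pl, hl₂, hls]
        · rw [po h' hh' e, hR₂.ls h' hh']
      · simp [insertCmd, Cmd.cost, WExp.cost, addE]
    · simp only [WExp.cost, par]; omega
  · rw [hc0] at hc
    have hxn : ¬ x < E.n := by intro hlt; simp [hlt] at hc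
    rw [if_neg (fun h => hxn h.1)]
    exact ⟨s₀, 1, .skip s₀, by omega, hR₀⟩
  · simp only [WExp.cost, ltE, par]; omega

/-! ### One update -/

def halfCmd (D : DynAlg) (h cx cy : ℕ) : Cmd :=
  .seq (releaseCmd D h cx) (.seq (commitCmd D (rowE 0 h (par cx)) (rowE 0 h (par cy)) (.cell 1 (.const 0)))
    (.seq (augmentCmd D h) (augmentCmd D h)))

def halfTime (D : DynAlg) (n TU : ℕ) : ℕ := 3 * commitTime D TU + 40 + 2 * augTime D n TU

theorem Rep.half (hR : Rep E i j v s d) {h cx cy x y : ℕ} (hh : h < 2) (hi : i < E.n) (hj : j < E.n)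
    (hc : cx = 8 ∧ x = i ∧ cy = 9 ∧ y = j ∨ cx = 9 ∧ x = j ∧ cy = 8 ∧ y = i) (hL : d.us.length + 7 ≤ E.L) :
    Halts E.ω E.W (halfCmd E.D h cx cy) s (halfTime E.D E.n E.TU) fun s' =>
      Rep E i j v s' ((halfStep E.H E.n h x y v d).run E.T) := by
  have hn := E.hn
  have hW := E.hW
  have hcx : ∀ {s : State F} {d : Book F}, Rep E i j v s d → s.w 5 cx = x ∧ s.w 5 cy = y := fun hR => by
    rcases hc with ⟨rfl, rfl, rfl, rfl⟩ | ⟨rfl, rfl, rfl, rfl⟩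
    · exact ⟨hR.i, hR.j⟩
    · exact ⟨hR.j, hR.i⟩
  have hxn : x < E.n ∧ y < E.n := by omega
  have hhn : h * E.n + x < 2 * E.n ∧ h * E.n + y < 2 * E.n := by interval_cases h <;> omega
  refine ((hR.release hh (by omega) (hcx hR).1 hxn.1 (by omega)).seq (B₂ := commitTime E.D E.TU + 2 * augTime E.D E.n E.TU)
    fun s₁ hR₁ => ?_).imp (by rw [halfTime]; omega) fun _ h => h
  rw [halfStep, Comp.run_bind, Comp.run_bind, Comp.run_bind]
  have b₁ := release_bound (T := E.T) (H := E.H) (h := h) (d := d) hxn.1 le_rfl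
  set d₁ := (DynRAM.release E.H E.n h x d).run E.T
  have l₁ := b₁.2.len
  have e := hR₁.hostExps (m := 0) (m' := 0) (h := h) (h' := h) (z := .cell 1 (.const 0)) (y := v)
    (par_host (hcx hR₁).1) (par_host (hcx hR₁).2)
    (fun s' hs => ⟨by simp only [FExp.Fits, WExp.Fits]; omega, by
      simp only [FExp.val, WExp.val, (hs 1 (by omega)).2, hR₁.v]⟩)
    (by have h13 : ∀ c, c = 8 ∨ c = 9 → ¬ IsLog c := fun c h h' => by have := h'.1; omega
        simp [par, WExp.Free, FExp.Free, IsLog])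
    (by simp [par, WExp.cost, FExp.cost])
  simp only [zero_mul, zero_add] at e
  refine (hR₁.commit e (by omega)).seq (B₂ := 2 * augTime E.D E.n E.TU) fun s₂ ⟨hR₂, _⟩ => ?_
  have b₂ := commit_bound (T := E.T) (n := E.n) (u := setB (h * E.n + x) (h * E.n + y) v) (d := d₁) le_rfl
  set d₂ := (DynRAM.commit (setB (h * E.n + x) (h * E.n + y) v) d₁).run E.T
  have hR₂ : Rep E i j v s₂ d₂ := hR₂
  have l₂ := b₂.2.len
  rw [two_mul]
  refine (hR₂.augment hh (by omega)).seq fun s₃ hR₃ => ?_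
  have b₃ := augment_bound (T := E.T) (H := E.H) (n := E.n) (h := h) (d := d₂) le_rfl
  have l₃ := b₃.2.len
  exact hR₃.augment hh (by omega)

def updCmd (D : DynAlg) : Cmd :=
  .seq (.seq (.setW 5 (.const 8) (.cell 1 (.const 0))) (.setW 5 (.const 9) (.cell 1 (.const 1))))
    (.ite (.cell 22 (.const 0)) .skip (.seq (halfCmd D 0 8 9) (halfCmd D 1 9 8)))

def updTime (D : DynAlg) (n TU : ℕ) : ℕ := 2 * halfTime D n TU + 20

/-- The memory holds the book `d`. -/
structure Holds (E : Env F) (s : State F) (d : Book F) : Prop where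
  n : s.w 5 0 = E.n
  H : s.w 5 6 = E.H
  ptr : s.w 13 0 = 0
  at' : E.At d.us (s.guest 20)
  ls : ∀ h < 2, s.lst h = d.ls h
  ok : ∀ h, (d.ls h).Ok E.n

theorem Rep.holds (h : Rep E i j v s d) : Holds E s d := ⟨h.n, h.H, h.ptr, h.at', h.ls, h.ok⟩

theorem Holds.update (h : Holds E s d) (u : Update E.n F) (hL : d.us.length + 14 ≤ E.L) :
    Halts E.ω E.W (updCmd E.D) (s.feed u) (updTime E.D E.n E.TU) fun s' =>
      Holds E s' ((fullStep E.H E.n u.row u.col u.value d).run E.T) := by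
  have hn := E.hn
  have hW := E.hW
  have bW : 4 * E.H < E.W := by nlinarith
  have hi := u.row.2
  have hj := u.col.2
  have ok : (Cmd.seq (.setW 5 (.const 8) (.cell 1 (.const 0))) (.setW 5 (.const 9) (.cell 1 (.const 1)))).Ok
      E.ω E.W (s.feed u) := by
    simp only [Cmd.Ok, WExp.Fits]; omega
  set s₁ := (Cmd.seq (.setW 5 (.const 8) (.cell 1 (.const 0))) (.setW 5 (.const 9) (.cell 1 (.const 1)))).ev
      E.ω (s.feed u) with hs₁
  have hw : ∀ b, b ≠ 1 → b ≠ 5 → s₁.w b = s.w b := fun b h1 h5 => by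
    simp [hs₁, Cmd.ev, State.feed, h1, h5]
  have hf : ∀ b, b ≠ 1 → s₁.f b = s.f b := fun b h1 => by
    simp [hs₁, Cmd.ev, State.feed, h1]
  have h5 : ∀ k < 8, s₁.w 5 k = s.w 5 k := fun k hk => by
    simp [hs₁, Cmd.ev, State.feed, WExp.val, show k ≠ 8 by omega, show k ≠ 9 by omega]
  have hg : s₁.guest 20 = s.guest 20 :=
    State.ext' (fun a i => congrFun (hw (a + 20) (by omega) (by omega)) i)
      fun a i => congrFun (hf (a + 20) (by omega)) i
  have hl : ∀ h < 2, s₁.lst h = s.lst h := fun h hh => lst_congr hh fun b hb => hw b (by omega) (by omega)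
  refine (ok.halts_seq (B := 2 * halfTime E.D E.n E.TU + 10) ?_).imp ?_ fun _ h => h
  · rw [← hs₁]
    refine (Halts.ite (B := 2 * halfTime E.D E.n E.TU + 1) (by simp only [WExp.Fits]; omega)
      (fun hc => ?_) fun hc => ?_).imp ?_ fun _ h => h
    · have hT : ¬ E.T d.us = true := fun ht => hc (by
        have : s.w 22 0 = 0 := (Env.T_eq h.at').1 ht
        simpa [WExp.val, hw 22 (by omega) (by omega)] using this)
      rw [fullStep, Comp.run_ask, if_neg hT, Comp.run_ret]
      exact ⟨s₁, 1, .skip s₁, by omega, by rw [h5 0 (by omega), h.n], by rw [h5 6 (by omega), h.H],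
        by rw [hw 13 (by omega) (by omega), h.ptr], by rw [hg]; exact h.at',
        fun k hk => by rw [hl k hk, h.ls k hk], h.ok⟩
    · have h22 : s₁.w 22 0 = 0 := by simpa [WExp.val] using hc
      have hT : E.T d.us = true := (Env.T_eq h.at').2 (by
        have : s.w 22 0 = 0 := by rw [← hw 22 (by omega) (by omega)]; exact h22
        exact this)
      have hR : Rep E u.row u.col u.value s₁ d :=
        ⟨by rw [h5 0 (by omega), h.n], by rw [h5 6 (by omega), h.H],
          by simp [hs₁, Cmd.ev, State.feed, WExp.val], by simp [hs₁, Cmd.ev, State.feed, WExp.val],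
          by simp [hs₁, Cmd.ev, State.feed], by rw [hw 13 (by omega) (by omega), h.ptr],
          by rw [hg]; exact h.at', h22, fun k hk => by rw [hl k hk, h.ls k hk], h.ok⟩
      rw [fullStep, Comp.run_ask, if_pos hT, Comp.run_bind]
      refine ((hR.half (h := 0) (by omega) hi hj (.inl ⟨rfl, rfl, rfl, rfl⟩) (by omega)).seq fun s₂ hR₂ => ?_).imp
        (by omega : halfTime E.D E.n E.TU + halfTime E.D E.n E.TU ≤ _) fun _ h => h
      have b₁ := halfStep_bound (T := E.T) (H := E.H) (h := 0) (y := u.col) (v := u.value) (d := d) hi le_rfl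
      have l₁ := b₁.2.len
      exact (hR₂.half (h := 1) (by omega) hi hj (.inr ⟨rfl, rfl, rfl, rfl⟩) (by omega)).imp le_rfl
        fun _ h => h.holds
    · simp only [WExp.cost]; omega
  · simp only [Cmd.cost, WExp.cost, updTime]; omega

end UpdateStep

end

section

section Assembly

/-! ### The data structure -/

/-- A matrix multiplication program and a guest, with bounds for their times and for the words. -/
structure Setting (F : Type*) [Field F] where
  p : Cmd
  D : DynAlg
  TM : ℕ → ℕ
  (W WD n d L L' TD TU : ℕ)
  hn : 2 * n < 2 ^ d
  hd : ∀ j < d, 2 ^ j < 2 * n + 1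
  hL : 14 * L ≤ L'
  elim : ElimCtx F p W (2 * 2 ^ d) TM
  le : WD ≤ W
  hW : 4 * 2 ^ d * (4 * 2 ^ d) + 30 < W
  hT : 2 * TU + 200 < W
  writes : ∀ b ∈ (D.upd.shift 20).writes, b < W
  guest : ∀ M : Matrix (Fin (4 * 2 ^ d)) (Fin (4 * 2 ^ d)) F, M.det ≠ 0 → ∀ ω,
    TimeBound (firstSingular F) D ω WD L' M TD TU

namespace Setting

variable (S : Setting F)

instance : NeZero (4 * 2 ^ S.d) := ⟨by positivity⟩

/-- The matrix of the guest. -/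
def mat (A : Matrix (Fin S.n) (Fin S.n) F) (ω : Tape F) (I : Finset ℕ) :
    Matrix (Fin (4 * 2 ^ S.d)) (Fin (4 * 2 ^ S.d)) F :=
  guestMat A (2 ^ S.d) ω I

/-- The basis that the elimination finds. -/
def Found (A : Matrix (Fin S.n) (Fin S.n) F) (ω : Tape F) (I : Finset ℕ) : Prop :=
  ∃ G K, Elim (xent (2 ^ S.d) (blockMat A) fun k => ω.elt (0, k)) G K (Ico 0 (2 * 2 ^ S.d)) ∧
    I = upperPart (2 ^ S.d) K

variable {S} {A : Matrix (Fin S.n) (Fin S.n) F} {ω : Tape F} {I : Finset ℕ}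

theorem Found.det (h : S.Found A ω I) : (S.mat A ω I).det ≠ 0 := by
  obtain ⟨G, K, h, rfl⟩ := h
  exact (det_ne_zero_iff fun i j => rfl).2 (upperPart_nonsing h)

/-- The setting of the update program. -/
abbrev env (h : S.Found A ω I) : Env F where
  D := S.D
  ω := ω
  W := S.W
  WD := S.WD
  n := S.n
  H := 2 ^ S.d
  L := S.L'
  TU := S.TU
  M := S.mat A ω I
  hn := S.hn
  time us os s hl hr h0 u := by
    obtain ⟨s', t, e, ht⟩ := (S.guest _ h.det (ω.guest 20)).2 us os s hl hr h0 u
    exact ⟨s', t, e, by exact_mod_cast ht⟩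
  le := S.le
  hW := S.hW
  hT := S.hT
  writes := S.writes

def prepTime (S : Setting F) : ℕ :=
  prepConst * (2 ^ S.d * 2 ^ S.d) + elimTime S.p S.TM (S.d + 1) + S.TD

def alg (S : Setting F) : DynAlg := ⟨prepCmd S.p S.D, updCmd S.D⟩

theorem prep_halts (A : Matrix (Fin S.n) (Fin S.n) F) (ω : Tape F) :
    Halts ω S.W S.alg.prep (initState A) S.prepTime fun s' =>
      ∃ I, ∃ h : S.Found A ω I, Holds (env h) s' (initBook F S.n I) := by
  refine (prepCmd_halts (TD := S.TD) A rfl S.hn S.hd S.elim S.hW S.le fun I hI => ?_).imp le_rfl ?_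
  · obtain ⟨g, t, e, ht⟩ := (S.guest _ hI (ω.guest 20)).1
    exact ⟨g, t, e, by exact_mod_cast ht⟩
  · rintro s' ⟨h1, h2, h3, I, hI, hl, t, hg⟩
    exact ⟨I, hI, h1, h2, h3, ⟨_, .prep hg⟩, hl, initBook_ok S.n I⟩

theorem _root_.DynRAM.Holds.read {E : Env F} {s : State F} {d : Book F} (h : Holds E s d) :
    (maxFullRankSubmatrix F).read s.w = d.out := by
  have h0 := h.ls 0 (by omega)
  have h1 := h.ls 1 (by omega)
  rw [Book.out, ← h0, ← h1]
  rfl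

/-- The runs of the data structure. -/
theorem runs {us : List (Update S.n F)} {os : List (maxFullRankSubmatrix F).Out} {s : State F}
    (hr : Runs (maxFullRankSubmatrix F) S.alg ω S.W A us os s) (hl : us.length ≤ S.L) :
    ∃ I, ∃ h : S.Found A ω I, ∃ d, Holds (env h) s d ∧ d.us.length ≤ 14 * us.length ∧
      ∀ adv : List (List ℕ × List ℕ) → Update S.n F, Follows adv us os →
        traj (2 ^ S.d) (env h).T (initBook F S.n I) adv us.length = ⟨us, os, d⟩ := by
  induction hr with
  | prep h =>
    obtain ⟨s', t', e, -, I, hI, hs⟩ := prep_halts A ω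
    obtain ⟨rfl, -⟩ := h.det e
    exact ⟨I, hI, _, hs, by simp [initBook], fun adv _ => by rw [hs.read]; rfl⟩
  | upd hr hc u hu ih =>
    rw [List.length_cons] at hl
    obtain ⟨I, hI, d, hs, hd, ht⟩ := ih (by omega)
    have hL := S.hL
    obtain ⟨s', t', e, -, hs'⟩ := hs.update u (by show _ ≤ S.L'; omega)
    obtain ⟨rfl, -⟩ := hu.det e
    refine ⟨I, hI, _, hs', ?_, fun adv hf => ?_⟩
    · have := (fullStep_bound (T := (env hI).T) (H := 2 ^ S.d) (n := S.n) (j := u.col) (v := u.value)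
        (d := d) u.row.2 u.col.2 le_rfl).2.len
      rw [List.length_cons]
      exact this.trans (by omega)
    · obtain ⟨rfl, hf⟩ := hf
      rw [List.length_cons, traj, ht adv hf, hs'.read]
      rfl

theorem timeBound (A : Matrix (Fin S.n) (Fin S.n) F) (ω : Tape F) :
    TimeBound (maxFullRankSubmatrix F) S.alg ω S.W S.L A S.prepTime (updTime S.D S.n S.TU) := by
  have hL := S.hL
  constructor
  · obtain ⟨s, t, e, ht, -⟩ := prep_halts A ω
    exact ⟨s, t, e, by exact_mod_cast ht⟩
  · intro us os s hl hr _ u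
    obtain ⟨I, hI, d, hs, hd, -⟩ := runs hr hl.le
    obtain ⟨s', t, e, ht, -⟩ := hs.update u (by show _ ≤ S.L'; omega)
    exact ⟨s', t, e, by exact_mod_cast ht⟩

theorem errs_subset (adv : List (List ℕ × List ℕ) → Update S.n F) :
    {ω | Errs (maxFullRankSubmatrix F) S.alg ω S.W S.L A adv} ⊆
      Unlucky S.D S.WD S.L' (2 ^ S.d) A (queries (2 ^ S.d)
        (idealT (2 ^ S.d) (startCfg (2 ^ S.d) A))
        (initBook F S.n (firstBasis (2 ^ S.d) (blockMat A))) adv S.L) := by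
  rintro ω ⟨us, os, s, hl, hr, hf, hcor⟩
  by_contra hu
  simp only [Unlucky, Set.mem_ofPred_eq, not_or, not_exists, not_and, not_not] at hu
  obtain ⟨hu1, hu2⟩ := hu
  obtain ⟨I, hI, d, hs, -, ht⟩ := runs hr hl
  have hb : I = firstBasis (2 ^ S.d) (blockMat A) := by
    obtain ⟨G, K, hE, rfl⟩ := hI
    exact upperPart_eq_firstBasis hE hu1
  subst hb
  have hT := traj_congr (T' := (env hI).T) (n := S.n) (adv := adv) (L := S.L) (fun q hq => by
    obtain ⟨h1, h2⟩ := hu2 q hq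
    rw [Bool.eq_iff_iff]
    refine Iff.trans ?_ (accepts_iff (S.guest _ hI.det (ω.guest 20))
      (((queries_bound S.L).2 q hq).trans S.hL) (h1 ((det_ne_zero_iff fun i j => rfl).1 hI.det))
      fun us hus hρ => h2 us hus hρ)
    simp [Env.T, acceptT]
    rfl) us.length hl
  rw [ht adv hf] at hT
  have := (traj_sound (sound_init S.hn (firstBasis_rowBasis _ (blockMat A))) S.hn adv us.length).correct S.hn
  rw [← hT, ← hs.read] at this
  exact hcor this

theorem tapeProb_errs_le [Fintype F] {ε : ℝ≥0∞}
    (hε : ∀ M : Matrix (Fin (4 * 2 ^ S.d)) (Fin (4 * 2 ^ S.d)) F, M.det ≠ 0 → ∀ q : ℕ → Update (4 * 2 ^ S.d) F,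
      tapeProb {ω | Errs (firstSingular F) S.D ω S.WD S.L' M fun os => q os.length} ≤ ε)
    (A : Matrix (Fin S.n) (Fin S.n) F) (adv : List (List ℕ × List ℕ) → Update S.n F) :
    tapeProb {ω | Errs (maxFullRankSubmatrix F) S.alg ω S.W S.L A adv} ≤
      (2 ^ S.d : ℕ) * ((2 * 2 ^ S.d : ℕ) / (Fintype.card F : ℝ≥0∞)) +
        (S.L * (4 * S.n.size + 15) : ℕ) *
          (ε + (14 * S.L + 1 : ℕ) * ((4 * 2 ^ S.d : ℕ) / (Fintype.card F : ℝ≥0∞))) :=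
  (tapeProb_mono (errs_subset adv)).trans (tapeProb_unlucky_le (by positivity) (queries_bound S.L).1
    (queries_bound S.L).2 fun M hM q => hε M hM _)

end Setting

end Assembly

end

section Bounds

/-! ### Growth -/

theorem exists_le_two_pow (r : ℝ) : ∃ e : ℕ, r ≤ 2 ^ e :=
  let ⟨e, h⟩ := pow_unbounded_of_one_lt r one_lt_two
  ⟨e, h.le⟩

theorem DoublingBounded.iterate {f : ℕ → ℝ} (hf : DoublingBounded f) : ∃ κ : ℝ, 0 ≤ κ ∧
    ∀ k n m : ℕ, 1 ≤ n → n ≤ m → m ≤ 2 ^ k * n → f m ≤ κ ^ k * f n := by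
  obtain ⟨h0, κ, hκ⟩ := hf
  have h1 : ∀ n m : ℕ, 1 ≤ n → n ≤ m → m ≤ 2 * n → f m ≤ max κ 1 * f n := fun n m a b c =>
    (hκ n m a b c).trans (mul_le_mul_of_nonneg_right (le_max_left _ _) (h0 n))
  have hp : 0 ≤ max κ 1 := zero_le_one.trans (le_max_right _ _)
  refine ⟨max κ 1, hp, fun k => ?_⟩
  induction k with
  | zero =>
    intro n m _ h2 h3
    obtain rfl : n = m := by omega
    simp
  | succ k ih =>
    intro n m hn h2 h3
    rw [pow_succ', mul_assoc] at h3
    by_cases hm : m ≤ 2 ^ k * n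
    · refine (ih n m hn h2 hm).trans (mul_le_mul_of_nonneg_right ?_ (h0 n))
      exact pow_le_pow_right₀ (le_max_right _ _) (Nat.le_succ k)
    · have hk : n ≤ 2 ^ k * n := Nat.le_mul_of_pos_left _ (by positivity)
      refine (h1 (2 ^ k * n) m (by omega) (by omega) (by omega)).trans ?_
      rw [pow_succ', mul_assoc]
      exact mul_le_mul_of_nonneg_left (ih n _ hn hk le_rfl) hp

theorem DoublingBounded.polynomial {f : ℕ → ℝ} (hf : DoublingBounded f) (C : ℝ) :
    ∃ e : ℕ, ∀ m : ℕ, 1 ≤ m → |C| * f m ≤ ((m : ℝ) + 1) ^ e := by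
  obtain ⟨κ, hκ, h⟩ := hf.iterate
  obtain ⟨e₁, h₁⟩ := exists_le_two_pow κ
  obtain ⟨e₂, h₂⟩ := exists_le_two_pow (|C| * f 1)
  refine ⟨2 * e₁ + e₂, fun m hm => ?_⟩
  have hm' : (2 : ℝ) ≤ m + 1 := by have : (1 : ℝ) ≤ m := by exact_mod_cast hm
                                   linarith
  have hs : (2 : ℝ) ^ m.size ≤ ((m : ℝ) + 1) ^ 2 := by
    have : 2 ^ (m.size - 1) ≤ m := Nat.lt_size.1 (by have := Nat.size_pos.2 hm; omega)
    have h2 : 2 ^ m.size ≤ (m + 1) ^ 2 := by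
      have e : m.size = m.size - 1 + 1 := by have := Nat.size_pos.2 hm; omega
      rw [e, pow_succ]
      nlinarith
    exact_mod_cast h2
  have := h m.size 1 m le_rfl hm (by have := Nat.lt_size_self m; omega)
  calc |C| * f m ≤ |C| * (κ ^ m.size * f 1) := mul_le_mul_of_nonneg_left this (abs_nonneg C)
    _ = κ ^ m.size * (|C| * f 1) := by ring
    _ ≤ (2 ^ e₁) ^ m.size * 2 ^ e₂ := by
      have := mul_nonneg (abs_nonneg C) (hf.1 1)
      gcongr
    _ = (2 ^ m.size) ^ e₁ * 2 ^ e₂ := by rw [← pow_mul, ← pow_mul, mul_comm e₁]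
    _ ≤ (((m : ℝ) + 1) ^ 2) ^ e₁ * ((m : ℝ) + 1) ^ e₂ := by gcongr
    _ = _ := by rw [← pow_mul, ← pow_add]

theorem rpow_polynomial (τ C : ℝ) : ∃ e : ℕ, ∀ m : ℕ, 1 ≤ m → |C| * (m : ℝ) ^ τ ≤ ((m : ℝ) + 1) ^ e := by
  obtain ⟨e₂, h₂⟩ := exists_le_two_pow |C|
  obtain ⟨e₁, h₁⟩ := exists_nat_ge τ
  refine ⟨e₂ + e₁, fun m hm => ?_⟩
  have hm' : (1 : ℝ) ≤ m := by exact_mod_cast hm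
  rw [pow_add]
  refine mul_le_mul (h₂.trans (pow_le_pow_left₀ (by norm_num) (by linarith) _)) ?_ (by positivity) (by positivity)
  refine (Real.rpow_le_rpow_of_exponent_le hm' h₁).trans ?_
  rw [Real.rpow_natCast]
  exact pow_le_pow_left₀ (by positivity) (by linarith) _

theorem elimTime_le {p : Cmd} {TM : ℕ → ℕ} {C τ : ℝ} (hC : 0 ≤ C) (hτ : 2 < τ)
    (h : ∀ m, (TM m : ℝ) ≤ C * (m : ℝ) ^ τ) (l : ℕ) :
    (elimTime p TM l : ℝ) ≤ (200 + (6 * mulConst p + 600) * (C + 2)) * ((2 ^ l : ℕ) : ℝ) ^ τ := by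
  have h4 : (4 : ℝ) ≤ 2 ^ τ := by
    have := Real.rpow_le_rpow_of_exponent_le one_le_two hτ.le
    norm_num at this
    exact this
  have hK : (0 : ℝ) ≤ 6 * mulConst p + 600 := by positivity
  induction l with
  | zero => simp [elimTime]; nlinarith
  | succ l ih =>
    set q := ((2 ^ l : ℕ) : ℝ) ^ τ with hq
    have hl : (1 : ℝ) ≤ (2 ^ l : ℕ) := by exact_mod_cast Nat.one_le_two_pow
    have e : ((2 ^ (l + 1) : ℕ) : ℝ) ^ τ = 2 ^ τ * q := by
      rw [hq, ← Real.mul_rpow (by norm_num) (by positivity)]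
      push_cast
      ring_nf
    have hsq : ((2 ^ l : ℕ) : ℝ) * (2 ^ l : ℕ) ≤ q := by
      have := Real.rpow_le_rpow_of_exponent_le hl hτ.le
      rw [Real.rpow_two, sq] at this
      exact this
    have hq1 : 1 ≤ q := le_trans (by nlinarith) hsq
    have hM := h (2 ^ l)
    rw [← hq] at hM
    rw [elimTime, e]
    push_cast at hsq hM ih ⊢
    have b : (2 : ℝ) ^ l * 2 ^ l + TM (2 ^ l) + 1 ≤ (C + 2) * q := by nlinarith
    have b2 := mul_le_mul_of_nonneg_left b hK
    set B := (6 * (mulConst p : ℝ) + 600) * (C + 2) with hB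
    have hB0 : 0 ≤ B := by positivity
    have b3 : 4 * ((200 + B) * q) ≤ 2 ^ τ * ((200 + B) * q) := mul_le_mul_of_nonneg_right h4 (by positivity)
    nlinarith

theorem updTime_le (D : DynAlg) : ∃ c : ℕ, ∀ n TU, updTime D n TU ≤ c * ((TU + 1) * (n.size + 1)) := by
  set k₁ := (restoreOne (guestWrites D)).cost + 72 with h1
  set k₂ := (restoreOne (guestWrites D ++ ([] ++ guestWrites D))).cost + 60 with h2
  refine ⟨994 * k₁ + 620 + 580 * k₂, fun n TU => ?_⟩
  have e : updTime D n TU = 14 * ((TU + 71) * k₁) + 340 + 4 * ((n.size + 1) * (70 + (2 * TU + 145) * k₂)) := by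
    simp only [updTime, halfTime, augTime, commitTime, testTime, ← h1, ← h2]
    ring
  rw [e]
  generalize n.size = z
  have a1 : (TU + 71) * k₁ ≤ 71 * ((TU + 1) * (z + 1)) * k₁ := Nat.mul_le_mul_right _ (by nlinarith)
  have a2 : (2 * TU + 145) * k₂ ≤ 145 * (TU + 1) * k₂ := Nat.mul_le_mul_right _ (by nlinarith)
  have a3 : (z + 1) * (70 + (2 * TU + 145) * k₂) ≤ (z + 1) * (70 * (TU + 1) + 145 * (TU + 1) * k₂) :=
    Nat.mul_le_mul_left _ (by omega)
  have a4 : 1 ≤ (TU + 1) * (z + 1) := Nat.mul_pos (by omega) (by omega)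
  nlinarith

theorem size_le_log {n : ℕ} (hn : 1 ≤ n) : (n.size : ℝ) + 1 ≤ 2 * (1 + Real.log n) := by
  have hs := Nat.size_pos.2 hn
  have h : 2 ^ (n.size - 1) ≤ n := Nat.lt_size.1 (by omega)
  have h' : ((2 : ℝ) ^ (n.size - 1)) ≤ n := by exact_mod_cast h
  have := Real.log_le_log (by positivity) h'
  rw [Real.log_pow, Nat.cast_sub hs] at this
  have l2 := Real.log_two_gt_d9
  have h1 : (1 : ℝ) ≤ n.size := by exact_mod_cast hs
  push_cast at this
  nlinarith

theorem TimeBound.mono {F : Type*} [Field F] {n : ℕ} {pr : Problem F} {D : DynAlg} {ω : Tape F} {W L : ℕ}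
    {A : Matrix (Fin n) (Fin n) F} {TP TP' TU TU' : ℝ} (h : TimeBound pr D ω W L A TP TU)
    (hP : TP ≤ TP') (hU : TU ≤ TU') : TimeBound pr D ω W L A TP' TU' :=
  ⟨let ⟨s, t, e, b⟩ := h.1; ⟨s, t, e, b.trans hP⟩, fun us os s a b c u =>
    let ⟨s', t, e, b⟩ := h.2 us os s a b c u; ⟨s', t, e, b.trans hU⟩⟩

/-- An update takes time. -/
theorem one_le_updateTime {F : Type*} [Field F] [Fintype F] {m : ℕ} {D : DynAlg} {W L : ℕ} {TP TU : ℝ}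
    (u : Update m F) (hL : 0 < L) (ht : ∀ ω, TimeBound (firstSingular F) D ω W L (1 : Matrix (Fin m) (Fin m) F) TP TU)
    (hp : tapeProb {ω | Errs (firstSingular F) D ω W L (1 : Matrix (Fin m) (Fin m) F) fun _ => u} < 1) :
    1 ≤ TU := by
  obtain ⟨ω, hω⟩ : ∃ ω, ω ∉ {ω | Errs (firstSingular F) D ω W L (1 : Matrix (Fin m) (Fin m) F) fun _ => u} := by
    by_contra! h
    rw [Set.eq_univ_of_forall h, tapeProb_univ] at hp
    exact lt_irrefl _ hp
  obtain ⟨s, t, e, -⟩ := (ht ω).1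
  have h0 : s.w 2 0 = 0 := by
    by_contra hne
    exact hω ⟨[], _, s, by simp, .prep e, trivial, fun hc => by
      have := hc.1 hne
      simp [applyAll] at this⟩
  obtain ⟨s', t', e', l⟩ := (ht ω).2 [] _ s (by simpa using hL) (.prep e) h0 u
  exact le_trans (by exact_mod_cast e'.one_le) l

/-! ### Powers -/

theorem mul_lt_pow {x k j y e c : ℕ} (hx : 2 ≤ x) (hk : k < 2 ^ j) (hy : y ≤ x ^ e) (hc : e + j ≤ c) :
    k * y < x ^ c := by
  have h1 : 2 ^ j ≤ x ^ j := Nat.pow_le_pow_left hx j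
  have h2 : x ^ (e + j) ≤ x ^ c := Nat.pow_le_pow_right (by omega) hc
  have h3 : 0 < x ^ e := by positivity
  rw [pow_add] at h2
  calc k * y ≤ k * x ^ e := Nat.mul_le_mul_left _ hy
    _ < x ^ j * x ^ e := Nat.mul_lt_mul_of_pos_right (by omega) h3
    _ ≤ x ^ c := by rwa [mul_comm]

theorem mem_lt_pow {x c b : ℕ} {l : List ℕ} (hx : 2 ≤ x) (hb : b ∈ l) (hc : l.sum ≤ c) : b < x ^ c :=
  ((List.single_le_sum (by simp) _ hb).trans hc).trans_lt
    (Nat.lt_two_pow_self.trans_le (Nat.pow_le_pow_left hx c))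

theorem div_le_inv_pow {A B : ℝ≥0∞} {x u v b : ℕ} (hx : 1 ≤ x) (hA : A ≤ (x : ℝ≥0∞) ^ u)
    (hB : (x : ℝ≥0∞) ^ b ≤ B) (h : u + v ≤ b) : A / B ≤ ((x : ℝ≥0∞) ^ v)⁻¹ := by
  have hx0 : (x : ℝ≥0∞) ^ v ≠ 0 := pow_ne_zero _ (by exact_mod_cast (by omega : x ≠ 0))
  have hxt : (x : ℝ≥0∞) ^ v ≠ ∞ := ENNReal.pow_ne_top (ENNReal.natCast_ne_top x)
  refine ENNReal.div_le_of_le_mul (hA.trans ?_)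
  rw [← ENNReal.div_eq_inv_mul, ENNReal.le_div_iff_mul_le (.inl hx0) (.inl hxt), ← pow_add]
  exact (pow_le_pow_right₀ (by exact_mod_cast hx) h).trans hB

end Bounds

section Sizes

/-- A power of two between `2 * n` and `4 * n`. -/
theorem exists_size {n : ℕ} (hn : 1 ≤ n) :
    ∃ d, 2 * n < 2 ^ d ∧ (∀ j < d, 2 ^ j < 2 * n + 1) ∧ 2 ^ d ≤ 4 * n := by
  refine ⟨Nat.clog 2 (2 * n + 1), Nat.le_pow_clog (by omega) _, fun j hj =>
    (Nat.lt_clog_iff_pow_lt (by omega)).1 hj, ?_⟩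
  have h0 : 0 < Nat.clog 2 (2 * n + 1) := Nat.clog_pos (by omega) (by omega)
  have := (Nat.lt_clog_iff_pow_lt (b := 2) (y := Nat.clog 2 (2 * n + 1) - 1) (x := 2 * n + 1)
    (by omega)).1 (by omega)
  have e : Nat.clog 2 (2 * n + 1) = Nat.clog 2 (2 * n + 1) - 1 + 1 := by omega
  rw [e, pow_succ]
  omega

/-- The setting for matrices of dimension `n`, with words below `(n + 1) ^ c`. -/
theorem exists_setting {p : Cmd} {D : DynAlg} {TM : ℕ → ℕ} {n d a a' cp cD ep eU c TD TU : ℕ} (hn : 1 ≤ n)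
    (hd : 2 * n < 2 ^ d ∧ (∀ j < d, 2 ^ j < 2 * n + 1) ∧ 2 ^ d ≤ 4 * n) (ha : a + 4 ≤ a')
    (hmul : ∀ m, 1 ≤ m → Multiplies p F ((m + 1) ^ cp) m (TM m)) (hTM : ∀ m, 1 ≤ m → TM m ≤ (m + 1) ^ ep)
    (hTU : TU ≤ (4 * 2 ^ d + 1) ^ eU)
    (hD : ∀ M : Matrix (Fin (4 * 2 ^ d)) (Fin (4 * 2 ^ d)) F, M.det ≠ 0 → ∀ ω,
      TimeBound (firstSingular F) D ω ((4 * 2 ^ d + 1) ^ cD) ((4 * 2 ^ d + 1) ^ a') M TD TU)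
    (hc : 5 * cD + 5 * cp + 5 * eU + 5 * ep + 40 + (p.shift 20).writes.sum + (D.upd.shift 20).writes.sum ≤ c) :
    ∃ S : Setting F, S.p = p ∧ S.D = D ∧ S.TM = TM ∧ S.W = (n + 1) ^ c ∧ S.WD = (4 * 2 ^ d + 1) ^ cD ∧
      S.n = n ∧ S.d = d ∧ S.L = (n + 1) ^ a ∧ S.L' = (4 * 2 ^ d + 1) ^ a' ∧ S.TD = TD ∧ S.TU = TU := by
  obtain ⟨hd1, hd2, hd3⟩ := hd
  have hx : 2 ≤ n + 1 := by omega
  have hx4 : 16 ≤ (n + 1) ^ 4 := Nat.pow_le_pow_left hx 4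
  have hm : 4 * 2 ^ d + 1 ≤ (n + 1) ^ 5 := by
    have : 16 * (n + 1) ≤ (n + 1) ^ 4 * (n + 1) := Nat.mul_le_mul_right _ hx4
    rw [← pow_succ] at this
    norm_num at this
    omega
  have hpow : ∀ y e, y + 1 ≤ 4 * 2 ^ d + 1 → (y + 1) ^ e ≤ (n + 1) ^ (5 * e) := fun y e hy => by
    rw [pow_mul]
    exact Nat.pow_le_pow_left (hy.trans hm) e
  have hmono : ∀ {e}, e ≤ c → (n + 1) ^ e ≤ (n + 1) ^ c := fun h => Nat.pow_le_pow_right (by omega) h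
  have hone : ∀ e, 1 ≤ (n + 1) ^ e := fun e => Nat.one_le_pow _ _ (by omega)
  have hsq : (4 * 2 ^ d) * (4 * 2 ^ d) ≤ (n + 1) ^ 10 := by
    rw [show 10 = 5 + 5 from rfl, pow_add]
    exact Nat.mul_le_mul (by omega) (by omega)
  refine ⟨{
    p := p
    D := D
    TM := TM
    W := (n + 1) ^ c
    WD := (4 * 2 ^ d + 1) ^ cD
    n := n
    d := d
    L := (n + 1) ^ a
    L' := (4 * 2 ^ d + 1) ^ a'
    TD := TD
    TU := TU
    hn := hd1
    hd := hd2
    hL := ?_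
    elim := ⟨fun m hm1 hm2 => ⟨?_, ?_⟩, ?_, fun b hb => mem_lt_pow hx hb (by omega)⟩
    le := (hpow _ _ le_rfl).trans (hmono (by omega))
    hW := ?_
    hT := ?_
    writes := fun b hb => mem_lt_pow hx hb (by omega)
    guest := hD }, rfl, rfl, rfl, rfl, rfl, rfl, rfl, rfl, rfl, rfl, rfl⟩
  · calc 14 * (n + 1) ^ a ≤ (n + 1) ^ 4 * (n + 1) ^ a := Nat.mul_le_mul_right _ (by omega)
      _ = (n + 1) ^ (a + 4) := by ring
      _ ≤ (n + 1) ^ a' := Nat.pow_le_pow_right (by omega) ha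
      _ ≤ _ := Nat.pow_le_pow_left (by omega) _
  · intro A B ω
    obtain ⟨s, t, e, h⟩ := hmul m hm1 A B ω
    exact ⟨s, t, e.mono ((hpow m cp (by omega)).trans (hmono (by omega))), h⟩
  · have h1 := mul_lt_pow (k := 902) (j := 10) (y := (n + 1) ^ (10 + 5 * ep)) (c := c) hx (by omega) le_rfl (by omega)
    have h2 : TM m ≤ (n + 1) ^ (10 + 5 * ep) :=
      (hTM m hm1).trans ((hpow m ep (by omega)).trans (Nat.pow_le_pow_right (by omega) (by omega)))
    have h3 : m * m ≤ (n + 1) ^ (10 + 5 * ep) :=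
      (Nat.mul_le_mul (by omega) (by omega)).trans (hsq.trans (Nat.pow_le_pow_right (by omega) (by omega)))
    have := hone (10 + 5 * ep)
    omega
  · have h1 := mul_lt_pow (k := 31) (j := 5) (c := c) hx (by omega) le_rfl (by omega) (y := (n + 1) ^ 10)
    have := hone 10
    nlinarith
  · have h1 := mul_lt_pow (k := 31) (j := 5) (c := c) hx (by omega) le_rfl (by omega) (y := (n + 1) ^ 10)
    have := hone 10
    omega
  · have h1 := mul_lt_pow (k := 202) (j := 8) (c := c) hx (by omega) le_rfl (by omega) (y := (n + 1) ^ (5 * eU))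
    have h2 := hTU.trans (hpow _ eU le_rfl)
    have := hone (5 * eU)
    omega

/-- The sum of the error probabilities. -/
theorem error_le {n H a a' b card : ℕ} (hn : 1 ≤ n) (hH : n ≤ 4 * H ∧ H ≤ 4 * n) (ha : a' = 2 * a + 7)
    (hb : 3 * a + 16 ≤ b) (hcard : (n + 1) ^ b ≤ card) :
    (H : ℝ≥0∞) * ((2 * H : ℕ) / (card : ℝ≥0∞)) + ((n + 1) ^ a * (4 * n.size + 15) : ℕ) *
        ((((4 * H : ℕ) : ℝ≥0∞) + 1) ^ a')⁻¹ + ((n + 1) ^ a * (4 * n.size + 15) : ℕ) *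
        ((14 * (n + 1) ^ a + 1 : ℕ) * ((4 * H : ℕ) / (card : ℝ≥0∞))) ≤ (((n : ℝ≥0∞) + 1) ^ a)⁻¹ := by
  have hx : 2 ≤ n + 1 := by omega
  have hx4 : 16 ≤ (n + 1) ^ 4 := Nat.pow_le_pow_left hx 4
  have hx5 : 16 * (n + 1) ≤ (n + 1) ^ 5 := by
    rw [pow_succ]
    exact Nat.mul_le_mul_right _ hx4
  have hB : ((n + 1 : ℕ) : ℝ≥0∞) ^ b ≤ card := by exact_mod_cast hcard
  have hs : n.size ≤ n := Nat.size_le.2 Nat.lt_two_pow_self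
  have hN : (n + 1) ^ a * (4 * n.size + 15) ≤ (n + 1) ^ (a + 5) := by
    rw [pow_add]
    exact Nat.mul_le_mul_left _ (by omega)
  have hℓ : 14 * (n + 1) ^ a + 1 ≤ (n + 1) ^ (a + 4) := by
    rw [pow_add]
    have : 1 ≤ (n + 1) ^ a := Nat.one_le_pow _ _ (by omega)
    nlinarith
  have t1 : (H : ℝ≥0∞) * ((2 * H : ℕ) / (card : ℝ≥0∞)) ≤ (((n + 1 : ℕ) : ℝ≥0∞) ^ (a + 2))⁻¹ := by
    rw [← mul_div_assoc]
    refine div_le_inv_pow (u := 10) (by omega) ?_ hB (by omega)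
    have : H * (2 * H) ≤ (n + 1) ^ 5 * (n + 1) ^ 5 := Nat.mul_le_mul (by omega) (by omega)
    rw [← pow_add] at this
    exact_mod_cast this
  have t2 : (((n + 1) ^ a * (4 * n.size + 15) : ℕ) : ℝ≥0∞) * ((((4 * H : ℕ) : ℝ≥0∞) + 1) ^ a')⁻¹ ≤
      (((n + 1 : ℕ) : ℝ≥0∞) ^ (a + 2))⁻¹ := by
    rw [← div_eq_mul_inv]
    refine div_le_inv_pow (u := a + 5) (b := 2 * a + 7) (by omega) (by exact_mod_cast hN) ?_ (by omega)
    rw [ha]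
    exact_mod_cast Nat.pow_le_pow_left (show n + 1 ≤ 4 * H + 1 by omega) _
  have t3 : (((n + 1) ^ a * (4 * n.size + 15) : ℕ) : ℝ≥0∞) *
      ((14 * (n + 1) ^ a + 1 : ℕ) * ((4 * H : ℕ) / (card : ℝ≥0∞))) ≤ (((n + 1 : ℕ) : ℝ≥0∞) ^ (a + 2))⁻¹ := by
    rw [← mul_div_assoc, ← mul_div_assoc]
    refine div_le_inv_pow (u := (a + 5) + ((a + 4) + 5)) (by omega) ?_ hB (by omega)
    have : (n + 1) ^ a * (4 * n.size + 15) * ((14 * (n + 1) ^ a + 1) * (4 * H)) ≤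
        (n + 1) ^ ((a + 5) + ((a + 4) + 5)) := by
      rw [pow_add, pow_add _ (a + 4)]
      exact Nat.mul_le_mul hN (Nat.mul_le_mul hℓ (by omega))
    exact_mod_cast this
  refine (add_le_add (add_le_add t1 t2) t3).trans ?_
  have h3 : (3 : ℝ≥0∞) ≤ ((n + 1 : ℕ) : ℝ≥0∞) ^ 2 := by
    have : 3 ≤ (n + 1) ^ 2 := by nlinarith
    exact_mod_cast this
  have := div_le_inv_pow (x := n + 1) (v := a) (b := a + 2) (by omega) h3 le_rfl (by omega)
  rw [div_eq_mul_inv] at this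
  push_cast at this ⊢
  refine le_trans (le_of_eq ?_) this
  ring

end Sizes

end DynRAM

theorem theorem1p6 {ι : Type*} (K : ι → Type*) [∀ i, Field (K i)] [∀ i, Fintype (K i)]
    (τ : ℝ) (hτ : 2 < τ) (hmul : DynRAM.MatMulInTime K τ)
    (P U : ℕ → ℝ) (hP : DynRAM.DoublingBounded P) (hU : DynRAM.DoublingBounded U)
    (hdetect : DynRAM.HasDataStructure K (fun i => DynRAM.firstSingular (K i))
      DynRAM.Adversary.oblivious P U) :
    ∃ k : ℕ, DynRAM.HasDataStructure K (fun i => DynRAM.maxFullRankSubmatrix (K i))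
      DynRAM.Adversary.outputAdaptive
      (fun n => P n + (n : ℝ) ^ τ) (fun n => U n * (1 + Real.log n) ^ k) := by
  obtain ⟨p, cp, Cp, hp⟩ := hmul
  obtain ⟨c₀, hc₀⟩ : ∃ c : DynRAM.DynAlg → ℕ, ∀ D n TU, DynRAM.updTime D n TU ≤ c D * ((TU + 1) * (n.size + 1)) :=
    ⟨fun D => (DynRAM.updTime_le D).choose, fun D => (DynRAM.updTime_le D).choose_spec⟩
  obtain ⟨κP, hκP, hPit⟩ := hP.iterate
  obtain ⟨κU, hκU, hUit⟩ := hU.iterate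
  refine ⟨1, fun a => ?_⟩
  obtain ⟨D, bD, cD, CD, hD⟩ := hdetect (2 * a + 7)
  obtain ⟨eU, heU⟩ := hU.polynomial CD
  obtain ⟨ep, hep⟩ := DynRAM.rpow_polynomial τ Cp
  set Q : ℝ := 200 + (6 * DynRAM.mulConst p + 600) * (|Cp| + 2) with hQ
  have hQ0 : 0 ≤ Q := by positivity
  refine ⟨⟨DynRAM.prepCmd p D, DynRAM.updCmd D⟩, 5 * bD + 3 * a + 16, 5 * cD + 5 * cp + 5 * eU + 5 * ep + 40 +
    (p.shift 20).writes.sum + (D.upd.shift 20).writes.sum, max (16 * DynRAM.prepConst + Q * 8 ^ τ + |CD| * κP ^ 4)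
      (4 * c₀ D * (|CD| * κU ^ 4)), fun i n hn hcard A _ => ?_⟩
  obtain ⟨d, hd⟩ := DynRAM.exists_size hn
  obtain ⟨hd1, -, hd3⟩ := id hd
  set c := 5 * cD + 5 * cp + 5 * eU + 5 * ep + 40 + (p.shift 20).writes.sum + (D.upd.shift 20).writes.sum with hc
  have hcardD : (4 * 2 ^ d + 1) ^ bD ≤ Fintype.card (K i) := by
    have h4 : 2 ^ 4 ≤ (n + 1) ^ 4 := Nat.pow_le_pow_left (by omega) 4
    have h5 : (n + 1) ^ 5 = (n + 1) ^ 4 * (n + 1) := pow_succ _ _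
    have h6 : 4 * 2 ^ d + 1 ≤ (n + 1) ^ 5 := by nlinarith
    refine (Nat.pow_le_pow_left h6 bD).trans ?_
    rw [← pow_mul]
    exact (Nat.pow_le_pow_right (by omega) (by omega)).trans hcard
  have hDi := hD i (4 * 2 ^ d) (by omega) hcardD
  have hTPn : ∀ n, CD * P n ≤ |CD| * P n := fun n => mul_le_mul_of_nonneg_right (le_abs_self _) (hP.1 n)
  have hTUn : ∀ n, CD * U n ≤ |CD| * U n := fun n => mul_le_mul_of_nonneg_right (le_abs_self _) (hU.1 n)
  have hTP0 : 0 ≤ |CD| * P (4 * 2 ^ d) := mul_nonneg (abs_nonneg _) (hP.1 _)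
  have hTU0 : 0 ≤ |CD| * U (4 * 2 ^ d) := mul_nonneg (abs_nonneg _) (hU.1 _)
  have hone : 1 ≤ CD * U (4 * 2 ^ d) := by
    refine DynRAM.one_le_updateTime (F := K i) (⟨⟨0, by omega⟩, ⟨0, by omega⟩, 0⟩) (Nat.pow_pos (by omega))
      (fun ω => (hDi 1 (by simp [DynRAM.firstSingular])).1 ω) (lt_of_le_of_lt
        ((hDi 1 (by simp [DynRAM.firstSingular])).2 _ ⟨fun _ => _, fun _ => rfl⟩) ?_)
    rw [ENNReal.inv_lt_one]
    have : 1 < (4 * 2 ^ d + 1) ^ (2 * a + 7) := Nat.one_lt_pow (by omega) (by omega)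
    exact_mod_cast this
  have hTU1 : 1 ≤ ⌊|CD| * U (4 * 2 ^ d)⌋₊ := Nat.le_floor (by exact_mod_cast hone.trans (hTUn _))
  obtain ⟨S, e1, e2, e3, e4, e5, e6, e7, e8, e9, e10, e11⟩ := DynRAM.exists_setting (F := K i) (p := p) (D := D)
    (TM := fun m => ⌊|Cp| * (m : ℝ) ^ τ⌋₊) (a := a) (a' := 2 * a + 7) (cp := cp) (cD := cD) (ep := ep) (eU := eU)
    (c := c) (TD := ⌊|CD| * P (4 * 2 ^ d)⌋₊) (TU := ⌊|CD| * U (4 * 2 ^ d)⌋₊) hn hd (by omega)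
    (fun m hm A B ω => by
      obtain ⟨s, t, e, ht, hs⟩ := hp i m hm A B ω
      exact ⟨s, t, e, Nat.le_floor (ht.trans (mul_le_mul_of_nonneg_right (le_abs_self _) (by positivity))), hs⟩)
    (fun m hm => Nat.floor_le_of_le (by exact_mod_cast hep m hm))
    (Nat.floor_le_of_le (by exact_mod_cast heU (4 * 2 ^ d) (by omega)))
    (fun M hM ω => by
      obtain ⟨⟨s, t, e, ht⟩, hu⟩ := (hDi M hM).1 ω
      refine ⟨⟨s, t, e, ?_⟩, fun us os s h1 h2 h3 u => ?_⟩
      · exact_mod_cast Nat.le_floor (ht.trans (hTPn _))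
      · obtain ⟨s', t, e, ht⟩ := hu us os s h1 h2 h3 u
        exact ⟨s', t, e, by exact_mod_cast Nat.le_floor (ht.trans (hTUn _))⟩) hc.ge
  have halg : S.alg = ⟨DynRAM.prepCmd p D, DynRAM.updCmd D⟩ := by rw [DynRAM.Setting.alg, e1, e2]
  have hprep : (S.prepTime : ℝ) ≤ max (16 * DynRAM.prepConst + Q * 8 ^ τ + |CD| * κP ^ 4)
      (4 * c₀ D * (|CD| * κU ^ 4)) * (P n + (n : ℝ) ^ τ) := by
    have hn1 : (1 : ℝ) ≤ n := by exact_mod_cast hn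
    have hP0 := hP.1 n
    have hnτ : 0 ≤ (n : ℝ) ^ τ := by positivity
    have hn2 : (n : ℝ) ^ 2 ≤ (n : ℝ) ^ τ := by
      rw [← Real.rpow_two]
      exact Real.rpow_le_rpow_of_exponent_le hn1 hτ.le
    have hH : ((2 : ℝ) ^ d) ≤ 4 * n := by exact_mod_cast hd3
    have hH0 : (0 : ℝ) < 2 ^ d := by positivity
    have b1 : (DynRAM.prepConst : ℝ) * (2 ^ d * 2 ^ d) ≤ 16 * DynRAM.prepConst * (n : ℝ) ^ τ := by
      have : (2 : ℝ) ^ d * 2 ^ d ≤ 16 * (n : ℝ) ^ τ := by nlinarith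
      have := mul_le_mul_of_nonneg_left this (Nat.cast_nonneg (α := ℝ) DynRAM.prepConst)
      linarith
    have b2 : (DynRAM.elimTime p (fun m => ⌊|Cp| * (m : ℝ) ^ τ⌋₊) (d + 1) : ℝ) ≤ Q * 8 ^ τ * (n : ℝ) ^ τ := by
      refine (DynRAM.elimTime_le (abs_nonneg Cp) hτ (fun m => Nat.floor_le (by positivity)) (d + 1)).trans ?_
      rw [mul_assoc, ← Real.mul_rpow (by norm_num) (by positivity)]
      refine mul_le_mul_of_nonneg_left (Real.rpow_le_rpow (by positivity) ?_ (by linarith)) hQ0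
      push_cast
      rw [pow_succ]
      linarith
    have b3 : (⌊|CD| * P (4 * 2 ^ d)⌋₊ : ℝ) ≤ |CD| * κP ^ 4 * P n := by
      rw [mul_assoc]
      exact (Nat.floor_le hTP0).trans
        (mul_le_mul_of_nonneg_left (hPit 4 n _ hn (by omega) (by omega)) (abs_nonneg _))
    rw [DynRAM.Setting.prepTime, e1, e3, e7, e10]
    push_cast
    refine le_trans ?_ (mul_le_mul_of_nonneg_right (le_max_left _ _) (by positivity))
    have k1 : 0 ≤ 16 * (DynRAM.prepConst : ℝ) + Q * 8 ^ τ := by positivity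
    have k2 : 0 ≤ |CD| * κP ^ 4 := by positivity
    nlinarith [mul_nonneg k1 hP0, mul_nonneg k2 hnτ]
  have hupd : (DynRAM.updTime S.D S.n S.TU : ℝ) ≤ max (16 * DynRAM.prepConst + Q * 8 ^ τ + |CD| * κP ^ 4)
      (4 * c₀ D * (|CD| * κU ^ 4)) * (U n * (1 + Real.log n) ^ 1) := by
    have hlog := Real.log_natCast_nonneg n
    have hU0 := hU.1 n
    rw [e2, e6, e11, pow_one]
    have b1 : (⌊|CD| * U (4 * 2 ^ d)⌋₊ : ℝ) ≤ |CD| * κU ^ 4 * U n := by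
      rw [mul_assoc]
      exact (Nat.floor_le hTU0).trans
        (mul_le_mul_of_nonneg_left (hUit 4 n _ hn (by omega) (by omega)) (abs_nonneg _))
    have b2 : (1 : ℝ) ≤ ⌊|CD| * U (4 * 2 ^ d)⌋₊ := by exact_mod_cast hTU1
    have b3 := DynRAM.size_le_log hn
    have b4 : (DynRAM.updTime D n ⌊|CD| * U (4 * 2 ^ d)⌋₊ : ℝ) ≤
        c₀ D * ((⌊|CD| * U (4 * 2 ^ d)⌋₊ + 1) * (n.size + 1)) := by exact_mod_cast hc₀ D n _
    refine b4.trans (le_trans ?_ (mul_le_mul_of_nonneg_right (le_max_right _ _) (by positivity)))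
    calc (c₀ D : ℝ) * ((⌊|CD| * U (4 * 2 ^ d)⌋₊ + 1) * (n.size + 1)) ≤
        c₀ D * ((2 * (|CD| * κU ^ 4 * U n)) * (2 * (1 + Real.log n))) := by
          refine mul_le_mul_of_nonneg_left (mul_le_mul (by linarith) b3 (by positivity) ?_) (Nat.cast_nonneg _)
          positivity
      _ = _ := by ring
  have hmono := fun (ω : DynRAM.Tape (K i)) (A : Matrix (Fin S.n) (Fin S.n) (K i)) =>
    (DynRAM.Setting.timeBound A ω).mono hprep hupd
  have herr := fun (A : Matrix (Fin S.n) (Fin S.n) (K i)) adv =>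
    DynRAM.Setting.tapeProb_errs_le (S := S) (ε := (((4 * 2 ^ S.d : ℕ) + 1 : ℝ≥0∞) ^ (2 * a + 7))⁻¹) (by
      rw [e2, e5, e7, e9]
      exact fun M hM q => (hDi M hM).2 _ ⟨q, fun _ => rfl⟩) A adv
  rw [halg, e4, e8] at hmono herr
  clear_value c
  subst e6
  refine ⟨fun ω => hmono ω A, fun adv _ => (herr A adv).trans ?_⟩
  rw [e7, mul_add, ← add_assoc]
  exact DynRAM.error_le (a' := 2 * a + 7) hn ⟨by omega, hd3⟩ rfl (by omega) hcard
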